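/- Let $dS_3$ be the unit hyperboloid $\{x\in\mathbb R^{4}:\eta(x,x)=1\}$, $\eta=\mathrm{diag}(-1,1,1,1)$, with induced metric $h_{ab}$, Levi-Civita connection $\mathcal D_a$, volume form $\epsilon_{abc}$ and $\square=\mathcal D^a\mathcal D_a$. Let $\sigma$ range over all smooth functions on $dS_3$ with $\square\sigma+3\sigma=0$, and write $\sigma_a=\mathcal D_a\sigma$, $\sigma_{ab}=\mathcal D_b\mathcal D_a\sigma$. A *quadratic tensor of order at most $n$* is a map assigning to every such $\sigma$ a rank-two tensor field, which is a real linear combination (with coefficients independent of $\sigma$) of index contractions of $\mathcal D^i\sigma\otimes\mathcal D^j\sigma$, $i+j\le n$, with copies of $h$ and $\epsilon$; let $Q_n$ be the space of these. It is called SD if it is symmetric and divergence-free for every $\sigma$, and SDT if it is moreover traceless for every $\sigma$. Let $(\mathrm{curl}\,T)_{ab}=\epsilon_a{}^{cd}\mathcal D_cT_{db}$, and call $(\mathrm{curl}\,T)_{(ab)}$ the symmetrized curl. Put $$M_{ab}=(5\sigma^2+\sigma_d\sigma^d)h_{ab}+4\sigma\sigma_{ab},\qquad X^{[3]}=\mathrm{curl}\,M,\qquad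 X^{[n]}=\mathrm{curl}^{\,n-3}X^{[3]}\quad(n\ge 3),$$ $$\kappa_{ab}=\sigma_a\sigma_b+h_{ab}\bigl(-\tfrac12\sigma_c\sigma^c+\tfrac32\sigma^2\bigr).$$ 1. $M\in Q_2$ is symmetric, $\mathcal D^bM_{ab}=\mathcal D_a M_c{}^c$, and $X^{[3]}$ equals the symmetrized curl of $M$. 2. For $n\le 2$ the only SDT element of $Q_n$ is $0$. For $n\ge 3$, $X^{[n]}$ is an SDT element of $Q_n$ not in $Q_{n-1}$, and for every SDT $F\in Q_n$ there is exactly one $c\in\mathbb R$ with $F-cX^{[n]}\in Q_{n-1}$. Hence, for every $n\ge0$, the SDT elements of $Q_n$ are exactly the linear combinations of $X^{[3]},\dots,X^{[n]}$ (only $0$ if $n\le 2$). 3. $\kappa\in Q_2$ is SD; neither its trace nor its symmetrized curl vanishes identically (i.e. for all $\sigma$); its symmetrized curl is $-\tfrac14X^{[3]}$; and it is the stress tensor $-\frac{2}{\sqrt{-h}}\frac{\delta L}{\delta h^{ab}}$ of $L=\sqrt{-h}\,(-\tfrac12\sigma_a\sigma^a+\tfrac32\sigma^2)$. 4. For every $n\ge0$,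 every SD $F\in Q_n$ can be written in exactly one way as $F=c\,\kappa+S+Z$ with $c\in\mathbb R$, $S\in Q_n$ SDT, and $Z\in Q_n$ SD with vanishing symmetrized curl. (Thus, up to SDT tensors, every SD tensor has vanishing symmetrized curl, with $\kappa$ as the only linearly independent exception.) 5. If $n\ge3$ is odd, then for every SD $F\in Q_n$ there is $c\in\mathbb R$ with $F-cX^{[n]}\in Q_{n-1}$. 6. There are SD tensors $Z_m\in Q_{2m}\setminus Q_{2m-1}$ ($m\ge1$), with trace not identically zero and vanishing symmetrized curl, such that for every $n\ge0$ the SD elements of $Q_n$ with vanishing symmetrized curl are exactly the linear combinations of the $Z_m$ with $2\le 2m\le n$. -/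

import Mathlib

open scoped ContDiff Matrix

noncomputable section

namespace DeSitter

/-! The three-dimensional de Sitter space `dS₃` is the hyperboloid `η(x,x) = 1` in `ℝ⁴`,
`η = diag(-1,1,1,1)`.  A covariant tensor on it is given by its ambient components; all tensors
constructed below are tangential (they vanish when contracted with the unit normal `x` in any
slot). For such tensors, contracting with `η` is the same as contracting with the induced inverse
metric. -/

/-- Diagonal entries of the Minkowski metric (which is its own inverse). -/
def eta : Fin 4 → ℝ := ![-1, 1, 1, 1]

/-- The Minkowski scalar product. -/
def dot (x y : Fin 4 → ℝ) : ℝ := ∑ i, eta i * x i * y i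

/-- The unit hyperboloid `dS₃`. -/
abbrev Hyp : Type := {x : Fin 4 → ℝ // dot x x = 1}

theorem dot_normalize {y : Fin 4 → ℝ} (hy : 0 < dot y y) :
    dot ((√(dot y y))⁻¹ • y) ((√(dot y y))⁻¹ • y) = 1 := by
  have h1 : dot ((√(dot y y))⁻¹ • y) ((√(dot y y))⁻¹ • y)
      = ((√(dot y y))⁻¹ * (√(dot y y))⁻¹) * dot y y := by
    conv_lhs => unfold dot
    conv_rhs => rw [show dot y y = ∑ i, eta i * y i * y i from rfl, Finset.mul_sum]
    refine Finset.sum_congr rfl fun i _ => ?_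
    simp only [Pi.smul_apply, smul_eq_mul]
    ring
  rw [h1, ← mul_inv, Real.mul_self_sqrt hy.le, inv_mul_cancel₀ hy.ne']

open Classical in
/-- Extension of a function on `dS₃` to the open cone `η(y,y) > 0`, constant along rays. -/
def ext (f : Hyp → ℝ) (y : Fin 4 → ℝ) : ℝ :=
  if hy : 0 < dot y y then f ⟨(√(dot y y))⁻¹ • y, dot_normalize hy⟩ else 0

/-- Smooth functions on `dS₃`. -/
def IsSmooth (f : Hyp → ℝ) : Prop := ContDiffOn ℝ ∞ (ext f) {y | 0 < dot y y}

/-- Covariant tensor fields of rank `k`, in ambient components. -/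
abbrev Tensor (k : ℕ) : Type := Hyp → (Fin k → Fin 4) → ℝ

/-- The tangential projector `P_a^b = δ_a^b - x_a x^b`. -/
def proj (x : Hyp) (a b : Fin 4) : ℝ :=
  (if a = b then 1 else 0) - eta a * x.1 a * x.1 b

/-- The induced metric `h_{ab} = η_{ab} - x_a x_b`. -/
def metric : Tensor 2 := fun x a =>
  (if a 0 = a 1 then eta (a 0) else 0) - (eta (a 0) * x.1 (a 0)) * (eta (a 1) * x.1 (a 1))

/-- The volume form of `dS₃`: `ε(u,v,w) = det(x,u,v,w)`. -/
def vol : Tensor 3 := fun x a =>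
  Matrix.det (Matrix.of (Fin.cons x.1 (fun i => Pi.single (a i) (1 : ℝ)) :
    Fin 4 → Fin 4 → ℝ))

/-- The Levi-Civita covariant derivative: the ambient derivative with all indices projected
tangentially. The index of the derivative comes first: `(cov T) ![c, a, …] = D_c T_{a…}`. -/
def cov {k : ℕ} (T : Tensor k) : Tensor (k + 1) := fun x a =>
  ∑ b : Fin (k + 1) → Fin 4, (∏ i, proj x (a i) (b i)) *
    fderiv ℝ (ext fun y => T y (Fin.tail b)) x.1 (Pi.single (b 0) 1)

/-- Tensor product. -/
def tmul {k l : ℕ} (S : Tensor k) (T : Tensor l) : Tensor (k + l) := fun x a =>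
  S x (fun i => a (Fin.castAdd l i)) * T x (fun j => a (Fin.natAdd k j))

/-- Contraction of the first two indices. -/
def contract {k : ℕ} (T : Tensor (k + 2)) : Tensor k := fun x a =>
  ∑ c, eta c * T x (Fin.cons c (Fin.cons c a))

/-- Permutation of the indices (a bijection `Fin k ≃ Fin l` forces `k = l`). -/
def permute {k l : ℕ} (e : Fin k ≃ Fin l) (T : Tensor k) : Tensor l := fun x a =>
  T x (a ∘ e)

/-- Iterated covariant derivatives of a scalar: `(iterCov σ k) ![a₁,…,aₖ] = D_{a₁} ⋯ D_{aₖ} σ`. -/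
def iterCov (σ : Hyp → ℝ) : (k : ℕ) → Tensor k
  | 0 => fun x _ => σ x
  | k + 1 => cov (iterCov σ k)

/-- The d'Alembertian of a scalar. -/
def box (σ : Hyp → ℝ) (x : Hyp) : ℝ := contract (k := 0) (iterCov σ 2) x ![]

/-- Smooth functions `σ` on `dS₃` with `□σ + 3σ = 0`. -/
def Sol : Type := {σ : Hyp → ℝ // IsSmooth σ ∧ ∀ x, box σ x + 3 * σ x = 0}

/-- Rules that assign a rank-`k` tensor field to every solution `σ`. -/
abbrev Rule (k : ℕ) : Type := Sol → Tensor k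

/-- `IsMonomial n k F`: `F` is formed from one product `D⋯Dσ ⊗ D⋯Dσ` with `n` derivatives in
total, copies of `h` and `ε`, index permutations and contractions. -/
inductive IsMonomial : ℕ → (k : ℕ) → Rule k → Prop
  | base (i j : ℕ) :
      IsMonomial (i + j) (i + j) (fun σ => tmul (iterCov σ.1 i) (iterCov σ.1 j))
  | metric {n k : ℕ} {F : Rule k} (hF : IsMonomial n k F) :
      IsMonomial n (2 + k) (fun σ => tmul DeSitter.metric (F σ))
  | vol {n k : ℕ} {F : Rule k} (hF : IsMonomial n k F) :
      IsMonomial n (3 + k) (fun σ => tmul DeSitter.vol (F σ))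
  | permute {n k l : ℕ} {F : Rule k} (e : Fin k ≃ Fin l) (hF : IsMonomial n k F) :
      IsMonomial n l (fun σ => DeSitter.permute e (F σ))
  | contract {n k : ℕ} {F : Rule (k + 2)} (hF : IsMonomial n (k + 2) F) :
      IsMonomial n k (fun σ => DeSitter.contract (F σ))

/-- Rank-two tensors quadratic in `σ` and its derivatives, of derivative order at most `n`:
real linear combinations of monomials with at most `n` derivatives in total. -/
def quadratic (n : ℕ) : Submodule ℝ (Rule 2) :=
  Submodule.span ℝ {F | ∃ m ≤ n, IsMonomial m 2 F}

/-- The trace `T^a_a`. -/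
def trace (T : Tensor 2) : Tensor 0 := contract (k := 0) T

/-- The divergence `D^b T_{ba}`. -/
def div (T : Tensor 2) : Tensor 1 := contract (k := 1) (cov T)

def IsSymm (T : Tensor 2) : Prop := ∀ x a b, T x ![a, b] = T x ![b, a]

/-- Symmetric and divergence-free for every solution. -/
def IsSD (F : Rule 2) : Prop := ∀ σ, IsSymm (F σ) ∧ div (F σ) = 0

/-- Symmetric, divergence-free and traceless for every solution. -/
def IsSDT (F : Rule 2) : Prop := IsSD F ∧ ∀ σ, trace (F σ) = 0

/-- `(curl T)_{ab} = ε_a^{cd} D_c T_{db}`. -/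
def curl (T : Tensor 2) : Tensor 2 := fun x a =>
  ∑ c, ∑ d, eta c * eta d * vol x ![a 0, c, d] * cov T x ![c, d, a 1]

/-- The symmetrized curl `(curl T)_{(ab)}`. -/
def symCurl (T : Tensor 2) : Tensor 2 := fun x a =>
  (curl T x ![a 0, a 1] + curl T x ![a 1, a 0]) / 2

/-- `σ_c σ^c`. -/
def gradSq (σ : Hyp → ℝ) (x : Hyp) : ℝ := ∑ c, eta c * iterCov σ 1 x ![c] ^ 2

/-- The potential `M_{ab} = (5σ² + σ_c σ^c) h_{ab} + 4 σ σ_{ab}`. -/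
def potential : Rule 2 := fun σ x a =>
  (5 * σ.1 x ^ 2 + gradSq σ.1 x) * metric x a + 4 * σ.1 x * iterCov σ.1 2 x a

/-- For `n ≥ 3`: `X^{[3]} = curl M` and `X^{[n]} = curl^{n-3} X^{[3]}`. -/
def X (n : ℕ) : Rule 2 := fun σ => curl^[n - 3] (curl (potential σ))

/-- `κ_{ab} = σ_a σ_b + h_{ab} (-½ σ_c σ^c + 3/2 σ²)`. -/
def kappa : Rule 2 := fun σ x a =>
  iterCov σ.1 1 x ![a 0] * iterCov σ.1 1 x ![a 1]
    + metric x a * (-(1 / 2) * gradSq σ.1 x + 3 / 2 * σ.1 x ^ 2)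

/-- The Lagrangian density `√|g| (-½ g^{ab} σ_a σ_b + 3/2 σ²)` at a point `x`, as a function of the
metric. The metric on the tangent space at `x` is encoded as a `4 × 4` matrix which extends it by
giving the normal `x` unit length and keeping it orthogonal to the tangent space; this changes
neither `|det g|` (relative to the density of `h`) nor `g^{ab} σ_a σ_b`. -/
def lagrangian (σ : Hyp → ℝ) (x : Hyp) (g : Matrix (Fin 4) (Fin 4) ℝ) : ℝ :=
  √|g.det| * (-(1 / 2) * ((fun a => iterCov σ 1 x ![a]) ⬝ᵥ (g⁻¹ *ᵥ fun a => iterCov σ 1 x ![a]))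
    + 3 / 2 * σ x ^ 2)

/-- `T` is the stress tensor of `σ`: the variation of the Lagrangian density under a variation
`k_{ab}` of the metric, at `h`, is `½ √|h| T^{ab} k_{ab}`
(equivalently `T_{ab} = -(2/√|h|) δL/δh^{ab}`). -/
def IsStressTensor (σ : Hyp → ℝ) (T : Tensor 2) : Prop :=
  IsSymm T ∧ (∀ x b, ∑ a, x.1 a * T x ![a, b] = 0) ∧
  ∀ (x : Hyp) (k : Matrix (Fin 4) (Fin 4) ℝ), k.IsSymm → k *ᵥ x.1 = 0 →
    HasDerivAt (fun t : ℝ => lagrangian σ x (Matrix.diagonal eta + t • k))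
      (1 / 2 * ∑ a, ∑ b, eta a * eta b * T x ![a, b] * k a b) 0

end DeSitter

end

noncomputable section

namespace DeSitter

/-! ### Pointwise tensor algebra -/

/-! Conserved tensors are classified by their leading symbols. Commuting two covariant derivatives
costs only undifferentiated terms, since `dS₃` has constant curvature (`cov_cov_comm`). So, up to
fewer derivatives, the i-th derivative of σ is symmetric, and by the field equation also traceless
(`exists_traceless`). On a three-dimensional Lorentzian tangent space, symmetric traceless tensors
are spanned by powers of null covectors (`mem_span_pw_nullV`). The order n part of a quadratic rule
is therefore governed by its symbol, obtained by replacing `Dⁱσ ⊗ Dʲσ` by `Kⁱ ⊗ Lʲ + Lⁱ ⊗ Kʲ` with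
null K and L: if the symbol vanishes on all null pairs, the rule has lower order
(`HasSymbol.mem_quadLt`). The null cone is a quadratic image of the plane on which SL(2, ℝ) acts, so
equivariance, homogeneity and continuity reduce the vanishing to the single pair K = (1,1,0,0), L =
(1,-1,0,0) (`HasSymbol.eq_zero_of_base`).

Conversely, a rule of lower order has zero symbol at this pair (`HasSymbol.eq_zero_of_mem`). This
needs actual solutions. For a unit timelike covector p, an explicit profile f makes σ = f(p·x) a
solution. When p grows like N K while p·x = s is kept fixed at the base point, the i-th derivative
there grows like Nⁱ f⁽ⁱ⁾(s) Kⁱ. Two such sequences are inserted into the polarized rule, with s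
chosen so that no derivative of f vanishes there; rescaling K separates the bidegrees (i, j).

Differentiating a rule multiplies its symbol by K + L, which at the chosen pair lies on the time
axis. For a symmetric divergence-free rule this leaves only the components T₁₁, T₁₂, T₂₂ of the
symbol, and the isometry that negates K and L kills T₁₂ at even orders and T₁₁, T₂₂ at odd ones
(`HasSymbol.sdSymbol`). Tracelessness means T₁₁ + T₂₂ = 0; the curl rotates the rows 1 and 2, so
vanishing symmetrized curl means T₁₂ = 0 and T₁₁ = T₂₂. Each order thus admits at most one new SDT
tensor, and each even order at most one new SD tensor with vanishing symmetrized curl.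

These candidates are realized as follows. The curl of a symmetric T with `div T = D tr T` is SDT
(`curl_symm`, `div_curl`, `trace_curl`); iterating it from M produces the X rules, with nonzero
symbols from order three on. The Hessian-type tensors of the iterated d'Alembertians of σ² are
conserved because Ric = 2h, and their symmetrized curl vanishes. At order two, κ and the first
Hessian-type tensor span all SD tensors, and comparing traces excludes an SDT combination; at orders
zero and one, additional invariance of the symbol excludes everything. Induction on the order gives
the spans and the existence of the decomposition.

Finally, 4κ + M is a Hessian plus a multiple of the metric, and both have vanishing symmetrized
curl; this computes the symmetrized curl of κ. For uniqueness, the symmetrized curl of a relation cκ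
+ S + Z = 0 reads curl S = (c/4) X⁽³⁾. Since curl raises the order of every X by one, leading orders
force S = 0, then c = 0 and Z = 0. -/

/-- Covariant tensors at a point, in ambient components. -/
abbrev Ten (k : ℕ) : Type := (Fin k → Fin 4) → ℝ

theorem sum_fin_succ_arrow {k : ℕ} (f : (Fin (k + 1) → Fin 4) → ℝ) :
    ∑ b, f b = ∑ c, ∑ b, f (Fin.cons c b) := by
  rw [← Fintype.sum_prod_type']
  exact (Fintype.sum_equiv (Fin.consEquiv fun _ => Fin 4) _ _ fun _ => rfl).symm

theorem sum_fin_add_arrow {k l : ℕ} (f : (Fin (k + l) → Fin 4) → ℝ) :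
    ∑ b, f b = ∑ b, ∑ c, f (Fin.append b c) := by
  rw [← Fintype.sum_prod_type']
  exact (Fintype.sum_equiv (Fin.appendEquiv k l) _ _ fun _ => rfl).symm

/-- Tensor product with a fixed left factor. -/
def tmulL {k l : ℕ} (S : Ten k) : Ten l →ₗ[ℝ] Ten (k + l) where
  toFun T a := S (fun i => a (Fin.castAdd l i)) * T (fun j => a (Fin.natAdd k j))
  map_add' T T' := by ext a; simp [mul_add]
  map_smul' r T := by ext a; simp; ring

/-- Contraction of the first two indices. -/
def contractL {k : ℕ} : Ten (k + 2) →ₗ[ℝ] Ten k where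
  toFun T a := ∑ c, eta c * T (Fin.cons c (Fin.cons c a))
  map_add' T T' := by ext a; simp [mul_add, Finset.sum_add_distrib]
  map_smul' r T := by
    ext a
    simp only [Pi.smul_apply, smul_eq_mul, RingHom.id_apply, Finset.mul_sum]
    exact Finset.sum_congr rfl fun _ _ => by ring

/-- Permutation of the indices. -/
def permuteL {k l : ℕ} (e : Fin k ≃ Fin l) : Ten k →ₗ[ℝ] Ten l where
  toFun T a := T (a ∘ e)
  map_add' _ _ := rfl
  map_smul' _ _ := rfl

theorem tmulL_apply {k l : ℕ} (S : Ten k) (T : Ten l) (a) : tmulL S T a =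
    S (fun i => a (Fin.castAdd l i)) * T (fun j => a (Fin.natAdd k j)) := rfl

theorem contractL_apply {k : ℕ} (T : Ten (k + 2)) (a) :
    contractL T a = ∑ c, eta c * T (Fin.cons c (Fin.cons c a)) := rfl

theorem permuteL_apply {k l : ℕ} (e : Fin k ≃ Fin l) (T : Ten k) (a) :
    permuteL e T a = T (a ∘ e) := rfl

/-! ### Action of matrices on tensors -/

/-- Action of a family of matrices, one for each slot. -/
def actv {k : ℕ} (M : Fin k → Matrix (Fin 4) (Fin 4) ℝ) : Ten k →ₗ[ℝ] Ten k where
  toFun T a := ∑ b, (∏ i, M i (a i) (b i)) * T b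
  map_add' T T' := by ext a; simp [mul_add, Finset.sum_add_distrib]
  map_smul' r T := by
    ext a
    simp only [Pi.smul_apply, smul_eq_mul, RingHom.id_apply, Finset.mul_sum]
    exact Finset.sum_congr rfl fun _ _ => by ring

/-- Action of a matrix on all slots. -/
def act {k : ℕ} (O : Matrix (Fin 4) (Fin 4) ℝ) : Ten k →ₗ[ℝ] Ten k := actv fun _ => O

theorem actv_apply {k : ℕ} (M : Fin k → Matrix (Fin 4) (Fin 4) ℝ) (T : Ten k) (a) :
    actv M T a = ∑ b, (∏ i, M i (a i) (b i)) * T b := rfl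

theorem act_apply {k : ℕ} (O : Matrix (Fin 4) (Fin 4) ℝ) (T : Ten k) (a) :
    act O T a = ∑ b, (∏ i, O (a i) (b i)) * T b := rfl

theorem actv_actv {k : ℕ} (M N : Fin k → Matrix (Fin 4) (Fin 4) ℝ) (T : Ten k) :
    actv M (actv N T) = actv (fun i => M i * N i) T := by
  ext a
  simp only [actv_apply, Finset.mul_sum, Matrix.mul_apply]
  rw [Finset.sum_comm]
  refine Finset.sum_congr rfl fun b _ => ?_
  rw [Finset.prod_univ_sum, Fintype.piFinset_univ, Finset.sum_mul]
  refine Finset.sum_congr rfl fun c _ => ?_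
  rw [Finset.prod_mul_distrib]; ring

theorem act_act {k : ℕ} (M N : Matrix (Fin 4) (Fin 4) ℝ) (T : Ten k) :
    act M (act N T) = act (M * N) T := actv_actv _ _ _

theorem act_one {k : ℕ} (T : Ten k) : act 1 T = T := by
  ext a
  rw [act_apply, Finset.sum_eq_single a]
  · simp
  · intro b _ hb
    obtain ⟨i, hi⟩ := Function.ne_iff.1 hb
    rw [Finset.prod_eq_zero (Finset.mem_univ i) (by simp [hi.symm]), zero_mul]
  · simp

theorem act_cons {k : ℕ} (O : Matrix (Fin 4) (Fin 4) ℝ) (T : Ten (k + 1)) (c : Fin 4)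
    (a : Fin k → Fin 4) :
    act O T (Fin.cons c a) = ∑ d, O c d * act O (fun b => T (Fin.cons d b)) a := by
  simp only [act_apply, sum_fin_succ_arrow, Fin.prod_univ_succ, Fin.cons_zero, Fin.cons_succ,
    Finset.mul_sum, mul_assoc]

theorem act_tmulL {k l : ℕ} (O : Matrix (Fin 4) (Fin 4) ℝ) (S : Ten k) (T : Ten l) :
    act O (tmulL S T) = tmulL (act O S) (act O T) := by
  ext a
  simp only [act_apply, tmulL, LinearMap.coe_mk, AddHom.coe_mk, sum_fin_add_arrow,
    Fin.prod_univ_add, Fin.append_left, Fin.append_right, Finset.sum_mul_sum]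
  refine Finset.sum_congr rfl fun b _ => Finset.sum_congr rfl fun c _ => ?_
  ring

theorem act_permuteL {k l : ℕ} (O : Matrix (Fin 4) (Fin 4) ℝ) (e : Fin k ≃ Fin l) (T : Ten k) :
    act O (permuteL e T) = permuteL e (act O T) := by
  ext a
  simp only [act_apply, permuteL, LinearMap.coe_mk, AddHom.coe_mk]
  refine Fintype.sum_equiv (Equiv.arrowCongr e.symm (Equiv.refl _)) _ _ fun b => ?_
  congr 1
  exact (Fintype.prod_equiv e _ _ fun i => by simp [Equiv.arrowCongr]).symm

/-- Both contracted slots receive O, so the form OᵀηO replaces η. It is used for isometries, where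
the form is η again, and for the projector, where it is η − x ⊗ x. -/
theorem contractL_act {k : ℕ} (O : Matrix (Fin 4) (Fin 4) ℝ) (T : Ten (k + 2)) :
    contractL (act O T) = act O (fun a => ∑ d, ∑ e, (∑ c, eta c * O c d * O c e) *
      T (Fin.cons d (Fin.cons e a))) := by
  ext a
  simp only [contractL, LinearMap.coe_mk, AddHom.coe_mk, act_cons]
  simp only [act_apply]
  simp only [Finset.mul_sum, Finset.sum_mul]
  rw [Finset.sum_comm]
  refine Eq.trans (Finset.sum_congr rfl fun d _ => Finset.sum_comm) ?_
  refine Eq.trans (Finset.sum_congr rfl fun d _ => Finset.sum_congr rfl fun e _ =>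
    Finset.sum_comm) ?_
  refine Eq.trans (Finset.sum_congr rfl fun d _ => Finset.sum_comm) ?_
  rw [Finset.sum_comm]
  refine Finset.sum_congr rfl fun b _ => Finset.sum_congr rfl fun d _ =>
    Finset.sum_congr rfl fun e _ => Finset.sum_congr rfl fun c _ => ?_
  ring

theorem contractL_act_isometry {k : ℕ} {O : Matrix (Fin 4) (Fin 4) ℝ}
    (hO : ∀ d e, ∑ c, eta c * O c d * O c e = if d = e then eta d else 0) (T : Ten (k + 2)) :
    contractL (act O T) = act O (contractL T) := by
  rw [contractL_act]
  congr 1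
  ext a
  simp [hO, contractL]

/-! ### Operations built from the metric and the volume form -/

/-- Families of linear operations on tensors, one at each point of `dS₃`. -/
abbrev CoefOp (m k : ℕ) : Type := Hyp → Ten m →ₗ[ℝ] Ten k

/-- Operations formed from the metric, the volume form, permutations and contractions. -/
inductive IsCoef (m : ℕ) : (k : ℕ) → CoefOp m k → Prop
  | id : IsCoef m m (fun _ => LinearMap.id)
  | metric {k : ℕ} {C : CoefOp m k} (hC : IsCoef m k C) :
      IsCoef m (2 + k) (fun x => tmulL (DeSitter.metric x) ∘ₗ C x)
  | vol {k : ℕ} {C : CoefOp m k} (hC : IsCoef m k C) :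
      IsCoef m (3 + k) (fun x => tmulL (DeSitter.vol x) ∘ₗ C x)
  | permute {k l : ℕ} {C : CoefOp m k} (e : Fin k ≃ Fin l) (hC : IsCoef m k C) :
      IsCoef m l (fun x => permuteL e ∘ₗ C x)
  | contract {k : ℕ} {C : CoefOp m (k + 2)} (hC : IsCoef m (k + 2) C) :
      IsCoef m k (fun x => contractL ∘ₗ C x)

theorem IsCoef.comp {m k l : ℕ} {C : CoefOp m k} {D : CoefOp k l} (hC : IsCoef m k C)
    (hD : IsCoef k l D) : IsCoef m l (fun x => D x ∘ₗ C x) := by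
  induction hD with
  | id => exact hC
  | metric _ ih => exact ih.metric
  | vol _ ih => exact ih.vol
  | permute e _ ih => exact ih.permute e
  | contract _ ih => exact ih.contract

theorem IsCoef.permuteL {k l : ℕ} (e : Fin k ≃ Fin l) :
    IsCoef k l (fun _ => permuteL e) := IsCoef.id.permute e

/-- The operation that leaves the first index alone and applies `C` to the others. -/
def liftC {m k : ℕ} (C : Ten m →ₗ[ℝ] Ten k) : Ten (m + 1) →ₗ[ℝ] Ten (k + 1) where
  toFun U a := C (fun B => U (Fin.cons (a 0) B)) (Fin.tail a)
  map_add' U V := by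
    ext a
    exact congrFun (C.map_add (fun B => U (Fin.cons (a 0) B)) fun B => V (Fin.cons (a 0) B)) _
  map_smul' r U := by
    ext a
    exact congrFun (C.map_smul r (fun B => U (Fin.cons (a 0) B))) _

theorem liftC_apply {m k : ℕ} (C : Ten m →ₗ[ℝ] Ten k) (U : Ten (m + 1)) (a) :
    liftC C U a = C (fun B => U (Fin.cons (a 0) B)) (Fin.tail a) := rfl

/-- Extension of a bijection by a fixed first index. -/
def liftE {k l : ℕ} (e : Fin k ≃ Fin l) : Fin (k + 1) ≃ Fin (l + 1) :=
  (finSuccEquiv k).trans ((Equiv.optionCongr e).trans (finSuccEquiv l).symm)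

@[simp] theorem liftE_zero {k l : ℕ} (e : Fin k ≃ Fin l) : liftE e 0 = 0 := by simp [liftE]

@[simp] theorem liftE_succ {k l : ℕ} (e : Fin k ≃ Fin l) (i : Fin k) :
    liftE e i.succ = (e i).succ := by simp [liftE]

theorem liftC_permuteL {k l : ℕ} (e : Fin k ≃ Fin l) :
    liftC (permuteL e) = permuteL (liftE e) := by
  refine LinearMap.ext fun U => funext fun a => ?_
  change U _ = U _
  congr 1
  ext i
  refine Fin.cases ?_ (fun i => ?_) i <;> simp [Fin.tail]

/-- Moves the index number `r` to the front. -/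
def moveFront (r k : ℕ) : Fin (r + (k + 1)) ≃ Fin (r + k + 1) where
  toFun i := if h : (i : ℕ) < r then ⟨i + 1, by omega⟩ else if (i : ℕ) = r then ⟨0, by omega⟩
    else ⟨i, by omega⟩
  invFun j := if h : (j : ℕ) = 0 then ⟨r, by omega⟩ else if (j : ℕ) ≤ r then ⟨j - 1, by omega⟩
    else ⟨j, by omega⟩
  left_inv i := by
    ext
    by_cases h1 : (i : ℕ) < r
    · have : (i : ℕ) + 1 ≤ r := h1
      simp [h1, this]
    · by_cases h2 : (i : ℕ) = r
      · simp [h2]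
      · have h3 : (i : ℕ) ≠ 0 := by omega
        have h4 : ¬ (i : ℕ) ≤ r := by omega
        simp [h1, h2, h3, h4]
  right_inv j := by
    ext
    by_cases h1 : (j : ℕ) = 0
    · simp [h1]
    · by_cases h2 : (j : ℕ) ≤ r
      · have h3 : (j : ℕ) - 1 < r := by omega
        simp [h1, h2, h3]; omega
      · have h3 : ¬ (j : ℕ) < r := by omega
        have h4 : ¬ (j : ℕ) = r := by omega
        simp [h1, h2, h3, h4]

theorem moveFront_castAdd (r k : ℕ) (i : Fin r) :
    moveFront r k (Fin.castAdd (k + 1) i) = (Fin.castAdd k i).succ := by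
  ext; simp [moveFront]

theorem moveFront_zero (r k : ℕ) : moveFront r k (Fin.natAdd r 0) = 0 := by
  ext; simp [moveFront]

theorem moveFront_succ (r k : ℕ) (i : Fin k) :
    moveFront r k (Fin.natAdd r i.succ) = (Fin.natAdd r i).succ := by
  ext; simp [moveFront]; omega

theorem liftC_tmulL {r k : ℕ} (S : Ten r) :
    liftC (tmulL (l := k) S) = permuteL (moveFront r k) ∘ₗ tmulL S := by
  refine LinearMap.ext fun U => funext fun a => ?_
  change S _ * U _ = S _ * U _
  congr 2
  · ext i; simp [moveFront_castAdd, Fin.tail]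
  · ext i
    refine Fin.cases ?_ (fun i => ?_) i
    · simp [moveFront_zero]
    · simp [moveFront_succ, Fin.tail]

/-- Moves the first index behind the next two. -/
def rotateE (k : ℕ) : Fin (k + 3) ≃ Fin (k + 3) :=
  (Equiv.swap 0 1).trans (Equiv.swap 0 2)

/-- The spectator index stands in front of the contracted pair and must be moved behind it before
the first two indices can be contracted. -/
theorem liftC_contractL {k : ℕ} :
    liftC (contractL (k := k)) = contractL ∘ₗ permuteL (rotateE k).symm := by
  refine LinearMap.ext fun U => funext fun a => ?_
  rw [liftC_apply, LinearMap.comp_apply, contractL_apply, contractL_apply]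
  refine Finset.sum_congr rfl fun c _ => ?_
  congr 2
  have h01 : (2 : Fin (k + 3)) ≠ 0 := by simp [Fin.ext_iff, Nat.mod_eq_of_lt]
  have h02 : (2 : Fin (k + 3)) ≠ 1 := by simp [Fin.ext_iff, Nat.mod_eq_of_lt]
  have h12 : (1 : Fin (k + 3)) ≠ 0 := by simp
  have h0 : (rotateE k).symm 0 = 2 := by
    rw [Equiv.symm_apply_eq, rotateE, Equiv.trans_apply, Equiv.swap_apply_of_ne_of_ne h01 h02,
      Equiv.swap_apply_right]
  have h1 : (rotateE k).symm 1 = 0 := by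
    rw [Equiv.symm_apply_eq, rotateE, Equiv.trans_apply, Equiv.swap_apply_left,
      Equiv.swap_apply_of_ne_of_ne h12 h02.symm]
  have h2 : (rotateE k).symm 2 = 1 := by
    rw [Equiv.symm_apply_eq, rotateE, Equiv.trans_apply, Equiv.swap_apply_right,
      Equiv.swap_apply_left]
  have h3 : ∀ i : Fin k, (rotateE k).symm i.succ.succ.succ = i.succ.succ.succ := by
    intro i
    have e0 : i.succ.succ.succ ≠ 0 := Fin.succ_ne_zero _
    have e1 : i.succ.succ.succ ≠ 1 := fun h => Fin.succ_ne_zero _ (Fin.succ_injective _ h)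
    have e2 : i.succ.succ.succ ≠ 2 := fun h =>
      Fin.succ_ne_zero _ (Fin.succ_injective _ (Fin.succ_injective _ h))
    rw [Equiv.symm_apply_eq, rotateE, Equiv.trans_apply, Equiv.swap_apply_of_ne_of_ne e0 e1,
      Equiv.swap_apply_of_ne_of_ne e0 e2]
  ext i
  refine Fin.cases ?_ (fun i => ?_) i
  · simp only [Function.comp_apply, h0]; rfl
  refine Fin.cases ?_ (fun i => ?_) i
  · rw [Function.comp_apply, show (Fin.succ 0 : Fin (k + 3)) = 1 from rfl, h1]; rfl
  refine Fin.cases ?_ (fun i => ?_) i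
  · rw [Function.comp_apply, show (Fin.succ (Fin.succ 0) : Fin (k + 3)) = 2 from rfl, h2]; rfl
  · rw [Function.comp_apply, h3]; rfl

/-- Needed because a covariant derivative adds an index in front on which the operation must not
act: with this closure property, derivatives of rules built by `IsCoef` are again of this kind. -/
theorem IsCoef.lift {m k : ℕ} {C : CoefOp m k} (hC : IsCoef m k C) :
    IsCoef (m + 1) (k + 1) (fun x => liftC (C x)) := by
  induction hC with
  | id =>
    convert IsCoef.id using 1
    funext x
    ext U a
    simp [liftC_apply, Fin.cons_self_tail]
  | metric _ ih =>
    have := (ih.metric).permute (moveFront 2 _)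
    convert this using 2 with x
    rw [← LinearMap.comp_assoc, ← liftC_tmulL]; rfl
  | vol _ ih =>
    have := (ih.vol).permute (moveFront 3 _)
    convert this using 2 with x
    rw [← LinearMap.comp_assoc, ← liftC_tmulL]; rfl
  | permute e _ ih =>
    have := ih.permute (liftE e)
    convert this using 2 with x
    rw [← liftC_permuteL]; rfl
  | contract _ ih =>
    have := (ih.permute (rotateE _).symm).contract
    convert this using 2 with x
    rw [← LinearMap.comp_assoc, ← liftC_contractL]; rfl

/-- Exchange of the two factors of a tensor product. -/
def swapE (k l : ℕ) : Fin (k + l) ≃ Fin (l + k) :=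
  finSumFinEquiv.symm.trans ((Equiv.sumComm _ _).trans finSumFinEquiv)

theorem tmulL_comm {k l : ℕ} (S : Ten k) (T : Ten l) :
    tmulL S T = permuteL (swapE l k) (tmulL T S) := by
  ext a
  change S _ * T _ = T _ * S _
  rw [mul_comm]
  congr 2 <;> ext i <;> simp [swapE]

theorem tmulL_permuteL_left {k k' l : ℕ} (e : Fin k ≃ Fin k') (S : Ten k) (T : Ten l) :
    tmulL (permuteL e S) T = permuteL (finSumFinEquiv.symm.trans
      ((Equiv.sumCongr e (Equiv.refl (Fin l))).trans finSumFinEquiv)) (tmulL S T) := by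
  ext a
  change S _ * T _ = S _ * T _
  congr 2 <;> ext i <;> simp

theorem tmulL_assoc {r k l : ℕ} (R : Ten r) (S : Ten k) (T : Ten l) :
    tmulL (tmulL R S) T = permuteL (finCongr (Nat.add_assoc r k l).symm)
      (tmulL R (tmulL S T)) := by
  ext a
  change R _ * S _ * T _ = R _ * (S _ * T _)
  rw [mul_assoc]
  congr 2
  congr 1
  ext i
  simp only [Function.comp_apply]
  congr 2
  ext; simp; omega

theorem tmulL_contractL_left {k l : ℕ} (S : Ten (k + 2)) (T : Ten l) :
    tmulL (contractL S) T =
      contractL (permuteL (finCongr (by omega : k + 2 + l = k + l + 2)) (tmulL S T)) := by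
  ext a
  simp only [tmulL_apply, contractL_apply, permuteL_apply]
  rw [Finset.sum_mul]
  refine Finset.sum_congr rfl fun c _ => ?_
  rw [mul_assoc]
  congr 3
  · ext i
    refine Fin.cases ?_ (fun i => ?_) i
    · rfl
    refine Fin.cases ?_ (fun i => ?_) i
    · rfl
    · rfl
  · ext i
    rw [Function.comp_apply, show finCongr (by omega : k + 2 + l = k + l + 2)
      (Fin.natAdd (k + 2) i) = (Fin.natAdd k i).succ.succ by ext; simp; omega]
    rfl

theorem IsCoef.tmul_right {m k : ℕ} {C : CoefOp m k} (hC : IsCoef m k C) (l : ℕ) :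
    ∃ D : CoefOp (m + l) (k + l), IsCoef (m + l) (k + l) D ∧
      ∀ x (S : Ten m) (T : Ten l), D x (tmulL S T) = tmulL (C x S) T := by
  induction hC with
  | id => exact ⟨_, IsCoef.id, fun _ _ _ => rfl⟩
  | metric _ ih =>
    obtain ⟨D, hD, h⟩ := ih
    exact ⟨_, hD.metric.permute _, fun x S T => by
      simp [h, tmulL_assoc]; rfl⟩
  | vol _ ih =>
    obtain ⟨D, hD, h⟩ := ih
    exact ⟨_, hD.vol.permute _, fun x S T => by
      simp [h, tmulL_assoc]; rfl⟩
  | permute e _ ih =>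
    obtain ⟨D, hD, h⟩ := ih
    exact ⟨_, hD.permute _, fun x S T => by
      simp [h, tmulL_permuteL_left]; rfl⟩
  | contract _ ih =>
    obtain ⟨D, hD, h⟩ := ih
    exact ⟨_, (hD.permute _).contract, fun x S T => by
      simp [h, tmulL_contractL_left]; rfl⟩

/-- The two operations are applied one after the other to the left factor, with the factors
exchanged in between and afterwards. -/
theorem IsCoef.tmul {m k m' k' : ℕ} {C : CoefOp m k} {C' : CoefOp m' k'} (hC : IsCoef m k C)
    (hC' : IsCoef m' k' C') : ∃ D : CoefOp (m + m') (k + k'), IsCoef (m + m') (k + k') D ∧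
      ∀ x (S : Ten m) (T : Ten m'), D x (tmulL S T) = tmulL (C x S) (C' x T) := by
  obtain ⟨D, hD, h⟩ := hC.tmul_right m'
  obtain ⟨D', hD', h'⟩ := hC'.tmul_right k
  refine ⟨_, hD.comp (((IsCoef.permuteL (swapE k m')).comp hD').permute (swapE k' k)), ?_⟩
  intro x S T
  simp only [LinearMap.comp_apply, h]
  rw [tmulL_comm (C x S) (C' x T), ← h', tmulL_comm T (C x S)]

/-! ### Smooth functions and ambient derivatives -/

theorem dot_add_single (x : Fin 4 → ℝ) (c : Fin 4) (t : ℝ) :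
    dot (x + t • Pi.single c 1) (x + t • Pi.single c 1)
      = dot x x + 2 * t * (eta c * x c) + t ^ 2 * eta c := by
  fin_cases c <;> simp [dot, Fin.sum_univ_four, eta] <;> ring

theorem dot_smul_smul (r : ℝ) (y : Fin 4 → ℝ) : dot (r • y) (r • y) = r ^ 2 * dot y y := by
  simp only [dot, Fin.sum_univ_four, Pi.smul_apply, smul_eq_mul]; ring

theorem contDiff_dot : ContDiff ℝ ∞ (fun y : Fin 4 → ℝ => dot y y) := by
  unfold dot; fun_prop

theorem isOpen_cone : IsOpen {y : Fin 4 → ℝ | 0 < dot y y} :=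
  isOpen_lt continuous_const contDiff_dot.continuous

theorem mem_cone (x : Hyp) : 0 < dot x.1 x.1 := by rw [x.2]; exact one_pos

theorem ext_of_pos (f : Hyp → ℝ) {y : Fin 4 → ℝ} (hy : 0 < dot y y) :
    ext f y = f ⟨(√(dot y y))⁻¹ • y, dot_normalize hy⟩ := dif_pos hy

theorem ext_coe (f : Hyp → ℝ) (x : Hyp) : ext f x.1 = f x := by
  rw [ext_of_pos f (mem_cone x)]
  congr 1
  ext1
  simp [x.2]

theorem ext_smul (f : Hyp → ℝ) {r : ℝ} (hr : 0 < r) (y : Fin 4 → ℝ) :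
    ext f (r • y) = ext f y := by
  by_cases hy : 0 < dot y y
  · have h : 0 < dot (r • y) (r • y) := by rw [dot_smul_smul]; positivity
    rw [ext_of_pos f h, ext_of_pos f hy]
    congr 2
    rw [dot_smul_smul, Real.sqrt_mul (by positivity), Real.sqrt_sq hr.le, smul_smul]
    congr 1
    field_simp
  · have h : ¬ 0 < dot (r • y) (r • y) := by
      rw [dot_smul_smul]; intro h; exact hy (pos_of_mul_pos_right h (by positivity))
    rw [ext, ext, dif_neg h, dif_neg hy]

theorem ext_add (f g : Hyp → ℝ) : ext (fun x => f x + g x) = fun y => ext f y + ext g y := by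
  funext y; unfold ext; split_ifs <;> simp

theorem ext_mul (f g : Hyp → ℝ) : ext (fun x => f x * g x) = fun y => ext f y * ext g y := by
  funext y; unfold ext; split_ifs <;> simp

theorem IsSmooth.add {f g : Hyp → ℝ} (hf : IsSmooth f) (hg : IsSmooth g) :
    IsSmooth (fun x => f x + g x) := by
  unfold IsSmooth; rw [ext_add]; exact ContDiffOn.add hf hg

theorem IsSmooth.mul {f g : Hyp → ℝ} (hf : IsSmooth f) (hg : IsSmooth g) :
    IsSmooth (fun x => f x * g x) := by
  unfold IsSmooth; rw [ext_mul]; exact ContDiffOn.mul hf hg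

theorem isSmooth_const (r : ℝ) : IsSmooth (fun _ => r) :=
  (contDiffOn_const (c := r)).congr fun _ hy => ext_of_pos _ hy

theorem IsSmooth.comp {f : Hyp → ℝ} (hf : IsSmooth f) {φ : ℝ → ℝ} (hφ : ContDiff ℝ ∞ φ) :
    IsSmooth (fun x => φ (f x)) :=
  (hφ.comp_contDiffOn hf).congr fun _ hy => by
    rw [ext_of_pos _ hy, Function.comp_apply, ext_of_pos _ hy]

theorem isSmooth_coord (a : Fin 4) : IsSmooth (fun x => x.1 a) := by
  have h : ContDiffOn ℝ ∞ (fun y : Fin 4 → ℝ => (√(dot y y))⁻¹ * y a) {y | 0 < dot y y} := by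
    refine ContDiffOn.mul (ContDiffOn.inv (ContDiffOn.sqrt contDiff_dot.contDiffOn ?_) ?_) ?_
    · intro y hy; exact ne_of_gt hy
    · intro y hy; exact ne_of_gt (Real.sqrt_pos.2 hy)
    · fun_prop
  exact h.congr fun y hy => by rw [ext_of_pos _ hy]; rfl

theorem IsSmooth.sum {ι : Type*} (s : Finset ι) {f : ι → Hyp → ℝ} (h : ∀ i ∈ s, IsSmooth (f i)) :
    IsSmooth (fun x => ∑ i ∈ s, f i x) := by
  classical
  induction s using Finset.induction_on with
  | empty => simpa using isSmooth_const 0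
  | insert i s hi ih =>
    simp only [Finset.sum_insert hi]
    exact (h i (Finset.mem_insert_self i s)).add
      (ih fun j hj => h j (Finset.mem_insert_of_mem hj))

theorem IsSmooth.prod {ι : Type*} (s : Finset ι) {f : ι → Hyp → ℝ} (h : ∀ i ∈ s, IsSmooth (f i)) :
    IsSmooth (fun x => ∏ i ∈ s, f i x) := by
  classical
  induction s using Finset.induction_on with
  | empty => simpa using isSmooth_const 1
  | insert i s hi ih =>
    simp only [Finset.prod_insert hi]
    exact (h i (Finset.mem_insert_self i s)).mul
      (ih fun j hj => h j (Finset.mem_insert_of_mem hj))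

theorem IsSmooth.contDiffAt {f : Hyp → ℝ} (hf : IsSmooth f) {y : Fin 4 → ℝ} (hy : 0 < dot y y) :
    ContDiffAt ℝ ∞ (ext f) y := ContDiffOn.contDiffAt hf (isOpen_cone.mem_nhds hy)

theorem IsSmooth.differentiableAt {f : Hyp → ℝ} (hf : IsSmooth f) {y : Fin 4 → ℝ}
    (hy : 0 < dot y y) : DifferentiableAt ℝ (ext f) y :=
  (hf.contDiffAt hy).differentiableAt (by simp)

/-- The ambient partial derivatives of a function on `dS₃`, extended to be constant along rays. -/
def pd (c : Fin 4) (f : Hyp → ℝ) (x : Hyp) : ℝ := fderiv ℝ (ext f) x.1 (Pi.single c 1)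

theorem pd_add {f g : Hyp → ℝ} (hf : IsSmooth f) (hg : IsSmooth g) (c : Fin 4) (x : Hyp) :
    pd c (fun x => f x + g x) x = pd c f x + pd c g x := by
  rw [pd, ext_add, fderiv_fun_add (hf.differentiableAt (mem_cone x))
    (hg.differentiableAt (mem_cone x))]; rfl

theorem pd_mul {f g : Hyp → ℝ} (hf : IsSmooth f) (hg : IsSmooth g) (c : Fin 4) (x : Hyp) :
    pd c (fun x => f x * g x) x = pd c f x * g x + f x * pd c g x := by
  rw [pd, ext_mul, fderiv_fun_mul (hf.differentiableAt (mem_cone x))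
    (hg.differentiableAt (mem_cone x))]
  simp [pd, ext_coe]; ring

theorem pd_congr_cone {f : Hyp → ℝ} {g : (Fin 4 → ℝ) → ℝ}
    (h : ∀ y, 0 < dot y y → ext f y = g y) (c : Fin 4) (x : Hyp) :
    pd c f x = fderiv ℝ g x.1 (Pi.single c 1) := by
  have : ext f =ᶠ[nhds x.1] g :=
    Filter.eventuallyEq_of_mem (isOpen_cone.mem_nhds (mem_cone x)) h
  rw [pd, this.fderiv_eq]

theorem pd_const (r : ℝ) (c : Fin 4) (x : Hyp) : pd c (fun _ => r) x = 0 := by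
  rw [pd_congr_cone (g := fun _ => r) fun y hy => ext_of_pos _ hy]; simp

theorem pd_const_mul {f : Hyp → ℝ} (hf : IsSmooth f) (r : ℝ) (c : Fin 4) (x : Hyp) :
    pd c (fun x => r * f x) x = r * pd c f x := by
  rw [pd_mul (isSmooth_const r) hf, pd_const]; ring

theorem pd_sum {ι : Type*} (s : Finset ι) {f : ι → Hyp → ℝ} (h : ∀ i ∈ s, IsSmooth (f i))
    (c : Fin 4) (x : Hyp) : pd c (fun x => ∑ i ∈ s, f i x) x = ∑ i ∈ s, pd c (f i) x := by
  classical
  induction s using Finset.induction_on with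
  | empty => simpa using pd_const 0 c x
  | insert i s hi ih =>
    simp only [Finset.sum_insert hi]
    have h' : ∀ j ∈ s, IsSmooth (f j) := fun j hj => h j (Finset.mem_insert_of_mem hj)
    rw [pd_add (h i (Finset.mem_insert_self i s)) (IsSmooth.sum s h'), ih h']

theorem pd_prod {ι : Type*} [DecidableEq ι] (s : Finset ι) {f : ι → Hyp → ℝ}
    (h : ∀ i ∈ s, IsSmooth (f i)) (c : Fin 4) (x : Hyp) :
    pd c (fun x => ∏ i ∈ s, f i x) x = ∑ i ∈ s, (∏ j ∈ s.erase i, f j x) * pd c (f i) x := by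
  induction s using Finset.induction_on with
  | empty => simpa using pd_const 1 c x
  | insert i s hi ih =>
    simp only [Finset.prod_insert hi]
    have h' : ∀ j ∈ s, IsSmooth (f j) := fun j hj => h j (Finset.mem_insert_of_mem hj)
    rw [pd_mul (h i (Finset.mem_insert_self i s)) (IsSmooth.prod s h'), ih h',
      Finset.sum_insert hi, Finset.erase_insert hi, Finset.mul_sum, mul_comm]
    congr 1
    refine Finset.sum_congr rfl fun j hj => ?_
    rw [Finset.erase_insert_of_ne (by rintro rfl; exact hi hj),
      Finset.prod_insert (by simp [hi]), mul_assoc]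

theorem pd_comp {f : Hyp → ℝ} (hf : IsSmooth f) {φ : ℝ → ℝ} (hφ : ContDiff ℝ ∞ φ) (c : Fin 4)
    (x : Hyp) : pd c (fun x => φ (f x)) x = deriv φ (f x) * pd c f x := by
  rw [pd_congr_cone (g := fun y => φ (ext f y)) fun y hy => by
    rw [ext_of_pos _ hy, ext_of_pos _ hy]]
  have h1 : HasDerivAt φ (deriv φ (ext f x.1)) (ext f x.1) :=
    (hφ.differentiable (by simp) _).hasDerivAt
  have h2 := h1.comp_hasFDerivAt x.1 (hf.differentiableAt (mem_cone x)).hasFDerivAt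
  have h3 : fderiv ℝ (fun y => φ (ext f y)) x.1 = _ := h2.fderiv
  rw [h3, ext_coe]; simp [pd]

theorem hasDerivAt_quadratic (a b : ℝ) :
    HasDerivAt (fun t : ℝ => 1 + 2 * t * a + t ^ 2 * b) (2 * a) 0 := by
  have h1 : HasDerivAt (fun t : ℝ => 2 * t * a) (2 * 1 * a) 0 :=
    ((hasDerivAt_id (0 : ℝ)).const_mul 2).mul_const a
  have h2 : HasDerivAt (fun t : ℝ => t ^ 2 * b) ((2 : ℕ) * 0 ^ (2 - 1) * b) 0 :=
    (hasDerivAt_pow 2 (0 : ℝ)).mul_const b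
  have h3 := (h1.const_add 1).add h2
  simp only [mul_one, Nat.add_one_sub_one, pow_one, mul_zero, zero_mul, add_zero] at h3
  exact h3

/-- The extended coordinate is y_a / √η(y,y), and its differential on the hyperboloid is the
tangential projector. -/
theorem pd_coord (c a : Fin 4) (x : Hyp) : pd c (fun x => x.1 a) x = proj x c a := by
  have hd := (isSmooth_coord a).differentiableAt (mem_cone x)
  rw [pd, ← hd.lineDeriv_eq_fderiv, lineDeriv]
  have h0 : ∀ᶠ t in nhds (0 : ℝ), 0 < dot (x.1 + t • Pi.single c 1) (x.1 + t • Pi.single c 1) := by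
    have hc : Continuous fun t : ℝ =>
        dot (x.1 + t • Pi.single c 1) (x.1 + t • Pi.single c (1 : ℝ)) :=
      contDiff_dot.continuous.comp (by fun_prop)
    exact hc.continuousAt.eventually (isOpen_lt continuous_const continuous_id |>.mem_nhds
      (by simp [x.2]))
  have h1 : (fun t : ℝ => ext (fun x => x.1 a) (x.1 + t • Pi.single c 1)) =ᶠ[nhds 0]
      fun t => (√(1 + 2 * t * (eta c * x.1 c) + t ^ 2 * eta c))⁻¹ *
        (x.1 a + t * (Pi.single c (1 : ℝ) : Fin 4 → ℝ) a) := by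
    filter_upwards [h0] with t ht
    rw [ext_of_pos _ ht]
    simp only [Pi.smul_apply, Pi.add_apply, smul_eq_mul]
    rw [dot_add_single, x.2]
  rw [h1.deriv_eq]
  have h2 := hasDerivAt_quadratic (eta c * x.1 c) (eta c)
  have h3 := (h2.sqrt (by simp)).inv (by simp)
  have h4 : HasDerivAt (fun t : ℝ => x.1 a + t * (Pi.single c (1 : ℝ) : Fin 4 → ℝ) a)
      ((Pi.single c (1 : ℝ) : Fin 4 → ℝ) a) 0 := by
    simpa using ((hasDerivAt_id (0 : ℝ)).mul_const _).const_add (x.1 a)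
  have h5 := (h3.mul h4).deriv
  refine h5.trans ?_
  simp [proj, Pi.single_apply, eq_comm]
  ring

/-- Euler's relation for an extension that is constant along rays. -/
theorem sum_mul_pd {f : Hyp → ℝ} (hf : IsSmooth f) (x : Hyp) : ∑ c, x.1 c * pd c f x = 0 := by
  have h1 : ∑ c, x.1 c * pd c f x = fderiv ℝ (ext f) x.1 x.1 := by
    conv_rhs => rw [show x.1 = ∑ c, x.1 c • Pi.single c (1 : ℝ) by
      rw [← pi_eq_sum_univ' x.1]]
    rw [← pi_eq_sum_univ' x.1, pi_eq_sum_univ' x.1, map_sum, ← pi_eq_sum_univ' x.1]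
    simp [pd]
  rw [h1, ← (hf.differentiableAt (mem_cone x)).lineDeriv_eq_fderiv, lineDeriv]
  have : (fun t : ℝ => ext f (x.1 + t • x.1)) =ᶠ[nhds 0] fun _ => ext f x.1 := by
    filter_upwards [lt_mem_nhds (show (-1 : ℝ) < 0 by norm_num)] with t ht
    rw [show x.1 + t • x.1 = (1 + t) • x.1 by rw [add_smul, one_smul], ext_smul f (by linarith)]
  rw [this.deriv_eq, deriv_const]

theorem fderiv_ext_smul {f : Hyp → ℝ} {r : ℝ} (hr : 0 < r) (y : Fin 4 → ℝ) :
    fderiv ℝ (ext f) (r • y) = r⁻¹ • fderiv ℝ (ext f) y := by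
  have h : (fun y => ext f (r • y)) = ext f := funext fun y => ext_smul f hr y
  have h2 := fderiv_comp_smul (𝕜 := ℝ) (f := ext f) (x := y) r
  rw [h] at h2
  rw [h2, smul_smul, inv_mul_cancel₀ hr.ne', one_smul]

/-- The partial derivative of the extension has degree −1, whereas `ext` extends its restriction
with degree 0; the square root makes up the difference. -/
theorem ext_pd (c : Fin 4) (f : Hyp → ℝ) {y : Fin 4 → ℝ} (hy : 0 < dot y y) :
    ext (pd c f) y = √(dot y y) * fderiv ℝ (ext f) y (Pi.single c 1) := by
  rw [ext_of_pos _ hy, pd, fderiv_ext_smul (inv_pos.2 (Real.sqrt_pos.2 hy)), inv_inv]; rfl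

theorem contDiffOn_fderiv_ext {f : Hyp → ℝ} (hf : IsSmooth f) (c : Fin 4) :
    ContDiffOn ℝ ∞ (fun y => fderiv ℝ (ext f) y (Pi.single c 1)) {y | 0 < dot y y} :=
  (hf.fderiv_of_isOpen isOpen_cone (by simp)).clm_apply contDiffOn_const

theorem IsSmooth.pd {f : Hyp → ℝ} (hf : IsSmooth f) (c : Fin 4) : IsSmooth (pd c f) := by
  refine ContDiffOn.congr (f := fun y => √(dot y y) * fderiv ℝ (ext f) y (Pi.single c 1)) ?_
    fun y hy => ext_pd c f hy
  exact (contDiff_dot.contDiffOn.sqrt fun y hy => ne_of_gt hy).mul (contDiffOn_fderiv_ext hf c)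

theorem fderiv_sqrt_dot (x : Hyp) (c : Fin 4) :
    fderiv ℝ (fun y : Fin 4 → ℝ => √(dot y y)) x.1 (Pi.single c 1) = eta c * x.1 c := by
  have hd : DifferentiableAt ℝ (fun y : Fin 4 → ℝ => √(dot y y)) x.1 :=
    (contDiff_dot.differentiable (by simp) x.1).sqrt (mem_cone x).ne'
  rw [← hd.lineDeriv_eq_fderiv, lineDeriv]
  simp only [dot_add_single, x.2]
  have h2 := hasDerivAt_quadratic (eta c * x.1 c) (eta c)
  rw [(h2.sqrt (by simp)).deriv]
  simp

theorem pd_pd {f : Hyp → ℝ} (hf : IsSmooth f) (c d : Fin 4) (x : Hyp) :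
    pd c (pd d f) x = eta c * x.1 c * pd d f x +
      fderiv ℝ (fun y => fderiv ℝ (ext f) y (Pi.single d 1)) x.1 (Pi.single c 1) := by
  rw [pd_congr_cone (g := fun y => √(dot y y) * fderiv ℝ (ext f) y (Pi.single d 1))
    fun y hy => ext_pd d f hy, fderiv_fun_mul]
  · simp [fderiv_sqrt_dot, x.2, pd]; ring
  · exact (contDiff_dot.differentiable (by simp) x.1).sqrt (mem_cone x).ne'
  · exact ((contDiffOn_fderiv_ext hf d).contDiffAt
      (isOpen_cone.mem_nhds (mem_cone x))).differentiableAt (by simp)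

/-- Genuine second partial derivatives commute; the asymmetry comes only from the factor √η(y,y) in
`ext_pd`, whose gradient on the hyperboloid is the lowered normal. -/
theorem pd_comm {f : Hyp → ℝ} (hf : IsSmooth f) (c d : Fin 4) (x : Hyp) :
    pd c (pd d f) x + eta d * x.1 d * pd c f x = pd d (pd c f) x + eta c * x.1 c * pd d f x := by
  rw [pd_pd hf, pd_pd hf]
  have hs : IsSymmSndFDerivAt ℝ (ext f) x.1 :=
    (hf.contDiffAt (mem_cone x)).isSymmSndFDerivAt (by simpa using (WithTop.coe_le_coe.2 le_top : ((2 : ℕ∞) : WithTop ℕ∞) ≤ ((⊤ : ℕ∞) : WithTop ℕ∞)))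
  have hd : DifferentiableAt ℝ (fderiv ℝ (ext f)) x.1 :=
    ((hf.fderiv_of_isOpen isOpen_cone (m := ∞) (by simp)).contDiffAt
      (isOpen_cone.mem_nhds (mem_cone x))).differentiableAt (by simp)
  have h : ∀ c d : Fin 4,
      fderiv ℝ (fun y => fderiv ℝ (ext f) y (Pi.single d 1)) x.1 (Pi.single c 1)
      = fderiv ℝ (fderiv ℝ (ext f)) x.1 (Pi.single c 1) (Pi.single d 1) := by
    intro c d
    rw [fderiv_clm_apply hd (differentiableAt_const _)]
    simp
  rw [h, h, hs.eq]
  ring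

/-! ### The covariant derivative -/

/-- The unit normal with lowered index. -/
def low (x : Hyp) (a : Fin 4) : ℝ := eta a * x.1 a

theorem eta_mul_eta (a : Fin 4) : eta a * eta a = 1 := by fin_cases a <;> simp [eta]

theorem sum_low_mul (x : Hyp) : ∑ a, low x a * x.1 a = 1 := x.2

/-- The tangential projector as a matrix. -/
def projM (x : Hyp) : Matrix (Fin 4) (Fin 4) ℝ := Matrix.of (proj x)

theorem projM_apply (x : Hyp) (a b : Fin 4) : projM x a b = proj x a b := rfl

theorem sum_proj_mul (x : Hyp) (a : Fin 4) (f : Fin 4 → ℝ) :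
    ∑ b, proj x a b * f b = f a - low x a * ∑ b, x.1 b * f b := by
  simp only [proj, sub_mul, Finset.sum_sub_distrib, ite_mul, one_mul, zero_mul,
    Finset.sum_ite_eq, Finset.mem_univ, if_true, Finset.mul_sum, low, mul_assoc]

theorem sum_mul_proj (x : Hyp) (b : Fin 4) (f : Fin 4 → ℝ) :
    ∑ a, f a * proj x a b = f b - (∑ a, f a * low x a) * x.1 b := by
  simp only [proj, mul_sub, Finset.sum_sub_distrib, mul_ite, mul_one, mul_zero,
    Finset.sum_ite_eq', Finset.mem_univ, if_true, Finset.sum_mul, low, mul_assoc]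

theorem sum_proj_mul_low (x : Hyp) (a : Fin 4) : ∑ b, proj x a b * low x b = 0 := by
  rw [sum_proj_mul]
  simp_rw [mul_comm (x.1 _)]
  rw [sum_low_mul]; ring

theorem sum_coord_mul_proj (x : Hyp) (b : Fin 4) : ∑ a, x.1 a * proj x a b = 0 := by
  rw [sum_mul_proj]
  simp_rw [mul_comm (x.1 _) (low x _)]
  rw [sum_low_mul]; ring

theorem projM_mul_projM (x : Hyp) : projM x * projM x = projM x := by
  ext a b
  simp only [Matrix.mul_apply, projM_apply]
  rw [sum_proj_mul, sum_coord_mul_proj]; ring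

theorem isSmooth_proj (a b : Fin 4) : IsSmooth (fun x => proj x a b) := by
  unfold proj
  simp only [sub_eq_add_neg, neg_mul_eq_neg_mul]
  exact (isSmooth_const _).add
    (((isSmooth_const (-eta a)).mul (isSmooth_coord a)).mul (isSmooth_coord b)) |> fun h => by
      simpa [neg_mul] using h

theorem isSmooth_low (a : Fin 4) : IsSmooth (fun x => low x a) :=
  (isSmooth_const _).mul (isSmooth_coord a)

theorem metric_cons (x : Hyp) (a b : Fin 4) : metric x ![a, b] = proj x a b * eta b := by
  simp only [metric, proj, Matrix.cons_val_zero, Matrix.cons_val_one]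
  by_cases h : a = b
  · subst h; simp; ring
  · simp [h]; ring

theorem metric_symm (x : Hyp) (a b : Fin 4) : metric x ![a, b] = metric x ![b, a] := by
  simp only [metric, Matrix.cons_val_zero, Matrix.cons_val_one]
  by_cases h : a = b
  · subst h; simp
  · simp [h, Ne.symm h]; ring

theorem pd_low (c a : Fin 4) (x : Hyp) : pd c (fun x => low x a) x = metric x ![c, a] := by
  unfold low
  rw [pd_const_mul (isSmooth_coord a), pd_coord, metric_cons]; ring

/-- Componentwise ambient derivative of a tensor field. -/
def pdT {k : ℕ} (c : Fin 4) (T : Tensor k) (x : Hyp) : Ten k := fun B => pd c (fun y => T y B) x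

/-- Smooth tangential tensor fields. -/
def Good {k : ℕ} (T : Tensor k) : Prop :=
  (∀ a, IsSmooth fun x => T x a) ∧ ∀ x, act (projM x) (T x) = T x

/-- The derivative index needs no projection: gradients of functions constant along rays annihilate
the normal. -/
theorem cov_cons {k : ℕ} {T : Tensor k} (hT : ∀ a, IsSmooth fun x => T x a) (x : Hyp) (c : Fin 4)
    (A : Fin k → Fin 4) : cov T x (Fin.cons c A) = act (projM x) (pdT c T x) A := by
  have h1 : cov T x (Fin.cons c A) =
      act (projM x) (fun b => pd (b 0) (fun y => T y (Fin.tail b)) x) (Fin.cons c A) := rfl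
  rw [h1, act_cons]
  simp only [Fin.cons_zero, Fin.tail_cons, act_apply, Finset.mul_sum]
  rw [Finset.sum_comm]
  refine Finset.sum_congr rfl fun b _ => ?_
  simp_rw [mul_left_comm (projM x c _), ← Finset.mul_sum]
  congr 1
  refine (sum_proj_mul x c fun d => pd d (fun y => T y b) x).trans ?_
  rw [sum_mul_pd (hT b)]
  simp [pdT]

theorem cov_apply {k : ℕ} {T : Tensor k} (hT : ∀ a, IsSmooth fun x => T x a) (x : Hyp)
    (a : Fin (k + 1) → Fin 4) : cov T x a = act (projM x) (pdT (a 0) T x) (Fin.tail a) := by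
  rw [← cov_cons hT, Fin.cons_self_tail]

theorem Good.cov {k : ℕ} {T : Tensor k} (hT : Good T) : Good (cov T) := by
  constructor
  · intro a
    exact IsSmooth.sum _ fun b _ => (IsSmooth.prod _ fun i _ => isSmooth_proj _ _).mul
      ((hT.1 _).pd _)
  · intro x
    have h1 : DeSitter.cov T x =
      act (projM x) (fun b => pd (b 0) (fun y => T y (Fin.tail b)) x) := rfl
    rw [h1, act_act, projM_mul_projM]

theorem Good.add {k : ℕ} {S T : Tensor k} (hS : Good S) (hT : Good T) : Good (S + T) :=
  ⟨fun a => (hS.1 a).add (hT.1 a), fun x => by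
    rw [Pi.add_apply, map_add, hS.2, hT.2]⟩

theorem Good.smul {k : ℕ} {T : Tensor k} (r : ℝ) (hT : Good T) : Good (r • T) :=
  ⟨fun a => (isSmooth_const r).mul (hT.1 a), fun x => by
    rw [Pi.smul_apply, map_smul, hT.2]⟩

theorem good_zero {k : ℕ} : Good (0 : Tensor k) :=
  ⟨fun _ => isSmooth_const 0, fun x => by simp⟩

theorem pdT_add {k : ℕ} {S T : Tensor k} (hS : ∀ a, IsSmooth fun x => S x a)
    (hT : ∀ a, IsSmooth fun x => T x a) (c : Fin 4) (x : Hyp) :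
    pdT c (S + T) x = pdT c S x + pdT c T x := by
  ext B; exact pd_add (hS B) (hT B) c x

theorem cov_add {k : ℕ} {S T : Tensor k} (hS : Good S) (hT : Good T) :
    cov (S + T) = cov S + cov T := by
  funext x a
  rw [Pi.add_apply, Pi.add_apply, cov_apply (hS.add hT).1, cov_apply hS.1, cov_apply hT.1,
    pdT_add hS.1 hT.1, map_add]; rfl

theorem cov_smul {k : ℕ} {T : Tensor k} (r : ℝ) (hT : Good T) : cov (r • T) = r • cov T := by
  funext x a
  have : pdT (a 0) (r • T) x = r • pdT (a 0) T x := by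
    ext B; exact pd_const_mul (hT.1 B) r (a 0) x
  rw [Pi.smul_apply, Pi.smul_apply, cov_apply (hT.smul r).1, cov_apply hT.1, this, map_smul]; rfl

theorem cov_zero {k : ℕ} : cov (0 : Tensor k) = 0 := by
  simpa using cov_smul 0 (good_zero (k := k))

theorem tmul_eq {k l : ℕ} (S : Tensor k) (T : Tensor l) (x : Hyp) :
    tmul S T x = tmulL (S x) (T x) := rfl

theorem permute_eq {k l : ℕ} (e : Fin k ≃ Fin l) (T : Tensor k) (x : Hyp) :
    permute e T x = permuteL e (T x) := rfl

theorem contract_eq {k : ℕ} (T : Tensor (k + 2)) (x : Hyp) :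
    contract T x = contractL (T x) := rfl

theorem Good.tmul {k l : ℕ} {S : Tensor k} {T : Tensor l} (hS : Good S) (hT : Good T) :
    Good (tmul S T) :=
  ⟨fun a => (hS.1 _).mul (hT.1 _), fun x => by rw [tmul_eq, act_tmulL, hS.2, hT.2]⟩

theorem Good.permute {k l : ℕ} {T : Tensor k} (e : Fin k ≃ Fin l) (hT : Good T) :
    Good (permute e T) :=
  ⟨fun a => hT.1 _, fun x => by rw [permute_eq, act_permuteL, hT.2]⟩

theorem Good.contract {k : ℕ} {T : Tensor (k + 2)} (hT : Good T) : Good (contract T) :=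
  ⟨fun a => IsSmooth.sum _ fun c _ => (isSmooth_const _).mul (hT.1 _), fun x => by
    rw [contract_eq, ← hT.2, contractL_act, act_act, projM_mul_projM]⟩

theorem isSmooth_metric (a) : IsSmooth (fun x => metric x a) := by
  have : (fun x => metric x a) = fun x => proj x (a 0) (a 1) * eta (a 1) := by
    funext x
    rw [← metric_cons]
    congr 1
    ext i; fin_cases i <;> rfl
  rw [this]
  exact (isSmooth_proj _ _).mul (isSmooth_const _)

theorem act_two (O : Matrix (Fin 4) (Fin 4) ℝ) (T : Ten 2) (a b : Fin 4) :
    act O T ![a, b] = ∑ c, O a c * ∑ d, O b d * T ![c, d] := by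
  have h0 : ∀ T : Ten 0, act O T = T := fun T => by
    ext a; simp [act_apply]; congr 1; exact Subsingleton.elim _ _
  change act O T (Fin.cons a (Fin.cons b Fin.elim0)) = _
  simp only [act_cons, h0]
  refine Finset.sum_congr rfl fun c _ => ?_
  congr 1

theorem vec_two (a : Fin 2 → Fin 4) : a = ![a 0, a 1] := by
  ext i; fin_cases i <;> rfl

theorem act_metric (x : Hyp) : act (projM x) (metric x) = metric x := by
  ext a
  rw [vec_two a, act_two]
  have h : ∀ c, ∑ d, projM x (a 1) d * metric x ![c, d] = metric x ![a 1, c] := by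
    intro c
    simp_rw [metric_symm x c, metric_cons, ← mul_assoc, ← Finset.sum_mul]
    simp only [projM_apply]
    rw [sum_proj_mul, sum_coord_mul_proj]; ring
  simp_rw [h, metric_symm x (a 1), metric_cons, ← mul_assoc, ← Finset.sum_mul]
  simp only [projM_apply]
  rw [sum_proj_mul, sum_coord_mul_proj]; ring

theorem good_metric : Good metric := ⟨isSmooth_metric, act_metric⟩

/-! ### Compatibility of the derivative with products, permutations, contractions, metric and volume
form -/

/-- Tangential tensors are killed by the unit normal in the first slot. -/
theorem sum_coord_mul_cons {k : ℕ} {x : Hyp} {T : Ten (k + 1)} (hT : act (projM x) T = T)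
    (A : Fin k → Fin 4) : ∑ c, x.1 c * T (Fin.cons c A) = 0 := by
  rw [← hT]
  simp only [act_cons, Finset.mul_sum, ← mul_assoc]
  rw [Finset.sum_comm]
  simp only [← Finset.sum_mul, projM_apply, sum_coord_mul_proj, zero_mul, Finset.sum_const_zero]

theorem cov_tmul {k l : ℕ} {S : Tensor k} {T : Tensor l} (hS : Good S) (hT : Good T) (x : Hyp)
    (a : Fin (k + l + 1) → Fin 4) :
    cov (tmul S T) x a =
      cov S x (Fin.cons (a 0) fun i => a (Fin.castAdd l i).succ) *
        T x (fun j => a (Fin.natAdd k j).succ) +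
      S x (fun i => a (Fin.castAdd l i).succ) *
        cov T x (Fin.cons (a 0) fun j => a (Fin.natAdd k j).succ) := by
  rw [cov_apply (hS.tmul hT).1, cov_cons hS.1, cov_cons hT.1]
  have : pdT (a 0) (tmul S T) x =
      tmulL (pdT (a 0) S x) (T x) + tmulL (S x) (pdT (a 0) T x) := by
    ext B
    exact pd_mul (hS.1 _) (hT.1 _) _ _
  rw [this, map_add, act_tmulL, act_tmulL, hS.2, hT.2]
  rfl

theorem cov_permute {k l : ℕ} (e : Fin k ≃ Fin l) {T : Tensor k} (hT : Good T) (x : Hyp) :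
    cov (permute e T) x = liftC (permuteL e) (cov T x) := by
  ext a
  rw [cov_apply (hT.permute e).1, liftC_apply]
  have : pdT (a 0) (permute e T) x = permuteL e (pdT (a 0) T x) := rfl
  have h : (fun B => cov T x (Fin.cons (a 0) B)) = act (projM x) (pdT (a 0) T x) :=
    funext fun B => cov_cons hT.1 x _ B
  rw [this, act_permuteL, h]

theorem sum_eta_proj_proj (x : Hyp) (d e : Fin 4) :
    ∑ c, eta c * proj x c d * proj x c e = (if d = e then eta d else 0) - x.1 d * x.1 e := by
  have h : ∀ c, eta c * proj x c d * proj x c e = (eta c * proj x c d) * proj x c e := fun _ => rfl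
  rw [sum_mul_proj x e fun c => eta c * proj x c d]
  have h2 : ∑ c, eta c * proj x c d * low x c = 0 := by
    rw [← sum_coord_mul_proj x d]
    refine Finset.sum_congr rfl fun c _ => ?_
    unfold low
    linear_combination proj x c d * x.1 c * eta_mul_eta c
  rw [h2, proj]
  by_cases h : d = e
  · subst h
    simp only [if_true]
    linear_combination -(x.1 d * x.1 d) * eta_mul_eta d
  · simp only [h, Ne.symm h, if_false]
    linear_combination -(x.1 d * x.1 e) * eta_mul_eta e

/-- Contracting after projection uses η − x ⊗ x in place of η. The difference is the double normal
component of the ambient derivative, which vanishes for tangential tensors. -/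
theorem cov_contract {k : ℕ} {T : Tensor (k + 2)} (hT : Good T) (x : Hyp) :
    cov (contract T) x = liftC contractL (cov T x) := by
  ext a
  rw [cov_apply hT.contract.1, liftC_apply]
  have h1 : (fun B => cov T x (Fin.cons (a 0) B)) = act (projM x) (pdT (a 0) T x) := by
    ext B; rw [cov_cons hT.1]
  have h2 : pdT (a 0) (contract T) x = contractL (pdT (a 0) T x) := by
    ext B
    refine (pd_sum Finset.univ (f := fun c y => eta c * T y (Fin.cons c (Fin.cons c B)))
      (fun c _ => (isSmooth_const _).mul (hT.1 _)) _ _).trans ?_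
    rw [contractL_apply]
    refine Finset.sum_congr rfl fun c _ => ?_
    exact pd_const_mul (hT.1 _) _ _ _
  rw [h1, h2, contractL_act]
  refine congrFun (congrArg (act (projM x)) (funext fun B => ?_)) _
  simp only [projM_apply, sum_eta_proj_proj]
  have h3 : ∀ d, ∑ e, x.1 d * x.1 e * pdT (a 0) T x (Fin.cons d (Fin.cons e B)) =
      x.1 d * ∑ e, x.1 e * pdT (a 0) T x (Fin.cons d (Fin.cons e B)) := fun d => by
    simp only [Finset.mul_sum, mul_assoc]
  simp only [sub_mul, Finset.sum_sub_distrib, h3]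
  -- Differentiating the identity x·T = 0: the normal component of the derivative is −T with the
  -- derivative index in the freed slot.
  have h4 : ∀ e, ∑ d, x.1 d * pdT (a 0) T x (Fin.cons d (Fin.cons e B)) =
      - T x (Fin.cons (a 0) (Fin.cons e B)) := by
    intro e
    have h5 : (fun y : Hyp => ∑ d, y.1 d * T y (Fin.cons d (Fin.cons e B))) = fun _ => 0 := by
      funext y; exact sum_coord_mul_cons (hT.2 y) _
    have h6 := pd_sum Finset.univ (f := fun d (y : Hyp) => y.1 d * T y (Fin.cons d (Fin.cons e B)))
      (fun d _ => (isSmooth_coord d).mul (hT.1 _)) (a 0) x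
    rw [h5, pd_const] at h6
    simp_rw [pd_mul (isSmooth_coord _) (hT.1 _), pd_coord] at h6
    rw [Finset.sum_add_distrib, sum_proj_mul x (a 0) fun d => T x (Fin.cons d (Fin.cons e B)),
      sum_coord_mul_cons (hT.2 x)] at h6
    simp only [pdT]
    linarith
  -- By the previous identity the double normal component is −x·T in the second slot, which vanishes
  -- as well.
  have h7 : ∑ d, x.1 d * ∑ e, x.1 e * pdT (a 0) T x (Fin.cons d (Fin.cons e B)) = 0 := by
    simp only [Finset.mul_sum]
    rw [Finset.sum_comm]
    have : ∀ e, ∑ d, x.1 d * (x.1 e * pdT (a 0) T x (Fin.cons d (Fin.cons e B)))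
        = - (x.1 e * T x (Fin.cons (a 0) (Fin.cons e B))) := by
      intro e
      rw [← mul_neg, ← h4, Finset.mul_sum]
      exact Finset.sum_congr rfl fun _ _ => by ring
    simp only [this, Finset.sum_neg_distrib]
    have h8 := sum_coord_mul_cons (T := permuteL (Equiv.swap 0 1) (T x)) (x := x)
      (by rw [act_permuteL, hT.2]) (Fin.cons (a 0) B)
    rw [neg_eq_zero, ← h8]
    refine Finset.sum_congr rfl fun c _ => ?_
    rw [permuteL_apply]
    congr 2
    ext i
    refine Fin.cases ?_ (fun i => ?_) i
    · simp
    refine Fin.cases ?_ (fun i => ?_) i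
    · simp
    · have hs : Equiv.swap (0 : Fin (k + 2)) 1 i.succ.succ = i.succ.succ :=
        Equiv.swap_apply_of_ne_of_ne (Fin.succ_ne_zero _)
          (fun h => Fin.succ_ne_zero _ (Fin.succ_injective _ h))
      rw [Function.comp_apply, hs]; rfl
  rw [h7, sub_zero, contractL_apply]
  refine Finset.sum_congr rfl fun c _ => ?_
  simp only [ite_mul, zero_mul, Finset.sum_ite_eq, Finset.mem_univ, if_true]

/-- The metric is η minus the square of the lowered normal, so each term of its derivative keeps one
undifferentiated normal, which the projection kills. -/
theorem cov_metric : cov metric = 0 := by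
  funext x a
  rw [cov_apply good_metric.1, vec_two (Fin.tail a), act_two]
  have h : ∀ c d, pdT (a 0) metric x ![c, d] =
      -(metric x ![a 0, c] * low x d) - low x c * metric x ![a 0, d] := by
    intro c d
    have h1 : (fun y : Hyp => metric y ![c, d]) =
        fun y => (if c = d then eta c else 0) + (-1) * (low y c * low y d) := by
      funext y; simp [metric, low]; ring
    change pd (a 0) (fun y : Hyp => metric y ![c, d]) x = _
    rw [h1, pd_add (isSmooth_const _) ((isSmooth_const _).mul
      ((isSmooth_low c).mul (isSmooth_low d))), pd_const, pd_const_mul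
      ((isSmooth_low c).mul (isSmooth_low d)), pd_mul (isSmooth_low c) (isSmooth_low d), pd_low,
      pd_low]
    ring
  simp only [h, mul_sub, mul_neg, Finset.sum_sub_distrib, Finset.sum_neg_distrib, projM_apply]
  have h2 : ∀ u : ℝ, ∀ b, ∑ d, proj x b d * (u * low x d) = 0 := by
    intro u b
    simp_rw [mul_left_comm _ u]
    rw [← Finset.mul_sum, sum_proj_mul_low, mul_zero]
  simp only [h2, mul_zero, Finset.sum_const_zero, neg_zero, zero_sub]
  have h3 : ∀ c, ∑ d, proj x (Fin.tail a 1) d * (low x c * metric x ![a 0, d]) =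
    low x c * ∑ d, proj x (Fin.tail a 1) d * metric x ![a 0, d] := by
    intro c; rw [Finset.mul_sum]; exact Finset.sum_congr rfl fun _ _ => by ring
  simp_rw [h3, mul_comm (low x _)]
  rw [h2, neg_zero]; rfl

/-- The determinant with first row `x` and the given remaining rows. -/
def detRows (x : Fin 4 → ℝ) (R : Fin 3 → Fin 4 → ℝ) : ℝ :=
  Matrix.det (Matrix.of (Fin.cons x R : Fin 4 → Fin 4 → ℝ))

/-- `detRows` as a multilinear function of the last three rows. -/
def detRowsM (x : Fin 4 → ℝ) : MultilinearMap ℝ (fun _ : Fin 3 => Fin 4 → ℝ) ℝ :=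
  (Matrix.detRowAlternating (n := Fin 4) (R := ℝ)).toMultilinearMap.curryLeft x

theorem detRowsM_apply (x : Fin 4 → ℝ) (R : Fin 3 → Fin 4 → ℝ) : detRowsM x R = detRows x R := by
  rw [detRowsM, MultilinearMap.curryLeft_apply]; rfl

theorem detRowsM_sum (x : Fin 4 → ℝ) (R : Fin 3 → Fin 4 → ℝ) :
    detRows x R = ∑ j, x j * detRows (Pi.single j 1) R := by
  simp_rw [← detRowsM_apply]
  have h : detRowsM x = ∑ j, x j • detRowsM (Pi.single j 1) := by
    conv_lhs => rw [pi_eq_sum_univ' x]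
    unfold detRowsM
    rw [map_sum]
    simp_rw [map_smul]
  rw [h]
  simp

theorem act_vol_aux (x : Fin 4 → ℝ) (O : Matrix (Fin 4) (Fin 4) ℝ) (a : Fin 3 → Fin 4) :
    act O (fun a : Fin 3 → Fin 4 => detRows x fun i => Pi.single (a i) 1) a =
      detRows x fun i => O (a i) := by
  rw [act_apply]
  have h := (detRowsM x).map_sum_finset
    (fun (i : Fin 3) (j : Fin 4) => O (a i) j • (Pi.single j 1 : Fin 4 → ℝ))
    (fun _ => Finset.univ)
  have h2 : (fun i => ∑ j, O (a i) j • (Pi.single j 1 : Fin 4 → ℝ)) = fun i => O (a i) := by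
    funext i; exact (pi_eq_sum_univ' _).symm
  rw [h2, Fintype.piFinset_univ, detRowsM_apply] at h
  rw [h]
  refine Finset.sum_congr rfl fun b _ => ?_
  rw [MultilinearMap.map_smul_univ, detRowsM_apply, smul_eq_mul]

theorem detRows_smul_eq_zero {x n : Fin 4 → ℝ} {R : Fin 3 → Fin 4 → ℝ} (hn : n ≠ 0)
    (hx : ∑ b, x b * n b = 0) (hR : ∀ i, ∑ b, R i b * n b = 0) : detRows x R = 0 := by
  refine Matrix.exists_mulVec_eq_zero_iff.1 ⟨n, hn, ?_⟩
  ext i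
  refine Fin.cases ?_ (fun i => ?_) i
  · exact hx
  · exact hR i

theorem detRows_sub_smul (x : Fin 4 → ℝ) (R : Fin 3 → Fin 4 → ℝ) (r : Fin 3 → ℝ) :
    detRows x (fun i => R i - r i • x) = detRows x R := by
  refine Matrix.det_eq_of_forall_row_eq_smul_add_const (k := 0)
    (Fin.cons 0 fun i => -r i : Fin 4 → ℝ) rfl ?_
  intro i j
  refine Fin.cases ?_ (fun i => ?_) i
  · simp
  · simp; ring

theorem vol_apply (x : Hyp) (a) : vol x a = detRows x.1 fun i => Pi.single (a i) 1 := rfl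

theorem act_vol (x : Hyp) : act (projM x) (vol x) = vol x := by
  ext a
  refine (act_vol_aux _ _ _).trans ?_
  rw [vol_apply, ← detRows_sub_smul x.1 _ fun i => -low x (a i)]
  congr 1
  funext i
  ext b
  simp [projM, proj, low, Pi.single_apply, eq_comm]

theorem isSmooth_vol (a) : IsSmooth (fun x => vol x a) := by
  have : (fun x : Hyp => vol x a) = fun x => ∑ σ : Equiv.Perm (Fin 4),
      (Equiv.Perm.sign σ : ℝ) * ∏ i, (Fin.cons x.1 (fun i => Pi.single (a i) (1 : ℝ)) :
    Fin 4 → Fin 4 → ℝ) (σ i) i := by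
    funext x
    rw [vol, Matrix.det_apply']; rfl
  rw [this]
  refine IsSmooth.sum _ fun σ _ => (isSmooth_const _).mul (IsSmooth.prod _ fun i _ => ?_)
  refine Fin.cases ?_ (fun j => ?_) (σ i)
  · exact isSmooth_coord i
  · exact isSmooth_const _

theorem good_vol : Good vol := ⟨isSmooth_vol, act_vol⟩

theorem vol_eq_sum (x : Hyp) (a : Fin 3 → Fin 4) :
    vol x a = ∑ j, x.1 j * detRows (Pi.single j 1) fun i => Pi.single (a i) 1 := by
  rw [vol_apply, detRowsM_sum]

/-- Differentiating the row x gives a tangential row; after projection all four rows annihilate the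
lowered normal, so the determinant is singular. -/
theorem cov_vol : cov vol = 0 := by
  funext x a
  rw [cov_apply good_vol.1]
  have h : pdT (a 0) vol x = fun b => detRows (proj x (a 0)) fun i => Pi.single (b i) 1 := by
    funext b
    have h1 : (fun y : Hyp => vol y b) = fun y : Hyp => ∑ j, y.1 j *
        detRows (Pi.single j 1) fun i => Pi.single (b i) 1 := funext fun y => vol_eq_sum y b
    change pd (a 0) (fun y : Hyp => vol y b) x = _
    rw [h1, pd_sum _ fun j _ => (isSmooth_coord j).mul (isSmooth_const _)]
    simp_rw [pd_mul (isSmooth_coord _) (isSmooth_const _), pd_const, pd_coord, mul_zero, add_zero]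
    exact (detRowsM_sum _ _).symm
  rw [h, act_vol_aux]
  refine detRows_smul_eq_zero (n := low x) ?_ (sum_proj_mul_low x _)
    fun i => sum_proj_mul_low x _
  intro h0
  have := sum_low_mul x
  simp [h0] at this

/-- Metric and volume form are parallel and the derivative commutes with permutations and
contractions, so it passes through every operation. -/
theorem good_apply {m k : ℕ} {C : CoefOp m k} (hC : IsCoef m k C) {T : Tensor m} (hT : Good T) :
    Good (fun x => C x (T x)) ∧ ∀ x, cov (fun x => C x (T x)) x = liftC (C x) (cov T x) := by
  induction hC with
  | id =>
    refine ⟨hT, fun x => ?_⟩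
    ext a
    simp [liftC_apply, Fin.cons_self_tail]
  | @metric k C _ ih =>
    refine ⟨good_metric.tmul ih.1, fun x => ?_⟩
    ext a
    refine (cov_tmul good_metric ih.1 x a).trans ?_
    rw [cov_metric, ih.2]
    simp only [Pi.zero_apply, zero_mul, zero_add]
    rfl
  | @vol k C _ ih =>
    refine ⟨good_vol.tmul ih.1, fun x => ?_⟩
    ext a
    refine (cov_tmul good_vol ih.1 x a).trans ?_
    rw [cov_vol, ih.2]
    simp only [Pi.zero_apply, zero_mul, zero_add]
    rfl
  | permute e _ ih =>
    refine ⟨ih.1.permute e, fun x => ?_⟩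
    refine (cov_permute e ih.1 x).trans ?_
    rw [ih.2]; rfl
  | contract _ ih =>
    refine ⟨ih.1.contract, fun x => ?_⟩
    refine (cov_contract ih.1 x).trans ?_
    rw [ih.2]; rfl

/-! ### Commutation of covariant derivatives -/

theorem prod_update_left {k : ℕ} (g : Fin k → Fin 4 → ℝ) (A : Fin k → Fin 4) (s : Fin k)
    (e : Fin 4) : ∏ i, g i (Function.update A s e i) =
      g s e * ∏ i ∈ Finset.univ.erase s, g i (A i) := by
  rw [← Finset.mul_prod_erase _ _ (Finset.mem_univ s), Function.update_self]
  congr 1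
  refine Finset.prod_congr rfl fun i hi => ?_
  rw [Function.update_of_ne (Finset.ne_of_mem_erase hi)]

theorem apply_update_eq {k : ℕ} {x : Hyp} {T : Ten k} (hT : act (projM x) T = T)
    (A : Fin k → Fin 4) (s : Fin k) (e : Fin 4) : T (Function.update A s e) =
      ∑ b, (proj x e (b s) * ∏ i ∈ Finset.univ.erase s, proj x (A i) (b i)) * T b := by
  conv_lhs => rw [← hT, act_apply]
  refine Finset.sum_congr rfl fun b _ => ?_
  rw [prod_update_left (fun i a => projM x a (b i))]; rfl

theorem sum_coord_mul_update {k : ℕ} {x : Hyp} {T : Ten k} (hT : act (projM x) T = T)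
    (A : Fin k → Fin 4) (s : Fin k) : ∑ e, x.1 e * T (Function.update A s e) = 0 := by
  simp only [apply_update_eq hT, Finset.mul_sum]
  rw [Finset.sum_comm]
  refine Finset.sum_eq_zero fun b _ => ?_
  simp_rw [← mul_assoc]
  rw [← Finset.sum_mul, ← Finset.sum_mul, sum_coord_mul_proj]; ring

theorem sum_proj_mul_update {k : ℕ} {x : Hyp} {T : Ten k} (hT : act (projM x) T = T)
    (A : Fin k → Fin 4) (s : Fin k) (d : Fin 4) :
    ∑ e, proj x d e * T (Function.update A s e) = T (Function.update A s d) := by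
  rw [sum_proj_mul x d fun e => T (Function.update A s e), sum_coord_mul_update hT]; ring

theorem pd_proj (c a b : Fin 4) (x : Hyp) : pd c (fun y => proj y a b) x =
    -(metric x ![c, a] * x.1 b) - low x a * proj x c b := by
  have h1 : (fun y : Hyp => proj y a b) =
      fun y => (if a = b then 1 else 0) + (-1) * (low y a * y.1 b) := by
    funext y; simp only [proj, low]; ring
  rw [h1, pd_add (isSmooth_const _) ((isSmooth_const _).mul
      ((isSmooth_low a).mul (isSmooth_coord b))), pd_const, pd_const_mul
      ((isSmooth_low a).mul (isSmooth_coord b)), pd_mul (isSmooth_low a) (isSmooth_coord b), pd_low,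
      pd_coord]
  ring

theorem sum_proj_mul_pd_proj (c a b : Fin 4) (x : Hyp) :
    ∑ e, proj x a e * pd c (fun y => proj y e b) x = -(metric x ![c, a] * x.1 b) := by
  simp only [pd_proj, mul_sub, Finset.sum_sub_distrib, mul_neg, Finset.sum_neg_distrib,
    ← mul_assoc, ← Finset.sum_mul, sum_proj_mul_low]
  have h : ∑ e, proj x a e * metric x ![c, e] = metric x ![c, a] := by
    simp_rw [metric_symm x c, metric_cons, ← mul_assoc, ← Finset.sum_mul]
    rw [sum_proj_mul, sum_coord_mul_proj]; ring
  rw [h]; ring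

/-- Obtained by differentiating the vanishing of the normal contraction in slot `s`, with the
projectors in the other slots held fixed. -/
theorem sum_slot_pdT {k : ℕ} {T : Tensor k} (hT : Good T) (x : Hyp) (d : Fin 4)
    (A : Fin k → Fin 4) (s : Fin k) :
    ∑ E : Fin k → Fin 4, (∏ i ∈ Finset.univ.erase s, proj x (A i) (E i)) * x.1 (E s) *
      pdT d T x E = - T x (Function.update A s d) := by
  have h1 : ∀ y : Hyp, ∑ E : Fin k → Fin 4, (∏ i ∈ Finset.univ.erase s, proj x (A i) (E i)) *
      (y.1 (E s) * T y E) = 0 := by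
    intro y
    have h2 : ∑ E : Fin k → Fin 4, (∏ i ∈ Finset.univ.erase s, proj x (A i) (E i)) *
      (y.1 (E s) * T y E) =
      actv (Function.update (fun _ => projM x) s (Matrix.of fun _ e => y.1 e)) (T y) A := by
      rw [actv_apply]
      refine Finset.sum_congr rfl fun E _ => ?_
      rw [← Finset.mul_prod_erase _ _ (Finset.mem_univ s), Function.update_self]
      have : ∏ i ∈ Finset.univ.erase s, proj x (A i) (E i) = ∏ i ∈ Finset.univ.erase s,
        Function.update (fun _ => projM x) s (Matrix.of fun _ e => y.1 e) i (A i) (E i) := by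
        refine Finset.prod_congr rfl fun i hi => ?_
        rw [Function.update_of_ne (Finset.ne_of_mem_erase hi)]; rfl
      rw [← this, Matrix.of_apply]; ring
    rw [h2, ← hT.2 y, act, actv_actv, actv_apply]
    refine Finset.sum_eq_zero fun E _ => ?_
    rw [Finset.prod_eq_zero (Finset.mem_univ s), zero_mul]
    rw [Function.update_self, Matrix.mul_apply]
    exact sum_coord_mul_proj y _
  have h3 := pd_sum Finset.univ (f := fun (E : Fin k → Fin 4) (y : Hyp) =>
    (∏ i ∈ Finset.univ.erase s, proj x (A i) (E i)) * (y.1 (E s) * T y E))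
    (fun E _ => (isSmooth_const _).mul ((isSmooth_coord _).mul (hT.1 E))) d x
  simp only [h1, pd_const] at h3
  simp_rw [pd_const_mul ((isSmooth_coord _).mul (hT.1 _)), pd_mul (isSmooth_coord _) (hT.1 _),
    pd_coord, mul_add] at h3
  rw [Finset.sum_add_distrib] at h3
  rw [apply_update_eq (hT.2 x)]
  have h4 : ∀ E : Fin k → Fin 4, (∏ i ∈ Finset.univ.erase s, proj x (A i) (E i)) * x.1 (E s) *
      pdT d T x E = (∏ i ∈ Finset.univ.erase s, proj x (A i) (E i)) *
        (x.1 (E s) * pd d (fun y => T y E) x) := fun E => mul_assoc _ _ _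
  simp_rw [h4]
  have h5 : ∀ b : Fin k → Fin 4,
      (proj x d (b s) * ∏ i ∈ Finset.univ.erase s, proj x (A i) (b i)) * T x b =
      (∏ i ∈ Finset.univ.erase s, proj x (A i) (b i)) * (proj x d (b s) * T x b) :=
    fun b => by ring
  simp_rw [h5]
  linarith

theorem pdT_cov {k : ℕ} {T : Tensor k} (hT : Good T) (x : Hyp) (c d : Fin 4) (B : Fin k → Fin 4) :
    pdT c (cov T) x (Fin.cons d B) =
      (∑ s, actv (Function.update (fun _ => projM x) s
        (Matrix.of fun a b => pd c (fun y => proj y a b) x)) (pdT d T x) B) +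
      act (projM x) (fun E => pd c (pd d fun y => T y E) x) B := by
  have h1 : (fun y => cov T y (Fin.cons d B)) = fun y => ∑ E, (∏ i, proj y (B i) (E i)) *
      pd d (fun z => T z E) y := by
    funext y; exact cov_cons hT.1 y d B
  change pd c (fun y => cov T y (Fin.cons d B)) x = _
  have hs : ∀ E : Fin k → Fin 4, IsSmooth fun y => ∏ i, proj y (B i) (E i) := fun E =>
    IsSmooth.prod _ fun i _ => isSmooth_proj _ _
  rw [h1, pd_sum _ fun E _ => (hs E).mul ((hT.1 E).pd d)]
  simp_rw [pd_mul (hs _) ((hT.1 _).pd d)]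
  rw [Finset.sum_add_distrib]
  congr 1
  simp_rw [pd_prod Finset.univ (fun i _ => isSmooth_proj _ _), Finset.sum_mul]
  rw [Finset.sum_comm]
  refine Finset.sum_congr rfl fun s _ => Finset.sum_congr rfl fun E _ => ?_
  rw [← Finset.mul_prod_erase _ _ (Finset.mem_univ s), Function.update_self, Matrix.of_apply,
    mul_comm (pd c _ x)]
  congr 2
  refine Finset.prod_congr rfl fun i hi => ?_
  rw [Function.update_of_ne (Finset.ne_of_mem_erase hi)]; rfl

/-- The projected derivative of a projector is −h times the normal, and the normal contracted with
the derivative of T gives back −T: this product is the source of the curvature. -/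
theorem act_slot {k : ℕ} {T : Tensor k} (hT : Good T) (x : Hyp) (c d : Fin 4)
    (A : Fin k → Fin 4) (s : Fin k) :
    act (projM x) (actv (Function.update (fun _ => projM x) s
        (Matrix.of fun a b => pd c (fun y => proj y a b) x)) (pdT d T x)) A =
      metric x ![c, A s] * T x (Function.update A s d) := by
  rw [act, actv_actv, actv_apply]
  have h := sum_slot_pdT hT x d A s
  have h2 : metric x ![c, A s] * T x (Function.update A s d) = -metric x ![c, A s] *
      (- T x (Function.update A s d)) := by ring
  rw [h2, ← h, Finset.mul_sum]
  refine Finset.sum_congr rfl fun E _ => ?_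
  rw [← Finset.mul_prod_erase _ _ (Finset.mem_univ s), Function.update_self, Matrix.mul_apply]
  simp only [Matrix.of_apply, projM_apply]
  rw [sum_proj_mul_pd_proj]
  have : ∏ i ∈ Finset.univ.erase s, (projM x * Function.update (fun _ => projM x) s
      (Matrix.of fun a b => pd c (fun y => proj y a b) x) i) (A i) (E i) =
      ∏ i ∈ Finset.univ.erase s, proj x (A i) (E i) := by
    refine Finset.prod_congr rfl fun i hi => ?_
    rw [Function.update_of_ne (Finset.ne_of_mem_erase hi), projM_mul_projM]; rfl
  rw [this]
  ring

/-- A form of the Gauss equation. All curvature comes from differentiating the projectors, slot by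
slot; the remaining summand is symmetric in c and d by `pd_comm`, so the commutator consists of the
explicit metric terms only. -/
theorem cov_cov {k : ℕ} {T : Tensor k} (hT : Good T) (x : Hyp) (c d : Fin 4) (A : Fin k → Fin 4) :
    cov (cov T) x (Fin.cons c (Fin.cons d A)) =
      (∑ s, metric x ![c, A s] * T x (Function.update A s d)) +
      act (projM x) (fun E => pd c (pd d fun y => T y E) x +
        low x d * pd c (fun y => T y E) x) A := by
  rw [cov_cons hT.cov.1, act_cons]
  have h1 : ∀ d', (fun B => pdT c (cov T) x (Fin.cons d' B)) =
      (∑ s, actv (Function.update (fun _ => projM x) s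
        (Matrix.of fun a b => pd c (fun y => proj y a b) x)) (pdT d' T x)) +
      act (projM x) (fun E => pd c (pd d' fun y => T y E) x) := by
    intro d'; funext B; rw [pdT_cov hT, Pi.add_apply, Finset.sum_apply]
  simp only [h1, map_add, map_sum, Pi.add_apply, Finset.sum_apply, act_slot hT, mul_add,
    Finset.sum_add_distrib, act_act, projM_mul_projM]
  congr 1
  · simp only [Finset.mul_sum]
    rw [Finset.sum_comm]
    refine Finset.sum_congr rfl fun s _ => ?_
    rw [← sum_proj_mul_update (hT.2 x) A s d, Finset.mul_sum]
    refine Finset.sum_congr rfl fun e _ => ?_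
    rw [projM_apply]; ring
  · simp only [act_apply, Finset.mul_sum]
    rw [Finset.sum_comm]
    refine Finset.sum_congr rfl fun E _ => ?_
    simp_rw [mul_left_comm (projM x d _), ← Finset.mul_sum]
    congr 1
    refine (sum_proj_mul x d fun d' => pd c (pd d' fun y => T y E) x).trans ?_
    have h2 : ∑ d', x.1 d' * pd c (pd d' fun y => T y E) x = - pd c (fun y => T y E) x := by
      have h3 := pd_sum Finset.univ (f := fun d' (y : Hyp) => y.1 d' * pd d' (fun y => T y E) y)
        (fun d' _ => (isSmooth_coord d').mul ((hT.1 E).pd d')) c x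
      simp only [sum_mul_pd (hT.1 E), pd_const] at h3
      simp_rw [pd_mul (isSmooth_coord _) ((hT.1 E).pd _), pd_coord] at h3
      rw [Finset.sum_add_distrib, sum_proj_mul x c fun d' => pd d' (fun y => T y E) x,
        sum_mul_pd (hT.1 E)] at h3
      linarith
    rw [h2]; ring

theorem cov_cov_comm {k : ℕ} {T : Tensor k} (hT : Good T) (x : Hyp) (c d : Fin 4)
    (A : Fin k → Fin 4) :
    cov (cov T) x (Fin.cons c (Fin.cons d A)) = cov (cov T) x (Fin.cons d (Fin.cons c A)) +
      ∑ s, (metric x ![c, A s] * T x (Function.update A s d) -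
        metric x ![d, A s] * T x (Function.update A s c)) := by
  rw [cov_cov hT, cov_cov hT, Finset.sum_sub_distrib]
  have : (fun E => pd c (pd d fun y => T y E) x + low x d * pd c (fun y => T y E) x) =
      fun E => pd d (pd c fun y => T y E) x + low x c * pd d (fun y => T y E) x :=
    funext fun E => pd_comm (hT.1 E) c d x
  rw [this]; ring

/-! ### Spans of rules -/

/-- The linear combinations of the rules that arise from the rules in `B` by operations in
`IsCoef`. -/
def coefSpan (B : Set (Σ r, Rule r)) (k : ℕ) : Submodule ℝ (Rule k) :=
  Submodule.span ℝ {F | ∃ r G C, ⟨r, G⟩ ∈ B ∧ IsCoef r k C ∧ F = fun σ x => C x (G σ x)}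

theorem coefSpan_mono {B B' : Set (Σ r, Rule r)} (h : B ⊆ B') (k : ℕ) :
    coefSpan B k ≤ coefSpan B' k :=
  Submodule.span_mono fun _ ⟨r, G, C, hG, hC, hF⟩ => ⟨r, G, C, h hG, hC, hF⟩

theorem mem_coefSpan {B : Set (Σ r, Rule r)} {r : ℕ} {G : Rule r} (h : ⟨r, G⟩ ∈ B) :
    G ∈ coefSpan B r :=
  Submodule.subset_span ⟨r, G, _, h, IsCoef.id, rfl⟩

theorem isCoef_contractL {k : ℕ} : IsCoef (k + 2) k (fun _ => contractL) := IsCoef.id.contract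

/-- Pointwise application of an operation to a rule. -/
def applyOp {k l : ℕ} (C : CoefOp k l) : Rule k →ₗ[ℝ] Rule l where
  toFun F σ x := C x (F σ x)
  map_add' F G := by funext σ x; exact map_add _ _ _
  map_smul' r F := by funext σ x; exact (C x).map_smul r (F σ x)

theorem applyOp_apply {k l : ℕ} (C : CoefOp k l) (F : Rule k) (σ : Sol) (x : Hyp) :
    applyOp C F σ x = C x (F σ x) := rfl

theorem applyOp_mem {B : Set (Σ r, Rule r)} {k l : ℕ} {C : CoefOp k l} (hC : IsCoef k l C)
    {F : Rule k} (hF : F ∈ coefSpan B k) : applyOp C F ∈ coefSpan B l := by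
  have h : coefSpan B k ≤ (coefSpan B l).comap (applyOp C) := by
    refine Submodule.span_le.2 ?_
    rintro _ ⟨r, G, D, hG, hD, rfl⟩
    exact Submodule.subset_span ⟨r, G, _, hG, hD.comp hC, rfl⟩
  exact h hF

theorem good_of_mem {B : Set (Σ r, Rule r)} (hB : ∀ p ∈ B, ∀ σ, Good (p.2 σ)) {k : ℕ}
    {F : Rule k} (hF : F ∈ coefSpan B k) (σ : Sol) : Good (F σ) := by
  refine Submodule.span_induction ?_ ?_ ?_ ?_ hF
  · rintro _ ⟨r, G, C, hG, hC, rfl⟩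
    exact (good_apply hC (hB _ hG σ)).1
  · exact good_zero
  · intro F G _ _ h1 h2; exact h1.add h2
  · intro r F _ h; exact h.smul r

/-- The covariant derivative of a rule. -/
def covR {k : ℕ} (F : Rule k) : Rule (k + 1) := fun σ => cov (F σ)

theorem covR_mem {B B' : Set (Σ r, Rule r)} (hB : ∀ p ∈ B, ∀ σ, Good (p.2 σ))
    (h : ∀ p ∈ B, covR p.2 ∈ coefSpan B' (p.1 + 1)) {k : ℕ} {F : Rule k}
    (hF : F ∈ coefSpan B k) : covR F ∈ coefSpan B' (k + 1) := by
  refine Submodule.span_induction (p := fun F hF => covR F ∈ coefSpan B' (k + 1)) ?_ ?_ ?_ ?_ hF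
  · rintro _ ⟨r, G, C, hG, hC, rfl⟩
    have h2 := applyOp_mem hC.lift (h _ hG)
    convert h2 using 1
    funext σ x
    exact (good_apply hC (hB _ hG σ)).2 x
  · convert Submodule.zero_mem _ using 1
    funext σ
    exact cov_zero
  · intro F G hF hG h1 h2
    convert Submodule.add_mem _ h1 h2 using 1
    funext σ
    exact cov_add (good_of_mem hB hF σ) (good_of_mem hB hG σ)
  · intro r F hF h
    convert Submodule.smul_mem _ r h using 1
    funext σ
    exact cov_smul r (good_of_mem hB hF σ)

/-- The iterated derivative as a rule. -/
def iterR (i : ℕ) : Rule i := fun σ => iterCov σ.1 i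

theorem good_iterCov {f : Hyp → ℝ} (hf : IsSmooth f) (i : ℕ) : Good (iterCov f i) := by
  induction i with
  | zero => exact ⟨fun _ => hf, fun x => by
      ext a; simp only [act_apply, iterCov]
      rw [Fintype.sum_unique]; simp⟩
  | succ i ih => exact ih.cov

theorem good_iterR (i : ℕ) (σ : Sol) : Good (iterR i σ) := good_iterCov σ.2.1 i

/-- Iterated derivatives of order less than `i`. -/
def linBase (i : ℕ) : Set (Σ r, Rule r) := {p | ∃ j < i, p = ⟨j, iterR j⟩}

/-- Linear rules of order less than `i`. -/
abbrev linLt (i k : ℕ) : Submodule ℝ (Rule k) := coefSpan (linBase i) k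

theorem good_linBase (i : ℕ) : ∀ p ∈ linBase i, ∀ σ, Good (p.2 σ) := by
  rintro _ ⟨j, _, rfl⟩ σ
  exact good_iterR j σ

theorem iterR_mem {i j : ℕ} (h : j < i) : iterR j ∈ linLt i j :=
  mem_coefSpan (B := linBase i) ⟨j, h, rfl⟩

theorem linLt_mono {i j : ℕ} (h : i ≤ j) (k : ℕ) : linLt i k ≤ linLt j k :=
  coefSpan_mono (by rintro _ ⟨l, hl, hp⟩; exact ⟨l, hl.trans_le h, hp⟩) k

theorem covR_mem_linLt {i k : ℕ} {F : Rule k} (hF : F ∈ linLt i k) :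
    covR F ∈ linLt (i + 1) (k + 1) := by
  refine covR_mem (good_linBase i) ?_ hF
  rintro _ ⟨j, hj, rfl⟩
  exact iterR_mem (Nat.succ_lt_succ hj)

theorem covR_sub {k : ℕ} {F G : Rule k} (hF : ∀ σ, Good (F σ)) (hG : ∀ σ, Good (G σ)) :
    covR (F - G) = covR F - covR G := by
  funext σ
  change cov (F σ - G σ) = cov (F σ) - cov (G σ)
  rw [sub_eq_add_neg, ← neg_one_smul ℝ (G σ), cov_add (hF σ) ((hG σ).smul _), cov_smul _ (hG σ),
    neg_one_smul, sub_eq_add_neg]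

/-! ### Symmetry of iterated derivatives up to lower order -/

/-- Places the indices of `h ⊗ T` as in the curvature term of slot `s`. -/
def curvE {k : ℕ} (s : Fin k) : Fin (2 + k) ≃ Fin (k + 2) :=
  (finCongr (Nat.add_comm 2 k)).trans (Equiv.swap 1 s.succ.succ)

theorem permuteL_curvE {k : ℕ} (s : Fin k) (x : Hyp) (T : Ten k) (c d : Fin 4) (A : Fin k → Fin 4) :
    permuteL (curvE s) (tmulL (metric x) T) (Fin.cons c (Fin.cons d A)) =
      metric x ![c, A s] * T (Function.update A s d) := by
  have h10 : (1 : Fin (k + 2)) ≠ 0 := by simp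
  rw [permuteL_apply, tmulL_apply]
  congr 2
  · ext i
    fin_cases i
    · have : curvE s (Fin.castAdd k 0) = 0 := by
        rw [curvE, Equiv.trans_apply, show finCongr (Nat.add_comm 2 k) (Fin.castAdd k 0) = 0 from
          Fin.ext (by simp), Equiv.swap_apply_of_ne_of_ne h10.symm (Fin.succ_ne_zero _).symm]
      change ((Fin.cons c (Fin.cons d A) : Fin (k + 2) → Fin 4)
        (curvE s (Fin.castAdd k 0)) : ℕ) = _
      rw [this]; rfl
    · have : curvE s (Fin.castAdd k 1) = s.succ.succ := by
        rw [curvE, Equiv.trans_apply, show finCongr (Nat.add_comm 2 k) (Fin.castAdd k 1) = 1 from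
          Fin.ext (by simp), Equiv.swap_apply_left]
      change ((Fin.cons c (Fin.cons d A) : Fin (k + 2) → Fin 4)
        (curvE s (Fin.castAdd k 1)) : ℕ) = _
      rw [this]; rfl
  · ext j
    have h2 : finCongr (Nat.add_comm 2 k) (Fin.natAdd 2 j) = j.succ.succ :=
      Fin.ext (by simp)
    rw [Function.comp_apply, curvE, Equiv.trans_apply, h2]
    by_cases h : j = s
    · subst h
      rw [Equiv.swap_apply_right, Function.update_self]; rfl
    · rw [Equiv.swap_apply_of_ne_of_ne, Function.update_of_ne h]
      · rfl
      · exact fun h => Fin.succ_ne_zero _ (Fin.succ_injective _ h)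
      · exact fun h' => h (Fin.succ_injective _ (Fin.succ_injective _ h'))

theorem cons_cons_eta {k : ℕ} (a : Fin (k + 2) → Fin 4) :
    a = Fin.cons (a 0) (Fin.cons (a 1) (Fin.tail (Fin.tail a))) := by
  ext i
  refine Fin.cases rfl (fun i => Fin.cases rfl (fun i => rfl) i) i

theorem cons_comp_swap {k : ℕ} (c d : Fin 4) (A : Fin k → Fin 4) :
    (Fin.cons c (Fin.cons d A) : Fin (k + 2) → Fin 4) ∘ Equiv.swap 0 1 =
      Fin.cons d (Fin.cons c A) := by
  ext i
  refine Fin.cases ?_ (fun i => ?_) i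
  · simp
  refine Fin.cases ?_ (fun i => ?_) i
  · simp
  · have hs : Equiv.swap (0 : Fin (k + 2)) 1 i.succ.succ = i.succ.succ :=
      Equiv.swap_apply_of_ne_of_ne (Fin.succ_ne_zero _)
        (fun h => Fin.succ_ne_zero _ (Fin.succ_injective _ h))
    rw [Function.comp_apply, hs]; rfl

theorem permuteL_swap_cov_cov {k : ℕ} {T : Tensor k} (hT : Good T) (x : Hyp) :
    permuteL (Equiv.swap 0 1) (cov (cov T) x) = cov (cov T) x +
      ∑ s, (permuteL (Equiv.swap 0 1) (permuteL (curvE s) (tmulL (metric x) (T x))) -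
        permuteL (curvE s) (tmulL (metric x) (T x))) := by
  ext a
  rw [cons_cons_eta a, permuteL_apply, cons_comp_swap, cov_cov_comm hT]
  simp only [Pi.add_apply, Finset.sum_apply, Pi.sub_apply, permuteL_curvE,
    permuteL_apply (Equiv.swap _ _), cons_comp_swap]

/-- Adjacent transpositions generate the permutations. Exchanging the two outermost derivatives
costs curvature terms with two derivatives fewer; any other adjacent exchange is a derivative of an
exchange in the previous order. -/
theorem permute_iterR (i : ℕ) (e : Equiv.Perm (Fin i)) :
    applyOp (fun _ => permuteL e) (iterR i) - iterR i ∈ linLt i i := by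
  induction i with
  | zero =>
    convert Submodule.zero_mem _ using 1
    rw [Subsingleton.elim e 1]
    exact sub_self _
  | succ n ih =>
    have he : e ∈ Submonoid.closure
      (Set.range fun i : Fin n => Equiv.swap i.castSucc i.succ) := by
      rw [Equiv.Perm.mclosure_swap_castSucc_succ]; trivial
    induction he using Submonoid.closure_induction with
    | one =>
      convert Submodule.zero_mem _ using 1
      exact sub_self _
    | mul e f _ _ he hf =>
      have h1 := Submodule.add_mem _ (applyOp_mem (IsCoef.permuteL e) hf) he
      convert h1 using 1
      rw [map_sub, sub_add_sub_cancel]; rfl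
    | mem e he =>
      obtain ⟨j, rfl⟩ := he
      match n, j with
      | n + 1, ⟨0, _⟩ =>
        have h1 : (fun σ x => ∑ s, (permuteL (Equiv.swap 0 1) (permuteL (curvE s)
            (tmulL (metric x) (iterR n σ x))) - permuteL (curvE s)
            (tmulL (metric x) (iterR n σ x)))) ∈ linLt (n + 2) (n + 2) := by
          have h2 : ∀ s : Fin n, applyOp (fun x => permuteL (curvE s) ∘ₗ tmulL (metric x))
              (iterR n) ∈ linLt (n + 2) (n + 2) := fun s =>
            applyOp_mem (IsCoef.id.metric.permute (curvE s)) (iterR_mem (by omega))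
          have h3 := Submodule.sum_mem _ (t := Finset.univ) fun s _ => Submodule.sub_mem _
            (applyOp_mem (IsCoef.permuteL (Equiv.swap 0 1)) (h2 s)) (h2 s)
          convert h3 using 1
          funext σ x
          simp only [Finset.sum_apply]
          rfl
        convert h1 using 1
        funext σ x
        have := permuteL_swap_cov_cov (good_iterR n σ) x
        change permuteL (Equiv.swap 0 1) (cov (cov (iterR n σ)) x) - cov (cov (iterR n σ)) x = _
        rw [this, add_sub_cancel_left]
      | n + 1, ⟨j + 1, hj⟩ =>
        have h1 := covR_mem_linLt (ih (Equiv.swap (Fin.castSucc ⟨j, by omega⟩)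
          (Fin.succ ⟨j, by omega⟩)))
        rw [covR_sub] at h1
        · convert h1 using 2
          swap
          · rfl
          funext σ x
          change permuteL _ (cov (iterR (n + 1) σ) x) = cov (permute _ (iterR (n + 1) σ)) x
          rw [cov_permute _ (good_iterR _ σ), liftC_permuteL]
          congr 2
          ext i
          refine Fin.cases ?_ (fun i => ?_) i
          · rw [liftE_zero, Equiv.swap_apply_of_ne_of_ne] <;> simp [Fin.ext_iff]
          · rw [liftE_succ]
            have := (Fin.succ_injective (n + 1)).swap_apply
              (Fin.castSucc (⟨j, by omega⟩ : Fin n)) (Fin.succ ⟨j, by omega⟩) i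
            rw [← this]; rfl
        · intro σ; exact (good_iterR _ σ).permute _
        · intro σ; exact good_iterR _ σ

/-- For two derivatives this is the field equation. In the induction step the new outer derivative
is moved inside the traced pair, at the cost of lower order terms. -/
theorem contract_iterR (i : ℕ) :
    applyOp (fun _ => contractL) (iterR (i + 2)) ∈ linLt (i + 2) i := by
  induction i with
  | zero =>
    have h := Submodule.smul_mem _ (-3 : ℝ) (iterR_mem (i := 2) (j := 0) (by omega))
    convert h using 1
    funext σ x a
    have h2 := σ.2.2 x
    rw [Subsingleton.elim a ![]]
    change box σ.1 x = -3 * σ.1 x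
    linarith
  | succ n ih =>
    have h1 := covR_mem_linLt ih
    have h2 := permute_iterR (n + 3) (rotateE n).symm
    have h3 := Submodule.sub_mem _ h1 (applyOp_mem isCoef_contractL h2)
    convert h3 using 1
    have h4 : covR (applyOp (fun _ => contractL) (iterR (n + 2))) =
        applyOp (fun _ => contractL) (applyOp (fun _ => permuteL (rotateE n).symm)
          (iterR (n + 3))) := by
      funext σ x
      refine (cov_contract (good_iterR (n + 2) σ) x).trans ?_
      rw [liftC_contractL]; rfl
    rw [h4, map_sub]
    exact (sub_sub_cancel _ _).symm

/-! ### Symmetric tensors as polynomials -/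

open MvPolynomial in
/-- The polynomial `T(X, …, X)`. -/
def toPoly {k : ℕ} : Ten k →ₗ[ℝ] MvPolynomial (Fin 4) ℝ where
  toFun T := ∑ b, T b • ∏ i, MvPolynomial.X (b i)
  map_add' S T := by simp [add_smul, Finset.sum_add_distrib]
  map_smul' r T := by simp [mul_smul, Finset.smul_sum]

/-- Totally symmetric tensors. -/
def SymT {k : ℕ} (T : Ten k) : Prop := ∀ e : Equiv.Perm (Fin k), permuteL e T = T

/-- Fixing the first index. -/
def headL {k : ℕ} (c : Fin 4) : Ten (k + 1) →ₗ[ℝ] Ten k where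
  toFun T B := T (Fin.cons c B)
  map_add' _ _ := rfl
  map_smul' _ _ := rfl

theorem headL_apply {k : ℕ} (c : Fin 4) (T : Ten (k + 1)) (B) : headL c T B = T (Fin.cons c B) :=
  rfl

section Poly
open MvPolynomial

theorem toPoly_apply {k : ℕ} (T : Ten k) : toPoly T = ∑ b, T b • ∏ i, MvPolynomial.X (b i) := rfl

theorem toPoly_succ {k : ℕ} (T : Ten (k + 1)) : toPoly T = ∑ c, MvPolynomial.X c * toPoly (headL c T) := by
  rw [toPoly_apply, ← Fintype.sum_equiv (Fin.consEquiv fun _ => Fin 4) _ _ fun _ => rfl,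
    Fintype.sum_prod_type]
  refine Finset.sum_congr rfl fun c _ => ?_
  rw [toPoly_apply, Finset.mul_sum]
  refine Finset.sum_congr rfl fun b _ => ?_
  rw [Fin.prod_univ_succ, mul_smul_comm]; rfl

theorem toPoly_permuteL {k l : ℕ} (e : Fin k ≃ Fin l) (T : Ten k) :
    toPoly (permuteL e T) = toPoly T := by
  rw [toPoly_apply, toPoly_apply]
  refine Fintype.sum_equiv (Equiv.arrowCongr e.symm (Equiv.refl _)) _ _ fun b => ?_
  congr 1
  exact (Fintype.prod_equiv e _ _ fun i => by simp [Equiv.arrowCongr]).symm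

theorem toPoly_tmulL {k l : ℕ} (S : Ten k) (T : Ten l) :
    toPoly (tmulL S T) = toPoly S * toPoly T := by
  rw [toPoly_apply, ← Fintype.sum_equiv (Fin.appendEquiv k l) _ _ fun _ => rfl,
    Fintype.sum_prod_type, toPoly_apply, toPoly_apply, Finset.sum_mul_sum]
  refine Finset.sum_congr rfl fun b _ => Finset.sum_congr rfl fun c _ => ?_
  rw [smul_mul_smul_comm, Fin.prod_univ_add]
  simp [Fin.appendEquiv, tmulL_apply]

theorem toPoly_zero_rank (T : Ten 0) : toPoly T = C (T default) := by
  rw [toPoly_apply, Fintype.sum_unique, Finset.univ_eq_empty, Finset.prod_empty, smul_eq_C_mul,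
    mul_one]
  congr 2
  exact Subsingleton.elim _ _

theorem SymT.headL {k : ℕ} {T : Ten (k + 1)} (hT : SymT T) (c : Fin 4) : SymT (headL c T) := by
  intro e
  ext B
  have h := congrFun (hT (liftE e)) (Fin.cons c B)
  rw [permuteL_apply] at h
  rw [permuteL_apply, headL_apply, headL_apply, ← h]
  congr 1
  ext i
  refine Fin.cases ?_ (fun i => ?_) i <;> simp

theorem SymT.headL_comm {k : ℕ} {T : Ten (k + 2)} (hT : SymT T) (c d : Fin 4) :
    DeSitter.headL c (DeSitter.headL d T) = DeSitter.headL d (DeSitter.headL c T) := by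
  ext B
  have h := congrFun (hT (Equiv.swap 0 1)) (Fin.cons c (Fin.cons d B))
  rw [permuteL_apply, cons_comp_swap] at h
  exact h

/-- By symmetry every one of the k + 1 slots contributes the same when differentiated. -/
theorem pderiv_toPoly {k : ℕ} {T : Ten (k + 1)} (hT : SymT T) (c : Fin 4) :
    pderiv c (toPoly T) = ((k : ℝ) + 1) • toPoly (headL c T) := by
  induction k with
  | zero =>
    rw [toPoly_succ, map_sum]
    simp_rw [toPoly_zero_rank, pderiv_mul, pderiv_C, pderiv_X]
    simp [Pi.single_apply]
  | succ k ih =>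
    rw [toPoly_succ, map_sum]
    simp_rw [pderiv_mul, ih (hT.headL _), pderiv_X, hT.headL_comm c]
    rw [Finset.sum_add_distrib]
    simp_rw [mul_smul_comm]
    rw [← Finset.smul_sum, ← toPoly_succ]
    simp [Pi.single_apply, add_smul]
    ring

theorem pderiv_toPoly_zero (T : Ten 0) (c : Fin 4) : pderiv c (toPoly T) = 0 := by
  rw [toPoly_zero_rank, pderiv_C]

/-- Partial derivatives of the polynomial belong to the tensor with one index fixed, so induction on
the rank recovers all components. -/
theorem SymT.eq_zero {k : ℕ} {T : Ten k} (hT : SymT T) (h : toPoly T = 0) : T = 0 := by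
  induction k with
  | zero =>
    rw [toPoly_zero_rank, C_eq_zero] at h
    ext a
    rw [Subsingleton.elim a default, h]; rfl
  | succ k ih =>
    ext a
    have h1 := ih (hT.headL (a 0)) (by
      have h2 := pderiv_toPoly hT (a 0)
      rw [h, map_zero] at h2
      exact (smul_eq_zero.1 h2.symm).resolve_left (by positivity))
    have h2 := congrFun h1 (Fin.tail a)
    rwa [headL_apply, Fin.cons_self_tail] at h2

/-! ### Symmetrization and the flat Laplacian -/

/-- Symmetrization. -/
def symz {k : ℕ} : Ten k →ₗ[ℝ] Ten k :=
  (Nat.factorial k : ℝ)⁻¹ • ∑ e : Equiv.Perm (Fin k), permuteL e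

theorem symz_apply {k : ℕ} (T : Ten k) :
    symz T = (Nat.factorial k : ℝ)⁻¹ • ∑ e : Equiv.Perm (Fin k), permuteL e T := by
  simp [symz]

theorem symT_symz {k : ℕ} (T : Ten k) : SymT (symz T) := by
  intro e
  rw [symz_apply, map_smul, map_sum]
  congr 1
  exact Fintype.sum_equiv (Equiv.mulLeft e) _ _ fun f => rfl

theorem toPoly_symz {k : ℕ} (T : Ten k) : toPoly (symz T) = toPoly T := by
  rw [symz_apply, map_smul, map_sum]
  simp_rw [toPoly_permuteL]
  rw [Finset.sum_const, Finset.card_univ, Fintype.card_perm, Fintype.card_fin,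
    ← Nat.cast_smul_eq_nsmul ℝ, smul_smul, inv_mul_cancel₀ (by positivity), one_smul]

/-- The flat Laplacian on polynomials. -/
def lap : MvPolynomial (Fin 4) ℝ →ₗ[ℝ] MvPolynomial (Fin 4) ℝ :=
  ∑ c, eta c • ((pderiv c).toLinearMap ∘ₗ (pderiv c).toLinearMap)

theorem lap_apply (p : MvPolynomial (Fin 4) ℝ) :
    lap p = ∑ c, eta c • pderiv c (pderiv c p) := by
  simp [lap]

theorem lap_mul (p r : MvPolynomial (Fin 4) ℝ) : lap (p * r) =
    lap p * r + (2 : ℝ) • ∑ c, eta c • (pderiv c p * pderiv c r) + p * lap r := by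
  simp only [lap_apply, Finset.sum_mul, Finset.mul_sum, Finset.smul_sum,
    ← Finset.sum_add_distrib]
  refine Finset.sum_congr rfl fun c _ => ?_
  simp only [pderiv_mul, map_add, smul_eq_C_mul]
  rw [show (C 2 : MvPolynomial (Fin 4) ℝ) = 2 from map_ofNat C 2]
  ring

/-- Turns traces into Laplacians, so that removing traces becomes the harmonic decomposition of
polynomials. -/
theorem lap_toPoly {k : ℕ} {T : Ten (k + 2)} (hT : SymT T) :
    lap (toPoly T) = (((k : ℝ) + 2) * (k + 1)) • toPoly (contractL T) := by
  have h : contractL T = ∑ c, eta c • headL c (headL c T) := by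
    ext a
    rw [contractL_apply, Finset.sum_apply]; rfl
  rw [lap_apply, h, map_sum, Finset.smul_sum]
  refine Finset.sum_congr rfl fun c _ => ?_
  rw [pderiv_toPoly hT, Derivation.map_smul, pderiv_toPoly (hT.headL c), map_smul, smul_smul, smul_smul,
    smul_smul]
  congr 1
  push_cast; ring

theorem lap_toPoly_zero (T : Ten 0) : lap (toPoly T) = 0 := by
  simp [lap_apply, pderiv_toPoly_zero]

theorem lap_toPoly_one (T : Ten 1) : lap (toPoly T) = 0 := by
  rw [lap_apply]
  refine Finset.sum_eq_zero fun c _ => ?_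
  rw [← toPoly_symz, pderiv_toPoly (symT_symz T), Derivation.map_smul, pderiv_toPoly_zero]
  simp

theorem SymT.contractL {k : ℕ} {T : Ten (k + 2)} (hT : SymT T) : SymT (contractL T) := by
  intro e
  have h : DeSitter.contractL T = ∑ c, eta c • DeSitter.headL c (DeSitter.headL c T) := by
    ext a
    rw [contractL_apply, Finset.sum_apply]; rfl
  rw [h, map_sum]
  simp_rw [map_smul, ((hT.headL _).headL _) e]

/-- Homogeneous polynomials of degree `d` that do not depend on the normal coordinate. -/
def IsTang (x : Hyp) (d : ℝ) (p : MvPolynomial (Fin 4) ℝ) : Prop :=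
  ∑ c, MvPolynomial.X c * pderiv c p = d • p ∧ ∑ c, x.1 c • pderiv c p = 0

theorem isTang_toPoly {x : Hyp} {k : ℕ} {T : Ten k} (hT : act (projM x) T = T) :
    IsTang x k (toPoly T) := by
  have h0 : act (projM x) (symz T) = symz T := by
    rw [symz_apply, map_smul, map_sum]
    simp_rw [act_permuteL, hT]
  rw [← toPoly_symz]
  have hs := symT_symz T
  generalize symz T = U at hs h0
  cases k with
  | zero => constructor <;> simp [pderiv_toPoly_zero]
  | succ k =>
    constructor
    · simp_rw [pderiv_toPoly hs, mul_smul_comm]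
      rw [← Finset.smul_sum, ← toPoly_succ]; push_cast; rfl
    · simp_rw [pderiv_toPoly hs, smul_comm (x.1 _) _]
      rw [← Finset.smul_sum]
      simp_rw [← map_smul toPoly]
      rw [← map_sum]
      have : ∑ c, x.1 c • headL c U = 0 := by
        ext B
        rw [Finset.sum_apply]
        exact sum_coord_mul_cons h0 B
      rw [this, map_zero, smul_zero]

theorem IsTang.mul {x : Hyp} {d e : ℝ} {p r : MvPolynomial (Fin 4) ℝ} (hp : IsTang x d p)
    (hr : IsTang x e r) : IsTang x (d + e) (p * r) := by
  constructor
  · have : ∀ c, MvPolynomial.X c * pderiv c (p * r) = (MvPolynomial.X c * pderiv c p) * r + p * (MvPolynomial.X c * pderiv c r) :=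
      fun c => by rw [pderiv_mul]; ring
    simp_rw [this]
    rw [Finset.sum_add_distrib, ← Finset.sum_mul, ← Finset.mul_sum, hp.1, hr.1, smul_mul_assoc,
      mul_smul_comm, add_smul]
  · have : ∀ c, x.1 c • pderiv c (p * r) = (x.1 c • pderiv c p) * r + p * (x.1 c • pderiv c r) :=
      fun c => by rw [pderiv_mul, smul_add, smul_mul_assoc, mul_smul_comm]
    simp_rw [this]
    rw [Finset.sum_add_distrib, ← Finset.sum_mul, ← Finset.mul_sum, hp.2, hr.2]
    simp

/-- The quadratic form of the metric as a polynomial. -/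
def qPoly (x : Hyp) : MvPolynomial (Fin 4) ℝ := toPoly (metric x)

theorem symT_metric (x : Hyp) : SymT (metric x) := by
  intro e
  ext a
  rw [permuteL_apply, vec_two (a ∘ e), vec_two a]
  simp only [Function.comp_apply]
  have h : (e 0 = 0 ∧ e 1 = 1) ∨ (e 0 = 1 ∧ e 1 = 0) := by
    have := e.injective.ne (show (0 : Fin 2) ≠ 1 by decide)
    generalize e 0 = u at *
    generalize e 1 = v at *
    revert u v; decide
  rcases h with ⟨h0, h1⟩ | ⟨h0, h1⟩
  · rw [h0, h1]; rfl
  · rw [h0, h1]; exact metric_symm x _ _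

theorem lap_qPoly (x : Hyp) : lap (qPoly x) = C 6 := by
  rw [qPoly, lap_toPoly (symT_metric x), toPoly_zero_rank, smul_eq_C_mul, ← C_mul]
  congr 1
  have h : contractL (metric x) default = 3 := by
    rw [contractL_apply]
    have h1 : ∀ c, eta c * metric x (Fin.cons c (Fin.cons c default)) =
        1 - low x c * x.1 c := by
      intro c
      rw [vec_two (Fin.cons c _)]
      change eta c * metric x ![c, c] = _
      rw [metric_cons]
      simp only [proj, if_true, low]
      linear_combination (1 - eta c * x.1 c * x.1 c) * eta_mul_eta c
    simp_rw [h1]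
    rw [Finset.sum_sub_distrib, sum_low_mul]; simp; norm_num
  rw [h]; norm_num

theorem toPoly_one (T : Ten 1) : toPoly T = ∑ c, C (T ![c]) * MvPolynomial.X c := by
  rw [toPoly_succ]
  refine Finset.sum_congr rfl fun c _ => ?_
  rw [toPoly_zero_rank, mul_comm]
  congr 3
  rw [headL_apply]
  congr 1
  ext i; fin_cases i; rfl

/-- The gradient of q is twice the tangential part of the Euler field; its normal part does not act
on a tangential polynomial. -/
theorem sum_pderiv_qPoly_mul {x : Hyp} {d : ℝ} {p : MvPolynomial (Fin 4) ℝ} (hp : IsTang x d p) :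
    ∑ c, eta c • (pderiv c (qPoly x) * pderiv c p) = (2 * d) • p := by
  have h1 : ∀ c, eta c • pderiv c (qPoly x) =
      C 2 * (MvPolynomial.X c - C (x.1 c) * ∑ b, C (low x b) * MvPolynomial.X b) := by
    intro c
    rw [qPoly, pderiv_toPoly (symT_metric x), toPoly_one]
    have h2 : ∀ b, headL c (metric x) ![b] = metric x ![c, b] := fun b => by
      rw [headL_apply]; congr 1
    simp_rw [h2]
    have h3 : ∀ b, eta c * metric x ![c, b] = (if c = b then 1 else 0) - x.1 c * low x b := by
      intro b
      rw [metric_cons]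
      simp only [proj, low]
      by_cases h : c = b
      · subst h; simp only [if_true]
        linear_combination (1 - eta c * x.1 c * x.1 c) * eta_mul_eta c
      · simp only [h, if_false]
        linear_combination (-(x.1 c * x.1 b * eta b)) * eta_mul_eta c
    have h4 : ∀ b, C (eta c) * (C (metric x ![c, b]) * MvPolynomial.X b) =
        (if c = b then MvPolynomial.X b else 0) - C (x.1 c) * (C (low x b) * MvPolynomial.X b) := by
      intro b
      rw [← mul_assoc, ← C_mul, h3, C_sub, C_mul, sub_mul, mul_assoc]
      congr 1
      split_ifs <;> simp
    rw [smul_comm, smul_eq_C_mul _ (eta c), Finset.mul_sum]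
    simp_rw [h4]
    rw [Finset.sum_sub_distrib, ← Finset.mul_sum, smul_eq_C_mul]
    simp only [Finset.sum_ite_eq, Finset.mem_univ, if_true]
    congr 2
    norm_num
  have h5 : ∀ c, eta c • (pderiv c (qPoly x) * pderiv c p) =
      C 2 * (MvPolynomial.X c * pderiv c p - (∑ b, C (low x b) * MvPolynomial.X b) * (x.1 c • pderiv c p)) := by
    intro c
    rw [← smul_mul_assoc, h1, smul_eq_C_mul]; ring
  simp_rw [h5]
  rw [← Finset.mul_sum, Finset.sum_sub_distrib, ← Finset.mul_sum, hp.1, hp.2, mul_zero, sub_zero,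
    mul_smul, smul_eq_C_mul _ (2 : ℝ)]

theorem lap_qPoly_mul {x : Hyp} {d : ℝ} {p : MvPolynomial (Fin 4) ℝ} (hp : IsTang x d p) :
    lap (qPoly x * p) = (6 + 4 * d) • p + qPoly x * lap p := by
  rw [lap_mul, sum_pderiv_qPoly_mul hp, lap_qPoly, ← smul_eq_C_mul, smul_smul, ← add_smul]
  congr 2; ring

theorem isTang_qPoly (x : Hyp) : IsTang x 2 (qPoly x) := by
  have := isTang_toPoly (act_metric x)
  exact_mod_cast this

theorem isTang_qPoly_pow_mul {x : Hyp} {d : ℝ} {p : MvPolynomial (Fin 4) ℝ} (hp : IsTang x d p)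
    (m : ℕ) : IsTang x (d + 2 * m) (qPoly x ^ m * p) := by
  induction m with
  | zero => simpa using hp
  | succ m ih =>
    have := (isTang_qPoly x).mul ih
    rw [← mul_assoc, ← pow_succ'] at this
    convert this using 1
    push_cast; ring

/-- The sl(2) relation between q and the Laplacian in three dimensions. For degrees d ≥ 0 the
constant is positive, so the recursion for harmonic projection can always divide by it. -/
theorem lap_qPoly_pow_mul {x : Hyp} {d : ℝ} {p : MvPolynomial (Fin 4) ℝ} (hp : IsTang x d p)
    (m : ℕ) : lap (qPoly x ^ (m + 1) * p) =
      (((m : ℝ) + 1) * (4 * d + 4 * m + 6)) • (qPoly x ^ m * p) + qPoly x ^ (m + 1) * lap p := by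
  induction m with
  | zero => simp [lap_qPoly_mul hp]; ring_nf
  | succ m ih =>
    rw [pow_succ', mul_assoc, lap_qPoly_mul (isTang_qPoly_pow_mul hp (m + 1)), ih, mul_add (qPoly x),
      mul_smul_comm, ← mul_assoc (qPoly x), ← pow_succ', ← add_assoc, ← add_smul,
      ← mul_assoc (qPoly x), ← pow_succ']
    congr 2
    push_cast; ring

end Poly

/-! ### Removing traces without leaving the span of lower order rules -/

/-- Symmetrization of a rule. -/
theorem symz_mem {B : Set (Σ r, Rule r)} {k : ℕ} {F : Rule k} (hF : F ∈ coefSpan B k) :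
    (fun σ x => symz (F σ x)) ∈ coefSpan B k := by
  have h := Submodule.smul_mem _ ((Nat.factorial k : ℝ)⁻¹) (Submodule.sum_mem _
    (t := Finset.univ) fun e _ => applyOp_mem (IsCoef.permuteL (e : Equiv.Perm (Fin k))) hF)
  convert h using 1
  funext σ x
  rw [symz_apply]
  simp only [Pi.smul_apply, Finset.sum_apply]
  rfl

/-- Multiplication with the metric, with the indices of the metric in some order among the
others. -/
def metricOp (k : ℕ) : CoefOp k (k + 2) := fun x =>
  permuteL (finCongr (Nat.add_comm 2 k)) ∘ₗ tmulL (metric x)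

theorem isCoef_metricOp (k : ℕ) : IsCoef k (k + 2) (metricOp k) := IsCoef.id.metric.permute _

theorem toPoly_metricOp {k : ℕ} (x : Hyp) (T : Ten k) :
    toPoly (metricOp k x T) = qPoly x * toPoly T := by
  rw [metricOp, LinearMap.comp_apply, toPoly_permuteL, toPoly_tmulL]; rfl

/-- Inverts the Laplacian on q^(m+1) times a polynomial, by recursion on the rank. The recursion
uses only symmetrization, contraction and multiplication with the metric, so the solution stays in
the span of linear rules of order less than i. -/
theorem exists_lap_eq {i : ℕ} (e : ℕ) : ∀ (m : ℕ) (G : Rule e), G ∈ linLt i e →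
    ∃ R ∈ linLt i e, ∀ σ x, lap (qPoly x ^ (m + 1) * toPoly (R σ x)) =
      qPoly x ^ m * toPoly (G σ x) := by
  induction e using Nat.strong_induction_on with
  | _ e ih =>
    intro m G hG
    set G' : Rule e := fun σ x => symz (G σ x) with hG'
    have hmem : G' ∈ linLt i e := symz_mem hG
    have htang : ∀ σ x, IsTang x e (toPoly (G' σ x)) := fun σ x =>
      isTang_toPoly ((good_of_mem (good_linBase i) hmem σ).2 x)
    have hpoly : ∀ σ x, toPoly (G σ x) = toPoly (G' σ x) := fun σ x => (toPoly_symz _).symm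
    set c : ℝ := ((m : ℝ) + 1) * (4 * e + 4 * m + 6) with hc
    have hc0 : c ≠ 0 := by positivity
    by_cases h2 : 2 ≤ e
    · obtain ⟨d, rfl⟩ := Nat.exists_eq_add_of_le' h2
      obtain ⟨R, hR, hR2⟩ := ih d (by omega) (m + 1) (applyOp (fun _ => contractL) G')
        (applyOp_mem isCoef_contractL hmem)
      -- The first term produces the required right-hand side and a by-product, the Laplacian of G'
      -- times q^(m+1). The second cancels it: R solves the equation for the trace of G', with rank
      -- lower by two and exponent m + 1.
      refine ⟨c⁻¹ • G' - (c⁻¹ * (((d : ℝ) + 2) * (d + 1))) • applyOp (metricOp d) R,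
        Submodule.sub_mem _ (Submodule.smul_mem _ _ hmem)
          (Submodule.smul_mem _ _ (applyOp_mem (isCoef_metricOp d) hR)), fun σ x => ?_⟩
      have h3 : (c⁻¹ • G' - (c⁻¹ * (((d : ℝ) + 2) * (d + 1))) • applyOp (metricOp d) R) σ x =
        c⁻¹ • G' σ x - (c⁻¹ * (((d : ℝ) + 2) * (d + 1))) • metricOp d x (R σ x) := rfl
      rw [h3, map_sub, map_smul, map_smul, toPoly_metricOp, mul_sub, map_sub, mul_smul_comm,
        mul_smul_comm, map_smul, map_smul, lap_qPoly_pow_mul (htang σ x),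
        ← mul_assoc (qPoly x ^ (m + 1)),
        ← pow_succ, hR2, lap_toPoly (symT_symz _), hpoly, smul_add, smul_smul,
        inv_mul_cancel₀ hc0, one_smul, mul_smul_comm, smul_smul]
      exact add_sub_cancel_right _ _
    · refine ⟨c⁻¹ • G', Submodule.smul_mem _ _ hmem, fun σ x => ?_⟩
      have h3 : (c⁻¹ • G') σ x = c⁻¹ • G' σ x := rfl
      have h4 : lap (toPoly (G' σ x)) = 0 := by
        have : e = 0 ∨ e = 1 := by omega
        rcases this with rfl | rfl
        · exact lap_toPoly_zero _
        · exact lap_toPoly_one _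
      rw [h3, map_smul, mul_smul_comm, map_smul, lap_qPoly_pow_mul (htang σ x), h4, mul_zero,
        add_zero, smul_smul, inv_mul_cancel₀ hc0, one_smul, hpoly]

/-- Up to lower order, `D^i σ` is symmetric and traceless. -/
theorem exists_traceless (i : ℕ) : ∃ S : Rule i, S - iterR i ∈ linLt i i ∧
    ∀ σ x, SymT (S σ x) ∧ act (projM x) (S σ x) = S σ x ∧ lap (toPoly (S σ x)) = 0 := by
  have hmem : (iterR i) ∈ linLt (i + 1) i := iterR_mem (Nat.lt_succ_self i)
  set G : Rule i := fun σ x => symz (iterR i σ x) with hG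
  have hG1 : G - iterR i ∈ linLt i i := by
    have h := Submodule.smul_mem _ ((Nat.factorial i : ℝ)⁻¹) (Submodule.sum_mem _
      (t := Finset.univ) fun e _ => permute_iterR i e)
    convert h using 1
    rw [Finset.sum_sub_distrib, Finset.sum_const, Finset.card_univ, Fintype.card_perm,
      Fintype.card_fin, smul_sub, ← Nat.cast_smul_eq_nsmul ℝ, smul_smul,
      inv_mul_cancel₀ (by positivity), one_smul]
    congr 1
    funext σ x
    simp only [hG, symz_apply, Pi.smul_apply, Finset.sum_apply]
    rfl
  have hG2 : G ∈ linLt (i + 1) i := symz_mem hmem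
  have hsub : ∀ {F : Rule i}, F ∈ linLt i i → ∀ σ x, act (projM x) (F σ x) = F σ x :=
    fun hF σ x => (good_of_mem (good_linBase i) hF σ).2 x
  have hGt : ∀ σ x, act (projM x) (G σ x) = G σ x :=
    fun σ x => (good_of_mem (good_linBase _) hG2 σ).2 x
  by_cases h2 : 2 ≤ i
  · obtain ⟨d, rfl⟩ := Nat.exists_eq_add_of_le' h2
    -- Symmetrization changes the derivative at lower order only, and the trace of the derivative is
    -- itself of lower order; so the correction below is too.
    have h3 : applyOp (fun _ => contractL) G ∈ linLt (d + 2) d := by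
      have h4 := Submodule.add_mem _ (applyOp_mem isCoef_contractL hG1) (contract_iterR d)
      rwa [← map_add, sub_add_cancel] at h4
    obtain ⟨R, hR, hR2⟩ := exists_lap_eq d 0 _ h3
    set R' : Rule (d + 2) := fun σ x => symz (applyOp (metricOp d) R σ x) with hR'
    have hRm : R' ∈ linLt (d + 2) (d + 2) := symz_mem (applyOp_mem (isCoef_metricOp d) hR)
    -- The constant is the one relating Laplacian and trace in `lap_toPoly`.
    refine ⟨G - (((d : ℝ) + 2) * (d + 1)) • R', ?_, fun σ x => ⟨?_, ?_, ?_⟩⟩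
    · rw [sub_right_comm]
      exact Submodule.sub_mem _ hG1 (Submodule.smul_mem _ _ hRm)
    · intro e
      change permuteL e (G σ x - (((d : ℝ) + 2) * (d + 1)) • R' σ x) =
        G σ x - (((d : ℝ) + 2) * (d + 1)) • R' σ x
      rw [map_sub, map_smul, symT_symz _ e, symT_symz _ e]
    · change act (projM x) (G σ x - (((d : ℝ) + 2) * (d + 1)) • R' σ x) =
        G σ x - (((d : ℝ) + 2) * (d + 1)) • R' σ x
      rw [map_sub, map_smul, hGt, hsub hRm]
    · change lap (toPoly (G σ x - (((d : ℝ) + 2) * (d + 1)) • R' σ x)) = 0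
      have h5 := hR2 σ x
      rw [zero_add, pow_one, pow_zero, one_mul] at h5
      rw [map_sub, map_smul, map_sub, map_smul, lap_toPoly (symT_symz _), hR', toPoly_symz,
        applyOp_apply, toPoly_metricOp, h5]
      exact sub_self _
  · refine ⟨G, hG1, fun σ x => ⟨symT_symz _, hGt σ x, ?_⟩⟩
    have : i = 0 ∨ i = 1 := by omega
    rcases this with rfl | rfl
    · exact lap_toPoly_zero _
    · exact lap_toPoly_one _

/-! ### Powers of null vectors -/

/-- Tensor powers of a covector. -/
def pw (v : Fin 4 → ℝ) (k : ℕ) : Ten k := fun B => ∏ i, v (B i)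

theorem act_pw (O : Matrix (Fin 4) (Fin 4) ℝ) (v : Fin 4 → ℝ) (k : ℕ) :
    act O (pw v k) = pw (O *ᵥ v) k := by
  ext a
  rw [act_apply, pw]
  simp only [Matrix.mulVec, dotProduct]
  rw [Finset.prod_univ_sum, Fintype.piFinset_univ]
  refine Finset.sum_congr rfl fun b _ => ?_
  rw [pw, Finset.prod_mul_distrib]

/-- A parametrization of the future null covectors orthogonal to the base point. -/
def nullV (a b : ℝ) : Fin 4 → ℝ := ![a ^ 2 + b ^ 2, a ^ 2 - b ^ 2, 2 * (a * b), 0]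

/-- Weights of the indices in a null frame. -/
def wt (c : Fin 4) : ℕ := ![2, 0, 1, 0] c

theorem exists_weight (k v : ℕ) (hv : v ≤ 2 * k) :
    ∃ B : Fin k → Fin 4, (∀ i, B i ≠ 3) ∧ ∑ i, wt (B i) = v := by
  induction k generalizing v with
  | zero => exact ⟨Fin.elim0, fun i => i.elim0, by simp; omega⟩
  | succ k ih =>
    have h : ∀ c : Fin 4, c ≠ 3 → wt c ≤ v → v - wt c ≤ 2 * k →
        ∃ B : Fin (k + 1) → Fin 4, (∀ i, B i ≠ 3) ∧ ∑ i, wt (B i) = v := by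
      intro c hc h1 h2
      obtain ⟨B, hB, hw⟩ := ih (v - wt c) h2
      refine ⟨Fin.cons c B, ?_, ?_⟩
      · intro i
        refine Fin.cases ?_ (fun i => ?_) i
        · simpa using hc
        · simpa using hB i
      · rw [Fin.sum_univ_succ]
        simp only [Fin.cons_zero, Fin.cons_succ, hw]
        omega
    have w0 : wt 0 = 2 := rfl
    have w1 : wt 1 = 0 := rfl
    have w2 : wt 2 = 1 := rfl
    by_cases h1 : v ≤ 2 * k
    · exact h 1 (by decide) (by omega) (by omega)
    · by_cases h2 : v = 2 * k + 1
      · exact h 2 (by decide) (by omega) (by omega)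
      · exact h 0 (by decide) (by omega) (by omega)

theorem weight_le {k : ℕ} (B : Fin k → Fin 4) : ∑ i, wt (B i) ≤ 2 * k := by
  have h : ∀ c, wt c ≤ 2 := by decide
  calc ∑ i, wt (B i) ≤ ∑ _i : Fin k, 2 := Finset.sum_le_sum fun i _ => h _
    _ = 2 * k := by simp [mul_comm]

/-- In a null frame, the components of a symmetric traceless tensor depend on the weight only. -/
theorem exists_weight_function {k : ℕ} {S : Ten k} (hS : SymT S)
    (ht : ∀ d (h : k = d + 2), headL 0 (headL 1 (permuteL (finCongr h) S)) =
      headL 2 (headL 2 (permuteL (finCongr h) S))) :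
    ∃ s : ℕ → ℝ, ∀ a, (∀ i, a i ≠ 3) → S a = s (∑ i, wt (a i)) := by
  induction k with
  | zero => exact ⟨fun _ => S default, fun a _ => by rw [Subsingleton.elim a default]⟩
  | succ k ih =>
    have hc : ∀ c, ∃ s : ℕ → ℝ, ∀ a, (∀ i, a i ≠ 3) → headL c S a = s (∑ i, wt (a i)) := by
      intro c
      refine ih (hS.headL c) ?_
      rintro d rfl
      have h := congrArg (headL c) (ht (d + 1) rfl)
      change headL 0 (headL 1 (headL c S)) = headL 2 (headL 2 (headL c S))
      change headL c (headL 0 (headL 1 S)) = headL c (headL 2 (headL 2 S)) at h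
      rwa [(hS.headL 1).headL_comm, hS.headL_comm c 1, (hS.headL 2).headL_comm c 2,
        hS.headL_comm c 2] at h
    choose s hs using hc
    -- Symmetry in the first two indices relates the weight functions for different first indices.
    have key : ∀ c c' : Fin 4, c ≠ 3 → c' ≠ 3 → ∀ v, v + 2 ≤ 2 * k →
        s c (wt c' + v) = s c' (wt c + v) := by
      intro c c' h3 h3' v hv
      obtain ⟨k, rfl⟩ : ∃ l, k = l + 1 := ⟨k - 1, by omega⟩
      obtain ⟨B, hB, hw⟩ := exists_weight k v (by omega)
      have h := congrFun (hS.headL_comm c' c) B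
      rw [headL_apply, headL_apply c (headL c' S), hs, hs, Fin.sum_univ_succ,
        Fin.sum_univ_succ] at h
      · simpa only [Fin.cons_zero, Fin.cons_succ, hw] using h
      · intro i; refine Fin.cases ?_ (fun i => ?_) i
        · simpa using h3
        · simpa using hB i
      · intro i; refine Fin.cases ?_ (fun i => ?_) i
        · simpa using h3'
        · simpa using hB i
    -- Tracelessness in the null frame: a leading pair (0,1) may be replaced by (2,2), which has the
    -- same weight.
    have tor : ∀ v, v + 2 ≤ 2 * k → s 1 (2 + v) = s 2 (1 + v) := by
      intro v hv
      obtain ⟨k, rfl⟩ : ∃ l, k = l + 1 := ⟨k - 1, by omega⟩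
      obtain ⟨B, hB, hw⟩ := exists_weight k v (by omega)
      have h := congrFun (ht k rfl) B
      change headL 1 S (Fin.cons 0 B) = headL 2 S (Fin.cons 2 B) at h
      rw [hs, hs, Fin.sum_univ_succ, Fin.sum_univ_succ] at h
      · simp only [Fin.cons_zero, Fin.cons_succ, hw] at h
        exact h
      · intro i; refine Fin.cases ?_ (fun i => ?_) i
        · simp
        · simpa using hB i
      · intro i; refine Fin.cases ?_ (fun i => ?_) i
        · simp
        · simpa using hB i
    have k01 : ∀ v, v + 2 ≤ 2 * k → s 0 (0 + v) = s 1 (2 + v) :=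
      key 0 1 (by decide) (by decide)
    have k21 : ∀ v, v + 2 ≤ 2 * k → s 2 (0 + v) = s 1 (1 + v) :=
      key 2 1 (by decide) (by decide)
    have k02 : ∀ v, v + 2 ≤ 2 * k → s 0 (1 + v) = s 2 (2 + v) :=
      key 0 2 (by decide) (by decide)
    -- Weights up to 2k occur with first index 1, whose weight is 0; the weight 2k + 1 needs first
    -- index 2 or 0, and 2k + 2 forces first index 0.
    refine ⟨fun w => if w ≤ 2 * k then s 1 w else if w = 2 * k + 1 then s 2 (2 * k) else
      s 0 (2 * k), fun a ha => ?_⟩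
    have h1 : S a = headL (a 0) S (Fin.tail a) := by rw [headL_apply, Fin.cons_self_tail]
    rw [h1, hs (a 0) (Fin.tail a) (fun i => ha i.succ), Fin.sum_univ_succ]
    have hw := weight_le (Fin.tail a)
    change s (a 0) (∑ i, wt (Fin.tail a i)) = (fun w => if w ≤ 2 * k then s 1 w else
      if w = 2 * k + 1 then s 2 (2 * k) else s 0 (2 * k)) (wt (a 0) + ∑ i, wt (Fin.tail a i))
    generalize ∑ i, wt (Fin.tail a i) = w at hw
    have ha0 := ha 0
    generalize a 0 = c at ha0
    simp only
    fin_cases c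
    · change s 0 w = if 2 + w ≤ _ then s 1 (2 + w) else if 2 + w = _ then _ else _
      split_ifs with h2 h3
      · have := k01 w (by omega); rwa [zero_add] at this
      · have := k02 (w - 1) (by omega)
        rwa [show 1 + (w - 1) = w by omega, show 2 + (w - 1) = 2 * k by omega] at this
      · rw [show w = 2 * k by omega]
    · change s 1 w = if 0 + w ≤ _ then s 1 (0 + w) else if 0 + w = _ then _ else _
      rw [zero_add, if_pos hw]
    · change s 2 w = if 1 + w ≤ _ then s 1 (1 + w) else if 1 + w = _ then _ else _
      split_ifs with h2 h3
      · by_cases h4 : w + 2 ≤ 2 * k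
        · have := k21 w h4; rwa [zero_add] at this
        · have := tor (w - 1) (by omega)
          rw [show 1 + (w - 1) = w by omega, show 2 + (w - 1) = 1 + w by omega] at this
          exact this.symm
      · rw [show w = 2 * k by omega]
      · omega
    · exact absurd rfl ha0

theorem wt_pow (a b : ℝ) (c : Fin 4) (hc : c ≠ 3) :
    (![a ^ 2, b ^ 2, a * b, 0] : Fin 4 → ℝ) c * b ^ wt c = a ^ wt c * b ^ 2 := by
  fin_cases c
  · change a ^ 2 * b ^ 2 = a ^ 2 * b ^ 2; rfl
  · change b ^ 2 * b ^ 0 = a ^ 0 * b ^ 2; ring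
  · change a * b * b ^ 1 = a ^ 1 * b ^ 2; ring
  · exact absurd rfl hc

/-- By duality. A functional that kills all the powers gives a polynomial in p which vanishes
identically; its coefficient of degree v sums the functional over multi-indices of weight v, and S
is constant on each such set. -/
theorem mem_span_pw_of_weight {k : ℕ} {S : Ten k} {s : ℕ → ℝ}
    (hs : ∀ a, (∀ i, a i ≠ 3) → S a = s (∑ i, wt (a i)))
    (h3 : ∀ a, ¬ (∀ i, a i ≠ 3) → S a = 0) :
    S ∈ Submodule.span ℝ (Set.range fun p : ℝ => pw ![p ^ 2, 1, p, 0] k) := by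
  classical
  by_contra hn
  obtain ⟨f, hf, hk⟩ := Submodule.exists_le_ker_of_notMem hn
  apply hf
  have hfs : ∀ T : Ten k, f T = ∑ a, T a * f (Pi.single a 1) := by
    intro T
    conv_lhs => rw [pi_eq_sum_univ' T]
    rw [map_sum]
    simp
  set P : Polynomial ℝ := ∑ a : Fin k → Fin 4, if ∀ i, a i ≠ 3 then
    Polynomial.monomial (∑ i, wt (a i)) (f (Pi.single a 1)) else 0 with hP
  have hP0 : P = 0 := by
    refine Polynomial.funext fun p => ?_
    have h1 : f (pw ![p ^ 2, 1, p, 0] k) = 0 := hk (Submodule.subset_span ⟨p, rfl⟩)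
    rw [hfs] at h1
    rw [hP, Polynomial.eval_finsetSum, Polynomial.eval_zero, ← h1]
    refine Finset.sum_congr rfl fun a _ => ?_
    split_ifs with ha
    · rw [Polynomial.eval_monomial, mul_comm, ← Finset.prod_pow_eq_pow_sum]
      congr 1
      refine Finset.prod_congr rfl fun i _ => ?_
      have := wt_pow p 1 (a i) (ha i)
      simpa using this.symm
    · push Not at ha
      obtain ⟨i, hi⟩ := ha
      rw [Polynomial.eval_zero, pw, Finset.prod_eq_zero (Finset.mem_univ i), zero_mul]
      rw [hi]; rfl
  -- Replacing each monomial of degree n by the value `s n` turns the zero polynomial into the value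
  -- of the functional at S.
  have h2 := congrArg (Polynomial.lsum fun n => (LinearMap.id : ℝ →ₗ[ℝ] ℝ).smulRight (s n)) hP0
  rw [hP, map_sum, map_zero] at h2
  rw [hfs, ← h2]
  refine Finset.sum_congr rfl fun a _ => ?_
  split_ifs with ha
  · rw [Polynomial.lsum_apply, Polynomial.sum_monomial_index _ _ (by simp), hs a ha]
    simp [mul_comm]
  · rw [h3 a ha]; simp

/-- The change to a null frame, and its inverse. -/
def nullFrame : Matrix (Fin 4) (Fin 4) ℝ :=
  !![1/2, 1/2, 0, 0; 1/2, -1/2, 0, 0; 0, 0, 1/2, 0; 0, 0, 0, 1]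

def nullFrameInv : Matrix (Fin 4) (Fin 4) ℝ :=
  !![1, 1, 0, 0; 1, -1, 0, 0; 0, 0, 2, 0; 0, 0, 0, 1]

theorem nullFrameInv_mul : nullFrameInv * nullFrame = 1 := by
  ext i j
  fin_cases i <;> fin_cases j <;>
    simp [nullFrame, nullFrameInv, Matrix.mul_apply, Fin.sum_univ_four] <;> norm_num

theorem headL_act {k : ℕ} (O : Matrix (Fin 4) (Fin 4) ℝ) (T : Ten (k + 1)) (c : Fin 4) :
    headL c (act O T) = ∑ d, O c d • act O (headL d T) := by
  ext a
  rw [headL_apply, act_cons, Finset.sum_apply]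
  rfl

theorem SymT.act {k : ℕ} {T : Ten k} (hT : SymT T) (O : Matrix (Fin 4) (Fin 4) ℝ) :
    SymT (act O T) := fun e => by rw [← act_permuteL, hT e]

theorem SymT.contractL_eq_zero {k : ℕ} {T : Ten (k + 2)} (hT : SymT T)
    (h : lap (toPoly T) = 0) : DeSitter.contractL T = 0 := by
  rw [lap_toPoly hT] at h
  exact hT.contractL.eq_zero ((smul_eq_zero.1 h).resolve_left (by positivity))

theorem SymT.apply_eq_zero {k : ℕ} {T : Ten k} (hT : SymT T) {c : Fin 4}
    (h : ∀ d (e : k = d + 1), DeSitter.headL c (permuteL (finCongr e) T) = 0) (a : Fin k → Fin 4)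
    (ha : ∃ i, a i = c) : T a = 0 := by
  cases k with
  | zero => exact ha.choose.elim0
  | succ k =>
    obtain ⟨i, hi⟩ := ha
    have h1 := congrFun (hT (Equiv.swap 0 i)) a
    rw [permuteL_apply] at h1
    have h2 := congrFun (h k rfl) (Fin.tail (a ∘ Equiv.swap 0 i))
    change T (Fin.cons c (Fin.tail (a ∘ Equiv.swap 0 i))) = 0 at h2
    rw [← h1, ← h2]
    congr 1
    rw [← hi]
    have : a i = (a ∘ Equiv.swap 0 i) 0 := by simp
    rw [this, Fin.cons_self_tail]

/-- Symmetric traceless tensors orthogonal to the base point are combinations of powers of null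
covectors. -/
theorem mem_span_pw_nullV {k : ℕ} {S : Ten k} (hS : SymT S) (hl : lap (toPoly S) = 0)
    (h3 : ∀ d (e : k = d + 1), headL 3 (permuteL (finCongr e) S) = 0) :
    S ∈ Submodule.span ℝ (Set.range fun p : ℝ × ℝ => pw (nullV p.1 p.2) k) := by
  have hS' := hS.act nullFrame
  obtain ⟨s, hs⟩ := exists_weight_function hS' (by
    rintro d rfl
    have h33 : headL 3 S = 0 := h3 (d + 1) rfl
    -- In the null frame the (0,1) component is (S₀₀ − S₁₁)/4 and the (2,2) component is S₂₂/4; they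
    -- agree because S is traceless and has no components along the base point.
    have ht : headL 0 (headL 0 S) = headL 1 (headL 1 S) + headL 2 (headL 2 S) := by
      have h := hS.contractL_eq_zero hl
      ext a
      have h2 := congrFun h a
      rw [contractL_apply, Fin.sum_univ_four] at h2
      have h4 := congrFun h33 (Fin.cons 3 a)
      simp only [headL_apply, Pi.add_apply, Pi.zero_apply, eta, Matrix.cons_val_zero,
        Matrix.cons_val_one, Matrix.cons_val] at h2 h4 ⊢
      linarith
    have h01 := hS.headL_comm 0 1
    change headL 0 (headL 1 (act nullFrame S)) = headL 2 (headL 2 (act nullFrame S))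
    simp only [headL_act, Fin.sum_univ_four, map_add, map_smul]
    simp only [nullFrame, Matrix.of_apply, Matrix.cons_val', Matrix.cons_val_zero,
      Matrix.cons_val_one, Matrix.cons_val, Matrix.cons_val_fin_one, zero_smul, add_zero, zero_add,
      ht, h01, map_add]
    module)
  have h33 : ∀ d (e : k = d + 1), headL 3 (permuteL (finCongr e) (act nullFrame S)) = 0 := by
    rintro d rfl
    change headL 3 (act nullFrame S) = 0
    rw [headL_act, Fin.sum_univ_four]
    have : headL 3 S = 0 := h3 d rfl
    rw [this]
    simp [nullFrame]
  have h4 := mem_span_pw_of_weight hs fun a ha => hS'.apply_eq_zero h33 a (by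
    push Not at ha; exact ha)
  have h5 : act nullFrameInv (act nullFrame S) = S := by
    rw [act_act, nullFrameInv_mul, act_one]
  rw [← h5]
  have h6 := Submodule.mem_map_of_mem (f := act nullFrameInv) h4
  rw [Submodule.map_span] at h6
  refine Submodule.span_mono ?_ h6
  rintro _ ⟨_, ⟨p, rfl⟩, rfl⟩
  -- The inverse frame change takes (p², 1, p, 0) to (p² + 1, p² − 1, 2p, 0).
  refine ⟨(p, 1), ?_⟩
  simp only [act_pw]
  congr 1
  ext i
  fin_cases i <;> simp [nullV, nullFrameInv, Matrix.mulVec, dotProduct, Fin.sum_univ_four]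
  all_goals ring

/-! ### Isometries -/

/-- `O` is an orientation preserving Lorentz transformation (acting on covectors) that maps the
point `x` to the point `y`. -/
structure IsIso (O : Matrix (Fin 4) (Fin 4) ℝ) (x y : Hyp) : Prop where
  iso : Oᵀ * Matrix.diagonal eta * O = Matrix.diagonal eta
  det : O.det = 1
  map : O *ᵥ low x = low y

theorem diagonal_eta_mul : Matrix.diagonal eta * Matrix.diagonal eta = 1 := by
  rw [Matrix.diagonal_mul_diagonal, ← Matrix.diagonal_one]
  congr 1; ext a; exact eta_mul_eta a

theorem isometry_left_inv {O : Matrix (Fin 4) (Fin 4) ℝ}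
    (h : Oᵀ * Matrix.diagonal eta * O = Matrix.diagonal eta) :
    (Matrix.diagonal eta * Oᵀ * Matrix.diagonal eta) * O = 1 := by
  rw [Matrix.mul_assoc, Matrix.mul_assoc, ← Matrix.mul_assoc Oᵀ, h, diagonal_eta_mul]

theorem isometry_right_inv {O : Matrix (Fin 4) (Fin 4) ℝ}
    (h : Oᵀ * Matrix.diagonal eta * O = Matrix.diagonal eta) :
    O * (Matrix.diagonal eta * Oᵀ * Matrix.diagonal eta) = 1 :=
  mul_eq_one_comm.1 (isometry_left_inv h)

theorem isometry_transpose {O : Matrix (Fin 4) (Fin 4) ℝ}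
    (h : Oᵀ * Matrix.diagonal eta * O = Matrix.diagonal eta) :
    O * Matrix.diagonal eta * Oᵀ = Matrix.diagonal eta := by
  have h2 := congrArg (· * Matrix.diagonal eta) (isometry_right_inv h)
  simp only [one_mul] at h2
  simp only [Matrix.mul_assoc] at h2
  rw [diagonal_eta_mul, Matrix.mul_one] at h2
  rw [Matrix.mul_assoc, h2]

theorem isometry_entries {O : Matrix (Fin 4) (Fin 4) ℝ} :
    Oᵀ * Matrix.diagonal eta * O = Matrix.diagonal eta ↔
      ∀ d e, ∑ c, eta c * O c d * O c e = if d = e then eta d else 0 := by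
  rw [← Matrix.ext_iff]
  refine forall_congr' fun d => forall_congr' fun e => ?_
  rw [Matrix.mul_apply, Matrix.diagonal_apply]
  simp_rw [Matrix.mul_diagonal, Matrix.transpose_apply, mul_comm (O _ d) (eta _)]

theorem isometry_entries_right {O : Matrix (Fin 4) (Fin 4) ℝ}
    (h : Oᵀ * Matrix.diagonal eta * O = Matrix.diagonal eta) (a b : Fin 4) :
    ∑ c, O a c * (eta c * O b c) = if a = b then eta a else 0 := by
  have h2 := congrFun (congrFun (isometry_transpose h) a) b
  rw [Matrix.mul_apply, Matrix.diagonal_apply] at h2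
  rw [← h2]
  refine Finset.sum_congr rfl fun c _ => ?_
  rw [Matrix.mul_diagonal, Matrix.transpose_apply, mul_assoc]

theorem isometry_det {O : Matrix (Fin 4) (Fin 4) ℝ}
    (h : Oᵀ * Matrix.diagonal eta * O = Matrix.diagonal eta) : O.det = 1 ∨ O.det = -1 := by
  have h2 := congrArg Matrix.det (isometry_left_inv h)
  have h3 := congrArg Matrix.det diagonal_eta_mul
  simp only [Matrix.det_mul, Matrix.det_transpose, Matrix.det_one] at h2 h3
  exact mul_self_eq_one_iff.1 (by linear_combination h2 - O.det * O.det * h3)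

theorem eta_mul_low (x : Hyp) (a : Fin 4) : eta a * low x a = x.1 a := by
  rw [low, ← mul_assoc, eta_mul_eta, one_mul]

theorem IsIso.map_apply {O : Matrix (Fin 4) (Fin 4) ℝ} {x y : Hyp} (h : IsIso O x y) (a : Fin 4) :
    ∑ b, O a b * low x b = low y a := congrFun h.map a

/-- The metric is invariant. -/
theorem IsIso.metric {O : Matrix (Fin 4) (Fin 4) ℝ} {x y : Hyp} (h : IsIso O x y) :
    act O (DeSitter.metric x) = DeSitter.metric y := by
  ext a
  rw [vec_two a, act_two]
  have hm : ∀ (x : Hyp) (c d : Fin 4), DeSitter.metric x ![c, d] =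
      (if c = d then eta c else 0) - low x c * low x d := fun x c d => by simp [DeSitter.metric, low]
  simp only [hm, mul_sub, Finset.sum_sub_distrib]
  congr 1
  · rw [← isometry_entries_right h.iso]
    refine Finset.sum_congr rfl fun c _ => ?_
    simp only [mul_ite, mul_zero, Finset.sum_ite_eq, Finset.mem_univ, if_true]; ring
  · rw [← h.map_apply, ← h.map_apply, Finset.sum_mul]
    refine Finset.sum_congr rfl fun c _ => ?_
    simp only [Finset.mul_sum]
    refine Finset.sum_congr rfl fun d _ => ?_
    ring

/-- The volume form is invariant. -/
theorem IsIso.vol {O : Matrix (Fin 4) (Fin 4) ℝ} {x y : Hyp} (h : IsIso O x y) :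
    act O (DeSitter.vol x) = DeSitter.vol y := by
  ext a
  refine (act_vol_aux _ _ _).trans ?_
  have hd : DeSitter.vol y a * O.det = DeSitter.vol y a := by rw [h.det, mul_one]
  rw [← hd, vol_apply, detRows, detRows, ← Matrix.det_mul]
  congr 1
  ext i j
  rw [Matrix.mul_apply]
  refine Fin.cases ?_ (fun i => ?_) i
  · have h2 := (isometry_entries.1 h.iso)
    have h3 : ∀ c, y.1 c * O c j = ∑ d, low x d * (eta c * O c d * O c j) := by
      intro c
      rw [← eta_mul_low, ← h.map_apply, Finset.mul_sum, Finset.sum_mul]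
      exact Finset.sum_congr rfl fun d _ => by ring
    simp only [Matrix.of_apply, Fin.cons_zero, h3]
    rw [Finset.sum_comm]
    simp only [← Finset.mul_sum, h2]
    simp only [mul_ite, mul_zero, Finset.sum_ite_eq', Finset.mem_univ, if_true]
    rw [mul_comm, eta_mul_low]
  · simp [Pi.single_apply]

theorem IsIso.mul_projM {O : Matrix (Fin 4) (Fin 4) ℝ} {x y : Hyp} (h : IsIso O x y) :
    O * projM x = projM y * O := by
  have hp : ∀ x, projM x = 1 - Matrix.vecMulVec (low x) x.1 := fun x => by
    ext a b
    simp [projM, proj, low, Matrix.one_apply, Matrix.vecMulVec_apply]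
  rw [hp, hp, mul_sub, sub_mul, mul_one, one_mul]
  congr 1
  ext a j
  simp only [Matrix.mul_apply, Matrix.vecMulVec_apply]
  rw [← h.map_apply]
  have h3 : ∑ c, y.1 c * O c j = x.1 j := by
    have h2 := (isometry_entries.1 h.iso)
    have h3 : ∀ c, y.1 c * O c j = ∑ d, low x d * (eta c * O c d * O c j) := by
      intro c
      rw [← eta_mul_low, ← h.map_apply, Finset.mul_sum, Finset.sum_mul]
      exact Finset.sum_congr rfl fun d _ => by ring
    simp only [h3]
    rw [Finset.sum_comm]
    simp only [← Finset.mul_sum, h2]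
    simp only [mul_ite, mul_zero, Finset.sum_ite_eq', Finset.mem_univ, if_true]
    rw [mul_comm, eta_mul_low]
  simp only [← mul_assoc, ← Finset.sum_mul]
  simp only [mul_assoc, ← Finset.mul_sum, h3]

/-- The operations in `IsCoef` are equivariant. -/
theorem IsIso.coef {O : Matrix (Fin 4) (Fin 4) ℝ} {x y : Hyp} (h : IsIso O x y) {m k : ℕ}
    {C : CoefOp m k} (hC : IsCoef m k C) (T : Ten m) : act O (C x T) = C y (act O T) := by
  induction hC with
  | id => rfl
  | metric _ ih => rw [LinearMap.comp_apply, act_tmulL, h.metric, ih]; rfl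
  | vol _ ih => rw [LinearMap.comp_apply, act_tmulL, h.vol, ih]; rfl
  | permute e _ ih => rw [LinearMap.comp_apply, act_permuteL, ih]; rfl
  | contract _ ih =>
    rw [LinearMap.comp_apply, ← contractL_act_isometry (isometry_entries.1 h.iso), ih]; rfl

theorem IsIso.act_symm {O : Matrix (Fin 4) (Fin 4) ℝ} {x y : Hyp} (h : IsIso O x y) {k : ℕ}
    (T : Ten k) : act (Matrix.diagonal eta * Oᵀ * Matrix.diagonal eta) (act O T) = T := by
  rw [act_act, isometry_left_inv h.iso, act_one]

/-- The base point. -/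
def base : Hyp := ⟨![0, 0, 0, 1], by simp [dot, Fin.sum_univ_four, eta]⟩

theorem low_base : low base = ![0, 0, 0, 1] := by
  ext a; fin_cases a <;> simp [low, base, eta]

/-- The normalization of s makes the matrix the reflection in the hyperplane η-orthogonal to n. -/
theorem reflection_isometry {n : Fin 4 → ℝ} {s : ℝ} (hs : s * ∑ c, eta c * n c * n c = 2) :
    (1 - s • Matrix.vecMulVec n (fun d => eta d * n d))ᵀ * Matrix.diagonal eta *
      (1 - s • Matrix.vecMulVec n (fun d => eta d * n d)) = Matrix.diagonal eta := by
  rw [isometry_entries]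
  intro d e
  have h : ∀ c : Fin 4, eta c * (1 - s • Matrix.vecMulVec n (fun d => eta d * n d)) c d *
      (1 - s • Matrix.vecMulVec n (fun d => eta d * n d)) c e =
      (if c = d then (if c = e then eta c else 0) else 0)
      - (if c = d then s * eta c * n c * eta e * n e else 0)
      - (if c = e then s * eta c * n c * eta d * n d else 0)
      + s * (eta c * n c * n c) * (s * eta d * n d * eta e * n e) := by
    intro c
    simp only [Matrix.sub_apply, Matrix.one_apply, Matrix.smul_apply, Matrix.vecMulVec_apply,
      smul_eq_mul]
    split_ifs <;> ring
  simp only [h, Finset.sum_add_distrib, Finset.sum_sub_distrib, ← Finset.sum_mul, ← Finset.mul_sum,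
    hs, Finset.sum_ite_eq', Finset.mem_univ, if_true]
  ring

theorem exists_isometry_base (x : Hyp) : ∃ O : Matrix (Fin 4) (Fin 4) ℝ,
    Oᵀ * Matrix.diagonal eta * O = Matrix.diagonal eta ∧ O *ᵥ low x = low base := by
  have hx : ∑ a, low x a * x.1 a = 1 := sum_low_mul x
  have hq : ∀ n : Fin 4 → ℝ, ∀ s : ℝ,
      (1 - s • Matrix.vecMulVec n (fun d => eta d * n d)) *ᵥ low x =
      fun a => low x a - s * n a * ∑ d, n d * x.1 d := by
    intro n s
    ext a
    simp only [Matrix.mulVec, dotProduct, Matrix.sub_apply, Matrix.one_apply, Matrix.smul_apply,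
      Matrix.vecMulVec_apply, smul_eq_mul, sub_mul, Finset.sum_sub_distrib, ite_mul, one_mul,
      zero_mul, Finset.sum_ite_eq, Finset.mem_univ, if_true, Finset.mul_sum]
    congr 1
    refine Finset.sum_congr rfl fun d _ => ?_
    rw [← eta_mul_low]; ring
  have hx4 : -x.1 0 * x.1 0 + x.1 1 * x.1 1 + x.1 2 * x.1 2 + x.1 3 * x.1 3 = 1 := by
    simpa [Fin.sum_univ_four, low, eta] using hx
  by_cases h : x.1 3 = 1
  · have h3 : x.1 3 = 1 := h
    -- Here x minus the base point is null (possibly nonzero), so it defines no reflection. The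
    -- reflection in their sum, of norm 4, takes x to minus the base point, and the sign change of
    -- the last coordinate corrects this.
    refine ⟨Matrix.diagonal ![1, 1, 1, -1] * (1 - (1 / 2 : ℝ) • Matrix.vecMulVec
      (low x + low base) fun d => eta d * (low x + low base) d), ?_, ?_⟩
    · rw [Matrix.transpose_mul, Matrix.diagonal_transpose]
      have hd : Matrix.diagonal ![1, 1, 1, -1] * Matrix.diagonal eta *
          Matrix.diagonal ![1, 1, 1, -1] = Matrix.diagonal eta := by
        simp only [Matrix.diagonal_mul_diagonal]
        congr 1; ext a; fin_cases a <;> simp [eta]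
      calc _ = (1 - (1 / 2 : ℝ) • Matrix.vecMulVec (low x + low base)
            fun d => eta d * (low x + low base) d)ᵀ * (Matrix.diagonal ![1, 1, 1, -1] *
            Matrix.diagonal eta * Matrix.diagonal ![1, 1, 1, -1]) * (1 - (1 / 2 : ℝ) •
            Matrix.vecMulVec (low x + low base) fun d => eta d * (low x + low base) d) := by
              simp only [Matrix.mul_assoc]
        _ = _ := by
          rw [hd]
          refine reflection_isometry ?_
          rw [low_base]
          simp [Fin.sum_univ_four, low, eta]
          rw [h3]; rw [h3] at hx4; linarith
    · rw [← Matrix.mulVec_mulVec, hq]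
      have : ∑ d, (low x + low base) d * x.1 d = 2 := by
        rw [low_base]
        simp [Fin.sum_univ_four, low, eta]
        rw [h3]; rw [h3] at hx4; linarith
      rw [this]
      ext a
      rw [Matrix.mulVec_diagonal, low_base]
      fin_cases a <;> simp <;> ring
  · have h3 : 1 - x.1 3 ≠ 0 := fun h' => h (by linarith)
    -- Reflection in the difference of x and the base point, whose norm is 2(1 − x₃), exchanges the
    -- two.
    refine ⟨1 - (1 / (1 - x.1 3)) • Matrix.vecMulVec
      (low x - low base) fun d => eta d * (low x - low base) d, ?_, ?_⟩
    · refine reflection_isometry ?_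
      rw [low_base]
      simp [Fin.sum_univ_four, low, eta]
      rw [inv_mul_eq_iff_eq_mul₀ h3]
      linear_combination hx4
    · rw [hq]
      have : ∑ d, (low x - low base) d * x.1 d = 1 - x.1 3 := by
        rw [low_base]
        simp [Fin.sum_univ_four, low, eta]
        linear_combination hx4
      rw [this]
      ext a
      rw [Pi.sub_apply]
      field_simp
      ring

theorem exists_isIso_base (x : Hyp) : ∃ O, IsIso O x base := by
  obtain ⟨O, h1, h2⟩ := exists_isometry_base x
  rcases isometry_det h1 with h | h
  · exact ⟨O, h1, h, h2⟩
  -- A reflection fixing the base point repairs the orientation.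
  · refine ⟨Matrix.diagonal ![1, 1, -1, 1] * O, ?_, ?_, ?_⟩
    · rw [Matrix.transpose_mul, Matrix.diagonal_transpose]
      have hd : Matrix.diagonal ![1, 1, -1, 1] * Matrix.diagonal eta *
          Matrix.diagonal ![1, 1, -1, 1] = Matrix.diagonal eta := by
        simp only [Matrix.diagonal_mul_diagonal]
        congr 1; ext a; fin_cases a <;> simp [eta]
      calc _ = Oᵀ * (Matrix.diagonal ![1, 1, -1, 1] * Matrix.diagonal eta *
            Matrix.diagonal ![1, 1, -1, 1]) * O := by simp only [Matrix.mul_assoc]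
        _ = _ := by rw [hd, h1]
    · rw [Matrix.det_mul, h, Matrix.det_diagonal]
      simp [Fin.prod_univ_four]
    · rw [← Matrix.mulVec_mulVec, h2, low_base]
      ext a
      rw [Matrix.mulVec_diagonal]
      fin_cases a <;> simp

/-! ### The action of SL(2, ℝ) on null covectors -/

/-- The Lorentz transformation defined by an element of `SL(2, ℝ)`. -/
def spinM (p q r s : ℝ) : Matrix (Fin 4) (Fin 4) ℝ :=
  !![(p ^ 2 + r ^ 2 + q ^ 2 + s ^ 2) / 2, (p ^ 2 + r ^ 2 - q ^ 2 - s ^ 2) / 2, p * q + r * s, 0;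
    (p ^ 2 - r ^ 2 + q ^ 2 - s ^ 2) / 2, (p ^ 2 - r ^ 2 - q ^ 2 + s ^ 2) / 2, p * q - r * s, 0;
    p * r + q * s, p * r - q * s, p * s + q * r, 0;
    0, 0, 0, 1]

/-- The parametrization of the null cone by the plane is equivariant, so pairs of null covectors can
be moved as pairs of vectors in the plane. -/
theorem spinM_nullV (p q r s a b : ℝ) :
    spinM p q r s *ᵥ nullV a b = nullV (p * a + q * b) (r * a + s * b) := by
  ext i
  fin_cases i <;> simp [spinM, nullV, Matrix.mulVec, dotProduct, Fin.sum_univ_four] <;> ring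

theorem isIso_spinM {p q r s : ℝ} (h : p * s - q * r = 1) : IsIso (spinM p q r s) base base where
  iso := by
    rw [isometry_entries]
    intro d e
    have h2 : (p * s - q * r) ^ 2 = 1 := by rw [h]; norm_num
    fin_cases d <;> fin_cases e <;> simp [spinM, Fin.sum_univ_four, eta] <;>
      first | linear_combination h2 | linear_combination -h2 | ring
  det := by
    have : (spinM p q r s).det = (p * s - q * r) ^ 3 := by
      simp [Matrix.det_succ_row_zero, Fin.sum_univ_succ, spinM, Fin.succAbove]
      ring
    rw [this, h]; norm_num
  map := by
    rw [low_base]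
    ext i
    fin_cases i <;> simp [spinM, Matrix.mulVec, dotProduct, Fin.sum_univ_four]

/-! ### Quadratic rules -/

/-- The product of two iterated derivatives. -/
def prodR (i j : ℕ) : Rule (i + j) := fun σ => tmul (iterCov σ.1 i) (iterCov σ.1 j)

def quadBase (n : ℕ) : Set (Σ r, Rule r) := {p | ∃ i j, i + j < n ∧ p = ⟨i + j, prodR i j⟩}

/-- Quadratic rules of order less than `n`. -/
abbrev quadLt (n k : ℕ) : Submodule ℝ (Rule k) := coefSpan (quadBase n) k

theorem quadLt_mono {m n : ℕ} (h : m ≤ n) (k : ℕ) : quadLt m k ≤ quadLt n k :=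
  coefSpan_mono (by rintro _ ⟨i, j, hl, hp⟩; exact ⟨i, j, hl.trans_le h, hp⟩) k

theorem prodR_mem {i j n : ℕ} (h : i + j < n) : prodR i j ∈ quadLt n (i + j) :=
  mem_coefSpan (B := quadBase n) ⟨i, j, h, rfl⟩

theorem good_prodR (i j : ℕ) (σ : Sol) : Good (prodR i j σ) :=
  (good_iterR i σ).tmul (good_iterR j σ)

theorem good_quadBase (n : ℕ) : ∀ p ∈ quadBase n, ∀ σ, Good (p.2 σ) := by
  rintro _ ⟨i, j, _, rfl⟩ σ
  exact good_prodR i j σ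

theorem good_quadLt {n k : ℕ} {F : Rule k} (hF : F ∈ quadLt n k) (σ : Sol) : Good (F σ) :=
  good_of_mem (good_quadBase n) hF σ

theorem quadLt_zero (k : ℕ) : quadLt 0 k = ⊥ := by
  refine (Submodule.span_eq_bot).2 ?_
  rintro _ ⟨r, G, C, ⟨i, j, h, -⟩, -⟩
  omega

theorem IsMonomial.exists_coef {n k : ℕ} {F : Rule k} (h : IsMonomial n k F) :
    ∃ i j C, i + j = n ∧ IsCoef (i + j) k C ∧ F = fun σ x => C x (prodR i j σ x) := by
  induction h with
  | base i j => exact ⟨i, j, _, rfl, IsCoef.id, rfl⟩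
  | metric _ ih =>
    obtain ⟨i, j, C, h, hC, rfl⟩ := ih
    exact ⟨i, j, _, h, hC.metric, rfl⟩
  | vol _ ih =>
    obtain ⟨i, j, C, h, hC, rfl⟩ := ih
    exact ⟨i, j, _, h, hC.vol, rfl⟩
  | permute e _ ih =>
    obtain ⟨i, j, C, h, hC, rfl⟩ := ih
    exact ⟨i, j, _, h, hC.permute e, rfl⟩
  | contract _ ih =>
    obtain ⟨i, j, C, h, hC, rfl⟩ := ih
    exact ⟨i, j, _, h, hC.contract, rfl⟩

theorem IsCoef.isMonomial {i j k : ℕ} {C : CoefOp (i + j) k} (hC : IsCoef (i + j) k C) :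
    IsMonomial (i + j) k (fun σ x => C x (prodR i j σ x)) := by
  induction hC with
  | id => exact .base i j
  | metric _ ih => exact ih.metric
  | vol _ ih => exact ih.vol
  | permute e _ ih => exact ih.permute e
  | contract _ ih => exact ih.contract

/-- The internal filtration uses strict bounds, so that order zero still has a (trivial)
predecessor; hence the shift by one. -/
theorem quadratic_eq (n : ℕ) : quadratic n = quadLt (n + 1) 2 := by
  refine congrArg (Submodule.span ℝ) (Set.ext fun F => ⟨?_, ?_⟩)
  · rintro ⟨m, hm, h⟩
    obtain ⟨i, j, C, rfl, hC, rfl⟩ := h.exists_coef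
    exact ⟨_, _, C, ⟨i, j, by omega, rfl⟩, hC, rfl⟩
  · rintro ⟨r, G, C, ⟨i, j, h, hp⟩, hC, rfl⟩
    cases hp
    exact ⟨i + j, by omega, hC.isMonomial⟩

/-- The Leibniz rule for products of derivatives. -/
theorem cov_prodR (i j : ℕ) (σ : Sol) (x : Hyp) : cov (prodR i j σ) x =
    permuteL (finCongr (Nat.succ_add i j)) (prodR (i + 1) j σ x) +
      permuteL (moveFront i j) (prodR i (j + 1) σ x) := by
  ext a
  refine (cov_tmul (good_iterR i σ) (good_iterR j σ) x a).trans ?_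
  rw [Pi.add_apply, permuteL_apply, permuteL_apply]
  simp only [prodR, tmul, Function.comp_def]
  congr 1
  · congr 1
    · change iterCov σ.1 (i + 1) x _ = _
      congr 1
      ext t
      refine Fin.cases ?_ (fun t => ?_) t
      · rfl
      · rfl
    · change iterCov σ.1 j x _ = _
      congr 1
      funext t
      congr 1
      ext; simp; omega
  · congr 1
    · change iterCov σ.1 i x _ = _
      congr 1
      funext t
      rw [moveFront_castAdd]
    · change iterCov σ.1 (j + 1) x _ = _
      congr 1
      funext t
      refine Fin.cases ?_ (fun t => ?_) t
      · rw [moveFront_zero]; rfl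
      · rw [moveFront_succ]; rfl

theorem covR_mem_quadLt {n k : ℕ} {F : Rule k} (hF : F ∈ quadLt n k) :
    covR F ∈ quadLt (n + 1) (k + 1) := by
  refine covR_mem (good_quadBase n) ?_ hF
  rintro _ ⟨i, j, h, rfl⟩
  have h1 := applyOp_mem (IsCoef.permuteL (finCongr (Nat.succ_add i j)))
    (prodR_mem (i := i + 1) (j := j) (n := n + 1) (by omega))
  have h2 := applyOp_mem (IsCoef.permuteL (moveFront i j))
    (prodR_mem (i := i) (j := j + 1) (n := n + 1) (by omega))
  convert Submodule.add_mem _ h1 h2 using 1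
  funext σ x
  exact cov_prodR i j σ x

/-- Products of linear rules. -/
def tmulR {r s : ℕ} (G : Rule r) (H : Rule s) : Rule (r + s) := fun σ => tmul (G σ) (H σ)

/-- Orders below a and below b add up to at most a + b − 2, hence the bound n + 1 on a + b. -/
theorem tmulR_mem_quadLt {a b n r s : ℕ} (h : a + b ≤ n + 1) {G : Rule r} {H : Rule s}
    (hG : G ∈ linLt a r) (hH : H ∈ linLt b s) : tmulR G H ∈ quadLt n (r + s) := by
  refine Submodule.span_induction (p := fun G _ => tmulR G H ∈ quadLt n (r + s)) ?_ ?_ ?_ ?_ hG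
  · rintro _ ⟨r', G', C, ⟨i, hi, hp⟩, hC, rfl⟩
    obtain ⟨rfl, hp⟩ := Sigma.mk.inj hp
    obtain rfl := eq_of_heq hp
    refine Submodule.span_induction
      (p := fun H _ => tmulR (fun σ x => C x (iterR r' σ x)) H ∈ quadLt n (r + s)) ?_ ?_ ?_ ?_ hH
    · rintro _ ⟨s', H', C', ⟨j, hj, hp⟩, hC', rfl⟩
      obtain ⟨rfl, hp⟩ := Sigma.mk.inj hp
      obtain rfl := eq_of_heq hp
      obtain ⟨D, hD, hD'⟩ := hC.tmul hC'
      refine Submodule.subset_span ⟨_, _, D, ⟨r', s', by omega, rfl⟩, hD, ?_⟩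
      funext σ x
      exact (hD' x _ _).symm
    · convert Submodule.zero_mem _ using 1
      funext σ x a
      exact mul_zero _
    · intro H H' _ _ h h'
      convert Submodule.add_mem _ h h' using 1
      funext σ x a
      exact mul_add _ _ _
    · intro c H _ h
      convert Submodule.smul_mem _ c h using 1
      funext σ x a
      exact mul_left_comm _ _ _
  · convert Submodule.zero_mem _ using 1
    funext σ x a
    exact zero_mul _
  · intro H H' _ _ h h'
    convert Submodule.add_mem _ h h' using 1
    funext σ x a
    exact add_mul _ _ _
  · intro c H _ h
    convert Submodule.smul_mem _ c h using 1
    funext σ x a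
    exact mul_assoc _ _ _

/-! ### Leading symbols -/

/-- Functions of two covectors with values in tensors. -/
abbrev Symbol (k : ℕ) : Type := (Fin 4 → ℝ) → (Fin 4 → ℝ) → Ten k

/-- The polarized symbol at the base point of `C (Dⁱσ ⊗ Dʲσ)`. -/
def monoSymbol {i j k : ℕ} (C : CoefOp (i + j) k) : Symbol k := fun K L =>
  C base (tmulL (pw K i) (pw L j)) + C base (tmulL (pw L i) (pw K j))

/-- `HasSymbol n k F τ`: the quadratic rule `F` has order at most `n`, and `τ` is a symbol of its
part of order `n`. -/
inductive HasSymbol (n k : ℕ) : Rule k → Symbol k → Prop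
  | low {F : Rule k} (h : F ∈ quadLt n k) : HasSymbol n k F 0
  | mono {i j : ℕ} {C : CoefOp (i + j) k} (h : i + j = n) (hC : IsCoef (i + j) k C) :
      HasSymbol n k (fun σ x => C x (prodR i j σ x)) (monoSymbol C)
  | add {F G : Rule k} {τ υ : Symbol k} (h : HasSymbol n k F τ) (h' : HasSymbol n k G υ) :
      HasSymbol n k (F + G) (τ + υ)
  | smul (r : ℝ) {F : Rule k} {τ : Symbol k} (h : HasSymbol n k F τ) :
      HasSymbol n k (r • F) (r • τ)

theorem exists_symbol {n k : ℕ} {F : Rule k} (h : F ∈ quadLt (n + 1) k) :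
    ∃ τ, HasSymbol n k F τ := by
  refine Submodule.span_induction (p := fun F _ => ∃ τ, HasSymbol n k F τ) ?_ ?_ ?_ ?_ h
  · rintro _ ⟨r, G, C, ⟨i, j, h, hp⟩, hC, rfl⟩
    cases hp
    rcases (Nat.lt_succ_iff.1 h).lt_or_eq with h | rfl
    · exact ⟨0, HasSymbol.low (Submodule.subset_span ⟨_, _, C, ⟨i, j, h, rfl⟩, hC, rfl⟩)⟩
    · exact ⟨_, .mono rfl hC⟩
  · exact ⟨0, .low (Submodule.zero_mem _)⟩
  · rintro F G _ _ ⟨τ, h⟩ ⟨υ, h'⟩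
    exact ⟨_, h.add h'⟩
  · rintro r F _ ⟨τ, h⟩
    exact ⟨_, h.smul r⟩

theorem HasSymbol.mem {n k : ℕ} {F : Rule k} {τ : Symbol k} (h : HasSymbol n k F τ) :
    F ∈ quadLt (n + 1) k := by
  induction h with
  | low h => exact quadLt_mono n.le_succ k h
  | @mono i j C h hC => exact Submodule.subset_span ⟨_, _, C, ⟨i, j, by omega, rfl⟩, hC, rfl⟩
  | add _ _ h h' => exact Submodule.add_mem _ h h'
  | smul r _ h => exact Submodule.smul_mem _ r h

theorem HasSymbol.congr {n k : ℕ} {F G : Rule k} {τ υ : Symbol k} (h : HasSymbol n k F τ)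
    (hF : F = G) (hτ : τ = υ) : HasSymbol n k G υ := hF ▸ hτ ▸ h

theorem HasSymbol.applyOp {n k l : ℕ} {C : CoefOp k l} (hC : IsCoef k l C) {F : Rule k}
    {τ : Symbol k} (h : HasSymbol n k F τ) :
    HasSymbol n l (DeSitter.applyOp C F) fun K L => C base (τ K L) := by
  induction h with
  | low h =>
    exact (HasSymbol.low (applyOp_mem hC h)).congr rfl
      (funext fun K => funext fun L => (map_zero (C base)).symm)
  | @mono i j D h hD =>
    exact (HasSymbol.mono h (hD.comp hC)).congr rfl
      (funext fun K => funext fun L => (map_add (C base) _ _).symm)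
  | add _ _ h h' =>
    exact (h.add h').congr (map_add _ _ _).symm
      (funext fun K => funext fun L => (map_add (C base) _ _).symm)
  | smul r _ h =>
    exact (h.smul r).congr (LinearMap.map_smul _ _ _).symm
      (funext fun K => funext fun L => ((C base).map_smul _ _).symm)

theorem pw_succ (K : Fin 4 → ℝ) (i : ℕ) (a : Fin (i + 1) → Fin 4) :
    pw K (i + 1) a = K (a 0) * pw K i (Fin.tail a) := Fin.prod_univ_succ _

/-- By the Leibniz rule the derivative falls on either factor, contributing K or L. -/
theorem HasSymbol.cov {n k : ℕ} {F : Rule k} {τ : Symbol k}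
    (h : HasSymbol n k F τ) :
    HasSymbol (n + 1) (k + 1) (covR F) fun K L a => (K (a 0) + L (a 0)) * τ K L (Fin.tail a) := by
  induction h with
  | low h =>
    exact (HasSymbol.low (covR_mem_quadLt h)).congr rfl
      (funext fun K => funext fun L => funext fun a => (mul_zero _).symm)
  | @mono i j C h hC =>
    subst h
    have h1 := HasSymbol.mono (Nat.succ_add i j)
      ((IsCoef.permuteL (finCongr (Nat.succ_add i j))).comp hC.lift)
    have h2 := HasSymbol.mono rfl ((IsCoef.permuteL (moveFront i j)).comp hC.lift)
    have k1 : ∀ K L : Fin 4 → ℝ, ∀ a, liftC (C base)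
        (permuteL (finCongr (Nat.succ_add i j)) (tmulL (pw K (i + 1)) (pw L j))) a =
        K (a 0) * C base (tmulL (pw K i) (pw L j)) (Fin.tail a) := by
      intro K L a
      rw [liftC_apply, ← smul_eq_mul, ← Pi.smul_apply, ← (C base).map_smul]
      refine congrFun (congrArg _ (funext fun B => ?_)) _
      rw [Pi.smul_apply, smul_eq_mul, permuteL_apply, tmulL_apply, tmulL_apply, pw_succ,
        mul_assoc]
      congr 2
      refine congrArg (pw L j) (funext fun t => ?_)
      rw [Function.comp_apply, show finCongr (Nat.succ_add i j) (Fin.natAdd (i + 1) t) =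
        (Fin.natAdd i t).succ from Fin.ext (by simp; omega)]
      rfl
    have k2 : ∀ K L : Fin 4 → ℝ, ∀ a, liftC (C base)
        (permuteL (moveFront i j) (tmulL (pw K i) (pw L (j + 1)))) a =
        L (a 0) * C base (tmulL (pw K i) (pw L j)) (Fin.tail a) := by
      intro K L a
      rw [liftC_apply, ← smul_eq_mul, ← Pi.smul_apply, ← (C base).map_smul]
      refine congrFun (congrArg _ (funext fun B => ?_)) _
      rw [Pi.smul_apply, smul_eq_mul, permuteL_apply, tmulL_apply, tmulL_apply, pw_succ,
        mul_left_comm]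
      simp only [Function.comp_apply, moveFront_zero, moveFront_castAdd, Fin.cons_zero,
        Fin.cons_succ]
      congr 2
      refine congrArg (pw L j) (funext fun t => ?_)
      simp only [Fin.tail, moveFront_succ, Fin.cons_succ]
    refine (h1.add h2).congr ?_ ?_
    · funext σ x
      refine Eq.symm (((good_apply hC (good_prodR i j σ)).2 x).trans ?_)
      rw [cov_prodR, map_add]
      rfl
    · funext K L a
      change liftC (C base) (permuteL (finCongr (Nat.succ_add i j))
          (tmulL (pw K (i + 1)) (pw L j))) a +
        liftC (C base) (permuteL (finCongr (Nat.succ_add i j)) (tmulL (pw L (i + 1)) (pw K j))) a +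
        (liftC (C base) (permuteL (moveFront i j) (tmulL (pw K i) (pw L (j + 1)))) a +
        liftC (C base) (permuteL (moveFront i j) (tmulL (pw L i) (pw K (j + 1)))) a) =
        (K (a 0) + L (a 0)) * (C base (tmulL (pw K i) (pw L j)) (Fin.tail a) +
        C base (tmulL (pw L i) (pw K j)) (Fin.tail a))
      rw [k1, k1, k2, k2]; ring
  | add h0 h0' h h' =>
    refine (h.add h').congr ?_ ?_
    · funext σ
      exact (cov_add (good_quadLt h0.mem σ) (good_quadLt h0'.mem σ)).symm
    · funext K L a
      exact (mul_add _ _ _).symm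
  | smul r h0 h =>
    refine (h.smul r).congr ?_ ?_
    · funext σ
      exact (cov_smul r (good_quadLt h0.mem σ)).symm
    · funext K L a
      exact mul_left_comm _ _ _

/-! Invariance properties of symbols. -/

/-- All coefficients are built from invariant tensors, so isometries fixing the base point act on
the symbol through its two arguments. -/
theorem HasSymbol.equivariant {n k : ℕ} {F : Rule k} {τ : Symbol k} (h : HasSymbol n k F τ)
    {O : Matrix (Fin 4) (Fin 4) ℝ} (hO : IsIso O base base) (K L : Fin 4 → ℝ) :
    τ (O *ᵥ K) (O *ᵥ L) = act O (τ K L) := by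
  induction h with
  | low h => exact (map_zero (act O)).symm
  | @mono i j C h hC =>
    simp only [monoSymbol, map_add, hO.coef hC, act_tmulL, act_pw]
  | add _ _ h h' => exact (congrArg₂ _ h h').trans (map_add (act O) _ _).symm
  | smul r _ h => exact (congrArg _ h).trans ((act O).map_smul r _).symm

theorem pw_smul (r : ℝ) (K : Fin 4 → ℝ) (i : ℕ) : pw (r • K) i = r ^ i • pw K i := by
  ext B
  simp [pw, Finset.prod_mul_distrib]

theorem tmulL_smul_left {k l : ℕ} (r : ℝ) (S : Ten k) (T : Ten l) :
    tmulL (r • S) T = r • tmulL S T := by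
  ext a; simp [tmulL_apply, mul_assoc]

theorem tmulL_add_left {k l : ℕ} (S S' : Ten k) (T : Ten l) :
    tmulL (S + S') T = tmulL S T + tmulL S' T := by
  ext a; simp [tmulL_apply, add_mul]

theorem HasSymbol.homogeneous {n k : ℕ} {F : Rule k} {τ : Symbol k} (h : HasSymbol n k F τ)
    (r : ℝ) (K L : Fin 4 → ℝ) : τ (r • K) (r • L) = r ^ n • τ K L := by
  induction h with
  | low h => simp
  | @mono i j C h hC =>
    subst h
    simp only [monoSymbol, pw_smul, tmulL_smul_left, LinearMap.map_smul, pow_add, smul_add,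
      mul_smul, smul_comm (r ^ j) (r ^ i)]
  | add _ _ h h' => simp [h, h']
  | smul s _ h => simp [h, smul_comm s]

theorem act_coef {m k : ℕ} {C : CoefOp m k} (hC : IsCoef m k C) {x : Hyp} {T : Ten m}
    (hT : act (projM x) T = T) : act (projM x) (C x T) = C x T := by
  induction hC with
  | id => exact hT
  | metric _ ih => rw [LinearMap.comp_apply, act_tmulL, act_metric, ih]
  | vol _ ih => rw [LinearMap.comp_apply, act_tmulL, act_vol, ih]
  | permute e _ ih => rw [LinearMap.comp_apply, act_permuteL, ih]
  | contract _ ih =>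
    rw [LinearMap.comp_apply, ← ih, contractL_act, act_act, projM_mul_projM]

theorem HasSymbol.tangential {n k : ℕ} {F : Rule k} {τ : Symbol k} (h : HasSymbol n k F τ)
    {K L : Fin 4 → ℝ} (hK : projM base *ᵥ K = K) (hL : projM base *ᵥ L = L) :
    act (projM base) (τ K L) = τ K L := by
  induction h with
  | low h => exact map_zero _
  | @mono i j C h hC =>
    rw [monoSymbol, map_add, act_coef hC, act_coef hC] <;>
      rw [act_tmulL, act_pw, act_pw, hK, hL]
  | add _ _ h h' => exact (map_add _ _ _).trans (congrArg₂ _ h h')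
  | smul r _ h => exact (LinearMap.map_smul _ r _).trans (congrArg _ h)

theorem continuous_pw (i : ℕ) : Continuous fun K => pw K i := by
  refine continuous_pi fun B => ?_
  exact continuous_finsetProd _ fun t _ => continuous_apply _

theorem continuous_tmulL {X : Type*} [TopologicalSpace X] {k l : ℕ} {f : X → Ten k} {g : X → Ten l}
    (hf : Continuous f) (hg : Continuous g) : Continuous fun y => tmulL (f y) (g y) := by
  refine continuous_pi fun a => ?_
  exact ((continuous_apply _).comp hf).mul ((continuous_apply _).comp hg)

theorem HasSymbol.continuous {n k : ℕ} {F : Rule k} {τ : Symbol k} (h : HasSymbol n k F τ) :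
    Continuous fun p : (Fin 4 → ℝ) × (Fin 4 → ℝ) => τ p.1 p.2 := by
  induction h with
  | low h => exact continuous_const
  | @mono i j C h hC =>
    have hc := LinearMap.continuous_of_finiteDimensional (C base)
    exact (hc.comp (continuous_tmulL ((continuous_pw i).comp continuous_fst)
      ((continuous_pw j).comp continuous_snd))).add
      (hc.comp (continuous_tmulL ((continuous_pw i).comp continuous_snd)
      ((continuous_pw j).comp continuous_fst)))
  | add _ _ h h' => exact h.add h'
  | smul r _ h => exact h.const_smul r

/-! ### Rules with vanishing symbol -/

/-- Real linear combinations of the operations in `IsCoef`. -/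
def opSpan (m k : ℕ) : Submodule ℝ (CoefOp m k) := Submodule.span ℝ {C | IsCoef m k C}

theorem applyOp_mem_of_opSpan {B : Set (Σ r, Rule r)} {k l : ℕ} {C : CoefOp k l}
    (hC : C ∈ opSpan k l) {F : Rule k} (hF : F ∈ coefSpan B k) : applyOp C F ∈ coefSpan B l := by
  induction hC using Submodule.span_induction with
  | mem C hC => exact applyOp_mem hC hF
  | zero => exact Submodule.zero_mem _
  | add C D _ _ h h' => exact Submodule.add_mem _ h h'
  | smul r C _ h => exact Submodule.smul_mem _ r h

theorem IsIso.opSpan {O : Matrix (Fin 4) (Fin 4) ℝ} {x y : Hyp} (h : IsIso O x y) {m k : ℕ}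
    {C : CoefOp m k} (hC : C ∈ opSpan m k) (T : Ten m) : act O (C x T) = C y (act O T) := by
  induction hC using Submodule.span_induction with
  | mem C hC => exact h.coef hC T
  | zero => exact map_zero (act O)
  | add C D _ _ h h' => exact (map_add (act O) _ _).trans (congrArg₂ (· + ·) h h')
  | smul r C _ h => exact ((act O).map_smul r _).trans (congrArg (r • ·) h)

/-- Collects the leading part into one operation for each bidegree (i, j), so that the bidegrees can
later be treated separately. -/
theorem HasSymbol.exists_rep {n k : ℕ} {F : Rule k} {τ : Symbol k} (h : HasSymbol n k F τ) :
    ∃ D : ∀ i j, CoefOp (i + j) k, (∀ i j, D i j ∈ DeSitter.opSpan (i + j) k) ∧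
      F - ∑ p ∈ Finset.HasAntidiagonal.antidiagonal n, DeSitter.applyOp (D p.1 p.2) (prodR p.1 p.2) ∈ quadLt n k ∧
      τ = ∑ p ∈ Finset.HasAntidiagonal.antidiagonal n, monoSymbol (D p.1 p.2) := by
  induction h with
  | low h =>
    refine ⟨fun i j => 0, fun i j => Submodule.zero_mem _, ?_, ?_⟩
    · rw [Finset.sum_eq_zero, sub_zero]
      · exact h
      · intro p _; rfl
    · refine (Finset.sum_eq_zero fun p _ => ?_).symm
      funext K L
      exact add_zero _
  | @mono i j C h hC =>
    obtain rfl := h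
    refine ⟨Pi.single (M := fun i => ∀ j, CoefOp (i + j) k) i (Pi.single j C), ?_, ?_, ?_⟩
    · intro i' j'
      by_cases hi : i' = i
      · subst hi
        rw [Pi.single_eq_same]
        by_cases hj : j' = j
        · subst hj
          rw [Pi.single_eq_same]
          exact Submodule.subset_span hC
        · rw [Pi.single_eq_of_ne hj]; exact Submodule.zero_mem _
      · rw [Pi.single_eq_of_ne hi]; exact Submodule.zero_mem _
    · rw [Finset.sum_eq_single (i, j)]
      · simp only [Pi.single_eq_same]
        convert Submodule.zero_mem _ using 1
        exact sub_self _
      · intro p hp hne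
        have : p.1 ≠ i := fun h => hne (Prod.ext h (by
          have := Finset.HasAntidiagonal.mem_antidiagonal.1 hp; simp only; omega))
        rw [Pi.single_eq_of_ne this]; rfl
      · intro h; exact absurd ((Finset.HasAntidiagonal.mem_antidiagonal (a := (i, j))).2 rfl) h
    · rw [Finset.sum_eq_single (i, j)]
      · simp only [Pi.single_eq_same]
      · intro p hp hne
        have : p.1 ≠ i := fun h => hne (Prod.ext h (by
          have := Finset.HasAntidiagonal.mem_antidiagonal.1 hp; simp only; omega))
        rw [Pi.single_eq_of_ne this]
        funext K L
        exact add_zero _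
      · intro h; exact absurd ((Finset.HasAntidiagonal.mem_antidiagonal (a := (i, j))).2 rfl) h
  | add _ _ h h' =>
    obtain ⟨D, h1, h2, h3⟩ := h
    obtain ⟨D', h1', h2', h3'⟩ := h'
    refine ⟨D + D', fun i j => Submodule.add_mem _ (h1 i j) (h1' i j), ?_, ?_⟩
    · convert Submodule.add_mem _ h2 h2' using 1
      refine Eq.trans ?_ (add_sub_add_comm _ _ _ _)
      rw [← Finset.sum_add_distrib]; rfl
    · rw [h3, h3', ← Finset.sum_add_distrib]
      refine Finset.sum_congr rfl fun p _ => ?_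
      funext K L
      exact add_add_add_comm _ _ _ _
  | smul r _ h =>
    obtain ⟨D, h1, h2, h3⟩ := h
    refine ⟨r • D, fun i j => Submodule.smul_mem _ r (h1 i j), ?_, ?_⟩
    · convert Submodule.smul_mem _ r h2 using 1
      rw [smul_sub, Finset.smul_sum]; rfl
    · rw [h3, Finset.smul_sum]
      refine Finset.sum_congr rfl fun p _ => ?_
      funext K L
      exact smul_add r _ _

theorem eq_zero_of_sum_antidiagonal {n : ℕ} {c : ℕ × ℕ → ℝ}
    (h : ∀ r : ℝ, 0 < r → ∑ p ∈ Finset.HasAntidiagonal.antidiagonal n, r ^ p.1 * c p = 0) :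
    ∀ p ∈ Finset.HasAntidiagonal.antidiagonal n, c p = 0 := by
  intro p hp
  have h0 : ∑ p ∈ Finset.HasAntidiagonal.antidiagonal n, Polynomial.monomial p.1 (c p) = 0 := by
    refine Polynomial.eq_zero_of_infinite_isRoot _ ((Set.Ioi_infinite (0 : ℝ)).mono fun r hr => ?_)
    change Polynomial.eval r _ = 0
    rw [Polynomial.eval_finsetSum, ← h r hr]
    refine Finset.sum_congr rfl fun p _ => ?_
    rw [Polynomial.eval_monomial, mul_comm]
  have h1 := congrArg (fun q => Polynomial.coeff q p.1) h0
  simp only [Polynomial.finsetSum_coeff, Polynomial.coeff_monomial, Polynomial.coeff_zero] at h1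
  rwa [Finset.sum_eq_single p, if_pos rfl] at h1
  · intro q hq hne
    refine if_neg fun h => hne (Prod.ext h ?_)
    have h2 := Finset.HasAntidiagonal.mem_antidiagonal.1 hp
    have h3 := Finset.HasAntidiagonal.mem_antidiagonal.1 hq
    omega
  · intro h; exact absurd hp h

theorem nullV_mul (r a b : ℝ) : nullV (r * a) (r * b) = r ^ 2 • nullV a b := by
  ext i; fin_cases i <;> simp [nullV] <;> ring

/-- Separation of bidegrees in a vanishing symbol. -/
theorem monoSymbol_separate {n k : ℕ} {D : ∀ i j, CoefOp (i + j) k} {K L : Fin 4 → ℝ}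
    (h : ∀ r : ℝ, 0 < r → (∑ p ∈ Finset.HasAntidiagonal.antidiagonal n,
      monoSymbol (D p.1 p.2)) (r • K) L = 0) {i j : ℕ} (hij : i + j = n) :
    D i j base (tmulL (pw K i) (pw L j)) + D j i base (tmulL (pw L j) (pw K i)) = 0 := by
  ext A
  refine eq_zero_of_sum_antidiagonal (n := n) (c := fun p =>
    D p.1 p.2 base (tmulL (pw K p.1) (pw L p.2)) A +
      D p.2 p.1 base (tmulL (pw L p.2) (pw K p.1)) A) (fun r hr => ?_) (i, j)
      (Finset.HasAntidiagonal.mem_antidiagonal.2 hij)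
  -- Scaling K by r weights the term with i copies of K by rⁱ; the exchanged summands are reindexed
  -- so that each power of r collects both placements of K and L.
  have h1 := congrFun (h r hr) A
  simp only [mul_add, Finset.sum_add_distrib]
  rw [← Finset.Nat.sum_antidiagonal_swap (n := n) (f := fun p : ℕ × ℕ => r ^ p.1 *
    D p.2 p.1 base (tmulL (pw L p.2) (pw K p.1)) A), ← Finset.sum_add_distrib]
  refine Eq.trans ?_ h1
  simp only [Finset.sum_apply]
  refine Finset.sum_congr rfl fun p _ => ?_
  simp only [monoSymbol, pw_smul, tmulL_smul_left, LinearMap.map_smul]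
  rfl

theorem headL_three_eq_zero {k : ℕ} {T : Ten k} (ht : act (projM base) T = T) (d : ℕ)
    (e : k = d + 1) : headL 3 (permuteL (finCongr e) T) = 0 := by
  subst e
  ext A
  have h : T (Fin.cons 3 A) = 0 := by
    have := sum_coord_mul_cons ht A
    simpa [Fin.sum_univ_four, base] using this
  exact h

theorem mem_span_pw_of_isIso {x : Hyp} {O : Matrix (Fin 4) (Fin 4) ℝ} (hO : IsIso O x base) {k : ℕ}
    {S : Ten k} (hS : SymT S) (ht : act (projM x) S = S) (hl : lap (toPoly S) = 0) :
    act O S ∈ Submodule.span ℝ (Set.range fun p : ℝ × ℝ => pw (nullV p.1 p.2) k) := by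
  refine mem_span_pw_nullV (hS.act O) ?_ ?_
  · rcases k with _ | _ | k
    · exact lap_toPoly_zero _
    · exact lap_toPoly_one _
    · rw [lap_toPoly (hS.act O), contractL_act_isometry (isometry_entries.1 hO.iso),
        hS.contractL_eq_zero hl]
      simp
  · refine headL_three_eq_zero ?_
    rw [act_act, ← hO.mul_projM, ← act_act, ht]

theorem tmulL_add_right {k l : ℕ} (S : Ten k) (T T' : Ten l) :
    tmulL S (T + T') = tmulL S T + tmulL S T' := map_add _ _ _

/-- A rule whose symbol vanishes on pairs of null covectors has lower order. -/
theorem HasSymbol.mem_quadLt {n k : ℕ} {F : Rule k} {τ : Symbol k} (h : HasSymbol n k F τ)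
    (h0 : ∀ a b c d, τ (nullV a b) (nullV c d) = 0) : F ∈ quadLt n k := by
  obtain ⟨D, h1, h2, rfl⟩ := h.exists_rep
  have h3 : ∀ {i j : ℕ}, i + j = n → ∀ a b c d,
      D i j base (tmulL (pw (nullV a b) i) (pw (nullV c d) j)) +
      D j i base (tmulL (pw (nullV c d) j) (pw (nullV a b) i)) = 0 := fun hij a b c d =>
    monoSymbol_separate (fun r hr => by
      rw [← Real.sq_sqrt hr.le, ← nullV_mul]; exact h0 _ _ _ _) hij
  choose S hS hS' using exists_traceless
  -- Replacing the derivatives by their symmetric traceless parts changes each product at lower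
  -- order only.
  have h4 : ∀ p ∈ Finset.HasAntidiagonal.antidiagonal n, DeSitter.applyOp (D p.1 p.2) (prodR p.1 p.2) -
      DeSitter.applyOp (D p.1 p.2) (tmulR (S p.1) (S p.2)) ∈ quadLt n k := by
    rintro ⟨i, j⟩ hp
    have hij : i + j = n := Finset.HasAntidiagonal.mem_antidiagonal.1 hp
    rw [← map_sub]
    refine applyOp_mem_of_opSpan (h1 i j) ?_
    have k1 : tmulR (S i - iterR i) (S j) ∈ quadLt n (i + j) := by
      refine tmulR_mem_quadLt (a := i) (b := j + 1) (by omega) (hS i) ?_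
      rw [← sub_add_cancel (S j) (iterR j)]
      exact Submodule.add_mem _ (linLt_mono j.le_succ j (hS j)) (iterR_mem j.lt_succ_self)
    have k2 : tmulR (iterR i) (S j - iterR j) ∈ quadLt n (i + j) :=
      tmulR_mem_quadLt (a := i + 1) (b := j) (by omega) (iterR_mem i.lt_succ_self) (hS j)
    have k3 := Submodule.neg_mem _ (Submodule.add_mem _ k1 k2)
    convert k3 using 1
    funext σ x a
    change iterCov σ.1 i x _ * iterCov σ.1 j x _ - S i σ x _ * S j σ x _ =
      -((S i σ x _ - iterCov σ.1 i x _) * S j σ x _ +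
        iterCov σ.1 i x _ * (S j σ x _ - iterCov σ.1 j x _))
    ring
  have h5 : ∑ p ∈ Finset.HasAntidiagonal.antidiagonal n,
      DeSitter.applyOp (D p.1 p.2) (tmulR (S p.1) (S p.2)) = 0 := by
    -- The symbol controls only the sum of the (i, j) term and the exchanged (j, i) term; summing
    -- over all bidegrees counts each term twice.
    have h6 : ∑ p ∈ Finset.HasAntidiagonal.antidiagonal n,
        (DeSitter.applyOp (D p.1 p.2) (tmulR (S p.1) (S p.2)) +
          DeSitter.applyOp (D p.2 p.1) (tmulR (S p.2) (S p.1))) = 0 := by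
      refine Finset.sum_eq_zero ?_
      rintro ⟨i, j⟩ hp
      have hij : i + j = n := Finset.HasAntidiagonal.mem_antidiagonal.1 hp
      funext σ x
      obtain ⟨O, hO⟩ := exists_isIso_base x
      have k0 : ∀ m, act O (S m σ x) ∈ Submodule.span ℝ
          (Set.range fun p : ℝ × ℝ => pw (nullV p.1 p.2) m) := fun m =>
        mem_span_pw_of_isIso hO (hS' m σ x).1 (hS' m σ x).2.1 (hS' m σ x).2.2
      -- Bilinear extension of the vanishing on null powers to all symmetric traceless factors.
      have k1 : ∀ T ∈ Submodule.span ℝ (Set.range fun p : ℝ × ℝ => pw (nullV p.1 p.2) i),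
          ∀ T' ∈ Submodule.span ℝ (Set.range fun p : ℝ × ℝ => pw (nullV p.1 p.2) j),
          D i j base (tmulL T T') + D j i base (tmulL T' T) = 0 := by
        intro T hT T' hT'
        induction hT using Submodule.span_induction with
        | mem T hT =>
          obtain ⟨⟨a, b⟩, rfl⟩ := hT
          induction hT' using Submodule.span_induction with
          | mem T' hT' =>
            obtain ⟨⟨c, d⟩, rfl⟩ := hT'
            exact h3 hij a b c d
          | zero =>
            have : tmulL (0 : Ten j) (pw (nullV a b) i) = 0 := by
              have := tmulL_smul_left 0 (0 : Ten j) (pw (nullV a b) i)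
              simpa using this
            rw [this]; simp
          | add T T' _ _ h h' =>
            rw [tmulL_add_right, tmulL_add_left, map_add, map_add, add_add_add_comm, h, h', add_zero]
          | smul r T _ h =>
            rw [tmulL_smul_left, LinearMap.map_smul, LinearMap.map_smul, LinearMap.map_smul,
              ← smul_add, h, smul_zero]
        | zero =>
          have : tmulL (0 : Ten i) T' = 0 := by
            have := tmulL_smul_left 0 (0 : Ten i) T'
            simpa using this
          rw [this]; simp
        | add T T' _ _ h h' =>
          rw [tmulL_add_right, tmulL_add_left, map_add, map_add, add_add_add_comm, h, h', add_zero]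
        | smul r T _ h =>
          rw [tmulL_smul_left, LinearMap.map_smul, LinearMap.map_smul, LinearMap.map_smul,
            ← smul_add, h, smul_zero]
      have k2 := k1 _ (k0 i) _ (k0 j)
      rw [← act_tmulL, ← act_tmulL, ← hO.opSpan (h1 i j), ← hO.opSpan (h1 j i), ← map_add] at k2
      have k3 := congrArg (act (Matrix.diagonal eta * Oᵀ * Matrix.diagonal eta)) k2
      rw [hO.act_symm, map_zero] at k3
      exact k3
    have h8 := Finset.Nat.sum_antidiagonal_swap (n := n) (f := fun p : ℕ × ℕ =>
      DeSitter.applyOp (D p.1 p.2) (tmulR (S p.1) (S p.2)))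
    simp only [Prod.fst_swap, Prod.snd_swap] at h8
    rw [Finset.sum_add_distrib, h8, ← two_smul ℝ] at h6
    exact (smul_eq_zero.1 h6).resolve_left two_ne_zero
  have h7 := Submodule.add_mem _ h2 (Submodule.sum_mem _ h4)
  rwa [Finset.sum_sub_distrib, h5, sub_zero, sub_add_cancel] at h7

/-- A symbol is determined on null pairs by its value at one pair. -/
theorem HasSymbol.eq_zero_of_base {n k : ℕ} {F : Rule k} {τ : Symbol k} (h : HasSymbol n k F τ)
    (h0 : τ (nullV 1 0) (nullV 0 1) = 0) (a b c d : ℝ) : τ (nullV a b) (nullV c d) = 0 := by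
  -- After division by μ, the square root of the determinant, the two parameter vectors are the
  -- columns of an SL(2, ℝ) matrix applied to the standard basis; homogeneity restores the scale,
  -- since `nullV` is quadratic.
  have hpos : ∀ a b c d, 0 < a * d - c * b → τ (nullV a b) (nullV c d) = 0 := by
    intro a b c d hδ
    set μ := √(a * d - c * b) with hμ
    have hμ2 : μ ^ 2 = a * d - c * b := Real.sq_sqrt hδ.le
    have hμ0 : μ ≠ 0 := (Real.sqrt_pos.2 hδ).ne'
    have hO := isIso_spinM (p := a / μ) (q := c / μ) (r := b / μ) (s := d / μ) (by
      field_simp; linarith)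
    have h1 := h.equivariant hO (nullV 1 0) (nullV 0 1)
    rw [spinM_nullV, spinM_nullV, h0, map_zero] at h1
    have e1 : nullV a b = μ ^ 2 • nullV (a / μ * 1 + c / μ * 0) (b / μ * 1 + d / μ * 0) := by
      rw [← nullV_mul]; congr 1 <;> field_simp <;> ring
    have e2 : nullV c d = μ ^ 2 • nullV (a / μ * 0 + c / μ * 1) (b / μ * 0 + d / μ * 1) := by
      rw [← nullV_mul]; congr 1 <;> field_simp <;> ring
    rw [e1, e2, h.homogeneous, h1, smul_zero]
  -- The parametrization is even, so changing the sign of one parameter vector reverses the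
  -- determinant without changing the null covectors.
  have hne : ∀ a b c d, a * d - c * b ≠ 0 → τ (nullV a b) (nullV c d) = 0 := by
    intro a b c d hδ
    rcases lt_or_gt_of_ne hδ with h1 | h1
    · have h2 := hpos a b (-c) (-d) (by linarith)
      rwa [show nullV (-c) (-d) = nullV c d by simp [nullV]] at h2
    · exact hpos a b c d h1
  -- Linearly dependent parameter vectors are reached by continuity: the perturbed determinant is a
  -- monic quadratic polynomial in ε, so it vanishes for finitely many ε only.
  have hc : Continuous fun ε : ℝ => τ (nullV (a + ε) b) (nullV c (d + ε)) := by
    have hn : ∀ f g : ℝ → ℝ, Continuous f → Continuous g →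
        Continuous fun ε => nullV (f ε) (g ε) := by
      intro f g hf hg
      refine continuous_pi fun i => ?_
      fin_cases i <;> simp only [nullV] <;> simp <;> fun_prop
    exact h.continuous.comp ((hn (fun ε => a + ε) (fun _ => b) (by fun_prop) (by fun_prop)).prodMk
      (hn (fun _ => c) (fun ε => d + ε) (by fun_prop) (by fun_prop)))
  have hfin : {ε : ℝ | (a + ε) * (d + ε) - c * b = 0}.Finite := by
    have hp : (Polynomial.X + Polynomial.C a) * (Polynomial.X + Polynomial.C d) -
        Polynomial.C (c * b) ≠ 0 := by
      intro h
      have := congrArg (fun q => Polynomial.coeff q 2) h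
      simp [add_mul, mul_add, ← pow_two] at this
    refine (Polynomial.finite_setOfPred_isRoot hp).subset fun ε hε => ?_
    simp only [Set.mem_ofPred_eq, Polynomial.IsRoot, Polynomial.eval_sub, Polynomial.eval_mul,
      Polynomial.eval_add, Polynomial.eval_X, Polynomial.eval_C] at hε ⊢
    linarith
  have hd : Dense {ε : ℝ | (a + ε) * (d + ε) - c * b = 0}ᶜ := hfin.countable.dense_compl ℝ
  have h2 := Continuous.ext_on hd hc (continuous_const (y := (0 : Ten k))) fun ε hε =>
    hne _ _ _ _ hε
  have h3 := congrFun h2 0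
  simpa using h3

theorem HasSymbol.mem_quadLt_of_base {n k : ℕ} {F : Rule k} {τ : Symbol k} (h : HasSymbol n k F τ)
    (h0 : τ (nullV 1 0) (nullV 0 1) = 0) : F ∈ quadLt n k :=
  h.mem_quadLt (h.eq_zero_of_base h0)

/-! ### A family of test solutions -/

/-- `(1 + s²)^(-1/2)`. -/
def invRoot (s : ℝ) : ℝ := (√(1 + s ^ 2))⁻¹

theorem one_add_sq_pos (s : ℝ) : 0 < 1 + s ^ 2 := by positivity

theorem invRoot_sq (s : ℝ) : (1 + s ^ 2) * invRoot s ^ 2 = 1 := by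
  rw [invRoot, inv_pow, Real.sq_sqrt (one_add_sq_pos s).le, mul_inv_cancel₀ (one_add_sq_pos s).ne']

theorem invRoot_ne_zero (s : ℝ) : invRoot s ≠ 0 :=
  inv_ne_zero (Real.sqrt_pos.2 (one_add_sq_pos s)).ne'

theorem hasDerivAt_invRoot (s : ℝ) : HasDerivAt invRoot (-s * invRoot s ^ 3) s := by
  have h1 : HasDerivAt (fun s : ℝ => 1 + s ^ 2) (2 * s) s := by
    simpa using (hasDerivAt_pow 2 s).const_add 1
  have h2 := (h1.sqrt (one_add_sq_pos s).ne').inv (Real.sqrt_pos.2 (one_add_sq_pos s)).ne'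
  refine h2.congr_deriv ?_
  have h3 : √(1 + s ^ 2) ≠ 0 := (Real.sqrt_pos.2 (one_add_sq_pos s)).ne'
  simp only [invRoot]
  field_simp

theorem contDiff_invRoot : ContDiff ℝ ∞ invRoot := by
  unfold invRoot
  refine ContDiff.inv (ContDiff.sqrt (by fun_prop) fun s => (one_add_sq_pos s).ne') fun s =>
    (Real.sqrt_pos.2 (one_add_sq_pos s)).ne'

/-- The numerators of the derivatives of the profile. -/
def profPoly : ℕ → Polynomial ℝ
  | 0 => 1 + Polynomial.C 2 * Polynomial.X ^ 2
  | i + 1 => Polynomial.derivative (profPoly i) * (1 + Polynomial.X ^ 2) -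
      Polynomial.C (2 * i + 1 : ℝ) * (Polynomial.X * profPoly i)

/-- The profile `(1 + 2 s²) / √(1 + s²)` and its derivatives. -/
def prof (i : ℕ) (s : ℝ) : ℝ := (profPoly i).eval s * invRoot s ^ (2 * i + 1)

theorem hasDerivAt_prof (i : ℕ) (s : ℝ) : HasDerivAt (prof i) (prof (i + 1) s) s := by
  have h := ((profPoly i).hasDerivAt s).mul ((hasDerivAt_invRoot s).fun_pow (2 * i + 1))
  refine h.congr_deriv (Eq.symm ?_)
  have h2 := invRoot_sq s
  simp only [prof, profPoly, Polynomial.eval_sub, Polynomial.eval_mul, Polynomial.eval_add,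
    Polynomial.eval_pow, Polynomial.eval_X, Polynomial.eval_C, Polynomial.eval_one,
    Nat.add_sub_cancel]
  rw [show 2 * (i + 1) + 1 = 2 * i + 3 by ring]
  push_cast
  simp only [pow_succ, pow_zero, one_mul] at h2 ⊢
  linear_combination (Polynomial.eval s (Polynomial.derivative (profPoly i)) *
    invRoot s ^ (2 * i) * invRoot s) * h2

theorem deriv_prof (i : ℕ) : deriv (prof i) = prof (i + 1) :=
  funext fun s => (hasDerivAt_prof i s).deriv

theorem contDiff_prof (i : ℕ) : ContDiff ℝ ∞ (prof i) :=
  ContDiff.mul (by simpa [Polynomial.coe_aeval_eq_eval] using Polynomial.contDiff_aeval (𝕜 := ℝ) (profPoly i) ∞) (contDiff_invRoot.pow _)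

/-- This is the equation □σ + 3σ = 0 for a function of p·x with p unit timelike. Its other
elementary solution s has vanishing second derivative and would not detect higher orders. -/
theorem prof_ode (s : ℝ) : (1 + s ^ 2) * prof 2 s + 3 * s * prof 1 s - 3 * prof 0 s = 0 := by
  have h2 := invRoot_sq s
  simp [prof, profPoly]
  linear_combination (3 * invRoot s ^ 3 + 3 * (1 + 2 * s ^ 2) * invRoot s) * h2

/-- From i = 2 on, where the polynomial is the constant 3, the degree d stays below 2i + 1. The
recursion multiplies the leading coefficient by d − (2i + 1), which is therefore nonzero. -/
theorem profPoly_ne_zero : ∀ i, profPoly i ≠ 0 := by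
  have h : ∀ i, (profPoly (i + 2)).natDegree < 2 * (i + 2) + 1 ∧ profPoly (i + 2) ≠ 0 := by
    intro i
    induction i with
    | zero =>
      have : profPoly 2 = Polynomial.C 3 := by
        refine Polynomial.funext fun s => ?_
        simp [profPoly]
        ring
      rw [zero_add, this]
      simp
    | succ i ih =>
      obtain ⟨h1, h2⟩ := ih
      set Q := profPoly (i + 2) with hQ
      have hs : profPoly (i + 1 + 2) = Polynomial.derivative Q +
          Polynomial.X * (Polynomial.X * Polynomial.derivative Q) -
          Polynomial.C (2 * ((i + 2 : ℕ) : ℝ) + 1) * (Polynomial.X * Q) := by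
        change Polynomial.derivative Q * _ - _ = _
        ring
      constructor
      · rw [hs]
        have d0 := Polynomial.natDegree_derivative_le Q
        have d1 : (Polynomial.X * Polynomial.derivative Q).natDegree ≤ 1 + (Q.natDegree - 1) :=
          Polynomial.natDegree_mul_le.trans (by simp)
        have d2 : (Polynomial.X * (Polynomial.X * Polynomial.derivative Q)).natDegree ≤
            1 + (1 + (Q.natDegree - 1)) :=
          Polynomial.natDegree_mul_le.trans (by simpa using d1)
        have d3 : (Polynomial.C (2 * ((i + 2 : ℕ) : ℝ) + 1) * (Polynomial.X * Q)).natDegree ≤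
            1 + Q.natDegree :=
          (Polynomial.natDegree_C_mul_le _ _).trans
            (Polynomial.natDegree_mul_le.trans (by simp))
        have d4 := Polynomial.natDegree_sub_le (Polynomial.derivative Q +
          Polynomial.X * (Polynomial.X * Polynomial.derivative Q))
          (Polynomial.C (2 * ((i + 2 : ℕ) : ℝ) + 1) * (Polynomial.X * Q))
        have d5 := Polynomial.natDegree_add_le (Polynomial.derivative Q)
          (Polynomial.X * (Polynomial.X * Polynomial.derivative Q))
        omega
      · intro h0
        have h3 := congrArg (fun q => Polynomial.coeff q (Q.natDegree + 1)) (hs.symm.trans h0)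
        have h4 : (Polynomial.X * Polynomial.derivative Q).coeff Q.natDegree =
            Q.natDegree * Q.leadingCoeff := by
          rw [Polynomial.leadingCoeff]
          rcases Q.natDegree with _ | d
          · simp
          · rw [Polynomial.coeff_X_mul, Polynomial.coeff_derivative]
            push_cast; ring
        simp only [Polynomial.coeff_sub, Polynomial.coeff_add, Polynomial.coeff_X_mul, h4,
          Polynomial.coeff_C_mul, Polynomial.coeff_derivative, Polynomial.coeff_zero] at h3
        rw [Polynomial.coeff_eq_zero_of_natDegree_lt (by omega), Polynomial.coeff_natDegree] at h3
        have h5 : (Q.natDegree : ℝ) < 2 * ((i + 2 : ℕ) : ℝ) + 1 := by exact_mod_cast h1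
        have h6 : Q.leadingCoeff * (Q.natDegree - (2 * ((i + 2 : ℕ) : ℝ) + 1)) = 0 := by
          linear_combination h3
        rcases mul_eq_zero.1 h6 with h7 | h7
        · exact h2 (Polynomial.leadingCoeff_eq_zero.1 h7)
        · linarith
  intro i
  match i with
  | 0 =>
    intro h
    have := congrArg (Polynomial.eval 0) h
    simp [profPoly] at this
  | 1 =>
    intro h
    have := congrArg (Polynomial.eval 1) h
    simp [profPoly] at this
    norm_num at this
  | i + 2 => exact (h i).2

/-- The numerators have countably many roots altogether. -/
theorem exists_prof_ne_zero : ∃ s, ∀ i, prof i s ≠ 0 := by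
  have h : (⋃ i, {s | (profPoly i).IsRoot s}).Countable := Set.countable_iUnion fun i =>
    (Polynomial.finite_setOfPred_isRoot (profPoly_ne_zero i)).countable
  obtain ⟨s, hs⟩ := (h.dense_compl ℝ).nonempty
  refine ⟨s, fun i => mul_ne_zero (fun h0 => hs ?_) (pow_ne_zero _ (invRoot_ne_zero s))⟩
  exact Set.mem_iUnion.2 ⟨i, h0⟩

/-! ### Solutions depending on x through p·x -/

/-- The pairing of a covector with a point. -/
def pair (p : Fin 4 → ℝ) (x : Hyp) : ℝ := ∑ a, p a * x.1 a

theorem isSmooth_pair (p : Fin 4 → ℝ) : IsSmooth (pair p) :=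
  IsSmooth.sum _ fun a _ => (isSmooth_const _).mul (isSmooth_coord a)

/-- The tangential part of a covector. -/
def tang (p : Fin 4 → ℝ) (x : Hyp) (a : Fin 4) : ℝ := ∑ b, proj x a b * p b

theorem tang_eq (p : Fin 4 → ℝ) (x : Hyp) (a : Fin 4) :
    tang p x a = p a + (-1) * (pair p x * low x a) := by
  rw [tang, sum_proj_mul, pair]
  simp_rw [mul_comm (p _)]
  ring

theorem isSmooth_tang (p : Fin 4 → ℝ) (a : Fin 4) : IsSmooth (fun x => tang p x a) :=
  IsSmooth.sum _ fun b _ => (isSmooth_proj a b).mul (isSmooth_const _)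

theorem pd_pair (p : Fin 4 → ℝ) (c : Fin 4) (x : Hyp) : pd c (pair p) x = tang p x c := by
  change pd c (fun x => ∑ a, p a * x.1 a) x = _
  rw [pd_sum _ (f := fun a x => p a * x.1 a)
    (fun a _ => (isSmooth_const _).mul (isSmooth_coord a))]
  simp only [pd_const_mul (isSmooth_coord _), pd_coord, tang]
  exact Finset.sum_congr rfl fun b _ => mul_comm _ _

theorem pd_tang (p : Fin 4 → ℝ) (c a : Fin 4) (x : Hyp) : pd c (fun x => tang p x a) x =
    -(tang p x c * low x a + pair p x * metric x ![c, a]) := by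
  simp only [tang_eq p _ a]
  rw [pd_add (isSmooth_const _) ((isSmooth_const _).mul ((isSmooth_pair p).mul (isSmooth_low a))),
    pd_const, pd_const_mul ((isSmooth_pair p).mul (isSmooth_low a)),
    pd_mul (isSmooth_pair p) (isSmooth_low a), pd_pair, pd_low]
  ring

/-- The test functions. -/
def testFun (p : Fin 4 → ℝ) (x : Hyp) : ℝ := prof 0 (pair p x)

theorem isSmooth_prof_pair (i : ℕ) (p : Fin 4 → ℝ) : IsSmooth fun x => prof i (pair p x) :=
  (isSmooth_pair p).comp (contDiff_prof i)

theorem pd_prof_pair (i : ℕ) (p : Fin 4 → ℝ) (c : Fin 4) (x : Hyp) :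
    pd c (fun x => prof i (pair p x)) x = prof (i + 1) (pair p x) * tang p x c := by
  rw [pd_comp (isSmooth_pair p) (contDiff_prof i), deriv_prof, pd_pair]

theorem sum_proj_mul_tang (p : Fin 4 → ℝ) (x : Hyp) (a : Fin 4) :
    ∑ b, proj x a b * tang p x b = tang p x a := by
  rw [sum_proj_mul]
  have : ∑ b, x.1 b * tang p x b = 0 := by
    simp only [tang, Finset.mul_sum, ← mul_assoc]
    rw [Finset.sum_comm]
    simp only [← Finset.sum_mul, sum_coord_mul_proj, zero_mul, Finset.sum_const_zero]
  rw [this]; ring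

theorem act_zero_rank (O : Matrix (Fin 4) (Fin 4) ℝ) (T : Ten 0) : act O T = T := by
  ext a
  rw [act_apply, Fintype.sum_unique]
  simp only [Finset.univ_eq_empty, Finset.prod_empty, one_mul]
  exact congrArg T (Subsingleton.elim _ _)

theorem act_one_rank (O : Matrix (Fin 4) (Fin 4) ℝ) (T : Ten 1) (a : Fin 4) :
    act O T ![a] = ∑ b, O a b * T ![b] := by
  change act O T (Fin.cons a Fin.elim0) = _
  simp only [act_cons, act_zero_rank]
  refine Finset.sum_congr rfl fun b _ => ?_
  congr 2

theorem vec_one (a : Fin 1 → Fin 4) : a = ![a 0] := by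
  ext i; fin_cases i; rfl

theorem cov_scalar {f : Hyp → ℝ} (hf : IsSmooth f) (x : Hyp) (a : Fin 4) :
    iterCov f 1 x ![a] = pd a f x := by
  change cov (iterCov f 0) x (Fin.cons a Fin.elim0) = _
  rw [cov_cons (T := iterCov f 0) fun _ => hf, act_zero_rank]; rfl

theorem iterCov_one_testFun (p : Fin 4 → ℝ) (x : Hyp) (a) :
    iterCov (testFun p) 1 x a = prof 1 (pair p x) * tang p x (a 0) := by
  conv_lhs => rw [vec_one a]
  exact (cov_scalar (isSmooth_prof_pair 0 p) x (a 0)).trans (pd_prof_pair 0 p _ x)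

theorem iterCov_two_testFun (p : Fin 4 → ℝ) (x : Hyp) (c a : Fin 4) :
    iterCov (testFun p) 2 x ![c, a] = prof 2 (pair p x) * tang p x c * tang p x a -
      prof 1 (pair p x) * pair p x * metric x ![c, a] := by
  have hs : ∀ A, IsSmooth fun x => iterCov (testFun p) 1 x A :=
    (good_iterCov (isSmooth_prof_pair 0 p) 1).1
  change cov (iterCov (testFun p) 1) x (Fin.cons c ![a]) = _
  rw [cov_cons hs, act_one_rank]
  have h : ∀ b, pdT c (iterCov (testFun p) 1) x ![b] = prof 2 (pair p x) * tang p x c * tang p x b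
      - prof 1 (pair p x) * tang p x c * low x b
      - prof 1 (pair p x) * pair p x * metric x ![c, b] := by
    intro b
    change pd c (fun x => iterCov (testFun p) 1 x ![b]) x = _
    simp only [iterCov_one_testFun, Matrix.cons_val_zero]
    rw [pd_mul (isSmooth_prof_pair 1 p) (isSmooth_tang p b), pd_prof_pair, pd_tang]
    ring
  simp only [h, projM_apply, mul_sub, Finset.sum_sub_distrib]
  have e1 : ∀ (r : ℝ) (f : Fin 4 → ℝ), ∑ b, proj x a b * (r * f b) = r * ∑ b, proj x a b * f b := by
    intro r f
    rw [Finset.mul_sum]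
    exact Finset.sum_congr rfl fun b _ => by ring
  rw [e1, e1, e1, sum_proj_mul_tang, sum_proj_mul_low]
  have e2 : ∑ b, proj x a b * metric x ![c, b] = metric x ![c, a] := by
    rw [sum_proj_mul]
    have : ∑ b, x.1 b * metric x ![c, b] = 0 := by
      simp only [metric_symm x c, metric_cons, ← mul_assoc, ← Finset.sum_mul, sum_coord_mul_proj,
        zero_mul]
    rw [this]; ring
  rw [e2]; ring

theorem trace_metric (x : Hyp) : ∑ c, eta c * metric x ![c, c] = 3 := by
  have h := sum_low_mul x
  simp only [metric_cons, proj, if_true, Fin.sum_univ_four, low] at h ⊢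
  have e := eta_mul_eta
  linear_combination (e 0) * (1 - eta 0 * x.1 0 * x.1 0) + (e 1) * (1 - eta 1 * x.1 1 * x.1 1)
    + (e 2) * (1 - eta 2 * x.1 2 * x.1 2) + (e 3) * (1 - eta 3 * x.1 3 * x.1 3) - h

theorem sum_tang_sq {p : Fin 4 → ℝ} (hp : ∑ a, eta a * p a * p a = -1) (x : Hyp) :
    ∑ c, eta c * (tang p x c * tang p x c) = -(1 + pair p x ^ 2) := by
  have h := sum_low_mul x
  have h1 : ∀ c, eta c * (tang p x c * tang p x c) = eta c * p c * p c
      - 2 * pair p x * (p c * x.1 c) + pair p x ^ 2 * (low x c * x.1 c) := by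
    intro c
    rw [tang_eq, low]
    linear_combination (-2 * pair p x * p c * x.1 c + pair p x ^ 2 * eta c * x.1 c * x.1 c) *
      eta_mul_eta c
  simp only [h1, Finset.sum_add_distrib, Finset.sum_sub_distrib, ← Finset.mul_sum, h, hp]
  rw [show ∑ a, p a * x.1 a = pair p x from rfl]; ring

theorem box_eq (σ : Hyp → ℝ) (x : Hyp) : box σ x = ∑ c, eta c * iterCov σ 2 x ![c, c] := rfl

/-- The solution defined by a unit timelike covector. -/
def testSol (p : Fin 4 → ℝ) (hp : ∑ a, eta a * p a * p a = -1) : Sol :=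
  ⟨testFun p, isSmooth_prof_pair 0 p, fun x => by
    rw [box_eq]
    have h1 : ∀ c, eta c * iterCov (testFun p) 2 x ![c, c] =
        prof 2 (pair p x) * (eta c * (tang p x c * tang p x c)) -
        prof 1 (pair p x) * pair p x * (eta c * metric x ![c, c]) := by
      intro c
      rw [iterCov_two_testFun]; ring
    simp only [h1, Finset.sum_sub_distrib, ← Finset.mul_sum, trace_metric, sum_tang_sq hp]
    have := prof_ode (pair p x)
    rw [testFun]
    linarith⟩

open scoped ContDiff Matrix Topology

open Filter

/-! ### Asymptotics of the test solutions -/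

/-- Functions of a covector `p` and a point, polynomial in `p` of degree less than `r` for given
`pair p x`. -/
inductive DegLt : ℕ → ((Fin 4 → ℝ) → Hyp → ℝ) → Prop
  | zero (r : ℕ) : DegLt r (fun _ _ => 0)
  | base (r : ℕ) {φ : ℝ → ℝ} {y : Hyp → ℝ} (hφ : ContDiff ℝ ∞ φ) (hy : IsSmooth y) :
      DegLt (r + 1) (fun p x => φ (pair p x) * y x)
  | coord {r : ℕ} {f : (Fin 4 → ℝ) → Hyp → ℝ} (c : Fin 4) (hf : DegLt r f) :
      DegLt (r + 1) (fun p x => p c * f p x)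
  | add {r : ℕ} {f g : (Fin 4 → ℝ) → Hyp → ℝ} (hf : DegLt r f) (hg : DegLt r g) :
      DegLt r (fun p x => f p x + g p x)

theorem DegLt.sum {r : ℕ} {ι : Type*} (s : Finset ι) {f : ι → (Fin 4 → ℝ) → Hyp → ℝ}
    (h : ∀ i ∈ s, DegLt r (f i)) : DegLt r (fun p x => ∑ i ∈ s, f i p x) := by
  classical
  induction s using Finset.induction_on with
  | empty => simpa using DegLt.zero r
  | insert i s hi ih =>
    simp only [Finset.sum_insert hi]
    exact (h i (Finset.mem_insert_self i s)).add
      (ih fun j hj => h j (Finset.mem_insert_of_mem hj))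

theorem DegLt.smooth {r : ℕ} {f : (Fin 4 → ℝ) → Hyp → ℝ} (hf : DegLt r f) (p : Fin 4 → ℝ) :
    IsSmooth (f p) := by
  induction hf with
  | zero => exact isSmooth_const 0
  | base r hφ hy => exact ((isSmooth_pair p).comp hφ).mul hy
  | coord c _ ih => exact (isSmooth_const _).mul ih
  | add _ _ h h' => exact h.add h'

theorem DegLt.mul_smooth {r : ℕ} {f : (Fin 4 → ℝ) → Hyp → ℝ} (hf : DegLt r f) {z : Hyp → ℝ}
    (hz : IsSmooth z) : DegLt r (fun p x => z x * f p x) := by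
  induction hf with
  | zero r => simpa using DegLt.zero r
  | base r hφ hy =>
    convert DegLt.base r hφ (hz.mul hy) using 3
    ring
  | coord c _ ih =>
    convert ih.coord c using 3
    ring
  | add _ _ h h' =>
    convert h.add h' using 3
    ring

/-- Only differentiating a function of p·x creates a new factor of p, and it creates exactly one. -/
theorem DegLt.pd {r : ℕ} {f : (Fin 4 → ℝ) → Hyp → ℝ} (hf : DegLt r f) (c : Fin 4) :
    DegLt (r + 1) (fun p => DeSitter.pd c (f p)) := by
  induction hf with
  | zero r =>
    convert DegLt.zero (r + 1) using 3
    exact pd_const 0 c _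
  | @base r φ y hφ hy =>
    have hφ' : ContDiff ℝ ∞ (deriv φ) := by
      simpa using hφ.iterate_deriv 1
    have h1 : DegLt (r + 1 + 1) (fun p x => ∑ d, p d *
        (deriv φ (pair p x) * (proj x c d * y x))) :=
      DegLt.sum _ fun d _ => (DegLt.base r hφ' ((isSmooth_proj c d).mul hy)).coord d
    convert h1.add (DegLt.base (r + 1) hφ (hy.pd c)) using 3 with p x
    rw [pd_mul ((isSmooth_pair p).comp hφ) hy, pd_comp (isSmooth_pair p) hφ, pd_pair, tang,
      Finset.mul_sum, Finset.sum_mul]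
    congr 1
    exact Finset.sum_congr rfl fun d _ => by ring
  | coord d hf ih =>
    convert ih.coord d using 3 with p x
    exact pd_const_mul (hf.smooth p) _ c x
  | add hf hg h h' =>
    convert h.add h' using 3 with p x
    exact pd_add (hf.smooth p) (hg.smooth p) c x

/-- As p grows like N K with p·x fixed, a term of degree below r in p is negligible against N^r. -/
theorem DegLt.tendsto {r : ℕ} {f : (Fin 4 → ℝ) → Hyp → ℝ} (hf : DegLt r f) {x : Hyp}
    {p : ℕ → Fin 4 → ℝ} {s : ℝ} (hp : ∀ n, pair (p n) x = s) {K : Fin 4 → ℝ}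
    (hK : ∀ c, Tendsto (fun n : ℕ => ((n : ℝ) + 1)⁻¹ * p n c) atTop (𝓝 (K c))) :
    Tendsto (fun n : ℕ => ((n : ℝ) + 1)⁻¹ ^ r * f (p n) x) atTop (𝓝 0) := by
  have h0 : Tendsto (fun n : ℕ => ((n : ℝ) + 1)⁻¹) atTop (𝓝 0) := by
    simpa using tendsto_one_div_add_atTop_nhds_zero_nat (𝕜 := ℝ)
  induction hf with
  | zero r => simp
  | @base r φ y hφ hy =>
    simp only [hp]
    have := (h0.pow (r + 1)).mul_const (φ s * y x)
    simpa using this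
  | coord c _ ih =>
    have := (hK c).mul ih
    rw [mul_zero] at this
    refine this.congr fun n => ?_
    ring
  | add _ _ h h' =>
    have := h.add h'
    rw [add_zero] at this
    refine this.congr fun n => ?_
    ring

/-- The leading part of the derivatives of the test solutions. -/
def leadT (i : ℕ) (p : Fin 4 → ℝ) : Tensor i := fun x a => prof i (pair p x) * pw (tang p x) i a

theorem tang_eq_mulVec (p : Fin 4 → ℝ) (x : Hyp) : projM x *ᵥ p = tang p x := rfl

theorem isSmooth_pw_tang (p : Fin 4 → ℝ) (i : ℕ) (a) : IsSmooth fun x => pw (tang p x) i a :=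
  IsSmooth.prod _ fun t _ => isSmooth_tang p (a t)

theorem DegLt.monomial {r i : ℕ} {f : (Fin 4 → ℝ) → Hyp → ℝ} (hf : DegLt r f) (B : Fin i → Fin 4) :
    DegLt (r + i) (fun p x => (∏ t, p (B t)) * f p x) := by
  induction i with
  | zero => simpa using hf
  | succ i ih =>
    have h := (ih (Fin.tail B)).coord (B 0)
    have e : (fun p x => (∏ t, p (B t)) * f p x) =
        fun (p : Fin 4 → ℝ) x => p (B 0) * ((∏ t, p (Fin.tail B t)) * f p x) := by
      funext p x
      rw [Fin.prod_univ_succ, mul_assoc]; rfl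
    rw [e]
    exact h

/-- Differentiating the profile gives the next leading term. Differentiating the projectors in the
tangential parts leaves the degree in p unchanged. -/
theorem pd_leadT (i : ℕ) (c : Fin 4) (a : Fin i → Fin 4) :
    ∃ f, DegLt (i + 1) f ∧ ∀ p x, pd c (fun x => leadT i p x a) x =
      leadT (i + 1) p x (Fin.cons c a) + f p x := by
  have hY : ∀ B : Fin i → Fin 4, IsSmooth fun x => ∏ t, proj x (a t) (B t) := fun B =>
    IsSmooth.prod _ fun t _ => isSmooth_proj _ _
  have hw : ∀ p x, pw (tang p x) i a =
      ∑ B : Fin i → Fin 4, (∏ t, p (B t)) * ∏ t, proj x (a t) (B t) := by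
    intro p x
    rw [← tang_eq_mulVec, ← act_pw, act_apply]
    exact Finset.sum_congr rfl fun B _ => mul_comm _ _
  refine ⟨_, DegLt.sum Finset.univ fun B _ =>
    add_comm 1 i ▸ (DegLt.base 0 (contDiff_prof i) ((hY B).pd c)).monomial B, fun p x => ?_⟩
  have h1 : pd c (fun x => pw (tang p x) i a) x =
      ∑ B : Fin i → Fin 4, (∏ t, p (B t)) * pd c (fun x => ∏ t, proj x (a t) (B t)) x := by
    simp only [hw]
    rw [pd_sum _ (f := fun (B : Fin i → Fin 4) x => (∏ t, p (B t)) * ∏ t, proj x (a t) (B t))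
      fun B _ => (isSmooth_const _).mul (hY B)]
    exact Finset.sum_congr rfl fun B _ => pd_const_mul (hY B) _ c x
  simp only [leadT]
  rw [pd_mul (isSmooth_prof_pair i p) (isSmooth_pw_tang p i a), pd_prof_pair, h1, pw_succ,
    Finset.mul_sum]
  congr 1
  · simp [mul_assoc]
  · exact Finset.sum_congr rfl fun B _ => by ring

/-- The leading term has every derivative falling on the profile; all other terms contain fewer
factors of p. -/
theorem iterCov_testFun (i : ℕ) (a : Fin i → Fin 4) : ∃ f, DegLt i f ∧ ∀ p x,
    iterCov (testFun p) i x a = leadT i p x a + f p x := by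
  induction i with
  | zero => exact ⟨_, DegLt.zero 0, fun p x => by simp [leadT, pw, testFun, iterCov]⟩
  | succ i ih =>
    choose f hf hf' using ih
    choose g hg hg' using pd_leadT i (a 0)
    refine ⟨_, DegLt.sum Finset.univ fun B _ => ((hg B).add ((hf B).pd (a 0))).mul_smooth
      (IsSmooth.prod Finset.univ fun t _ => isSmooth_proj ((Fin.tail a) t) (B t)), fun p x => ?_⟩
    have hs : ∀ B, IsSmooth fun x => iterCov (testFun p) i x B :=
      (good_iterCov (isSmooth_prof_pair 0 p) i).1
    change cov (iterCov (testFun p) i) x a = _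
    rw [cov_apply hs, act_apply]
    have h1 : ∀ B, pdT (a 0) (iterCov (testFun p) i) x B =
        leadT (i + 1) p x (Fin.cons (a 0) B) + (g B p x + pd (a 0) (f B p) x) := by
      intro B
      change pd (a 0) (fun x => iterCov (testFun p) i x B) x = _
      simp only [hf' B]
      have hl : IsSmooth fun x => leadT i p x B :=
        (isSmooth_prof_pair i p).mul (isSmooth_pw_tang p i B)
      rw [pd_add hl ((hf B).smooth p), hg', add_assoc]
    simp only [h1, mul_add, Finset.sum_add_distrib]
    congr 1
    have h2 : act (projM x) (pw (tang p x) i) = pw (tang p x) i := by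
      rw [act_pw]
      congr 1
      ext b
      exact sum_proj_mul_tang p x b
    have h3 := congrFun h2 (Fin.tail a)
    rw [act_apply] at h3
    rw [leadT, pw_succ, ← h3, Finset.mul_sum, Finset.mul_sum]
    refine Finset.sum_congr rfl fun B _ => ?_
    rw [leadT, pw_succ]
    simp only [Fin.cons_zero, Fin.tail_cons, projM_apply]
    ring

/-- The limit of the rescaled derivatives of the test solutions. -/
theorem tendsto_iterCov_testFun (i : ℕ) {x : Hyp} {p : ℕ → Fin 4 → ℝ} {s : ℝ}
    (hp : ∀ n, pair (p n) x = s) {K : Fin 4 → ℝ}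
    (hK : ∀ c, Tendsto (fun n : ℕ => ((n : ℝ) + 1)⁻¹ * p n c) atTop (𝓝 (K c)))
    (hKx : projM x *ᵥ K = K) :
    Tendsto (fun n : ℕ => ((n : ℝ) + 1)⁻¹ ^ i • iterCov (testFun (p n)) i x) atTop
      (𝓝 (prof i s • pw K i)) := by
  refine tendsto_pi_nhds.2 fun a => ?_
  obtain ⟨f, hf, hf'⟩ := iterCov_testFun i a
  have h1 : ∀ b, Tendsto (fun n : ℕ => ((n : ℝ) + 1)⁻¹ * tang (p n) x b) atTop (𝓝 (K b)) := by
    intro b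
    have h2 : Tendsto (fun n : ℕ => ∑ d, proj x b d * (((n : ℝ) + 1)⁻¹ * p n d)) atTop
        (𝓝 (∑ d, proj x b d * K d)) := tendsto_finsetSum _ fun d _ => (hK d).const_mul _
    have h3 : ∑ d, proj x b d * K d = K b := congrFun hKx b
    rw [h3] at h2
    refine h2.congr fun n => ?_
    rw [tang, Finset.mul_sum]
    exact Finset.sum_congr rfl fun d _ => by ring
  have h2 : Tendsto (fun n : ℕ => ∏ t, (((n : ℝ) + 1)⁻¹ * tang (p n) x (a t))) atTop
      (𝓝 (∏ t, K (a t))) := tendsto_finsetProd _ fun t _ => h1 (a t)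
  have h3 := (h2.const_mul (prof i s)).add (hf.tendsto hp hK)
  rw [add_zero] at h3
  refine h3.congr fun n => ?_
  rw [Pi.smul_apply, smul_eq_mul, hf', leadT, hp, Finset.prod_mul_distrib, Finset.prod_const,
    Finset.card_univ, Fintype.card_fin, pw]
  ring

/-! ### Polarization and concentrating sequences -/

/-- Sums of solutions are solutions. -/
def Sol.add (σ υ : Sol) : Sol :=
  ⟨fun x => σ.1 x + υ.1 x, σ.2.1.add υ.2.1, fun x => by
    have h1 : ∀ i, iterCov (fun x => σ.1 x + υ.1 x) i = iterCov σ.1 i + iterCov υ.1 i := by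
      intro i
      induction i with
      | zero => rfl
      | succ i ih =>
        change cov _ = _
        rw [ih]
        exact cov_add (good_iterCov σ.2.1 i) (good_iterCov υ.2.1 i)
    have h2 := σ.2.2 x
    have h3 := υ.2.2 x
    rw [box_eq] at h2 h3 ⊢
    rw [h1]
    simp only [Pi.add_apply, mul_add, Finset.sum_add_distrib]
    linarith⟩

theorem iterR_add (σ υ : Sol) (i : ℕ) : iterR i (σ.add υ) = iterR i σ + iterR i υ := by
  induction i with
  | zero => rfl
  | succ i ih =>
    change cov (iterR i (σ.add υ)) = _
    rw [ih]
    exact cov_add (good_iterR i σ) (good_iterR i υ)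

/-- Polarization of a rule. -/
def pol {k : ℕ} (F : Rule k) (σ υ : Sol) : Tensor k := F (σ.add υ) - F σ - F υ

theorem pol_prodR (i j : ℕ) (σ υ : Sol) (x : Hyp) : pol (prodR i j) σ υ x =
    tmulL (iterR i σ x) (iterR j υ x) + tmulL (iterR i υ x) (iterR j σ x) := by
  funext a
  have h1 := iterR_add σ υ i
  have h2 := iterR_add σ υ j
  change iterR i (σ.add υ) x _ * iterR j (σ.add υ) x _ - iterR i σ x _ * iterR j σ x _ -
    iterR i υ x _ * iterR j υ x _ = iterR i σ x _ * iterR j υ x _ + iterR i υ x _ * iterR j σ x _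
  rw [h1, h2]
  simp only [Pi.add_apply]
  ring

theorem pol_applyOp {k l : ℕ} (C : CoefOp k l) (F : Rule k) (σ υ : Sol) (x : Hyp) :
    pol (applyOp C F) σ υ x = C x (pol F σ υ x) := by
  change C x _ - C x _ - C x _ = C x (_ - _ - _)
  rw [map_sub, map_sub]

theorem pol_add {k : ℕ} (F G : Rule k) (σ υ : Sol) : pol (F + G) σ υ = pol F σ υ + pol G σ υ := by
  simp only [pol, Pi.add_apply]; abel

theorem pol_smul {k : ℕ} (r : ℝ) (F : Rule k) (σ υ : Sol) : pol (r • F) σ υ = r • pol F σ υ := by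
  simp only [pol, Pi.smul_apply, smul_sub]

theorem pol_sum {k : ℕ} {ι : Type*} (s : Finset ι) (F : ι → Rule k) (σ υ : Sol) :
    pol (∑ i ∈ s, F i) σ υ = ∑ i ∈ s, pol (F i) σ υ := by
  simp only [pol, Finset.sum_apply, Finset.sum_sub_distrib]

/-- A pair of sequences of solutions that concentrate on the covectors `K` and `L`. -/
structure Concentrates (σ υ : ℕ → Sol) (K L : Fin 4 → ℝ) (s : ℝ) : Prop where
  left : ∀ i, Tendsto (fun n : ℕ => ((n : ℝ) + 1)⁻¹ ^ i • iterR i (σ n) base) atTop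
    (𝓝 (prof i s • pw K i))
  right : ∀ i, Tendsto (fun n : ℕ => ((n : ℝ) + 1)⁻¹ ^ i • iterR i (υ n) base) atTop
    (𝓝 (prof i s • pw L i))

theorem Concentrates.tendsto_prodR {σ υ : ℕ → Sol} {K L : Fin 4 → ℝ} {s : ℝ}
    (h : Concentrates σ υ K L s) {i j k : ℕ} (C : CoefOp (i + j) k) :
    Tendsto (fun n : ℕ => ((n : ℝ) + 1)⁻¹ ^ (i + j) • pol (applyOp C (prodR i j)) (σ n) (υ n) base)
      atTop (𝓝 ((prof i s * prof j s) • monoSymbol C K L)) := by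
  have ht : ∀ {f : ℕ → Ten i} {g : ℕ → Ten j} {S T}, Tendsto f atTop (𝓝 S) →
      Tendsto g atTop (𝓝 T) → Tendsto (fun n => tmulL (f n) (g n)) atTop (𝓝 (tmulL S T)) := by
    intro f g S T hf hg
    have hc : Continuous fun q : Ten i × Ten j => tmulL q.1 q.2 :=
      continuous_tmulL continuous_fst continuous_snd
    exact (hc.tendsto (S, T)).comp (hf.prodMk_nhds hg)
  have hC := (LinearMap.continuous_of_finiteDimensional (C base)).tendsto
    (tmulL (prof i s • pw K i) (prof j s • pw L j) + tmulL (prof i s • pw L i) (prof j s • pw K j))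
  have h1 := hC.comp ((ht (h.left i) (h.right j)).add (ht (h.right i) (h.left j)))
  convert h1 using 1
  · funext n
    rw [pol_applyOp, pol_prodR, ← (C base).map_smul]
    simp only [Function.comp_apply, tmulL_smul_left, LinearMap.map_smul, smul_smul, smul_add,
      pow_add, map_add, mul_comm (_ ^ j)]
  · simp only [tmulL_smul_left, LinearMap.map_smul, smul_smul, map_add, monoSymbol, smul_add,
      mul_comm (prof j s)]

theorem Concentrates.tendsto_quadLt {σ υ : ℕ → Sol} {K L : Fin 4 → ℝ} {s : ℝ}
    (h : Concentrates σ υ K L s) {m k : ℕ} {F : Rule k} (hF : F ∈ quadLt m k) :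
    Tendsto (fun n : ℕ => ((n : ℝ) + 1)⁻¹ ^ m • pol F (σ n) (υ n) base) atTop (𝓝 0) := by
  have h0 : Tendsto (fun n : ℕ => ((n : ℝ) + 1)⁻¹) atTop (𝓝 0) := by
    simpa using tendsto_one_div_add_atTop_nhds_zero_nat (𝕜 := ℝ)
  induction hF using Submodule.span_induction with
  | mem F hF =>
    obtain ⟨r, G, C, ⟨i, j, hij, hp⟩, hC, rfl⟩ := hF
    cases hp
    have h1 := (h0.pow (m - (i + j))).smul (h.tendsto_prodR C)
    rw [zero_pow (by omega), zero_smul] at h1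
    refine h1.congr fun n => ?_
    rw [smul_smul, ← pow_add, Nat.sub_add_cancel hij.le]
    rfl
  | zero =>
    refine (tendsto_const_nhds (x := 0)).congr fun n => ?_
    simp [pol]
  | add F G _ _ h h' =>
    have h1 := h.add h'
    rw [add_zero] at h1
    refine h1.congr fun n => ?_
    rw [pol_add, ← smul_add]; rfl
  | smul r F _ h =>
    have h1 := h.const_smul r
    rw [smul_zero] at h1
    refine h1.congr fun n => ?_
    rw [pol_smul, smul_comm]; rfl

/-- With N = n + 1 and b the lowered base point, p = s b + N K − (1 + s²)/(2 K·M) N⁻¹ M. The last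
term makes p unit timelike; p·x stays equal to s at the base point and p/N tends to K. -/
theorem exists_tendsto_testSol (s : ℝ) {K M : Fin 4 → ℝ} (hK3 : K 3 = 0) (hM3 : M 3 = 0)
    (hK : ∑ a, eta a * K a * K a = 0) (hM : ∑ a, eta a * M a * M a = 0)
    (hKM : ∑ a, eta a * K a * M a ≠ 0) :
    ∃ σ : ℕ → Sol, ∀ i, Tendsto (fun n : ℕ => ((n : ℝ) + 1)⁻¹ ^ i • iterR i (σ n) base) atTop
      (𝓝 (prof i s • pw K i)) := by
  set q := ∑ a, eta a * K a * M a with hq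
  set p : ℕ → Fin 4 → ℝ := fun n a => s * low base a + ((n : ℝ) + 1) * K a +
    (-(1 + s ^ 2) / (2 * q)) * ((n : ℝ) + 1)⁻¹ * M a with hp
  have hn : ∀ n : ℕ, (n : ℝ) + 1 ≠ 0 := fun n => Nat.cast_add_one_ne_zero n
  have h1 : ∀ n, ∑ a, eta a * p n a * p n a = -1 := by
    intro n
    have h2 : ∑ a, eta a * p n a * p n a = s ^ 2 + 2 * (((n : ℝ) + 1) * ((n : ℝ) + 1)⁻¹) *
        (-(1 + s ^ 2) / (2 * q)) * q + ((n : ℝ) + 1) ^ 2 * (∑ a, eta a * K a * K a) +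
        ((-(1 + s ^ 2) / (2 * q)) * ((n : ℝ) + 1)⁻¹) ^ 2 * ∑ a, eta a * M a * M a := by
      simp only [hp, low_base]
      generalize -(1 + s ^ 2) / (2 * q) = t
      rw [hq]
      simp [Fin.sum_univ_four, eta, hK3, hM3]
      ring
    rw [h2, hK, hM, mul_inv_cancel₀ (hn n)]
    field_simp
    ring
  refine ⟨fun n => testSol (p n) (h1 n), fun i => ?_⟩
  refine tendsto_iterCov_testFun i (x := base) (p := p) (s := s) (fun n => ?_) (fun c => ?_) ?_
  · simp only [pair, hp, low_base]
    simp [Fin.sum_univ_four, base, hK3, hM3]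
  · have h0 : Tendsto (fun n : ℕ => ((n : ℝ) + 1)⁻¹) atTop (𝓝 0) := by
      simpa using tendsto_one_div_add_atTop_nhds_zero_nat (𝕜 := ℝ)
    have h2 := ((h0.mul_const (s * low base c)).add (tendsto_const_nhds (x := K c))).add
      ((h0.pow 2).mul_const ((-(1 + s ^ 2) / (2 * q)) * M c))
    rw [zero_mul, zero_add, zero_pow two_ne_zero, zero_mul, add_zero] at h2
    refine h2.congr fun n => ?_
    have := hn n
    simp only [hp]
    field_simp
  · ext a
    change ∑ b, proj base a b * K b = K a
    rw [sum_proj_mul]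
    have : ∑ b, base.1 b * K b = 0 := by simp [Fin.sum_univ_four, base, hK3]
    rw [this]; ring

/-- Symbols are determined by the rule on pairs of null covectors. -/
theorem HasSymbol.eq_zero_of_mem {m k : ℕ} {F : Rule k} {τ : Symbol k} (h : HasSymbol m k F τ)
    (hF : F ∈ quadLt m k) : τ (nullV 1 0) (nullV 0 1) = 0 := by
  obtain ⟨D, -, h2, rfl⟩ := h.exists_rep
  obtain ⟨s, hs⟩ := exists_prof_ne_zero
  have hG : ∑ p ∈ Finset.HasAntidiagonal.antidiagonal m,
      DeSitter.applyOp (D p.1 p.2) (prodR p.1 p.2) ∈ quadLt m k := by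
    have := Submodule.sub_mem _ hF h2
    rwa [sub_sub_cancel] at this
  -- In the limit each bidegree is weighted by the two derivatives of the profile at s, so the limit
  -- is a symbol with modified coefficients.
  let E : ∀ i j, CoefOp (i + j) k := fun i j => (prof i s * prof j s) • D i j
  have key : ∀ r : ℝ, 0 < r → (∑ p ∈ Finset.HasAntidiagonal.antidiagonal m,
      monoSymbol (E p.1 p.2)) (r • nullV 1 0) (nullV 0 1)
        = 0 := by
    -- The rescaled polarized rule has two limits along the concentrating sequences: the weighted
    -- symbol, and zero because the rule has lower order.
    intro r hr
    obtain ⟨σ, hσ⟩ := exists_tendsto_testSol s (K := r • nullV 1 0) (M := nullV 0 1)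
      (by simp [nullV]) (by simp [nullV]) (by simp [Fin.sum_univ_four, nullV, eta])
      (by simp [Fin.sum_univ_four, nullV, eta]) (by
        simp [Fin.sum_univ_four, nullV, eta]; intro h; linarith)
    obtain ⟨υ, hυ⟩ := exists_tendsto_testSol s (K := nullV 0 1) (M := nullV 1 0)
      (by simp [nullV]) (by simp [nullV]) (by simp [Fin.sum_univ_four, nullV, eta])
      (by simp [Fin.sum_univ_four, nullV, eta]) (by
        simp [Fin.sum_univ_four, nullV, eta])
    have hc : Concentrates σ υ (r • nullV 1 0) (nullV 0 1) s := ⟨hσ, hυ⟩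
    have h3 : Tendsto (fun n : ℕ => ∑ p ∈ Finset.HasAntidiagonal.antidiagonal m,
        ((n : ℝ) + 1)⁻¹ ^ (p.1 + p.2) •
          pol (DeSitter.applyOp (D p.1 p.2) (prodR p.1 p.2)) (σ n) (υ n) base) atTop
        (𝓝 (∑ p ∈ Finset.HasAntidiagonal.antidiagonal m,
          (prof p.1 s * prof p.2 s) • monoSymbol (D p.1 p.2) (r • nullV 1 0) (nullV 0 1))) :=
      tendsto_finsetSum _ fun p _ => hc.tendsto_prodR _
    have h4 := hc.tendsto_quadLt hG
    have h5 := tendsto_nhds_unique (h3.congr fun n => ?_) h4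
    · rw [Finset.sum_apply, Finset.sum_apply, ← h5]
      refine Finset.sum_congr rfl fun p _ => ?_
      exact (smul_add (prof p.1 s * prof p.2 s) (D p.1 p.2 base _) (D p.1 p.2 base _)).symm
    · rw [pol_sum, Finset.sum_apply, Finset.smul_sum]
      refine Finset.sum_congr rfl fun p hp => ?_
      exact congrArg (fun e => ((n : ℝ) + 1)⁻¹ ^ e • _)
        (Finset.HasAntidiagonal.mem_antidiagonal.1 hp)
  have h6 : ∀ p ∈ Finset.HasAntidiagonal.antidiagonal m,
      D p.1 p.2 base (tmulL (pw (nullV 1 0) p.1) (pw (nullV 0 1) p.2)) +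
        D p.2 p.1 base (tmulL (pw (nullV 0 1) p.2) (pw (nullV 1 0) p.1)) = 0 := by
    intro p hp
    have h7 : (prof p.1 s * prof p.2 s) •
          D p.1 p.2 base (tmulL (pw (nullV 1 0) p.1) (pw (nullV 0 1) p.2)) +
        (prof p.2 s * prof p.1 s) •
          D p.2 p.1 base (tmulL (pw (nullV 0 1) p.2) (pw (nullV 1 0) p.1)) = 0 :=
      monoSymbol_separate (D := E) key (Finset.HasAntidiagonal.mem_antidiagonal.1 hp)
    -- Once the bidegrees are separated, the common nonzero weight of the two terms cancels.
    rw [mul_comm (prof p.2 s), ← smul_add] at h7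
    exact (smul_eq_zero.1 h7).resolve_left (mul_ne_zero (hs _) (hs _))
  have h8 := Finset.Nat.sum_antidiagonal_swap (n := m) (f := fun p : ℕ × ℕ =>
    D p.1 p.2 base (tmulL (pw (nullV 0 1) p.1) (pw (nullV 1 0) p.2)))
  simp only [Prod.fst_swap, Prod.snd_swap] at h8
  rw [Finset.sum_apply, Finset.sum_apply]
  simp only [monoSymbol]
  rw [Finset.sum_add_distrib, ← h8, ← Finset.sum_add_distrib]
  exact Finset.sum_eq_zero h6

/-! ### Symbols of divergence-free symmetric rules -/

theorem HasSymbol.sub {n k : ℕ} {F G : Rule k} {τ υ : Symbol k} (h : HasSymbol n k F τ)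
    (h' : HasSymbol n k G υ) : HasSymbol n k (F - G) (τ - υ) :=
  (h.add (h'.smul (-1))).congr (by rw [neg_one_smul, sub_eq_add_neg])
    (by rw [neg_one_smul, sub_eq_add_neg])

theorem isIso_diagonal {d : Fin 4 → ℝ} (hd : ∀ a, d a * d a = 1) (h1 : ∏ a, d a = 1)
    (h3 : d 3 = 1) : IsIso (Matrix.diagonal d) base base where
  iso := by
    rw [Matrix.diagonal_transpose, Matrix.diagonal_mul_diagonal, Matrix.diagonal_mul_diagonal]
    congr 1
    ext a
    rw [mul_right_comm, hd, one_mul]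
  det := by rw [Matrix.det_diagonal, h1]
  map := by
    rw [low_base]
    ext a
    rw [Matrix.mulVec_diagonal]
    fin_cases a <;> simp [h3]

theorem act_diagonal {k : ℕ} (d : Fin 4 → ℝ) (T : Ten k) (a) :
    act (Matrix.diagonal d) T a = (∏ i, d (a i)) * T a := by
  rw [act_apply, Finset.sum_eq_single a]
  · simp
  · intro b _ hb
    obtain ⟨i, hi⟩ := Function.ne_iff.1 hb
    rw [Finset.prod_eq_zero (Finset.mem_univ i), zero_mul]
    rw [Matrix.diagonal_apply_ne _ hi.symm]
  · intro h; exact absurd (Finset.mem_univ a) h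

/-- The restrictions on the symbol at the base pair. -/
structure SDSymbol (n : ℕ) (T : Ten 2) : Prop where
  zero_left : ∀ b, T ![0, b] = 0
  zero_right : ∀ b, T ![b, 0] = 0
  three_left : ∀ b, T ![3, b] = 0
  three_right : ∀ b, T ![b, 3] = 0
  symm : T ![2, 1] = T ![1, 2]
  even : Even n → T ![1, 2] = 0
  odd : Odd n → T ![1, 1] = 0 ∧ T ![2, 2] = 0

theorem SDSymbol.eq_zero {n : ℕ} {T : Ten 2} (h : SDSymbol n T) (h11 : T ![1, 1] = 0)
    (h12 : T ![1, 2] = 0) (h22 : T ![2, 2] = 0) : T = 0 := by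
  ext a
  rw [vec_two a]
  have h21 := h.symm.trans h12
  have z1 := h.zero_left
  have z2 := h.zero_right
  have z3 := h.three_left
  have z4 := h.three_right
  generalize a 0 = b
  generalize a 1 = c
  fin_cases b <;> fin_cases c <;> simp [h11, h12, h22, h21, z1, z2, z3, z4]

theorem projM_base_nullV (a b : ℝ) : projM base *ᵥ nullV a b = nullV a b := by
  ext c
  change ∑ d, proj base c d * nullV a b d = _
  rw [sum_proj_mul]
  simp [Fin.sum_univ_four, base, nullV]

theorem HasSymbol.sdSymbol {n : ℕ} {F : Rule 2} {τ : Symbol 2} (h : HasSymbol n 2 F τ)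
    (hF : IsSD F) : SDSymbol n (τ (nullV 1 0) (nullV 0 1)) := by
  have hs : ∀ a b, τ (nullV 1 0) (nullV 0 1) ![a, b] = τ (nullV 1 0) (nullV 0 1) ![b, a] := by
    have h1 := h.sub (h.applyOp (IsCoef.permuteL (Equiv.swap 0 1)))
    have h2 : F - DeSitter.applyOp (fun _ => permuteL (Equiv.swap 0 1)) F = 0 := by
      funext σ x a
      change F σ x a - F σ x (a ∘ _) = 0
      rw [vec_two a, vec_two (_ ∘ _), (hF σ).1]
      exact sub_self _
    rw [h2] at h1
    have h3 := h1.eq_zero_of_mem (Submodule.zero_mem _)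
    intro a b
    have h4 := congrFun h3 ![a, b]
    change τ _ _ ![a, b] - τ _ _ (![a, b] ∘ _) = 0 at h4
    rw [vec_two (_ ∘ _)] at h4
    exact sub_eq_zero.1 h4
  -- K + L = (2, 0, 0, 0), so the symbol of the divergence is −2 T₀ᵦ.
  have h0 : ∀ b, τ (nullV 1 0) (nullV 0 1) ![0, b] = 0 := by
    have h1 := h.cov.applyOp isCoef_contractL
    have h2 : DeSitter.applyOp (fun _ => contractL) (covR F) = 0 := by
      funext σ
      exact (hF σ).2
    rw [h2] at h1
    have h3 := h1.eq_zero_of_mem (Submodule.zero_mem _)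
    intro b
    have h4 := congrFun h3 ![b]
    rw [contractL_apply, Fin.sum_univ_four] at h4
    have e : ∀ c, nullV 1 0 c + nullV 0 1 c = ![2, 0, 0, 0] c := by
      intro c; fin_cases c <;> simp [nullV]; norm_num
    simp only [Fin.cons_zero, Fin.tail_cons, e, eta] at h4
    simpa using h4
  have ht := h.tangential (projM_base_nullV 1 0) (projM_base_nullV 0 1)
  have h3 : ∀ b, τ (nullV 1 0) (nullV 0 1) ![3, b] = 0 := by
    intro b
    have := sum_coord_mul_cons ht ![b]
    rw [Fin.sum_univ_four] at this
    simp [base] at this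
    exact this
  -- This isometry negates both K and L, so homogeneity equates its action on T with (−1)ⁿ.
  have hp := h.equivariant (isIso_diagonal (d := ![-1, -1, 1, 1])
    (by intro a; fin_cases a <;> simp) (by simp [Fin.prod_univ_four]) rfl) (nullV 1 0) (nullV 0 1)
  have e1 : Matrix.diagonal ![-1, -1, 1, 1] *ᵥ nullV 1 0 = (-1 : ℝ) • nullV 1 0 := by
    ext a; rw [Matrix.mulVec_diagonal]; fin_cases a <;> simp [nullV]
  have e2 : Matrix.diagonal ![-1, -1, 1, 1] *ᵥ nullV 0 1 = (-1 : ℝ) • nullV 0 1 := by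
    ext a; rw [Matrix.mulVec_diagonal]; fin_cases a <;> simp [nullV]
  rw [e1, e2, h.homogeneous] at hp
  have hp' : ∀ a b, (-1 : ℝ) ^ n * τ (nullV 1 0) (nullV 0 1) ![a, b] =
      (![-1, -1, 1, 1] a * ![-1, -1, 1, 1] b) * τ (nullV 1 0) (nullV 0 1) ![a, b] := by
    intro a b
    have := congrFun hp ![a, b]
    rw [act_diagonal, Fin.prod_univ_two] at this
    exact this
  refine ⟨h0, fun b => (hs b 0).trans (h0 b), h3, fun b => (hs b 3).trans (h3 b), hs 2 1, ?_, ?_⟩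
  · intro hn
    have := hp' 1 2
    rw [hn.neg_one_pow] at this
    simp at this
    linarith
  · intro hn
    have h1 := hp' 1 1
    have h2 := hp' 2 2
    rw [hn.neg_one_pow] at h1 h2
    simp at h1 h2
    constructor <;> linarith

theorem pw_zero (K : Fin 4 → ℝ) : pw K 0 = fun _ => 1 := by
  ext B; simp [pw]

theorem HasSymbol.eq_of_zero {k : ℕ} {F : Rule k} {τ : Symbol k} (h : HasSymbol 0 k F τ)
    (K L K' L' : Fin 4 → ℝ) : τ K L = τ K' L' := by
  induction h with
  | low h => rfl
  | @mono i j C h hC =>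
    obtain ⟨rfl, rfl⟩ : i = 0 ∧ j = 0 := by omega
    simp only [monoSymbol, pw_zero]
  | add _ _ h h' => exact congrArg₂ (· + ·) h h'
  | smul r _ h => exact congrArg (r • ·) h

theorem HasSymbol.eq_of_one {k : ℕ} {F : Rule k} {τ : Symbol k} (h : HasSymbol 1 k F τ)
    {K L K' L' : Fin 4 → ℝ} (hK : K + L = K' + L') : τ K L = τ K' L' := by
  have hK' : ∀ c, K c + L c = K' c + L' c := fun c => congrFun hK c
  induction h with
  | low h => rfl
  | @mono i j C h hC =>
    rcases Nat.eq_zero_or_pos i with hi | hi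
    · obtain ⟨rfl, rfl⟩ : i = 0 ∧ j = 1 := by omega
      simp only [monoSymbol, ← map_add]
      congr 1
      ext a
      simp only [Pi.add_apply, tmulL_apply, pw, Finset.univ_eq_empty, Finset.prod_empty, one_mul,
        Finset.univ_unique, Finset.prod_singleton]
      rw [add_comm, hK', add_comm]
    · obtain ⟨rfl, rfl⟩ : i = 1 ∧ j = 0 := by omega
      simp only [monoSymbol, ← map_add]
      congr 1
      ext a
      simp only [Pi.add_apply, tmulL_apply, pw, Finset.univ_eq_empty, Finset.prod_empty, mul_one,
        Finset.univ_unique, Finset.prod_singleton]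
      rw [hK']
  | add _ _ h h' => exact congrArg₂ (· + ·) h h'
  | smul r _ h => exact congrArg (r • ·) h

/-- There are no symmetric divergence-free rules of order at most one. -/
theorem eq_zero_of_isSD {F : Rule 2} (hF : F ∈ quadLt 2 2) (hSD : IsSD F) : F = 0 := by
  -- A quarter turn in the plane of the coordinates 1 and 2; it fixes K + L.
  have hrot := isIso_spinM (p := √2 / 2) (q := -(√2 / 2)) (r := √2 / 2) (s := √2 / 2) (by
    have : √2 * √2 = (2 : ℝ) := Real.mul_self_sqrt (by norm_num)
    linear_combination this / 2)
  have hrow : ∀ T : Ten 2, ∀ a b, act (spinM (√2 / 2) (-(√2 / 2)) (√2 / 2) (√2 / 2)) T ![a, b] =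
      ∑ c, !![1, 0, 0, 0; 0, 0, -1, 0; 0, 1, 0, 0; 0, 0, 0, (1 : ℝ)] a c *
      ∑ d, !![1, 0, 0, 0; 0, 0, -1, 0; 0, 1, 0, 0; 0, 0, 0, (1 : ℝ)] b d * T ![c, d] := by
    intro T a b
    have h2 : (√2 / 2) ^ 2 = (1 / 2 : ℝ) := by rw [div_pow, Real.sq_sqrt (by norm_num)]; norm_num
    have e : spinM (√2 / 2) (-(√2 / 2)) (√2 / 2) (√2 / 2) =
        !![1, 0, 0, 0; 0, 0, -1, 0; 0, 1, 0, 0; 0, 0, 0, (1 : ℝ)] := by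
      ext i j
      fin_cases i <;> fin_cases j <;> simp [spinM] <;>
        first | linear_combination 2 * h2 | linear_combination -2 * h2
    rw [act_two, e]
  -- At order one the symbol depends on K + L only and so is invariant under the quarter turn, which
  -- gives T₁₂ = −T₂₁; with symmetry both vanish.
  have h1 : F ∈ quadLt 1 2 := by
    obtain ⟨τ, hτ⟩ := exists_symbol hF
    refine hτ.mem_quadLt_of_base ?_
    have hs := hτ.sdSymbol hSD
    have he := hτ.equivariant hrot (nullV 1 0) (nullV 0 1)
    rw [spinM_nullV, spinM_nullV, hτ.eq_of_one (K' := nullV 1 0) (L' := nullV 0 1)] at he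
    · have h12 := congrFun he ![1, 2]
      rw [hrow] at h12
      simp [Fin.sum_univ_four] at h12
      have := hs.symm
      exact hs.eq_zero (hs.odd odd_one).1 (by linarith) (hs.odd odd_one).2
    · have h2 : (√2 / 2) ^ 2 = (1 / 2 : ℝ) := by
        rw [div_pow, Real.sq_sqrt (by norm_num)]; norm_num
      ext i
      fin_cases i <;> simp [nullV] <;>
        linear_combination 4 * h2
  -- At order zero the symbol is constant, hence invariant under boosts as well: a boost in the 0–1
  -- plane turns T₀ᵦ = 0 into T₁₁ = 0, and the quarter turn gives T₂₂ = T₁₁.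
  have h0 : F ∈ quadLt 0 2 := by
    obtain ⟨τ, hτ⟩ := exists_symbol h1
    refine hτ.mem_quadLt_of_base ?_
    have hs := hτ.sdSymbol hSD
    have he := hτ.equivariant hrot (nullV 1 0) (nullV 0 1)
    have hb := hτ.equivariant (isIso_spinM (p := 2) (q := 0) (r := 0) (s := 1 / 2) (by norm_num))
      (nullV 1 0) (nullV 0 1)
    rw [hτ.eq_of_zero _ _ (nullV 1 0) (nullV 0 1)] at he hb
    have z1 := hs.zero_left
    have z2 := hs.zero_right
    have h11 := congrFun he ![1, 1]
    have h00 := congrFun hb ![0, 0]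
    rw [hrow] at h11
    rw [act_two] at h00
    simp [Fin.sum_univ_four] at h11
    simp [Fin.sum_univ_four, spinM, z1, z2] at h00
    norm_num at h00
    exact hs.eq_zero h00 (hs.even Even.zero) (by rw [← h11, h00])
  rwa [quadLt_zero] at h0

/-- The symbol of the curl at the base pair. -/
def curlSymbol (T : Ten 2) : Ten 2 := fun a =>
  ∑ c, ∑ d, eta c * eta d * vol base ![a 0, c, d] * (![2, 0, 0, 0] c * T ![d, a 1])

/-- Components of the identity matrix. -/
def delta (a b : Fin 4) : ℝ := if a = b then 1 else 0

theorem vol_base (a b c : Fin 4) : vol base ![a, b, c] =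
    -(delta a 0 * (delta b 1 * delta c 2 - delta b 2 * delta c 1)
      - delta a 1 * (delta b 0 * delta c 2 - delta b 2 * delta c 0)
      + delta a 2 * (delta b 0 * delta c 1 - delta b 1 * delta c 0)) := by
  have h : vol base ![a, b, c] = Matrix.det !![(0 : ℝ), 0, 0, 1;
      delta a 0, delta a 1, delta a 2, delta a 3; delta b 0, delta b 1, delta b 2, delta b 3;
      delta c 0, delta c 1, delta c 2, delta c 3] := by
    rw [vol]
    congr 1
    ext i j
    refine Fin.cases ?_ (fun i => ?_) i
    · fin_cases j <;> rfl
    · change (Pi.single ((![a, b, c] : Fin 3 → Fin 4) i) (1 : ℝ) : Fin 4 → ℝ) j = _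
      rw [Pi.single_apply]
      fin_cases i <;> fin_cases j <;> simp [delta, eq_comm]
  rw [h]
  simp [Matrix.det_succ_row_zero, Fin.sum_univ_succ, Fin.succAbove]
  ring

/-- Since K + L is purely temporal, the curl acts on the rows 1 and 2 as twice a quarter turn. -/
theorem curlSymbol_one (T : Ten 2) (b : Fin 4) : curlSymbol T ![1, b] = -2 * T ![2, b] := by
  simp [curlSymbol, Fin.sum_univ_four, vol_base, eta, delta]

theorem curlSymbol_two (T : Ten 2) (b : Fin 4) : curlSymbol T ![2, b] = 2 * T ![1, b] := by
  simp [curlSymbol, Fin.sum_univ_four, vol_base, eta, delta]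

/-! ### The curl and the divergence -/

/-- The placement of indices in the curl. -/
def curlE : Fin (3 + 3) ≃ Fin (2 + 2 + 2) where
  toFun := ![4, 2, 0, 3, 1, 5]
  invFun := ![2, 4, 1, 3, 0, 5]
  left_inv := by decide
  right_inv := by decide

/-- The curl as an operation on the derivative. -/
def curlC : CoefOp 3 2 := fun x => contractL ∘ₗ contractL ∘ₗ permuteL curlE ∘ₗ tmulL (vol x)

theorem isCoef_curlC : IsCoef 3 2 curlC := ((IsCoef.id.vol.permute curlE).contract).contract

theorem curlC_apply (x : Hyp) (U : Ten 3) (a) : curlC x U a =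
    ∑ c, ∑ d, eta c * eta d * vol x ![a 0, c, d] * U ![c, d, a 1] := by
  rw [curlC, LinearMap.comp_apply, LinearMap.comp_apply, LinearMap.comp_apply, contractL_apply]
  simp only [contractL_apply, permuteL_apply, tmulL_apply, Finset.mul_sum]
  refine Finset.sum_congr rfl fun c _ => Finset.sum_congr rfl fun d _ => ?_
  rw [show (fun i => (Fin.cons d (Fin.cons d (Fin.cons c (Fin.cons c a))) ∘ curlE)
      (Fin.castAdd 3 i) : Fin 3 → Fin 4) = ![a 0, c, d] by ext i; fin_cases i <;> rfl,
    show (fun i => (Fin.cons d (Fin.cons d (Fin.cons c (Fin.cons c a))) ∘ curlE)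
      (Fin.natAdd 3 i) : Fin 3 → Fin 4) = ![c, d, a 1] by ext i; fin_cases i <;> rfl]
  ring

theorem curl_eq (T : Tensor 2) (x : Hyp) : curl T x = curlC x (cov T x) := by
  funext a
  rw [curlC_apply]; rfl

theorem curl_apply (T : Tensor 2) (x : Hyp) (a b : Fin 4) : curl T x ![a, b] =
    ∑ c, ∑ d, eta c * eta d * vol x ![a, c, d] * cov T x ![c, d, b] := rfl

theorem Good.curl {T : Tensor 2} (hT : Good T) : Good (curl T) := by
  rw [show DeSitter.curl T = fun x => curlC x (DeSitter.cov T x) from funext (curl_eq T)]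
  exact (good_apply isCoef_curlC hT.cov).1

theorem curl_add {S T : Tensor 2} (hS : Good S) (hT : Good T) : curl (S + T) = curl S + curl T := by
  funext x
  rw [Pi.add_apply, curl_eq, curl_eq, curl_eq, cov_add hS hT, Pi.add_apply, map_add]

theorem curl_smul (r : ℝ) {T : Tensor 2} (hT : Good T) : curl (r • T) = r • curl T := by
  funext x
  rw [Pi.smul_apply, curl_eq, curl_eq, cov_smul r hT, Pi.smul_apply, map_smul]

theorem div_apply (T : Tensor 2) (x : Hyp) (a) : div T x a = ∑ b, eta b * cov T x ![b, b, a 0] := by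
  change ∑ b, eta b * cov T x (Fin.cons b (Fin.cons b a)) = _
  refine Finset.sum_congr rfl fun b _ => ?_
  congr 2
  ext i
  fin_cases i <;> rfl

theorem div_add {S T : Tensor 2} (hS : Good S) (hT : Good T) : div (S + T) = div S + div T := by
  funext x
  change contractL (cov (S + T) x) = contractL (cov S x) + contractL (cov T x)
  rw [cov_add hS hT, Pi.add_apply, map_add]

theorem div_smul (r : ℝ) {T : Tensor 2} (hT : Good T) : div (r • T) = r • div T := by
  funext x
  change contractL (cov (r • T) x) = r • contractL (cov T x)
  rw [cov_smul r hT, Pi.smul_apply, map_smul]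

theorem trace_apply (T : Tensor 2) (x : Hyp) (a) : trace T x a = ∑ b, eta b * T x ![b, b] := by
  change ∑ b, eta b * T x (Fin.cons b (Fin.cons b a)) = _
  refine Finset.sum_congr rfl fun b _ => ?_
  congr 2
  ext i
  fin_cases i <;> rfl

theorem trace_add (S T : Tensor 2) : trace (S + T) = trace S + trace T := by
  funext x
  exact map_add contractL _ _

theorem trace_smul (r : ℝ) (T : Tensor 2) : trace (r • T) = r • trace T := by
  funext x
  exact contractL.map_smul r _

theorem vol_swap_left (x : Hyp) (a b c : Fin 4) : vol x ![a, b, c] = -vol x ![b, a, c] := by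
  have h := Matrix.det_permute (Equiv.swap (1 : Fin 4) 2) (Matrix.of (Fin.cons x.1
    (fun i => Pi.single ((![b, a, c] : Fin 3 → Fin 4) i) (1 : ℝ)) : Fin 4 → Fin 4 → ℝ))
  rw [Equiv.Perm.sign_swap (by decide)] at h
  simp only [Units.val_neg, Units.val_one, Int.cast_neg, Int.cast_one, neg_one_mul] at h
  refine Eq.trans ?_ h
  rw [vol]
  congr 1
  ext i j
  fin_cases i <;> rfl

theorem vol_swap_right (x : Hyp) (a b c : Fin 4) : vol x ![a, b, c] = -vol x ![a, c, b] := by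
  have h := Matrix.det_permute (Equiv.swap (2 : Fin 4) 3) (Matrix.of (Fin.cons x.1
    (fun i => Pi.single ((![a, c, b] : Fin 3 → Fin 4) i) (1 : ℝ)) : Fin 4 → Fin 4 → ℝ))
  rw [Equiv.Perm.sign_swap (by decide)] at h
  simp only [Units.val_neg, Units.val_one, Int.cast_neg, Int.cast_one, neg_one_mul] at h
  refine Eq.trans ?_ h
  rw [vol]
  congr 1
  ext i j
  fin_cases i <;> rfl

theorem vol_swap_outer (x : Hyp) (a b c : Fin 4) : vol x ![a, b, c] = -vol x ![c, b, a] := by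
  rw [vol_swap_left, vol_swap_right, vol_swap_left, neg_neg]

theorem sum_antisymm {f : Fin 4 → Fin 4 → ℝ} (h : ∀ a b, f a b = -f b a) :
    ∑ a, ∑ b, f a b = 0 := by
  have h1 : ∑ a, ∑ b, f a b = -∑ a, ∑ b, f a b := by
    conv_lhs => rw [Finset.sum_comm]
    rw [← Finset.sum_neg_distrib]
    refine Finset.sum_congr rfl fun a _ => ?_
    rw [← Finset.sum_neg_distrib]
    exact Finset.sum_congr rfl fun b _ => h b a
  linarith

theorem sum_antisymm_left {f : Fin 4 → Fin 4 → Fin 4 → ℝ} (h : ∀ a b c, f a b c = -f b a c) :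
    ∑ a, ∑ b, ∑ c, f a b c = 0 :=
  sum_antisymm fun a b => by
    rw [← Finset.sum_neg_distrib]
    exact Finset.sum_congr rfl fun c _ => h a b c

theorem sum_antisymm_right {f : Fin 4 → Fin 4 → Fin 4 → ℝ} (h : ∀ a b c, f a b c = -f a c b) :
    ∑ a, ∑ b, ∑ c, f a b c = 0 :=
  Finset.sum_eq_zero fun a _ => sum_antisymm (h a)

theorem sum_antisymm_outer {f : Fin 4 → Fin 4 → Fin 4 → ℝ} (h : ∀ a b c, f a b c = -f c b a) :
    ∑ a, ∑ b, ∑ c, f a b c = 0 := by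
  rw [Finset.sum_comm]
  exact Finset.sum_eq_zero fun b _ => sum_antisymm fun a c => h a b c

theorem cov_symm {T : Tensor 2} (hT : Good T) (hs : IsSymm T) (x : Hyp) (c a b : Fin 4) :
    cov T x ![c, a, b] = cov T x ![c, b, a] := by
  have h : permute (Equiv.swap 0 1) T = T := by
    funext x a
    rw [vec_two a]
    change T x (![a 0, a 1] ∘ Equiv.swap 0 1) = _
    rw [vec_two (_ ∘ _)]
    exact hs x _ _
  have h1 := congrFun (cov_permute (Equiv.swap 0 1) hT x) ![c, a, b]
  rw [h, liftC_apply, permuteL_apply] at h1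
  rw [h1]
  congr 1
  ext i
  fin_cases i <;> rfl

theorem cov_cov_two {T : Tensor 2} (hT : Good T) (x : Hyp) (c d a b : Fin 4) :
    cov (cov T) x ![c, d, a, b] = cov (cov T) x ![d, c, a, b] +
      (metric x ![c, a] * T x ![d, b] - metric x ![d, a] * T x ![c, b]) +
      (metric x ![c, b] * T x ![a, d] - metric x ![d, b] * T x ![a, c]) := by
  have h := cov_cov_comm hT x c d ![a, b]
  rw [Fin.sum_univ_two] at h
  have e0 : ∀ d, Function.update (![a, b] : Fin 2 → Fin 4) 0 d = ![d, b] := by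
    intro d; ext i; fin_cases i <;> rfl
  have e1 : ∀ d, Function.update (![a, b] : Fin 2 → Fin 4) 1 d = ![a, d] := by
    intro d; ext i; fin_cases i <;> rfl
  rw [e0, e0, e1, e1] at h
  exact h.trans (add_assoc _ _ _).symm

theorem cov_cov_one {T : Tensor 1} (hT : Good T) (x : Hyp) (c d a : Fin 4) :
    cov (cov T) x ![c, d, a] = cov (cov T) x ![d, c, a] +
      (metric x ![c, a] * T x ![d] - metric x ![d, a] * T x ![c]) := by
  have h := cov_cov_comm hT x c d ![a]
  rw [Fin.sum_univ_one] at h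
  have e0 : ∀ d, Function.update (![a] : Fin 1 → Fin 4) 0 d = ![d] := by
    intro d; ext i; fin_cases i; rfl
  rw [e0, e0] at h
  exact h

theorem hess_symm {f : Tensor 0} (hf : Good f) : IsSymm (cov (cov f)) := by
  intro x a b
  have h := cov_cov_comm hf x a b ![]
  rw [Finset.univ_eq_empty, Finset.sum_empty, add_zero] at h
  exact h

/-- The volume form antisymmetrizes the two derivatives, leaving half their commutator. Each
curvature term pairs the antisymmetric form with the metric or with T in two of its indices, and
both are symmetric. -/
theorem div_curl {T : Tensor 2} (hT : Good T) (hs : IsSymm T) : div (curl T) = 0 := by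
  funext x a
  rw [div_apply]
  generalize a 0 = a
  have h1 : ∀ b, cov (curl T) x ![b, b, a] = ∑ c, ∑ d, eta c * eta d * vol x ![b, c, d] *
      cov (cov T) x ![b, c, d, a] := by
    intro b
    rw [show curl T = fun x => curlC x (cov T x) from funext (curl_eq T),
      (good_apply isCoef_curlC hT.cov).2 x, liftC_apply, curlC_apply]
    rfl
  simp only [h1, Finset.mul_sum]
  set V := cov (cov T) x with hV
  have h2 : ∑ b, ∑ c, ∑ d, eta b * (eta c * eta d * vol x ![b, c, d] *
      (V ![b, c, d, a] + V ![c, b, d, a])) = 0 := by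
    refine sum_antisymm_left fun b c d => ?_
    rw [vol_swap_left x b c d]; ring
  have t1 : ∑ b, ∑ c, ∑ d, eta b * (eta c * eta d * vol x ![b, c, d] *
      (metric x ![b, d] * T x ![c, a])) = 0 := by
    refine sum_antisymm_outer fun b c d => ?_
    rw [vol_swap_outer x b c d, metric_symm x b d]; ring
  have t2 : ∑ b, ∑ c, ∑ d, eta b * (eta c * eta d * vol x ![b, c, d] *
      (metric x ![c, d] * T x ![b, a])) = 0 := by
    refine sum_antisymm_right fun b c d => ?_
    rw [vol_swap_right x b c d, metric_symm x c d]; ring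
  have t3 : ∑ b, ∑ c, ∑ d, eta b * (eta c * eta d * vol x ![b, c, d] *
      (metric x ![b, a] * T x ![d, c])) = 0 := by
    refine sum_antisymm_right fun b c d => ?_
    rw [vol_swap_right x b c d, hs x d c]; ring
  have t4 : ∑ b, ∑ c, ∑ d, eta b * (eta c * eta d * vol x ![b, c, d] *
      (metric x ![c, a] * T x ![d, b])) = 0 := by
    refine sum_antisymm_outer fun b c d => ?_
    rw [vol_swap_outer x b c d, hs x d b]; ring
  -- Symmetric part in the two derivatives plus half the commutator.
  have h3 : ∀ b c d, eta b * (eta c * eta d * vol x ![b, c, d] * V ![b, c, d, a]) =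
      1 / 2 * (eta b * (eta c * eta d * vol x ![b, c, d] * (V ![b, c, d, a] + V ![c, b, d, a]))) +
      1 / 2 * (eta b * (eta c * eta d * vol x ![b, c, d] * (metric x ![b, d] * T x ![c, a]))) -
      1 / 2 * (eta b * (eta c * eta d * vol x ![b, c, d] * (metric x ![c, d] * T x ![b, a]))) +
      1 / 2 * (eta b * (eta c * eta d * vol x ![b, c, d] * (metric x ![b, a] * T x ![d, c]))) -
      1 / 2 * (eta b * (eta c * eta d * vol x ![b, c, d] * (metric x ![c, a] * T x ![d, b]))) := by
    intro b c d
    have h := cov_cov_two hT x b c d a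
    rw [← hV] at h
    linear_combination (1 / 2 * eta b * eta c * eta d * vol x ![b, c, d]) * h
  have h4 : ∀ f : Fin 4 → Fin 4 → Fin 4 → ℝ, ∑ b, ∑ c, ∑ d, f b c d = 0 →
      ∑ b, ∑ c, ∑ d, 1 / 2 * f b c d = 0 := by
    intro f hf
    rw [← mul_zero (1 / 2 : ℝ), ← hf]
    simp only [Finset.mul_sum]
  simp only [h3, Finset.sum_add_distrib, Finset.sum_sub_distrib, h4 _ h2, h4 _ t1, h4 _ t2,
    h4 _ t3, h4 _ t4]
  simp

/-- The trace antisymmetrizes the two indices of T. -/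
theorem trace_curl {T : Tensor 2} (hT : Good T) (hs : IsSymm T) : trace (curl T) = 0 := by
  funext x a
  rw [trace_apply]
  simp only [curl_apply, Finset.mul_sum]
  refine sum_antisymm_outer fun b c d => ?_
  rw [vol_swap_outer x b c d, cov_symm hT hs x c d b]; ring

/-- Pointwise implications between invariant equations need only be checked at the base point. -/
theorem op_transport {m k k' l : ℕ} {A : CoefOp m k} {A' : CoefOp m k'} {B : CoefOp m l}
    (hA : A ∈ opSpan m k) (hA' : A' ∈ opSpan m k') (hB : B ∈ opSpan m l)
    (h : ∀ U : Ten m, act (projM base) U = U → A base U = 0 → A' base U = 0 → B base U = 0)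
    {x : Hyp} {U : Ten m} (hU : act (projM x) U = U) (hAU : A x U = 0) (hAU' : A' x U = 0) :
    B x U = 0 := by
  obtain ⟨O, hO⟩ := exists_isIso_base x
  have h1 := h (act O U) (by rw [act_act, ← hO.mul_projM, ← act_act, hU])
    (by rw [← hO.opSpan hA, hAU, map_zero]) (by rw [← hO.opSpan hA', hAU', map_zero])
  rw [← hO.opSpan hB] at h1
  rw [← hO.act_symm (B x U), h1, map_zero]

theorem curlC_base_symm {U : Ten 3} (hU : act (projM base) U = U)
    (hs : ∀ c a b, U ![c, a, b] = U ![c, b, a])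
    (hc : ∀ a, -U ![0, 0, a] + U ![1, 1, a] + U ![2, 2, a] + U ![3, 3, a] =
        -U ![a, 0, 0] + U ![a, 1, 1] + U ![a, 2, 2] + U ![a, 3, 3]) (a b : Fin 4) :
    curlC base U ![b, a] = curlC base U ![a, b] := by
  have h3 : ∀ a b, U ![3, a, b] = 0 := by
    intro a b
    have := sum_coord_mul_cons hU ![a, b]
    rw [Fin.sum_univ_four] at this
    simp [base] at this
    exact this
  have h4 : ∀ a b, U ![a, 3, b] = 0 := by
    intro a b
    have := sum_coord_mul_cons (x := base) (T := permuteL (Equiv.swap 0 1) U)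
      (by rw [act_permuteL, hU]) ![a, b]
    rw [Fin.sum_univ_four] at this
    simp [base, permuteL_apply] at this
    rw [← this]
  have F : ∀ a b, curlC base U ![a, b] = ∑ c, ∑ d, eta c * eta d * vol base ![a, c, d] *
      U ![c, d, b] := fun a b => curlC_apply base U ![a, b]
  obtain ⟨u, hu⟩ : ∃ u : Fin 4 → Fin 4 → Fin 4 → ℝ, ∀ a b c, U ![a, b, c] = u a b c :=
    ⟨_, fun _ _ _ => rfl⟩
  simp only [hu] at hs hc h3 h4 F
  have f0 : ∀ b, curlC base U ![0, b] = u 2 1 b - u 1 2 b := by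
    intro b
    rw [F]
    simp [Fin.sum_univ_four, vol_base, eta, delta]; ring
  have f1 : ∀ b, curlC base U ![1, b] = u 2 0 b - u 0 2 b := by
    intro b
    rw [F]
    simp [Fin.sum_univ_four, vol_base, eta, delta]; ring
  have f2 : ∀ b, curlC base U ![2, b] = u 0 1 b - u 1 0 b := by
    intro b
    rw [F]
    simp [Fin.sum_univ_four, vol_base, eta, delta]; ring
  have f3 : ∀ b, curlC base U ![3, b] = 0 := by
    intro b
    rw [F]
    simp [vol_base, delta]
  have h5 : ∀ a b, u a b 3 = 0 := fun a b => (hs _ _ _).trans (h4 _ _)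
  have k0 := hc 0
  have k1 := hc 1
  have k2 := hc 2
  simp only [h3, h4] at k0 k1 k2
  have g01 : curlC base U ![0, 1] = curlC base U ![1, 0] := by
    rw [f0, f1]; linarith [hs 0 0 2, hs 1 1 2, hs 2 0 0, hs 0 2 0, hs 1 2 1]
  have g02 : curlC base U ![0, 2] = curlC base U ![2, 0] := by
    rw [f0, f2]; linarith [hs 0 0 1, hs 2 1 2]
  have g12 : curlC base U ![1, 2] = curlC base U ![2, 1] := by
    rw [f1, f2]; linarith [hs 1 1 0, hs 2 2 0, hs 1 0 1, hs 2 0 2]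
  have g3 : ∀ a, curlC base U ![a, 3] = curlC base U ![3, a] := by
    intro a
    rw [f3]
    fin_cases a
    · exact (f0 3).trans (by rw [h5, h5, sub_zero])
    · exact (f1 3).trans (by rw [h5, h5, sub_zero])
    · exact (f2 3).trans (by rw [h5, h5, sub_zero])
    · exact f3 3
  fin_cases a <;> fin_cases b
  exacts [rfl, g01.symm, g02.symm, (g3 0).symm, g01, rfl, g12.symm, (g3 1).symm, g02, g12, rfl,
    (g3 2).symm, g3 0, g3 1, g3 2, rfl]

/-- The antisymmetric part of the curl is dual to the divergence minus the gradient of the trace.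
This is linear algebra in the derivative of T at one point, so `op_transport` reduces it to
components at the base point. -/
theorem curl_symm {T : Tensor 2} (hT : Good T) (hs : IsSymm T) (hd : div T = cov (trace T)) :
    IsSymm (curl T) := by
  intro x a b
  -- The hypotheses on the derivative are written as kernels of invariant operations: symmetry in
  -- the last two indices, and equality of divergence and gradient of the trace.
  have hA : (fun _ => permuteL (Equiv.swap 1 2) - LinearMap.id : CoefOp 3 3) ∈ opSpan 3 3 :=
    Submodule.sub_mem _ (Submodule.subset_span (IsCoef.permuteL _))
      (Submodule.subset_span IsCoef.id)
  have hA' : (fun _ => contractL - contractL ∘ₗ permuteL (Equiv.swap 0 2) : CoefOp 3 1) ∈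
      opSpan 3 1 := Submodule.sub_mem _ (Submodule.subset_span isCoef_contractL)
      (Submodule.subset_span ((IsCoef.permuteL _).comp isCoef_contractL))
  have hB : (fun x => permuteL (Equiv.swap 0 1) ∘ₗ curlC x - curlC x : CoefOp 3 2) ∈ opSpan 3 2 :=
    Submodule.sub_mem _ (Submodule.subset_span (isCoef_curlC.permute _))
      (Submodule.subset_span isCoef_curlC)
  have sw : ∀ (e : Equiv.Perm (Fin 3)) (a : Fin 3 → Fin 4), a ∘ e = ![a (e 0), a (e 1), a (e 2)] :=
    fun e a => by ext i; fin_cases i <;> rfl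
  have h := op_transport hA hA' hB (fun U hU h1 h2 => ?_) (hT.cov.2 x) ?_ ?_
  · have h3 := congrFun h ![b, a]
    change curlC x _ (![b, a] ∘ _) - curlC x _ ![b, a] = 0 at h3
    rw [vec_two (_ ∘ _)] at h3
    rw [curl_eq]
    exact sub_eq_zero.1 h3
  · have hs' : ∀ c a b, U ![c, a, b] = U ![c, b, a] := by
      intro c a b
      have := congrFun h1 ![c, b, a]
      change U (![c, b, a] ∘ Equiv.swap 1 2) - U ![c, b, a] = 0 at this
      rw [sw] at this
      exact sub_eq_zero.1 this
    have hc : ∀ a, -U ![0, 0, a] + U ![1, 1, a] + U ![2, 2, a] + U ![3, 3, a] =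
        -U ![a, 0, 0] + U ![a, 1, 1] + U ![a, 2, 2] + U ![a, 3, 3] := by
      intro a
      have h4 := congrFun h2 ![a]
      change ∑ b, eta b * U ![b, b, a] - ∑ b, eta b * U (![b, b, a] ∘ Equiv.swap 0 2) = 0 at h4
      simp only [sw, Fin.sum_univ_four, eta] at h4
      change _ - ((-1) * U ![a, 0, 0] + 1 * U ![a, 1, 1] + 1 * U ![a, 2, 2] +
        1 * U ![a, 3, 3]) = 0 at h4
      change ((-1) * U ![0, 0, a] + 1 * U ![1, 1, a] + 1 * U ![2, 2, a] +
        1 * U ![3, 3, a]) - _ = 0 at h4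
      linarith
    ext a
    rw [vec_two a]
    generalize a 0 = a0
    generalize a 1 = a1
    change curlC base U (![a0, a1] ∘ Equiv.swap 0 1) - curlC base U ![a0, a1] = 0
    rw [vec_two (_ ∘ _), sub_eq_zero]
    exact curlC_base_symm hU hs' hc a0 a1
  · ext a
    change cov T x (a ∘ Equiv.swap 1 2) - cov T x a = 0
    rw [sw, show a = ![a 0, a 1, a 2] by ext i; fin_cases i <;> rfl]
    exact sub_eq_zero.2 (cov_symm hT hs x _ _ _)
  · ext a
    have h1 := congrFun (congrFun hd x) a
    have h2 := congrFun (cov_contract (k := 0) hT x) a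
    change cov (trace T) x a = _ at h2
    rw [h2, liftC_apply] at h1
    change div T x a - ∑ b, eta b * cov T x (Fin.cons b (Fin.cons b a) ∘ Equiv.swap 0 2) = 0
    rw [h1, sub_eq_zero]
    change ∑ b, eta b * cov T x (Fin.cons (a 0) (Fin.cons b (Fin.cons b (Fin.tail a)))) = _
    refine Finset.sum_congr rfl fun b _ => ?_
    rw [sw]
    congr 2
    ext i; fin_cases i <;> rfl

/-! ### Divergence and curl of the basic tensors -/

/-- The multiple of the metric by a scalar. -/
def metricT (f : Tensor 0) : Tensor 2 := tmul metric f

theorem metricT_apply (f : Tensor 0) (x : Hyp) (a) : metricT f x a = metric x a * f x ![] := by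
  change metric x a * f x _ = _
  rw [Subsingleton.elim (fun j => a (Fin.natAdd 2 j)) ![]]

theorem Good.metricT {f : Tensor 0} (hf : Good f) : Good (metricT f) := good_metric.tmul hf

theorem metricT_symm (f : Tensor 0) : IsSymm (metricT f) := fun x a b => by
  rw [metricT_apply, metricT_apply, metric_symm]

theorem cov_metricT {f : Tensor 0} (hf : Good f) (x : Hyp) (c a b : Fin 4) :
    cov (metricT f) x ![c, a, b] = metric x ![a, b] * cov f x ![c] := by
  refine (cov_tmul good_metric hf x ![c, a, b]).trans ?_
  rw [cov_metric, Pi.zero_apply, Pi.zero_apply, zero_mul, zero_add]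
  congr 2
  ext i; fin_cases i <;> rfl

theorem sum_metric_mul {v : Tensor 1} (hv : Good v) (x : Hyp) (a : Fin 4) :
    ∑ b, eta b * (metric x ![b, a] * v x ![b]) = v x ![a] := by
  have h : ∀ b, eta b * (metric x ![b, a] * v x ![b]) = proj x a b * v x ![b] := by
    intro b
    rw [metric_symm, metric_cons]
    linear_combination proj x a b * v x ![b] * eta_mul_eta b
  simp only [h]
  rw [sum_proj_mul x a fun b => v x ![b],
    show ∑ b, x.1 b * v x ![b] = 0 from sum_coord_mul_cons (hv.2 x) ![], mul_zero, sub_zero]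

theorem div_metricT {f : Tensor 0} (hf : Good f) : div (metricT f) = cov f := by
  funext x a
  rw [div_apply, vec_one a]
  simp only [cov_metricT hf]
  exact sum_metric_mul hf.cov x (a 0)

theorem trace_metricT (f : Tensor 0) : trace (metricT f) = (3 : ℝ) • f := by
  funext x a
  rw [trace_apply, Subsingleton.elim a ![]]
  simp only [metricT_apply, ← mul_assoc, ← Finset.sum_mul, trace_metric]
  rfl

theorem sum_vol_mul_metric (x : Hyp) (a b c : Fin 4) :
    ∑ d, eta d * (vol x ![a, c, d] * metric x ![d, b]) = vol x ![a, c, b] := by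
  have h1 : ∀ d, eta d * (vol x ![a, c, d] * metric x ![d, b]) =
      proj x b d * permuteL (Equiv.swap 0 2) (vol x) ![d, c, a] := by
    intro d
    rw [metric_symm, metric_cons, permuteL_apply,
      show (![d, c, a] : Fin 3 → Fin 4) ∘ Equiv.swap 0 2 = ![a, c, d] by
        ext i; fin_cases i <;> rfl]
    linear_combination proj x b d * vol x ![a, c, d] * eta_mul_eta d
  simp only [h1]
  have h2 : act (projM x) (permuteL (Equiv.swap 0 2) (vol x)) =
      permuteL (Equiv.swap 0 2) (vol x) := by rw [act_permuteL, good_vol.2]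
  rw [sum_proj_mul x b fun d => permuteL (Equiv.swap 0 2) (vol x) ![d, c, a]]
  have h3 := sum_coord_mul_cons h2 ![c, a]
  rw [show ∑ d, x.1 d * permuteL (Equiv.swap 0 2) (vol x) ![d, c, a] = 0 from h3, mul_zero,
    sub_zero, permuteL_apply]
  congr 1
  ext i; fin_cases i <;> rfl

theorem curl_metricT {f : Tensor 0} (hf : Good f) (x : Hyp) (a b : Fin 4) :
    curl (metricT f) x ![a, b] = ∑ c, eta c * (vol x ![a, c, b] * cov f x ![c]) := by
  rw [curl_apply]
  refine Finset.sum_congr rfl fun c _ => ?_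
  rw [← sum_vol_mul_metric x a b c, Finset.sum_mul, Finset.mul_sum]
  refine Finset.sum_congr rfl fun d _ => ?_
  rw [cov_metricT hf]; ring

theorem symCurl_apply (T : Tensor 2) (x : Hyp) (a) :
    symCurl T x a = (curl T x ![a 0, a 1] + curl T x ![a 1, a 0]) / 2 := rfl

/-- The curl of a multiple of the metric is the volume form contracted with a gradient, hence
antisymmetric. -/
theorem symCurl_metricT {f : Tensor 0} (hf : Good f) : symCurl (metricT f) = 0 := by
  funext x a
  rw [symCurl_apply, curl_metricT hf, curl_metricT hf, ← Finset.sum_add_distrib]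
  rw [Finset.sum_eq_zero fun c _ => ?_]
  · exact zero_div _
  · rw [vol_swap_outer]; ring

theorem symCurl_add {S T : Tensor 2} (hS : Good S) (hT : Good T) :
    symCurl (S + T) = symCurl S + symCurl T := by
  funext x a
  simp only [symCurl_apply, curl_add hS hT, Pi.add_apply]; ring

theorem symCurl_smul (r : ℝ) {T : Tensor 2} (hT : Good T) : symCurl (r • T) = r • symCurl T := by
  funext x a
  simp only [symCurl_apply, curl_smul r hT, Pi.smul_apply, smul_eq_mul]; ring

/-- The commutator of two derivatives on the gradient is a curvature term, which for constant
curvature is the antisymmetrized derivative of −f h. -/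
theorem curl_hess {f : Tensor 0} (hf : Good f) : curl (cov (cov f)) = -curl (metricT f) := by
  funext x a
  rw [vec_two a, Pi.neg_apply, Pi.neg_apply, curl_apply, curl_apply, ← sub_eq_zero, sub_neg_eq_add,
    ← Finset.sum_add_distrib]
  simp only [← Finset.sum_add_distrib]
  refine sum_antisymm fun c d => ?_
  rw [vol_swap_right x (a 0) c d, cov_metricT hf, cov_metricT hf, cov_cov_one hf.cov x c d (a 1)]
  ring

theorem symCurl_hess {f : Tensor 0} (hf : Good f) : symCurl (cov (cov f)) = 0 := by
  have h := symCurl_metricT hf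
  funext x a
  have h1 := congrFun (congrFun h x) a
  rw [symCurl_apply] at h1 ⊢
  rw [curl_hess hf]
  simp only [Pi.neg_apply, Pi.zero_apply] at h1 ⊢
  linarith

theorem cov_trace {T : Tensor 2} (hT : Good T) (x : Hyp) (a) :
    cov (trace T) x a = ∑ b, eta b * cov T x ![a 0, b, b] := by
  refine (congrFun (cov_contract (k := 0) hT x) a).trans ?_
  change ∑ b, eta b * cov T x (Fin.cons (a 0) (Fin.cons b (Fin.cons b (Fin.tail a)))) = _
  refine Finset.sum_congr rfl fun b _ => ?_
  congr 2
  ext i; fin_cases i <;> rfl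

/-- The Ricci tensor is 2h, which produces the gradient term. This explains the term 2f in `hessT`.
-/
theorem div_hess {f : Tensor 0} (hf : Good f) :
    div (cov (cov f)) = cov (trace (cov (cov f))) + (2 : ℝ) • cov f := by
  funext x a
  rw [Pi.add_apply, Pi.add_apply, Pi.smul_apply, Pi.smul_apply, div_apply, cov_trace hf.cov.cov]
  have h : ∀ b, eta b * cov (cov (cov f)) x ![b, b, a 0] =
      eta b * cov (cov (cov f)) x ![a 0, b, b] + eta b * metric x ![b, b] * cov f x ![a 0] -
        eta b * (metric x ![b, a 0] * cov f x ![b]) := by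
    intro b
    rw [cov_symm hf.cov.cov (hess_symm hf), cov_cov_one hf.cov x b (a 0) b, metric_symm x (a 0) b]
    ring
  simp only [h, Finset.sum_sub_distrib, Finset.sum_add_distrib, ← Finset.sum_mul, trace_metric,
    sum_metric_mul hf.cov]
  rw [← vec_one a, smul_eq_mul]; ring

/-- The conserved tensor `D_a D_b f - h_{ab} (□ f + 2 f)`. -/
def hessT (f : Tensor 0) : Tensor 2 :=
  cov (cov f) + (-1 : ℝ) • metricT (trace (cov (cov f)) + (2 : ℝ) • f)

theorem Good.trace {T : Tensor 2} (hT : Good T) : Good (trace T) := Good.contract (k := 0) hT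

theorem hessT_symm {f : Tensor 0} (hf : Good f) : IsSymm (hessT f) := fun x a b => by
  simp only [hessT, Pi.add_apply, Pi.smul_apply, hess_symm hf x a b, metricT_symm _ x a b]

theorem div_hessT {f : Tensor 0} (hf : Good f) : div (hessT f) = 0 := by
  have h := hf.cov.cov.trace.add (hf.smul 2)
  rw [hessT, div_add hf.cov.cov (h.metricT.smul _), div_smul _ h.metricT, div_metricT h,
    div_hess hf, cov_add hf.cov.cov.trace (hf.smul 2), cov_smul 2 hf, neg_one_smul,
    add_neg_cancel]

theorem symCurl_hessT {f : Tensor 0} (hf : Good f) : symCurl (hessT f) = 0 := by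
  have h := hf.cov.cov.trace.add (hf.smul 2)
  rw [hessT, symCurl_add hf.cov.cov (h.metricT.smul _), symCurl_smul _ h.metricT,
    symCurl_metricT h, symCurl_hess hf, smul_zero, add_zero]

/-! ### Symbols of the basic rules -/

theorem HasSymbol.curl {n : ℕ} {F : Rule 2} {τ : Symbol 2} (h : HasSymbol n 2 F τ) :
    ∃ υ, HasSymbol (n + 1) 2 (fun σ => DeSitter.curl (F σ)) υ ∧
      υ (nullV 1 0) (nullV 0 1) = curlSymbol (τ (nullV 1 0) (nullV 0 1)) := by
  refine ⟨_, (h.cov.applyOp isCoef_curlC).congr ?_ rfl, ?_⟩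
  · funext σ x
    exact (curl_eq (F σ) x).symm
  · ext a
    refine (curlC_apply _ _ _).trans ?_
    refine Finset.sum_congr rfl fun c _ => Finset.sum_congr rfl fun d _ => ?_
    rw [show (Fin.tail ![c, d, a 1] : Fin 2 → Fin 4) = ![d, a 1] from rfl,
      show (![c, d, a 1] : Fin 3 → Fin 4) 0 = c from rfl,
      show nullV 1 0 c + nullV 0 1 c = ![2, 0, 0, 0] c by
        fin_cases c <;> simp [nullV]; norm_num]

theorem HasSymbol.metricT {n : ℕ} {F : Rule 0} {τ : Symbol 0} (h : HasSymbol n 0 F τ) :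
    ∃ υ, HasSymbol n 2 (fun σ => DeSitter.metricT (F σ)) υ ∧
      ∀ a, υ (nullV 1 0) (nullV 0 1) a =
        DeSitter.metric base a * τ (nullV 1 0) (nullV 0 1) ![] := by
  refine ⟨_, (h.applyOp IsCoef.id.metric).congr ?_ rfl, fun a => ?_⟩
  · rfl
  · change DeSitter.metric base _ * τ (nullV 1 0) (nullV 0 1) _ = _
    congr 2
    exact Subsingleton.elim _ _

theorem HasSymbol.trace {n : ℕ} {F : Rule 2} {τ : Symbol 2} (h : HasSymbol n 2 F τ) :
    ∃ υ, HasSymbol n 0 (fun σ => DeSitter.trace (F σ)) υ ∧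
      υ (nullV 1 0) (nullV 0 1) ![] =
        -τ (nullV 1 0) (nullV 0 1) ![0, 0] + τ (nullV 1 0) (nullV 0 1) ![1, 1] +
        τ (nullV 1 0) (nullV 0 1) ![2, 2] + τ (nullV 1 0) (nullV 0 1) ![3, 3] := by
  refine ⟨_, (h.applyOp (isCoef_contractL (k := 0))).congr rfl rfl, ?_⟩
  have h1 : ∀ T : Ten 2, contractL (k := 0) T ![] = -T ![0, 0] + T ![1, 1] + T ![2, 2] +
      T ![3, 3] := by
    intro T
    refine (show contractL (k := 0) T ![] = ∑ c, eta c * T ![c, c] from rfl).trans ?_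
    simp [Fin.sum_univ_four, eta]
  exact h1 _

theorem HasSymbol.hess {n : ℕ} {F : Rule 0} {τ : Symbol 0} (h : HasSymbol n 0 F τ) :
    ∃ υ, HasSymbol (n + 2) 2 (fun σ => DeSitter.cov (DeSitter.cov (F σ))) υ ∧
      ∀ a b, υ (nullV 1 0) (nullV 0 1) ![a, b] =
        ![2, 0, 0, 0] a * ![2, 0, 0, 0] b * τ (nullV 1 0) (nullV 0 1) ![] := by
  refine ⟨_, h.cov.cov, fun a b => ?_⟩
  have h1 : ∀ c, nullV 1 0 c + nullV 0 1 c = ![2, 0, 0, 0] c := by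
    intro c
    fin_cases c <;> simp [nullV]; norm_num
  rw [mul_assoc, ← h1, ← h1]
  rfl

/-- `σ²` and its iterated d'Alembertians. -/
def sqR : ℕ → Rule 0
  | 0 => prodR 0 0
  | m + 1 => fun σ => trace (cov (cov (sqR m σ)))

theorem good_sqR (m : ℕ) (σ : Sol) : Good (sqR m σ) := by
  induction m with
  | zero => exact good_prodR 0 0 σ
  | succ m ih => exact ih.cov.cov.trace

theorem exists_symbol_prodR (i j : ℕ) : ∃ τ, HasSymbol (i + j) (i + j) (prodR i j) τ ∧
    ∀ K L, τ K L = tmulL (pw K i) (pw L j) + tmulL (pw L i) (pw K j) :=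
  ⟨_, HasSymbol.mono rfl IsCoef.id, fun _ _ => rfl⟩

/-- σ² has symbol 2, and each d'Alembertian multiplies by the norm of K + L, which is −4. -/
theorem exists_symbol_sqR (m : ℕ) : ∃ τ, HasSymbol (2 * m) 0 (sqR m) τ ∧
    τ (nullV 1 0) (nullV 0 1) ![] = 2 * (-4) ^ m := by
  induction m with
  | zero =>
    obtain ⟨τ, h, h1⟩ := exists_symbol_prodR 0 0
    refine ⟨τ, h, ?_⟩
    have h2 := congrFun (h1 (nullV 1 0) (nullV 0 1)) ![]
    rw [h2, Pi.add_apply, tmulL_apply, tmulL_apply, pw_zero, pw_zero]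
    norm_num
  | succ m ih =>
    obtain ⟨τ, h, h1⟩ := ih
    obtain ⟨τ', h', h1'⟩ := h.hess
    obtain ⟨τ'', h'', h1''⟩ := h'.trace
    refine ⟨τ'', h'', ?_⟩
    rw [h1'', h1', h1', h1', h1', h1]
    simp
    ring

/-- The exceptional family: conserved tensors with vanishing symmetrized curl. -/
def zetaR (m : ℕ) : Rule 2 := fun σ => hessT (sqR m σ)

theorem isSD_zetaR (m : ℕ) : IsSD (zetaR m) := fun σ =>
  ⟨hessT_symm (good_sqR m σ), div_hessT (good_sqR m σ)⟩

theorem symCurl_zetaR (m : ℕ) (σ : Sol) : symCurl (zetaR m σ) = 0 := symCurl_hessT (good_sqR m σ)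

/-- The Hessian contributes only to the (0,0) component; the rest comes from −h times the next
d'Alembertian, so the two diagonal components agree. -/
theorem exists_symbol_zetaR (m : ℕ) : ∃ τ, HasSymbol (2 * m + 2) 2 (zetaR m) τ ∧
    τ (nullV 1 0) (nullV 0 1) ![1, 1] = 8 * (-4) ^ m ∧
    τ (nullV 1 0) (nullV 0 1) ![2, 2] = 8 * (-4) ^ m ∧
    τ (nullV 1 0) (nullV 0 1) ![1, 2] = 0 ∧ τ (nullV 1 0) (nullV 0 1) ![0, 0] = 0 := by
  obtain ⟨τ, h, h1⟩ := exists_symbol_sqR m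
  obtain ⟨τ₁, h₁, e₁⟩ := h.hess
  obtain ⟨τ₂, h₂, e₂⟩ := exists_symbol_sqR (m + 1)
  obtain ⟨τ₃, h₃, e₃⟩ := (h₂.add (.low (quadLt_mono (by omega) 0 (h.smul 2).mem))).metricT
  refine ⟨_, (h₁.add (h₃.smul (-1))).congr rfl rfl, ?_⟩
  simp only [Pi.add_apply, Pi.smul_apply, e₁, e₃, e₂, h1, Pi.zero_apply, add_zero, smul_eq_mul]
  simp [DeSitter.metric, base, eta]
  exact ⟨by ring, by ring⟩

theorem exists_symbol_grad : ∃ τ, HasSymbol 2 2 (prodR 1 1) τ ∧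
    ∀ K L a b, τ K L ![a, b] = K a * L b + L a * K b := by
  obtain ⟨τ, h, h1⟩ := exists_symbol_prodR 1 1
  refine ⟨τ, h, fun K L a b => (congrFun (h1 K L) _).trans ?_⟩
  change (∏ i : Fin 1, K _) * (∏ i : Fin 1, L _) + (∏ i : Fin 1, L _) * (∏ i : Fin 1, K _) = _
  simp only [Fin.prod_univ_one]
  rfl

theorem exists_symbol_hess : ∃ τ, HasSymbol 2 2 (prodR 2 0) τ ∧
    ∀ K L a b, τ K L ![a, b] = K a * K b + L a * L b := by
  obtain ⟨τ, h, h1⟩ := exists_symbol_prodR 2 0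
  refine ⟨τ, h, fun K L a b => (congrFun (h1 K L) _).trans ?_⟩
  change (∏ i : Fin 2, K _) * (∏ i : Fin 0, L _) + (∏ i : Fin 2, L _) * (∏ i : Fin 0, K _) = _
  simp only [Fin.prod_univ_two, Finset.univ_eq_empty, Finset.prod_empty, mul_one]
  rfl

/-- `σ_c σ^c` as a rule. -/
def gradR : Rule 0 := fun σ => trace (prodR 1 1 σ)

theorem good_gradR (σ : Sol) : Good (gradR σ) := Good.trace (good_prodR 1 1 σ)

theorem exists_symbol_gradR : ∃ τ, HasSymbol 2 0 gradR τ ∧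
    τ (nullV 1 0) (nullV 0 1) ![] = -4 := by
  obtain ⟨τ, h, h1⟩ := exists_symbol_grad
  obtain ⟨τ', h', h1'⟩ := h.trace
  refine ⟨τ', h', ?_⟩
  rw [h1', h1, h1, h1, h1]
  simp [nullV]
  norm_num

theorem gradSq_eq (σ : Sol) (x : Hyp) : gradSq σ.1 x = gradR σ x ![] := by
  rw [gradR, trace_apply]
  refine Finset.sum_congr rfl fun c _ => ?_
  change eta c * iterCov σ.1 1 x ![c] ^ 2 = eta c * (iterCov σ.1 1 x _ * iterCov σ.1 1 x _)
  rw [sq]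
  congr 3 <;> ext i <;> fin_cases i <;> rfl

theorem sq_eq (σ : Sol) (x : Hyp) : σ.1 x ^ 2 = prodR 0 0 σ x ![] := sq _

theorem grad_eq (σ : Sol) (x : Hyp) (a) : prodR 1 1 σ x a =
    iterCov σ.1 1 x ![a 0] * iterCov σ.1 1 x ![a 1] := by
  change iterCov σ.1 1 x _ * iterCov σ.1 1 x _ = _
  congr 2 <;> ext i <;> fin_cases i <;> rfl

theorem hess_eq (σ : Sol) (x : Hyp) (a) : prodR 2 0 σ x a = σ.1 x * iterCov σ.1 2 x a := by
  change iterCov σ.1 2 x _ * σ.1 x = _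
  rw [mul_comm]
  rfl

theorem potential_eq : potential = fun σ => metricT ((5 : ℝ) • prodR 0 0 σ + gradR σ) +
    (4 : ℝ) • (prodR 2 0 σ : Tensor 2) := by
  funext σ x a
  rw [Pi.add_apply, Pi.add_apply, metricT_apply, Pi.smul_apply, Pi.smul_apply, hess_eq,
    Pi.add_apply, Pi.add_apply, Pi.smul_apply, Pi.smul_apply, ← sq_eq, ← gradSq_eq, potential,
    smul_eq_mul, smul_eq_mul]
  ring

theorem kappa_eq : kappa = fun σ => (prodR 1 1 σ : Tensor 2) +
    metricT ((-(1 / 2) : ℝ) • gradR σ + (3 / 2 : ℝ) • prodR 0 0 σ) := by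
  funext σ x a
  rw [Pi.add_apply, Pi.add_apply, metricT_apply, grad_eq,
    Pi.add_apply, Pi.add_apply, Pi.smul_apply, Pi.smul_apply, Pi.smul_apply, Pi.smul_apply,
    ← sq_eq, ← gradSq_eq, kappa, smul_eq_mul, smul_eq_mul]

theorem exists_symbol_potential : ∃ τ, HasSymbol 2 2 potential τ ∧
    τ (nullV 1 0) (nullV 0 1) ![1, 1] = 4 ∧ τ (nullV 1 0) (nullV 0 1) ![2, 2] = -4 ∧
    τ (nullV 1 0) (nullV 0 1) ![1, 2] = 0 ∧ τ (nullV 1 0) (nullV 0 1) ![2, 1] = 0 := by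
  obtain ⟨τ₁, h₁, e₁⟩ := exists_symbol_prodR 0 0
  obtain ⟨τ₂, h₂, e₂⟩ := exists_symbol_gradR
  obtain ⟨τ₃, h₃, e₃⟩ := exists_symbol_hess
  obtain ⟨τ₄, h₄, e₄⟩ := (h₂.add (.low (quadLt_mono (by omega) 0 (h₁.smul 5).mem))).metricT
  refine ⟨_, (h₄.add (h₃.smul 4)).congr ?_ rfl, ?_⟩
  · rw [potential_eq]
    funext σ
    exact congrArg (fun f => metricT f + (4 : ℝ) • (prodR 2 0 σ : Tensor 2)) (add_comm _ _)
  · simp only [Pi.add_apply, Pi.smul_apply, e₄, e₃, e₂, Pi.zero_apply, add_zero, smul_eq_mul]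
    simp [DeSitter.metric, base, eta, nullV]
    norm_num

theorem exists_symbol_kappa : ∃ τ, HasSymbol 2 2 kappa τ ∧
    τ (nullV 1 0) (nullV 0 1) ![1, 1] = 0 ∧ τ (nullV 1 0) (nullV 0 1) ![2, 2] = 2 := by
  obtain ⟨τ₁, h₁, e₁⟩ := exists_symbol_prodR 0 0
  obtain ⟨τ₂, h₂, e₂⟩ := exists_symbol_gradR
  obtain ⟨τ₃, h₃, e₃⟩ := exists_symbol_grad
  obtain ⟨τ₄, h₄, e₄⟩ := ((h₂.smul (-(1 / 2))).add
    (.low (quadLt_mono (by omega) 0 (h₁.smul (3 / 2)).mem))).metricT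
  refine ⟨_, (h₃.add h₄).congr kappa_eq.symm rfl, ?_⟩
  simp only [Pi.add_apply, Pi.smul_apply, e₄, e₃, e₂, Pi.zero_apply, add_zero, smul_eq_mul]
  simp [DeSitter.metric, base, eta, nullV]
  norm_num

/-! ### The potential and the exceptional tensor -/

theorem trace_iterCov_two (σ : Sol) : trace (iterCov σ.1 2) = (-3 : ℝ) • iterCov σ.1 0 := by
  funext x a
  have h := σ.2.2 x
  rw [Subsingleton.elim a ![]]
  change box σ.1 x = -3 * σ.1 x
  linarith

theorem div_iterCov_two (σ : Sol) : div (iterCov σ.1 2) = (-1 : ℝ) • iterCov σ.1 1 := by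
  have h0 := good_iterCov σ.2.1 0
  refine (div_hess h0).trans ?_
  rw [show trace (cov (cov (iterCov σ.1 0))) = _ from trace_iterCov_two σ, cov_smul _ h0,
    ← add_smul]
  norm_num
  rfl

theorem cov_sq (σ : Sol) (x : Hyp) (a) :
    cov (prodR 0 0 σ) x a = 2 * σ.1 x * iterCov σ.1 1 x a := by
  refine (cov_tmul (good_iterR 0 σ) (good_iterR 0 σ) x a).trans ?_
  change iterCov σ.1 1 x _ * σ.1 x + σ.1 x * iterCov σ.1 1 x _ = _
  rw [show (Fin.cons (a 0) fun i : Fin 0 => a (Fin.castAdd 0 i).succ : Fin 1 → Fin 4) = a by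
      ext i; fin_cases i; rfl,
    show (Fin.cons (a 0) fun i : Fin 0 => a (Fin.natAdd 0 i).succ : Fin 1 → Fin 4) = a by
      ext i; fin_cases i; rfl]
  ring

theorem cov_grad (σ : Sol) (x : Hyp) (c a b : Fin 4) : cov (prodR 1 1 σ) x ![c, a, b] =
    iterCov σ.1 2 x ![c, a] * iterCov σ.1 1 x ![b] +
      iterCov σ.1 1 x ![a] * iterCov σ.1 2 x ![c, b] := by
  refine (cov_tmul (good_iterR 1 σ) (good_iterR 1 σ) x ![c, a, b]).trans ?_
  change iterCov σ.1 2 x _ * iterCov σ.1 1 x _ + iterCov σ.1 1 x _ * iterCov σ.1 2 x _ = _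
  congr 3 <;> (ext i; fin_cases i) <;> rfl

theorem cov_hess (σ : Sol) (x : Hyp) (c a b : Fin 4) : cov (prodR 2 0 σ) x ![c, a, b] =
    iterCov σ.1 3 x ![c, a, b] * σ.1 x + iterCov σ.1 2 x ![a, b] * iterCov σ.1 1 x ![c] := by
  refine (cov_tmul (good_iterR 2 σ) (good_iterR 0 σ) x ![c, a, b]).trans ?_
  change iterCov σ.1 3 x _ * σ.1 x + iterCov σ.1 2 x _ * iterCov σ.1 1 x _ = _
  congr 3 <;> ext i <;> fin_cases i <;> rfl

/-- `σ^b σ_{ab}`. -/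
def gradHess (σ : Sol) : Tensor 1 := fun x a =>
  ∑ b, eta b * (iterCov σ.1 1 x ![b] * iterCov σ.1 2 x ![a 0, b])

theorem iterCov_two_symm (σ : Sol) : IsSymm (iterCov σ.1 2) := hess_symm (good_iterCov σ.2.1 0)

theorem cov_gradR (σ : Sol) (x : Hyp) (a) : cov (gradR σ) x a = 2 * gradHess σ x a := by
  rw [gradR, cov_trace (good_prodR 1 1 σ), gradHess, Finset.mul_sum]
  refine Finset.sum_congr rfl fun b _ => ?_
  rw [cov_grad]; ring

theorem sum_box (σ : Sol) (x : Hyp) : ∑ b, eta b * iterCov σ.1 2 x ![b, b] = -3 * σ.1 x := by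
  rw [← box_eq]
  linarith [σ.2.2 x]

theorem div_grad (σ : Sol) (x : Hyp) (a) :
    div (prodR 1 1 σ) x a = -3 * σ.1 x * iterCov σ.1 1 x a + gradHess σ x a := by
  rw [div_apply, gradHess, ← sum_box, Finset.sum_mul, ← Finset.sum_add_distrib]
  refine Finset.sum_congr rfl fun b _ => ?_
  rw [cov_grad, iterCov_two_symm σ x b (a 0), ← vec_one a]; ring

theorem div_hessR (σ : Sol) (x : Hyp) (a) :
    div (prodR 2 0 σ) x a = -σ.1 x * iterCov σ.1 1 x a + gradHess σ x a := by
  have h := congrFun (congrFun (div_iterCov_two σ) x) a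
  rw [div_apply, Pi.smul_apply, Pi.smul_apply, smul_eq_mul] at h
  rw [div_apply, gradHess, show -σ.1 x * iterCov σ.1 1 x a = (-1 * iterCov σ.1 1 x a) * σ.1 x by
    ring, ← h, Finset.sum_mul, ← Finset.sum_add_distrib]
  refine Finset.sum_congr rfl fun b _ => ?_
  rw [cov_hess, iterCov_two_symm σ x b (a 0)]
  change eta b * (cov (iterCov σ.1 2) x _ * _ + _) = _
  ring

theorem trace_hessR (σ : Sol) : trace (prodR 2 0 σ) = (-3 : ℝ) • prodR 0 0 σ := by
  funext x a
  rw [trace_apply, Subsingleton.elim a ![], Pi.smul_apply, Pi.smul_apply, ← sq_eq, smul_eq_mul,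
    show (-3 : ℝ) * σ.1 x ^ 2 = -3 * σ.1 x * σ.1 x by ring, ← sum_box, Finset.sum_mul]
  refine Finset.sum_congr rfl fun b _ => ?_
  rw [hess_eq]; ring

theorem good_potential (σ : Sol) : Good (potential σ) := by
  rw [potential_eq]
  exact (((good_prodR 0 0 σ).smul 5).add (good_gradR σ)).metricT.add ((good_prodR 2 0 σ).smul 4)

theorem good_kappa (σ : Sol) : Good (kappa σ) := by
  rw [kappa_eq]
  exact (good_prodR 1 1 σ).add
    (((good_gradR σ).smul _).add ((good_prodR 0 0 σ).smul _)).metricT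

theorem potential_symm (σ : Sol) : IsSymm (potential σ) := fun x a b => by
  simp only [potential, metric_symm x a b, iterCov_two_symm σ x a b]

/-- Both sides equal 6σσ_a + 6σ^bσ_ab; with the Hessian coefficient normalized to 4, this forces the
coefficients 5 and 1 in M. -/
theorem div_potential (σ : Sol) : div (potential σ) = cov (trace (potential σ)) := by
  have h0 := (good_prodR 0 0 σ).smul 5
  have h1 := good_gradR σ
  have h2 := good_prodR 2 0 σ
  rw [potential_eq]
  dsimp only
  rw [trace_add, trace_metricT, trace_smul, trace_hessR, div_add (h0.add h1).metricT (h2.smul 4),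
    div_metricT (h0.add h1), div_smul 4 h2, cov_add ((h0.add h1).smul 3) (((good_prodR 0 0 σ).smul
    (-3)).smul 4), cov_smul 3 (h0.add h1), cov_smul 4 ((good_prodR 0 0 σ).smul (-3)),
    cov_smul (-3) (good_prodR 0 0 σ), cov_add h0 h1, cov_smul 5 (good_prodR 0 0 σ)]
  funext x a
  simp only [Pi.add_apply, Pi.smul_apply, smul_eq_mul, cov_sq, cov_gradR]
  rw [div_hessR]
  ring

theorem isSD_kappa : IsSD kappa := by
  refine fun σ => ⟨fun x a b => ?_, ?_⟩
  · simp only [kappa, metric_symm x a b]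
    change iterCov σ.1 1 x ![a] * iterCov σ.1 1 x ![b] + _ =
      iterCov σ.1 1 x ![b] * iterCov σ.1 1 x ![a] + _
    rw [mul_comm (iterCov σ.1 1 x ![a])]
  · have h0 := good_prodR 0 0 σ
    have h1 := good_gradR σ
    rw [kappa_eq]
    dsimp only
    rw [div_add (good_prodR 1 1 σ) ((h1.smul _).add (h0.smul _)).metricT,
      div_metricT ((h1.smul _).add (h0.smul _)), cov_add (h1.smul _) (h0.smul _), cov_smul _ h1,
      cov_smul _ h0]
    funext x a
    simp only [Pi.add_apply, Pi.smul_apply, smul_eq_mul, cov_sq, cov_gradR]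
    rw [div_grad, Pi.zero_apply, Pi.zero_apply]
    ring

theorem curl_potential_symm (σ : Sol) : IsSymm (curl (potential σ)) :=
  curl_symm (good_potential σ) (potential_symm σ) (div_potential σ)

theorem symCurl_of_symm {T : Tensor 2} (h : IsSymm (curl T)) : symCurl T = curl T := by
  funext x a
  rw [symCurl_apply, h x (a 1) (a 0), ← vec_two a]
  ring

/-- The Hessian of σ² contains both σ_aσ_b and σσ_ab, so it trades κ for M up to a multiple of the
metric; neither the Hessian nor that multiple has a symmetrized curl. -/
theorem four_kappa_add_potential (σ : Sol) : (4 : ℝ) • kappa σ + potential σ =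
    (2 : ℝ) • cov (cov (prodR 0 0 σ)) + metricT ((-1 : ℝ) • gradR σ + (11 : ℝ) • prodR 0 0 σ) := by
  funext x a
  have h : cov (cov (prodR 0 0 σ)) x a = 2 * (iterCov σ.1 1 x ![a 0] * iterCov σ.1 1 x ![a 1] +
      σ.1 x * iterCov σ.1 2 x a) := by
    have h1 : cov (prodR 0 0 σ) = (2 : ℝ) • (prodR 0 1 σ : Tensor 1) := by
      funext x a
      rw [cov_sq, vec_one a, mul_assoc]
      change _ = 2 * (σ.1 x * iterCov σ.1 1 x _)
      congr 3
      ext i; fin_cases i; rfl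
    rw [h1, cov_smul 2 (good_prodR 0 1 σ), Pi.smul_apply, Pi.smul_apply, smul_eq_mul, vec_two a]
    congr 1
    refine (cov_tmul (good_iterR 0 σ) (good_iterR 1 σ) x ![a 0, a 1]).trans ?_
    change iterCov σ.1 1 x _ * iterCov σ.1 1 x _ + σ.1 x * iterCov σ.1 2 x _ = _
    congr 3 <;> ext i <;> fin_cases i <;> rfl
  simp only [Pi.add_apply, Pi.smul_apply, smul_eq_mul, metricT_apply, h, ← sq_eq, ← gradSq_eq,
    potential, kappa]
  ring

theorem symCurl_kappa (σ : Sol) : symCurl (kappa σ) = (-(1 / 4) : ℝ) • curl (potential σ) := by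
  have h0 := good_prodR 0 0 σ
  have h1 := (good_gradR σ).smul (-1)
  have h := congrArg symCurl (four_kappa_add_potential σ)
  rw [symCurl_add ((good_kappa σ).smul 4) (good_potential σ), symCurl_smul 4 (good_kappa σ),
    symCurl_add (h0.cov.cov.smul 2) (h1.add (h0.smul 11)).metricT, symCurl_smul 2 h0.cov.cov,
    symCurl_hess h0, symCurl_metricT (h1.add (h0.smul 11)), smul_zero, add_zero,
    symCurl_of_symm (curl_potential_symm σ)] at h
  rw [eq_neg_of_add_eq_zero_right h]
  funext x a
  simp only [Pi.smul_apply, Pi.neg_apply, smul_eq_mul]; ring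

/-! ### The rules `X` -/

theorem X_three (σ : Sol) : X 3 σ = curl (potential σ) := rfl

theorem X_succ {n : ℕ} (hn : 3 ≤ n) (σ : Sol) : X (n + 1) σ = curl (X n σ) := by
  obtain ⟨k, rfl⟩ := Nat.exists_eq_add_of_le' hn
  rw [X, X, show k + 3 + 1 - 3 = (k + 3 - 3) + 1 by omega, Function.iterate_succ_apply']

theorem isSDT_curl {F : Rule 2} (hF : IsSDT F) (hg : ∀ σ, Good (F σ)) :
    IsSDT fun σ => curl (F σ) := by
  have h : ∀ σ, div (F σ) = cov (trace (F σ)) := fun σ => by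
    rw [(hF.1 σ).2, hF.2 σ, cov_zero]
  exact ⟨fun σ => ⟨curl_symm (hg σ) (hF.1 σ).1 (h σ), div_curl (hg σ) (hF.1 σ).1⟩,
    fun σ => trace_curl (hg σ) (hF.1 σ).1⟩

theorem good_X {n : ℕ} (hn : 3 ≤ n) (σ : Sol) : Good (X n σ) := by
  induction n, hn using Nat.le_induction with
  | base => exact (good_potential σ).curl
  | succ n hn ih => rw [X_succ hn]; exact ih.curl

theorem isSDT_X {n : ℕ} (hn : 3 ≤ n) : IsSDT (X n) := by
  induction n, hn using Nat.le_induction with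
  | base => exact ⟨fun σ => ⟨curl_potential_symm σ, div_curl (good_potential σ)
      (potential_symm σ)⟩, fun σ => trace_curl (good_potential σ) (potential_symm σ)⟩
  | succ n hn ih =>
    rw [show X (n + 1) = fun σ => curl (X n σ) from funext fun σ => X_succ hn σ]
    exact isSDT_curl ih (good_X hn)

/-- Each curl turns the off-diagonal component into a traceless diagonal pair, or back, with a
factor ±2, so the symbol never vanishes. -/
theorem exists_symbol_X {n : ℕ} (hn : 3 ≤ n) : ∃ τ, HasSymbol n 2 (X n) τ ∧ ∃ t : ℝ, t ≠ 0 ∧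
    (Odd n → τ (nullV 1 0) (nullV 0 1) ![1, 2] = t) ∧
    (Even n → τ (nullV 1 0) (nullV 0 1) ![1, 1] = -t ∧
      τ (nullV 1 0) (nullV 0 1) ![2, 2] = t) := by
  induction n, hn using Nat.le_induction with
  | base =>
    obtain ⟨τ, h, h11, h22, h12, h21⟩ := exists_symbol_potential
    obtain ⟨υ, h', e⟩ := h.curl
    refine ⟨υ, h', 8, by norm_num, fun _ => ?_, fun h => absurd h (by decide)⟩
    rw [e, curlSymbol_one, h22]
    norm_num
  | succ n hn ih =>
    obtain ⟨τ, h, t, ht, ho, he⟩ := ih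
    have hs := h.sdSymbol (isSDT_X hn).1
    obtain ⟨υ, h', e⟩ := h.curl
    rw [show (fun σ => curl (X n σ)) = X (n + 1) from funext fun σ => (X_succ hn σ).symm] at h'
    rcases Nat.even_or_odd n with hn' | hn'
    · refine ⟨υ, h', -2 * t, mul_ne_zero (by norm_num) ht, fun _ => ?_, fun h1 => ?_⟩
      · rw [e, curlSymbol_one, (he hn').2]
      · exact absurd h1 (by rw [Nat.not_even_iff_odd]; exact hn'.add_one)
    · refine ⟨υ, h', 2 * t, mul_ne_zero (by norm_num) ht, fun h1 => ?_, fun _ => ⟨?_, ?_⟩⟩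
      · exact absurd h1 (by rw [Nat.not_odd_iff_even]; exact hn'.add_one)
      · rw [e, curlSymbol_one, hs.symm, ho hn']; ring
      · rw [e, curlSymbol_two, ho hn']

theorem X_mem {n : ℕ} (hn : 3 ≤ n) : X n ∈ quadLt (n + 1) 2 := by
  obtain ⟨τ, h, -⟩ := exists_symbol_X hn
  exact h.mem

theorem smul_X_mem_iff {n : ℕ} (hn : 3 ≤ n) {c : ℝ} : c • X n ∈ quadLt n 2 ↔ c = 0 := by
  refine ⟨fun h => ?_, fun h => by rw [h, zero_smul]; exact Submodule.zero_mem _⟩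
  obtain ⟨τ, hτ, t, ht, ho, he⟩ := exists_symbol_X hn
  have h1 := (hτ.smul c).eq_zero_of_mem h
  rcases Nat.even_or_odd n with hn' | hn'
  · have h2 := congrFun h1 ![2, 2]
    simp only [Pi.smul_apply, (he hn').2, Pi.zero_apply, smul_eq_mul, mul_eq_zero, ht] at h2
    simpa using h2
  · have h2 := congrFun h1 ![1, 2]
    simp only [Pi.smul_apply, ho hn', Pi.zero_apply, smul_eq_mul, mul_eq_zero, ht] at h2
    simpa using h2

/-! ### Spaces of conserved rules -/

theorem isSymm_add {S T : Tensor 2} (hS : IsSymm S) (hT : IsSymm T) : IsSymm (S + T) :=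
  fun x a b => congrArg₂ (· + ·) (hS x a b) (hT x a b)

theorem isSymm_smul (r : ℝ) {T : Tensor 2} (hT : IsSymm T) : IsSymm (r • T) :=
  fun x a b => congrArg (r * ·) (hT x a b)

/-- Symmetric divergence-free rules of order less than `n`. -/
def sdLt (n : ℕ) : Submodule ℝ (Rule 2) where
  carrier := {F | F ∈ quadLt n 2 ∧ IsSD F}
  add_mem' := fun {F G} hF hG => ⟨Submodule.add_mem _ hF.1 hG.1, fun σ =>
    ⟨isSymm_add (hF.2 σ).1 (hG.2 σ).1, by
      rw [Pi.add_apply, div_add (good_quadLt hF.1 σ) (good_quadLt hG.1 σ), (hF.2 σ).2, (hG.2 σ).2,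
        add_zero]⟩⟩
  zero_mem' := ⟨Submodule.zero_mem _, fun σ => ⟨fun _ _ _ => rfl, by
    have h := div_smul 0 (good_quadLt (Submodule.zero_mem (quadLt n 2)) σ)
    rwa [zero_smul, zero_smul] at h⟩⟩
  smul_mem' := fun r F hF => ⟨Submodule.smul_mem _ r hF.1, fun σ =>
    ⟨isSymm_smul r (hF.2 σ).1, by
      rw [Pi.smul_apply, div_smul r (good_quadLt hF.1 σ), (hF.2 σ).2, smul_zero]⟩⟩

theorem sdLt_mono {m n : ℕ} (h : m ≤ n) : sdLt m ≤ sdLt n :=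
  fun _ hF => ⟨quadLt_mono h 2 hF.1, hF.2⟩

/-- Traceless rules among these. -/
def sdtLt (n : ℕ) : Submodule ℝ (Rule 2) where
  carrier := {F | F ∈ sdLt n ∧ ∀ σ, trace (F σ) = 0}
  add_mem' := fun {F G} hF hG => ⟨Submodule.add_mem _ hF.1 hG.1, fun σ => by
    rw [Pi.add_apply, trace_add, hF.2, hG.2, add_zero]⟩
  zero_mem' := ⟨Submodule.zero_mem _, fun σ => by
    have h := trace_smul 0 (0 : Tensor 2)
    rwa [zero_smul, zero_smul] at h⟩
  smul_mem' := fun r F hF => ⟨Submodule.smul_mem _ r hF.1, fun σ => by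
    rw [Pi.smul_apply, trace_smul, hF.2, smul_zero]⟩

theorem mem_sdtLt {n : ℕ} {F : Rule 2} : F ∈ sdtLt n ↔ F ∈ quadLt n 2 ∧ IsSDT F := and_assoc

theorem sdtLt_mono {m n : ℕ} (h : m ≤ n) : sdtLt m ≤ sdtLt n :=
  fun _ hF => ⟨sdLt_mono h hF.1, hF.2⟩

/-- Rules with vanishing symmetrized curl among these. -/
def sdcLt (n : ℕ) : Submodule ℝ (Rule 2) where
  carrier := {F | F ∈ sdLt n ∧ ∀ σ, symCurl (F σ) = 0}
  add_mem' := fun {F G} hF hG => ⟨Submodule.add_mem _ hF.1 hG.1, fun σ => by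
    rw [Pi.add_apply, symCurl_add (good_quadLt hF.1.1 σ) (good_quadLt hG.1.1 σ), hF.2, hG.2,
      add_zero]⟩
  zero_mem' := ⟨Submodule.zero_mem _, fun σ => by
    have h := symCurl_smul 0 (good_quadLt (Submodule.zero_mem (quadLt n 2)) σ)
    rwa [zero_smul, zero_smul] at h⟩
  smul_mem' := fun r F hF => ⟨Submodule.smul_mem _ r hF.1, fun σ => by
    rw [Pi.smul_apply, symCurl_smul r (good_quadLt hF.1.1 σ), hF.2, smul_zero]⟩

theorem mem_sdcLt {n : ℕ} {F : Rule 2} :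
    F ∈ sdcLt n ↔ F ∈ quadLt n 2 ∧ IsSD F ∧ ∀ σ, symCurl (F σ) = 0 := and_assoc

theorem sdcLt_mono {m n : ℕ} (h : m ≤ n) : sdcLt m ≤ sdcLt n :=
  fun _ hF => ⟨sdLt_mono h hF.1, hF.2⟩

theorem sdLt_two : sdLt 2 = ⊥ := (Submodule.eq_bot_iff _).2 fun _ hF => eq_zero_of_isSD hF.1 hF.2

theorem sdLt_of_le {n : ℕ} (h : n ≤ 2) : sdLt n = ⊥ := le_bot_iff.1 (sdLt_two ▸ sdLt_mono h)

theorem X_mem_sdtLt {n : ℕ} (hn : 3 ≤ n) : X n ∈ sdtLt (n + 1) :=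
  mem_sdtLt.2 ⟨X_mem hn, isSDT_X hn⟩

theorem zetaR_mem_sdcLt (m : ℕ) : zetaR m ∈ sdcLt (2 * m + 3) := by
  obtain ⟨τ, h, -⟩ := exists_symbol_zetaR m
  exact mem_sdcLt.2 ⟨h.mem, isSD_zetaR m, symCurl_zetaR m⟩

theorem kappa_mem_sdLt : kappa ∈ sdLt 3 := by
  obtain ⟨τ, h, -⟩ := exists_symbol_kappa
  exact ⟨h.mem, isSD_kappa⟩

/-- The order of a conserved rule drops if three components of its symbol vanish. -/
theorem mem_sdLt_of_symbol {n : ℕ} {F : Rule 2} {τ : Symbol 2} (h : HasSymbol n 2 F τ)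
    (hF : IsSD F) (h11 : τ (nullV 1 0) (nullV 0 1) ![1, 1] = 0)
    (h12 : Odd n → τ (nullV 1 0) (nullV 0 1) ![1, 2] = 0)
    (h22 : τ (nullV 1 0) (nullV 0 1) ![2, 2] = 0) : F ∈ sdLt n := by
  have hs := h.sdSymbol hF
  refine ⟨h.mem_quadLt_of_base (hs.eq_zero h11 ?_ h22), hF⟩
  rcases Nat.even_or_odd n with hn | hn
  · exact hs.even hn
  · exact h12 hn

theorem HasSymbol.sdt {n : ℕ} {F : Rule 2} {τ : Symbol 2} (h : HasSymbol n 2 F τ)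
    (hF : IsSDT F) :
    τ (nullV 1 0) (nullV 0 1) ![2, 2] = -τ (nullV 1 0) (nullV 0 1) ![1, 1] := by
  obtain ⟨υ, h', e⟩ := h.trace
  have h0 := h'.eq_zero_of_mem (by
    rw [show (fun σ => DeSitter.trace (F σ)) = 0 from funext hF.2]
    exact Submodule.zero_mem _)
  have hs := h.sdSymbol hF.1
  rw [h0, hs.zero_left, hs.three_left, Pi.zero_apply] at e
  linarith

/-- In the symmetrized curl of the symbol, the (1,1) entry is a multiple of T₁₂ and the (1,2) entry
a multiple of T₁₁ − T₂₂. -/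
theorem HasSymbol.sdc {n : ℕ} {F : Rule 2} {τ : Symbol 2} (h : HasSymbol n 2 F τ)
    (hF : IsSD F) (hc : ∀ σ, symCurl (F σ) = 0) :
    τ (nullV 1 0) (nullV 0 1) ![1, 2] = 0 ∧
      τ (nullV 1 0) (nullV 0 1) ![2, 2] = τ (nullV 1 0) (nullV 0 1) ![1, 1] := by
  obtain ⟨υ, h', e⟩ := h.curl
  have h0 := (h'.add (h'.applyOp (IsCoef.permuteL (Equiv.swap 0 1)))).eq_zero_of_mem (by
    rw [show _ + _ = (0 : Rule 2) from ?_]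
    · exact Submodule.zero_mem _
    · funext σ x a
      have h1 := congrFun (congrFun (hc σ) x) a
      change DeSitter.curl (F σ) x a + DeSitter.curl (F σ) x (a ∘ Equiv.swap 0 1) = 0
      rw [symCurl_apply, ← vec_two a] at h1
      rw [vec_two (a ∘ _)]
      change _ / 2 = (0 : ℝ) at h1
      change _ + DeSitter.curl (F σ) x ![a 1, a 0] = 0
      linarith)
  have h2 : ∀ a b, curlSymbol (τ (nullV 1 0) (nullV 0 1)) ![a, b] +
      curlSymbol (τ (nullV 1 0) (nullV 0 1)) ![b, a] = 0 := by
    intro a b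
    have h3 := congrFun h0 ![a, b]
    change υ _ _ ![a, b] + υ (nullV 1 0) (nullV 0 1) (![a, b] ∘ Equiv.swap 0 1) = 0 at h3
    rw [vec_two (_ ∘ _), e] at h3
    exact h3
  have hs := (h.sdSymbol hF).symm
  have h11 := h2 1 1
  have h12 := h2 1 2
  rw [curlSymbol_one] at h11
  rw [curlSymbol_one, curlSymbol_two] at h12
  constructor <;> linarith

/-! ### Classification of conserved rules -/

/-- At odd orders T₁₂ is the only free component, and it is nonzero for X; tracelessness is not
needed. -/
theorem exists_sub_X_mem_of_odd {n : ℕ} (hn : 3 ≤ n) (ho : Odd n) {F : Rule 2}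
    (hF : F ∈ sdLt (n + 1)) : ∃ c : ℝ, F - c • X n ∈ sdLt n := by
  obtain ⟨τ, h⟩ := exists_symbol hF.1
  obtain ⟨υ, hX, t, ht, hXo, -⟩ := exists_symbol_X hn
  have hs := h.sdSymbol hF.2
  have hs' := hX.sdSymbol (isSDT_X hn).1
  have hXm := (X_mem_sdtLt hn).1
  refine ⟨τ (nullV 1 0) (nullV 0 1) ![1, 2] / t, mem_sdLt_of_symbol (h.sub (hX.smul _))
    (Submodule.sub_mem _ hF (Submodule.smul_mem _ _ hXm)).2 ?_ (fun _ => ?_) ?_⟩ <;>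
  simp only [Pi.sub_apply, Pi.smul_apply, smul_eq_mul, (hs.odd ho).1, (hs'.odd ho).1,
    (hs.odd ho).2, (hs'.odd ho).2, hXo ho]
  · ring
  · field_simp; ring
  · ring

theorem exists_sub_X_zetaR_mem {m : ℕ} {F : Rule 2} (hF : F ∈ sdLt (2 * m + 5)) :
    ∃ c d : ℝ, F - c • X (2 * m + 4) - d • zetaR (m + 1) ∈ sdLt (2 * m + 4) := by
  have hn : 3 ≤ 2 * m + 4 := by omega
  have he : Even (2 * m + 4) := ⟨m + 2, by ring⟩
  obtain ⟨τ, h⟩ := exists_symbol hF.1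
  obtain ⟨υ, hX, t, ht, -, hXe⟩ := exists_symbol_X hn
  obtain ⟨ζ, hZ, z11, z22, -⟩ := exists_symbol_zetaR (m + 1)
  have hp : ((-4 : ℝ)) ^ (m + 1) ≠ 0 := pow_ne_zero _ (by norm_num)
  generalize ((-4 : ℝ)) ^ (m + 1) = p at hp z11 z22
  set a := τ (nullV 1 0) (nullV 0 1) ![1, 1] with ha
  set b := τ (nullV 1 0) (nullV 0 1) ![2, 2] with hb
  -- Solves for the diagonal (a, b) as a combination of (−t, t) from X and (8p, 8p) from the
  -- Hessian-type tensor.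
  refine ⟨(b - a) / (2 * t), (a + b) / (16 * p),
    mem_sdLt_of_symbol ((h.sub (hX.smul _)).sub (hZ.smul _))
    (Submodule.sub_mem _ (Submodule.sub_mem _ hF (Submodule.smul_mem _ _ (X_mem_sdtLt hn).1))
      (Submodule.smul_mem _ _ (zetaR_mem_sdcLt (m + 1)).1)).2 ?_ (fun ho => ?_) ?_⟩
  · simp only [Pi.sub_apply, Pi.smul_apply, smul_eq_mul, z11, (hXe he).1, ← ha]
    field_simp; ring
  · exact absurd he (Nat.not_even_iff_odd.2 ho)
  · simp only [Pi.sub_apply, Pi.smul_apply, smul_eq_mul, z22, (hXe he).2, ← hb]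
    field_simp; ring

/-- At order two κ plays the part of X: its diagonal (0, 2) and the diagonal (8, 8) span both free
components, and what remains has order at most one, hence vanishes. -/
theorem exists_eq_kappa_zetaR {F : Rule 2} (hF : F ∈ sdLt 3) :
    ∃ c d : ℝ, F = c • kappa + d • zetaR 0 := by
  obtain ⟨τ, h⟩ := exists_symbol hF.1
  obtain ⟨υ, hκ, k11, k22⟩ := exists_symbol_kappa
  obtain ⟨ζ, hZ, z11, z22, -⟩ := exists_symbol_zetaR 0
  set a := τ (nullV 1 0) (nullV 0 1) ![1, 1] with ha
  set b := τ (nullV 1 0) (nullV 0 1) ![2, 2] with hb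
  have h1 := mem_sdLt_of_symbol ((h.sub (hκ.smul ((b - a) / 2))).sub (hZ.smul (a / 8)))
    (Submodule.sub_mem _ (Submodule.sub_mem _ hF (Submodule.smul_mem _ _ kappa_mem_sdLt))
      (Submodule.smul_mem _ _ (zetaR_mem_sdcLt 0).1)).2 ?_ (fun ho => absurd ho (by decide)) ?_
  · refine ⟨(b - a) / 2, a / 8, ?_⟩
    have h2 := h1
    rw [sdLt_two, Submodule.mem_bot, sub_sub, sub_eq_zero] at h2
    exact h2
  · simp only [Pi.sub_apply, Pi.smul_apply, smul_eq_mul, z11, k11, ← ha]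
    ring
  · simp only [Pi.sub_apply, Pi.smul_apply, smul_eq_mul, z22, k22, ← hb]
    ring

theorem exists_sq_ne_zero : ∃ (σ : Sol) (x : Hyp), prodR 0 0 σ x ![] ≠ 0 := by
  by_contra! h
  obtain ⟨τ, hτ, e⟩ := exists_symbol_sqR 0
  have h0 := hτ.eq_zero_of_mem (by
    rw [show sqR 0 = 0 from funext fun σ => funext fun x => funext fun a => by
      rw [Subsingleton.elim a ![]]; exact h σ x]
    exact Submodule.zero_mem _)
  rw [h0] at e
  norm_num at e

theorem trace_kappa (σ : Sol) :
    trace (kappa σ) = (-(1 / 2) : ℝ) • gradR σ + (9 / 2 : ℝ) • prodR 0 0 σ := by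
  rw [kappa_eq]
  dsimp only
  rw [trace_add, trace_metricT]
  change gradR σ + _ = _
  funext x a
  simp only [Pi.add_apply, Pi.smul_apply, smul_eq_mul]
  ring

theorem sqR_one (σ : Sol) : sqR 1 σ = (2 : ℝ) • gradR σ + (-6 : ℝ) • prodR 0 0 σ := by
  have h := congrArg trace (four_kappa_add_potential σ)
  rw [trace_add, trace_smul, trace_kappa, trace_add, trace_smul, trace_metricT, potential_eq] at h
  dsimp only at h
  rw [trace_add, trace_metricT, trace_smul, trace_hessR] at h
  funext x a
  have h1 := congrFun (congrFun h x) a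
  change trace (cov (cov (prodR 0 0 σ))) x a = _
  simp only [Pi.add_apply, Pi.smul_apply, smul_eq_mul] at h1 ⊢
  linarith

theorem trace_zetaR_zero (σ : Sol) :
    trace (zetaR 0 σ) = (-4 : ℝ) • gradR σ + (6 : ℝ) • prodR 0 0 σ := by
  have h := sqR_one σ
  rw [zetaR, hessT, trace_add, trace_smul, trace_metricT]
  change sqR 1 σ + (-1 : ℝ) • (3 : ℝ) • (sqR 1 σ + (2 : ℝ) • prodR 0 0 σ) = _
  rw [h]
  funext x a
  simp only [Pi.add_apply, Pi.smul_apply, smul_eq_mul]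
  ring

/-- At leading order a traceless combination must have c = −8d. Then the gradient terms of the trace
cancel, but −30 dσ² remains, so d = 0. -/
theorem sdtLt_three : sdtLt 3 = ⊥ := by
  refine (Submodule.eq_bot_iff _).2 fun F hF => ?_
  obtain ⟨c, d, rfl⟩ := exists_eq_kappa_zetaR hF.1
  obtain ⟨υ, hκ, k11, k22⟩ := exists_symbol_kappa
  obtain ⟨ζ, hZ, z11, z22, -⟩ := exists_symbol_zetaR 0
  have h := ((hκ.smul c).add (hZ.smul d)).sdt (mem_sdtLt.1 hF).2
  simp only [Pi.add_apply, Pi.smul_apply, smul_eq_mul, z11, k11, z22, k22] at h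
  obtain rfl : c = -8 * d := by linarith
  obtain ⟨σ, x, hx⟩ := exists_sq_ne_zero
  have h1 := congrFun (congrFun (hF.2 σ) x) ![]
  rw [Pi.add_apply, trace_add, Pi.smul_apply, Pi.smul_apply, trace_smul, trace_smul, trace_kappa,
    trace_zetaR_zero] at h1
  simp only [Pi.add_apply, Pi.smul_apply, smul_eq_mul, Pi.zero_apply] at h1
  have h2 : d * prodR 0 0 σ x ![] = 0 := by linarith
  rw [(mul_eq_zero.1 h2).resolve_right hx]
  simp

theorem sdtLt_of_le {n : ℕ} (h : n ≤ 3) : sdtLt n = ⊥ := le_bot_iff.1 (sdtLt_three ▸ sdtLt_mono h)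

theorem exists_sub_X_mem {n : ℕ} (hn : 3 ≤ n) {F : Rule 2} (hF : F ∈ sdtLt (n + 1)) :
    ∃ c : ℝ, F - c • X n ∈ sdtLt n := by
  have h : ∃ c : ℝ, F - c • X n ∈ sdLt n := by
    rcases Nat.even_or_odd n with he | ho
    · obtain ⟨τ, h⟩ := exists_symbol hF.1.1
      obtain ⟨υ, hX, t, ht, -, hXe⟩ := exists_symbol_X hn
      have h1 := h.sdt (mem_sdtLt.1 hF).2
      refine ⟨τ (nullV 1 0) (nullV 0 1) ![2, 2] / t, mem_sdLt_of_symbol (h.sub (hX.smul _))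
        (Submodule.sub_mem _ hF.1 (Submodule.smul_mem _ _ (X_mem_sdtLt hn).1)).2 ?_
        (fun ho => absurd he (Nat.not_even_iff_odd.2 ho)) ?_⟩ <;>
      simp only [Pi.sub_apply, Pi.smul_apply, smul_eq_mul, (hXe he).1, (hXe he).2, h1]
      · field_simp; ring
      · field_simp; ring
    · exact exists_sub_X_mem_of_odd hn ho hF.1
  obtain ⟨c, hc⟩ := h
  exact ⟨c, hc, (Submodule.sub_mem _ hF (Submodule.smul_mem _ c (X_mem_sdtLt hn))).2⟩

theorem span_X (n : ℕ) : Submodule.span ℝ (X '' Set.Icc 3 n) = sdtLt (n + 1) := by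
  apply le_antisymm
  · refine Submodule.span_le.2 ?_
    rintro _ ⟨k, hk, rfl⟩
    exact sdtLt_mono (Nat.succ_le_succ hk.2) (X_mem_sdtLt hk.1)
  · induction n with
    | zero => rw [sdtLt_of_le (by norm_num)]; exact bot_le
    | succ n ih =>
      rcases Nat.lt_or_ge n 2 with hn | hn
      · rw [sdtLt_of_le (by omega)]; exact bot_le
      · intro F hF
        obtain ⟨c, hc⟩ := exists_sub_X_mem (by omega) hF
        rw [← sub_add_cancel F (c • X (n + 1))]
        exact Submodule.add_mem _ (Submodule.span_mono (Set.image_mono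
          (Set.Icc_subset_Icc_right n.le_succ)) (ih hc)) (Submodule.smul_mem _ _
          (Submodule.subset_span ⟨n + 1, ⟨by omega, le_rfl⟩, rfl⟩))

/-- At odd orders the symbol must vanish; at even orders it is determined by T₁₁ = T₂₂ and matched
by one Hessian-type tensor. -/
theorem sdcLt_le (n : ℕ) :
    sdcLt (n + 1) ≤ Submodule.span ℝ (zetaR '' {m | 2 * m + 2 ≤ n}) := by
  induction n with
  | zero =>
    intro F hF
    have h0 := hF.1
    rw [sdLt_of_le (by norm_num)] at h0
    rw [(Submodule.mem_bot ℝ).1 h0]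
    exact Submodule.zero_mem _
  | succ n ih =>
    intro F hF
    have hmono : Submodule.span ℝ (zetaR '' {m | 2 * m + 2 ≤ n}) ≤
        Submodule.span ℝ (zetaR '' {m | 2 * m + 2 ≤ n + 1}) :=
      Submodule.span_mono (Set.image_mono fun m hm => Nat.le_succ_of_le hm)
    obtain ⟨τ, h⟩ := exists_symbol hF.1.1
    obtain ⟨h12, h22⟩ := h.sdc hF.1.2 hF.2
    have hs := h.sdSymbol hF.1.2
    rcases Nat.even_or_odd (n + 1) with ⟨k, hk⟩ | ho
    · obtain ⟨m, rfl⟩ : ∃ m, n = 2 * m + 1 := ⟨k - 1, by omega⟩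
      obtain ⟨ζ, hZ, z11, z22, z12, -⟩ := exists_symbol_zetaR m
      have hp : ((-4 : ℝ)) ^ m ≠ 0 := pow_ne_zero _ (by norm_num)
      generalize ((-4 : ℝ)) ^ m = p at hp z11 z22
      have hZm := zetaR_mem_sdcLt m
      have hd : F - (τ (nullV 1 0) (nullV 0 1) ![1, 1] / (8 * p)) • zetaR m ∈
          sdcLt (2 * m + 2) := by
        have h1 := Submodule.sub_mem _ hF (Submodule.smul_mem _
          (τ (nullV 1 0) (nullV 0 1) ![1, 1] / (8 * p)) hZm)
        refine ⟨mem_sdLt_of_symbol (h.sub (hZ.smul _)) h1.1.2 ?_ (fun _ => ?_) ?_, h1.2⟩ <;>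
        simp only [Pi.sub_apply, Pi.smul_apply, smul_eq_mul, z11, z22, z12, h12, h22]
        · field_simp; ring
        · ring
        · field_simp; ring
      rw [← sub_add_cancel F ((τ (nullV 1 0) (nullV 0 1) ![1, 1] / (8 * p)) • zetaR m)]
      exact Submodule.add_mem _ (hmono (ih hd)) (Submodule.smul_mem _ _
        (Submodule.subset_span ⟨m, Set.mem_ofPred.2 le_rfl, rfl⟩))
    · exact hmono (ih ⟨mem_sdLt_of_symbol h hF.1.2 (hs.odd ho).1 (fun _ => h12) (hs.odd ho).2,
        hF.2⟩)

theorem span_zetaR (n : ℕ) :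
    Submodule.span ℝ (zetaR '' {m | 2 * m + 2 ≤ n}) = sdcLt (n + 1) := by
  refine le_antisymm (Submodule.span_le.2 ?_) (sdcLt_le n)
  rintro _ ⟨m, hm, rfl⟩
  exact sdcLt_mono (Nat.succ_le_succ hm) (zetaR_mem_sdcLt m)

/-- Leading terms are removed one order at a time: by X at odd orders, by X and a Hessian-type
tensor at even orders from four on, and by κ in place of X at order two. -/
theorem exists_decomp (n : ℕ) {F : Rule 2} (hF : F ∈ sdLt (n + 1)) :
    ∃ c : ℝ, ∃ S ∈ sdtLt (n + 1), ∃ Z ∈ sdcLt (n + 1), F = c • kappa + S + Z := by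
  induction n generalizing F with
  | zero =>
    rw [sdLt_of_le (by norm_num), Submodule.mem_bot] at hF
    exact ⟨0, 0, Submodule.zero_mem _, 0, Submodule.zero_mem _, by simp [hF]⟩
  | succ n ih =>
    rcases Nat.even_or_odd (n + 1) with ⟨k, hk⟩ | ho
    · rcases Nat.lt_or_ge n 3 with hn | hn
      · obtain rfl : n = 1 := by omega
        obtain ⟨c, d, rfl⟩ := exists_eq_kappa_zetaR hF
        exact ⟨c, 0, Submodule.zero_mem _, _, Submodule.smul_mem _ d (zetaR_mem_sdcLt 0),
          by rw [add_zero]⟩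
      · obtain ⟨m, rfl⟩ : ∃ m, n = 2 * m + 3 := ⟨k - 2, by omega⟩
        obtain ⟨p, q, h⟩ := exists_sub_X_zetaR_mem hF
        obtain ⟨c, S, hS, Z, hZ, e⟩ := ih h
        refine ⟨c, S + p • X (2 * m + 4), Submodule.add_mem _ (sdtLt_mono (Nat.le_succ _) hS)
          (Submodule.smul_mem _ _ (X_mem_sdtLt (n := 2 * m + 4) (by omega))), Z + q • zetaR (m + 1),
          Submodule.add_mem _ (sdcLt_mono (Nat.le_succ _) hZ)
          (Submodule.smul_mem _ _ (zetaR_mem_sdcLt (m + 1))), ?_⟩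
        rw [sub_sub, sub_eq_iff_eq_add] at e
        rw [e]
        abel
    · rcases Nat.lt_or_ge n 2 with hn | hn
      · rw [sdLt_of_le (by obtain ⟨k, hk⟩ := ho; omega), Submodule.mem_bot] at hF
        exact ⟨0, 0, Submodule.zero_mem _, 0, Submodule.zero_mem _, by simp [hF]⟩
      · obtain ⟨p, h⟩ := exists_sub_X_mem_of_odd (by omega) ho hF
        obtain ⟨c, S, hS, Z, hZ, e⟩ := ih h
        refine ⟨c, S + p • X (n + 1), Submodule.add_mem _ (sdtLt_mono (Nat.le_succ _) hS)
          (Submodule.smul_mem _ _ (X_mem_sdtLt (n := n + 1) (by omega))), Z,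
          sdcLt_mono (Nat.le_succ _) hZ, ?_⟩
        rw [sub_eq_iff_eq_add] at e
        rw [e]
        abel

/-- The top multiple of X in S would reappear one order higher in the curl, at order at least four,
whereas the curl has order at most three. -/
theorem eq_zero_of_curl_mem (n : ℕ) {S : Rule 2} (hS : S ∈ sdtLt (n + 1))
    (h : (fun σ => curl (S σ)) ∈ quadLt 4 2) : S = 0 := by
  induction n with
  | zero =>
    rw [sdtLt_of_le (by norm_num)] at hS
    exact (Submodule.mem_bot ℝ).1 hS
  | succ n ih =>
    rcases Nat.lt_or_ge n 2 with hn | hn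
    · rw [sdtLt_of_le (by omega)] at hS
      exact (Submodule.mem_bot ℝ).1 hS
    · obtain ⟨c, hc⟩ := exists_sub_X_mem (by omega) hS
      have hX := X_mem_sdtLt (n := n + 1) (by omega)
      obtain ⟨τ, hτ⟩ := exists_symbol hc.1.1
      obtain ⟨υ, hυ, -⟩ := hτ.curl
      have h1 : c • X (n + 2) = (fun σ => curl (S σ)) - fun σ => curl ((S - c • X (n + 1)) σ) := by
        funext σ
        have h3 : S σ = (S - c • X (n + 1)) σ + c • X (n + 1) σ := (sub_add_cancel (S σ) _).symm
        rw [Pi.sub_apply, Pi.smul_apply, X_succ (by omega)]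
        nth_rw 1 [h3]
        rw [curl_add (good_quadLt hc.1.1 σ) ((good_quadLt hX.1.1 σ).smul c),
          curl_smul c (good_quadLt hX.1.1 σ), add_sub_cancel_left]
      have h2 : c • X (n + 2) ∈ quadLt (n + 2) 2 := by
        rw [h1]
        exact Submodule.sub_mem _ (quadLt_mono (by omega) 2 h) (quadLt_mono (by omega) 2 hυ.mem)
      rw [(smul_X_mem_iff (by omega)).1 h2, zero_smul, sub_zero] at hc
      exact ih hc

/-- The symmetrized curl eliminates Z and turns the relation into curl S = (c/4) X⁽³⁾; the previous
lemma gives S = 0, and then c = 0 since X⁽³⁾ has order exactly three. -/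
theorem decomp_unique (n : ℕ) {c : ℝ} {S Z : Rule 2} (hS : S ∈ sdtLt (n + 1))
    (hZ : Z ∈ sdcLt (n + 1)) (h : c • kappa + S + Z = 0) : c = 0 ∧ S = 0 ∧ Z = 0 := by
  have h1 : (fun σ => curl (S σ)) = (c / 4) • X 3 := by
    funext σ
    have gS := good_quadLt hS.1.1 σ
    have gZ := good_quadLt hZ.1.1 σ
    have gk := good_kappa σ
    have hcurl := (isSDT_curl (mem_sdtLt.1 hS).2 (good_quadLt hS.1.1)).1 σ
    have h2 := congrArg symCurl (congrFun h σ)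
    rw [Pi.add_apply, Pi.add_apply, Pi.smul_apply, symCurl_add ((gk.smul c).add gS) gZ,
      symCurl_add (gk.smul c) gS, symCurl_smul c gk, hZ.2,
      symCurl_kappa, symCurl_of_symm hcurl.1, add_zero,
      show symCurl ((0 : Rule 2) σ) = 0 from (Submodule.zero_mem (sdcLt 0)).2 σ] at h2
    rw [eq_neg_of_add_eq_zero_right h2, Pi.smul_apply, X_three, smul_smul, ← neg_smul]
    congr 1
    ring
  have hS0 := eq_zero_of_curl_mem n hS (by
    rw [h1]; exact Submodule.smul_mem _ _ (X_mem le_rfl))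
  subst hS0
  have h3 : (c / 4) • X 3 ∈ quadLt 3 2 := by
    rw [← h1, show (fun σ => curl ((0 : Rule 2) σ)) = 0 from ?_]
    · exact Submodule.zero_mem _
    · funext σ x
      rw [curl_eq, show cov ((0 : Rule 2) σ) = 0 from cov_zero, Pi.zero_apply, map_zero]
      rfl
  have hc : c = 0 := by linarith [(smul_X_mem_iff le_rfl).1 h3]
  subst hc
  refine ⟨rfl, rfl, ?_⟩
  simpa using h

theorem exists_trace_kappa_ne_zero : ∃ σ, trace (kappa σ) ≠ 0 := by
  by_contra! h
  have h1 : kappa ∈ sdtLt 3 := ⟨kappa_mem_sdLt, h⟩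
  obtain ⟨τ, hτ, k11, k22⟩ := exists_symbol_kappa
  have h2 := hτ.sdt (mem_sdtLt.1 h1).2
  rw [k11, k22] at h2
  norm_num at h2

theorem exists_symCurl_kappa_ne_zero : ∃ σ, symCurl (kappa σ) ≠ 0 := by
  by_contra! h
  have h1 : (-(1 / 4) : ℝ) • X 3 ∈ quadLt 3 2 := by
    rw [show (-(1 / 4) : ℝ) • X 3 = 0 from funext fun σ => (symCurl_kappa σ).symm.trans (h σ)]
    exact Submodule.zero_mem _
  have h2 := (smul_X_mem_iff le_rfl).1 h1
  norm_num at h2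

theorem exists_trace_zetaR_ne_zero (m : ℕ) : ∃ σ, trace (zetaR m σ) ≠ 0 := by
  by_contra! h
  have h1 : zetaR m ∈ sdtLt (2 * m + 3) := ⟨(zetaR_mem_sdcLt m).1, h⟩
  obtain ⟨τ, hτ, z11, z22, -⟩ := exists_symbol_zetaR m
  have h2 := hτ.sdt (mem_sdtLt.1 h1).2
  have hp : ((-4 : ℝ)) ^ m ≠ 0 := pow_ne_zero _ (by norm_num)
  rw [z11, z22] at h2
  exact hp (by linarith)

theorem zetaR_notMem (m : ℕ) : zetaR m ∉ quadLt (2 * m + 2) 2 := by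
  intro h
  obtain ⟨τ, hτ, z11, -⟩ := exists_symbol_zetaR m
  have hp : ((-4 : ℝ)) ^ m ≠ 0 := pow_ne_zero _ (by norm_num)
  rw [hτ.eq_zero_of_mem h, Pi.zero_apply] at z11
  exact hp (by linarith)

/-! ### The stress tensor -/

theorem det_diagonal_eta : (Matrix.diagonal eta).det = -1 := by
  rw [Matrix.det_diagonal]
  simp [Fin.prod_univ_four, eta]

theorem hasDerivAt_quadForm_inv (k : Matrix (Fin 4) (Fin 4) ℝ) (v : Fin 4 → ℝ) :
    HasDerivAt (fun t : ℝ => v ⬝ᵥ ((Matrix.diagonal eta + t • k)⁻¹ *ᵥ v))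
      (-(v ⬝ᵥ ((Matrix.diagonal eta * k * Matrix.diagonal eta) *ᵥ v))) 0 := by
  -- An auxiliary choice of norm, needed only to differentiate the inverse; the result does not
  -- depend on it.
  let _ : NormedRing (Matrix (Fin 4) (Fin 4) ℝ) := Matrix.linftyOpNormedRing
  let _ : NormedAlgebra ℝ (Matrix (Fin 4) (Fin 4) ℝ) := Matrix.linftyOpNormedAlgebra
  let u : (Matrix (Fin 4) (Fin 4) ℝ)ˣ :=
    ⟨Matrix.diagonal eta, Matrix.diagonal eta, diagonal_eta_mul, diagonal_eta_mul⟩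
  let q : Matrix (Fin 4) (Fin 4) ℝ →ₗ[ℝ] ℝ :=
    { toFun := fun M => v ⬝ᵥ (M *ᵥ v)
      map_add' := fun M N => by rw [Matrix.add_mulVec, dotProduct_add]
      map_smul' := fun r M => by rw [Matrix.smul_mulVec, dotProduct_smul]; rfl }
  have h2 : HasDerivAt (fun t : ℝ => Matrix.diagonal eta + t • k) k 0 := by
    exact (((hasDerivAt_id (0 : ℝ)).smul_const k).const_add (Matrix.diagonal eta)).congr_deriv
      (one_smul ℝ k)
  have h1 := (hasFDerivAt_ringInverse (𝕜 := ℝ) u).comp_hasDerivAt_of_eq 0 h2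
    (by rw [zero_smul, add_zero])
  have h3 := (q.toContinuousLinearMap.hasFDerivAt).comp_hasDerivAt 0 h1
  refine (h3.congr_deriv ?_).congr_of_eventuallyEq (Filter.Eventually.of_forall fun t => ?_)
  · change v ⬝ᵥ ((-(Matrix.diagonal eta * k * Matrix.diagonal eta)) *ᵥ v) = _
    rw [Matrix.neg_mulVec, dotProduct_neg]
  · change v ⬝ᵥ (_ *ᵥ v) = v ⬝ᵥ (_ *ᵥ v)
    rw [Matrix.nonsing_inv_eq_ringInverse]
    rfl

theorem hasDerivAt_det (k : Matrix (Fin 4) (Fin 4) ℝ) :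
    HasDerivAt (fun t : ℝ => (Matrix.diagonal eta + t • k).det)
      (-(Matrix.diagonal eta * k).trace) 0 := by
  have h : ∀ t : ℝ, (Matrix.diagonal eta + t • k).det =
      -(1 + t • (Matrix.diagonal eta * k)).det := by
    intro t
    have h1 : Matrix.diagonal eta + t • k =
        Matrix.diagonal eta * (1 + t • (Matrix.diagonal eta * k)) := by
      rw [mul_add, mul_one, Matrix.mul_smul, ← mul_assoc, diagonal_eta_mul, one_mul]
    rw [h1, Matrix.det_mul, det_diagonal_eta, neg_one_mul]
  -- The part of the determinant of second and higher order in t, divided by t²; only the linear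
  -- term, the trace, contributes at t = 0.
  let p := Polynomial.divX (Polynomial.divX
    (1 + (Polynomial.X : Polynomial ℝ) • (Matrix.diagonal eta * k).map Polynomial.C).det)
  have h2 := (((hasDerivAt_id (0 : ℝ)).const_mul (Matrix.diagonal eta * k).trace).const_add 1).add
    ((p.hasDerivAt 0).mul ((hasDerivAt_id (0 : ℝ)).pow 2))
  refine (h2.neg.congr_deriv ?_).congr_of_eventuallyEq (Filter.Eventually.of_forall fun t => ?_)
  · simp
  · exact (h t).trans (congrArg Neg.neg (Matrix.det_one_add_smul t _))

theorem hasDerivAt_sqrt_abs_det (k : Matrix (Fin 4) (Fin 4) ℝ) :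
    HasDerivAt (fun t : ℝ => √|(Matrix.diagonal eta + t • k).det|)
      ((Matrix.diagonal eta * k).trace / 2) 0 := by
  have h0 : (Matrix.diagonal eta + (0 : ℝ) • k).det = -1 := by
    rw [zero_smul, add_zero, det_diagonal_eta]
  have h1 : HasDerivAt (fun x : ℝ => |x|) (-1) (Matrix.diagonal eta + (0 : ℝ) • k).det :=
    hasDerivAt_abs_neg (by rw [h0]; norm_num)
  have h2 := (h1.comp (0 : ℝ) (hasDerivAt_det k)).sqrt (by
    simp only [Function.comp]
    rw [h0]; norm_num)
  refine h2.congr_deriv ?_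
  simp only [Function.comp]
  rw [h0]
  norm_num

theorem isStressTensor_kappa (σ : Sol) : IsStressTensor σ.1 (kappa σ) := by
  refine ⟨(isSD_kappa σ).1, fun x b => sum_coord_mul_cons ((good_kappa σ).2 x) ![b], ?_⟩
  intro x k hk hkx
  set v : Fin 4 → ℝ := fun a => iterCov σ.1 1 x ![a] with hv
  have h := (hasDerivAt_sqrt_abs_det k).mul
    (((hasDerivAt_quadForm_inv k v).const_mul (-(1 / 2))).add_const (3 / 2 * σ.1 x ^ 2))
  refine h.congr_deriv ?_
  have hinv : (Matrix.diagonal eta)⁻¹ = Matrix.diagonal eta :=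
    Matrix.inv_eq_left_inv diagonal_eta_mul
  have hG : v ⬝ᵥ (Matrix.diagonal eta *ᵥ v) = gradSq σ.1 x := by
    refine Finset.sum_congr rfl fun c _ => ?_
    rw [Matrix.mulVec_diagonal]
    ring
  have hT : v ⬝ᵥ ((Matrix.diagonal eta * k * Matrix.diagonal eta) *ᵥ v) =
      ∑ a, ∑ b, eta a * eta b * (v a * v b) * k a b := by
    refine Finset.sum_congr rfl fun a _ => ?_
    rw [Matrix.mulVec, dotProduct, Finset.mul_sum]
    refine Finset.sum_congr rfl fun b _ => ?_
    rw [Matrix.mul_diagonal, Matrix.diagonal_mul]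
    ring
  -- The variation k annihilates the normal, so contracting it with h or with η gives the same
  -- trace.
  have hm : ∑ a, ∑ b, eta a * eta b * metric x ![a, b] * k a b =
      (Matrix.diagonal eta * k).trace := by
    have h1 : ∀ a, ∑ b, eta a * eta b * metric x ![a, b] * k a b = eta a * k a a := by
      intro a
      have h2 : ∑ b, k a b * x.1 b = 0 := congrFun hkx a
      have h3 : ∀ b, eta a * eta b * metric x ![a, b] * k a b =
          (if a = b then eta a * k a b else 0) - x.1 a * (k a b * x.1 b) := by
        intro b
        have ha := eta_mul_eta a
        have hb := eta_mul_eta b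
        simp only [metric, Matrix.cons_val_zero, Matrix.cons_val_one]
        by_cases hab : a = b
        · subst hab
          simp only [if_true]
          linear_combination (eta a * k a a - (eta a * eta a + 1) * x.1 a * x.1 a * k a a) * ha
        · simp only [hab, if_false]
          linear_combination (-(eta b * eta b) * x.1 a * x.1 b * k a b) * ha -
            x.1 a * x.1 b * k a b * hb
      simp only [h3, Finset.sum_sub_distrib, ← Finset.mul_sum, h2, mul_zero, sub_zero,
        Finset.sum_ite_eq, Finset.mem_univ, if_true]
    simp only [h1, Matrix.trace, Matrix.diag, Matrix.diagonal_mul]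
  have hκ : ∑ a, ∑ b, eta a * eta b * kappa σ x ![a, b] * k a b =
      ∑ a, ∑ b, eta a * eta b * (v a * v b) * k a b +
      (-(1 / 2) * gradSq σ.1 x + 3 / 2 * σ.1 x ^ 2) *
        ∑ a, ∑ b, eta a * eta b * metric x ![a, b] * k a b := by
    simp only [Finset.mul_sum, ← Finset.sum_add_distrib]
    refine Finset.sum_congr rfl fun a _ => Finset.sum_congr rfl fun b _ => ?_
    simp only [kappa, hv, Matrix.cons_val_zero, Matrix.cons_val_one]
    ring
  rw [hκ, hm, ← hT, zero_smul, add_zero, hinv, hG, det_diagonal_eta]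
  norm_num
  ring

end DeSitter

end

/-! ### Assembly of the classification -/

theorem mainTheorem8 :
    -- the potential `M`, and `X^{[3]}` as its (symmetrized) curl
    (DeSitter.potential ∈ DeSitter.quadratic 2 ∧
      ∀ σ, DeSitter.IsSymm (DeSitter.potential σ) ∧
        DeSitter.div (DeSitter.potential σ) =
          DeSitter.cov (DeSitter.trace (DeSitter.potential σ)) ∧
        DeSitter.X 3 σ = DeSitter.symCurl (DeSitter.potential σ)) ∧
    -- no SDT tensor of order at most two
    (∀ n ≤ 2, ∀ F ∈ DeSitter.quadratic n, DeSitter.IsSDT F → F = 0) ∧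
    -- exactly one SDT tensor at each order `n ≥ 3`, namely `X^{[n]}`
    (∀ n ≥ 3, DeSitter.X n ∈ DeSitter.quadratic n ∧
      DeSitter.X n ∉ DeSitter.quadratic (n - 1) ∧ DeSitter.IsSDT (DeSitter.X n) ∧
      ∀ F ∈ DeSitter.quadratic n, DeSitter.IsSDT F →
        ∃! c : ℝ, F - c • DeSitter.X n ∈ DeSitter.quadratic (n - 1)) ∧
    -- the general SDT tensor
    (∀ (n : ℕ) (F : DeSitter.Rule 2), F ∈ DeSitter.quadratic n ∧ DeSitter.IsSDT F ↔
      F ∈ Submodule.span ℝ (DeSitter.X '' Set.Icc 3 n)) ∧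
    -- the exceptional tensor `κ`
    (DeSitter.kappa ∈ DeSitter.quadratic 2 ∧ DeSitter.IsSD DeSitter.kappa ∧
      (∃ σ, DeSitter.trace (DeSitter.kappa σ) ≠ 0) ∧
      (∃ σ, DeSitter.symCurl (DeSitter.kappa σ) ≠ 0) ∧
      (∀ σ, DeSitter.symCurl (DeSitter.kappa σ) = (-(1 / 4) : ℝ) • DeSitter.X 3 σ) ∧
      ∀ σ : DeSitter.Sol, DeSitter.IsStressTensor σ.1 (DeSitter.kappa σ)) ∧
    -- SD = ℝ κ ⊕ SDT ⊕ {SD with vanishing symmetrized curl}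
    (∀ (n : ℕ), ∀ F ∈ DeSitter.quadratic n, DeSitter.IsSD F →
      ∃! p : ℝ × DeSitter.Rule 2 × DeSitter.Rule 2,
        (p.2.1 ∈ DeSitter.quadratic n ∧ DeSitter.IsSDT p.2.1) ∧
        (p.2.2 ∈ DeSitter.quadratic n ∧ DeSitter.IsSD p.2.2 ∧
          ∀ σ, DeSitter.symCurl (p.2.2 σ) = 0) ∧
        F = p.1 • DeSitter.kappa + p.2.1 + p.2.2) ∧
    -- at odd orders there is no SD tensor besides `X^{[n]}`, up to lower order
    (∀ n ≥ 3, Odd n → ∀ F ∈ DeSitter.quadratic n, DeSitter.IsSD F →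
      ∃ c : ℝ, F - c • DeSitter.X n ∈ DeSitter.quadratic (n - 1)) ∧
    -- SD tensors with vanishing symmetrized curl: one at each even order, with nonzero trace
    (∃ Z : ℕ → DeSitter.Rule 2,
      (∀ m ≥ 1, Z m ∈ DeSitter.quadratic (2 * m) ∧ Z m ∉ DeSitter.quadratic (2 * m - 1) ∧
        DeSitter.IsSD (Z m) ∧ (∃ σ, DeSitter.trace (Z m σ) ≠ 0) ∧
        ∀ σ, DeSitter.symCurl (Z m σ) = 0) ∧
      ∀ (n : ℕ) (F : DeSitter.Rule 2),
        (F ∈ DeSitter.quadratic n ∧ DeSitter.IsSD F ∧ ∀ σ, DeSitter.symCurl (F σ) = 0) ↔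
          F ∈ Submodule.span ℝ (Z '' {m | 1 ≤ m ∧ 2 * m ≤ n})) := by
  have hq : ∀ (n : ℕ) (F : DeSitter.Rule 2),
      F ∈ DeSitter.quadratic n ↔ F ∈ DeSitter.quadLt (n + 1) 2 := fun n F => by
    rw [DeSitter.quadratic_eq]
  have hq' : ∀ n ≥ 1, ∀ (F : DeSitter.Rule 2),
      F ∈ DeSitter.quadratic (n - 1) ↔ F ∈ DeSitter.quadLt n 2 := fun n hn F => by
    rw [DeSitter.quadratic_eq, Nat.sub_add_cancel hn]
  refine ⟨⟨?_, fun σ => ⟨DeSitter.potential_symm σ, DeSitter.div_potential σ, ?_⟩⟩, ?_, ?_, ?_,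
    ⟨?_, DeSitter.isSD_kappa, DeSitter.exists_trace_kappa_ne_zero,
      DeSitter.exists_symCurl_kappa_ne_zero, DeSitter.symCurl_kappa,
      DeSitter.isStressTensor_kappa⟩, ?_, ?_, ?_⟩
  · obtain ⟨τ, h, -⟩ := DeSitter.exists_symbol_potential
    exact (hq _ _).2 h.mem
  · exact (DeSitter.symCurl_of_symm (DeSitter.curl_potential_symm σ)).symm
  · intro n hn F hF hS
    have h := DeSitter.mem_sdtLt.2 ⟨(hq _ _).1 hF, hS⟩
    rwa [DeSitter.sdtLt_of_le (Nat.succ_le_succ hn), Submodule.mem_bot] at h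
  · intro n hn
    have hn1 : 1 ≤ n := (by norm_num : 1 ≤ 3).trans hn
    refine ⟨(hq _ _).2 (DeSitter.X_mem hn), fun h => ?_, DeSitter.isSDT_X hn, fun F hF hS => ?_⟩
    · rw [hq' n hn1, ← one_smul ℝ (DeSitter.X n), DeSitter.smul_X_mem_iff hn] at h
      exact one_ne_zero h
    · obtain ⟨c, hc⟩ := DeSitter.exists_sub_X_mem hn (DeSitter.mem_sdtLt.2 ⟨(hq _ _).1 hF, hS⟩)
      refine ⟨c, (hq' n hn1 _).2 hc.1.1, fun d hd => ?_⟩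
      have h := Submodule.sub_mem _ hc.1.1 ((hq' n hn1 _).1 hd)
      rw [sub_sub_sub_cancel_left, ← sub_smul, DeSitter.smul_X_mem_iff hn] at h
      exact sub_eq_zero.1 h
  · intro n F
    rw [DeSitter.span_X, DeSitter.mem_sdtLt, hq]
  · exact (hq _ _).2 DeSitter.kappa_mem_sdLt.1
  · intro n F hF hS
    obtain ⟨c, S, hS, Z, hZ, e⟩ := DeSitter.exists_decomp n ⟨(hq _ _).1 hF, hS⟩
    refine ⟨(c, S, Z), ⟨?_, ?_, e⟩, ?_⟩
    · rw [hq]; exact DeSitter.mem_sdtLt.1 hS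
    · rw [hq]; exact DeSitter.mem_sdcLt.1 hZ
    · rintro ⟨c', S', Z'⟩ ⟨hS', hZ', e'⟩
      dsimp only at hS' hZ' e'
      rw [hq] at hS' hZ'
      -- The difference of two decompositions is a vanishing combination.
      obtain ⟨h1, h2, h3⟩ := DeSitter.decomp_unique n (c := c' - c)
        (Submodule.sub_mem _ (DeSitter.mem_sdtLt.2 hS') hS)
        (Submodule.sub_mem _ (DeSitter.mem_sdcLt.2 hZ') hZ) (by
          rw [sub_smul, ← sub_eq_zero.2 (e'.symm.trans e)]
          abel)
      rw [sub_eq_zero.1 h1, sub_eq_zero.1 h2, sub_eq_zero.1 h3]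
  · intro n hn ho F hF hS
    obtain ⟨c, hc⟩ := DeSitter.exists_sub_X_mem_of_odd hn ho ⟨(hq _ _).1 hF, hS⟩
    exact ⟨c, (hq' n ((by norm_num : 1 ≤ 3).trans hn) _).2 hc.1⟩
  -- The tensor built from the k-th iterated d'Alembertian of σ² has order 2k + 2, hence the shift;
  -- the value at m = 0 is irrelevant.
  · refine ⟨fun m => DeSitter.zetaR (m - 1), fun m hm => ?_, fun n F => ?_⟩
    · obtain ⟨k, rfl⟩ := Nat.exists_eq_add_of_le' hm
      have h := DeSitter.mem_sdcLt.1 (DeSitter.zetaR_mem_sdcLt k)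
      refine ⟨(hq _ _).2 h.1, ?_, h.2.1, DeSitter.exists_trace_zetaR_ne_zero k, h.2.2⟩
      rw [hq' _ (by omega)]
      exact DeSitter.zetaR_notMem k
    · rw [hq, ← DeSitter.mem_sdcLt, ← DeSitter.span_zetaR]
      have hset : (fun m => DeSitter.zetaR (m - 1)) '' {m | 1 ≤ m ∧ 2 * m ≤ n} =
          DeSitter.zetaR '' {m | 2 * m + 2 ≤ n} := by
        ext G
        constructor
        · rintro ⟨m, ⟨h1, h2⟩, rfl⟩
          exact ⟨m - 1, show 2 * (m - 1) + 2 ≤ n by omega, rfl⟩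
        · rintro ⟨m, h, rfl⟩
          exact ⟨m + 1, ⟨by omega, h⟩, rfl⟩
      rw [hset]
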